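/- **Setting.** Let $A$ be an $A_\infty$-algebra over $\mathbb C$, graded by $\mathbb Z$ or $\mathbb Z_2$: linear maps $r_n:A[1]^{\otimes n}\to A[1]$ ($n\ge1$) of degree $+1$ with $\sum r_{n-j+1}\circ(1^{\otimes i}\otimes r_j\otimes 1^{\otimes(n-i-j)})=0$ (Koszul signs); $\widetilde a$ denotes the degree in $A[1]$, $A[1]_i=A_{i+1}$. Let $B_A$ be the completed tensor algebra on $A[1]^*$ (formal series in the coordinates $s^a$ dual to a homogeneous basis $e_a$) with the derivation $Q(s^a)=\sum_n Q^a_{a_1\dots a_n}s^{a_1}\cdots s^{a_n}$, where $r_n(e_{a_1},\dots,e_{a_n})=\sum_a Q^a_{a_1\dots a_n}e_a$. Let $\Omega(B_A)$ be the (completed) universal algebra of non-commutative forms, i.e. formal series in the words in $s^a,ds^a$, let $\mathcal C(B_A)=\Omega(B_A)/[\Omega(B_A),\Omega(B_A)]$ be the Karoubi complex (graded commutators, closed span) with de Rham differential $d$, and $L_Q$ the Lie derivative. An $A_\infty$-morphism $F:A\to A'$ is the same as an algebra map $B_{A'}\to B_A$ compatible with $Q',Q$, and $F_*:\mathcal C(B_{A'})\to\mathcal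 C(B_A)$ is the induced map of forms. All 2-forms are homogeneous of a fixed degree $k$. The flat part $\omega_{ab}(ds^ads^b)_{\mathrm c}$ of a 2-form, with $\omega_{ab}=(-1)^{\widetilde a\widetilde b+1}\omega_{ba}$, corresponds to the pairing $\langle e_a,e_b\rangle=(-1)^{\widetilde a+1}\omega_{ab}$. A pairing of this degree is non-degenerate if it is a perfect pairing between the homogeneous components that it pairs (for finite-dimensional spaces: its matrix is invertible). A $d$- and $L_Q$-closed 2-form on $B_A$ is homologically non-degenerate if its flat part induces a non-degenerate pairing on $H=H_{r_1}(A)$. Let $\mathscr H=H_{L_Q}(\mathcal C^2(B_A)_{\mathrm{cl,hnd}})$ be the set of classes in the $L_Q$-cohomology of the $d$-closed 2-forms that have a homologically non-degenerate representative. Two classes are $A_\infty$-quasi-isomorphic if one is $F_*$ of the other for an $A_\infty$-quasi-isomorphism $F:A\to A$. A non-degenerate cyclic structure on a minimal model of $A$ (a *cyclic minimal model*) is a minimal $A_\infty$-structure $(r'_n)$ on $H$, $A_\infty$-quasi-isomorphic to $A$, with a non-degenerate pairing on $H$ that corresponds to a flat 2-form of degree $k$, i.e. satisfies $\langle a,b\rangle=(-1)^{(\widetilde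 a+1)(\widetilde b+1)}\langle b,a\rangle$, and such that $\langle a_0,r'_n(a_1,\dots,a_n)\rangle=(-1)^{\widetilde a_0(\widetilde a_1+\dots+\widetilde a_n)}\langle a_1,r'_n(a_2,\dots,a_n,a_0)\rangle$. Two of them agree up to a (formal) change of basis if there is an $A_\infty$-isomorphism $\phi$ between them such that $\phi_*$ takes the flat form of one pairing to the flat form of the other in $\mathcal C^2$. **Theorem.** For every $A$ and $k$: 1. Homological non-degeneracy of an $L_Q$-closed, $d$-closed 2-form depends only on its class in $H_{L_Q}(\mathcal C^2(B_A)_{\mathrm{cl}})$. 2. Let $\omega$ represent a class in $\mathscr H$, and let $F:(H,r'')\to A$ be an $A_\infty$-quasi-isomorphism from a minimal $A_\infty$-structure on $H$. Then there are a cyclic minimal model on $H$, whose pairing is the one associated to the flat part of $F_*\omega$, and an $A_\infty$-isomorphism $\phi$ from it to $(H,r'')$ with $\phi_1=\mathrm{id}$, such that $\phi_*F_*\omega$ equals the flat form of that pairing in $\mathcal C^2(B_H)$. 3. A pairing on $H$ is the pairing of some cyclic minimal model if and only if it is associated to the flat part of $F_*\omega$ for some $\omega$ and $F$ as in 2. 4.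 $A_\infty$-quasi-isomorphism on $\mathscr H$, and agreement up to change of basis of cyclic minimal models, are equivalence relations, and there is a bijection between $A_\infty$-quasi-isomorphism classes in $\mathscr H$ and cyclic minimal models of $A$ up to change of basis. Under it, the class of $[\omega]$ corresponds to that of $(H,r',\langle\cdot,\cdot\rangle)$ if and only if there is an $A_\infty$-quasi-isomorphism $F:(H,r')\to A$ such that $F_*\omega$ and the flat form of $\langle\cdot,\cdot\rangle$ have the same class in $H_{L_{Q'}}(\mathcal C^2(B_H)_{\mathrm{cl}})$. -/

import Mathlib

open scoped BigOperators

noncomputable section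

/-! Graded vector spaces are graded by `ZMod m`; `m = 0` gives `ℤ` and `m = 2` gives `ℤ₂`. -/

/-- A homogeneous element of the suspension `A[1]`, together with its degree there
(the "tilde degree"): `A[1]_g = A_{g+1}`. -/
abbrev Letter {m : ℕ} {A : Type*} [AddCommGroup A] [Module ℂ A]
    (𝒜 : ZMod m → Submodule ℂ A) : Type _ :=
  Σ g : ZMod m, 𝒜 (g + 1)

/-- A letter of a non-commutative differential form: `(false, a)` is a slot of type `s`, and
`(true, a)` is a slot of type `ds`. -/
abbrev DLetter {m : ℕ} {A : Type*} [AddCommGroup A] [Module ℂ A]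
    (𝒜 : ZMod m → Submodule ℂ A) : Type _ :=
  Bool × Letter 𝒜

/-- The sign `(-1)^g`, for `g` in `ℤ` or `ℤ₂`. -/
def sgn {m : ℕ} (g : ZMod m) : ℂ := (-1) ^ g.val

/-- The Koszul sign `(-1)^{g h}`, for `g, h` in `ℤ` or `ℤ₂`. -/
def koszul {m : ℕ} (g h : ZMod m) : ℂ := (-1) ^ (g.val * h.val)

section Words

variable {m : ℕ} {A : Type*} [AddCommGroup A] [Module ℂ A] {𝒜 : ZMod m → Submodule ℂ A}

/-- Total tilde degree of a word. -/
def tdeg (l : List (Letter 𝒜)) : ZMod m := (l.map fun x => x.1).sum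

/-- Form degree of a word: its number of letters `ds`. -/
def marks (l : List (DLetter 𝒜)) : ℕ := l.countP fun x => x.1

/-- The word with the distinction of `s` and `ds` forgotten. -/
def plain (l : List (DLetter 𝒜)) : List (Letter 𝒜) := l.map fun x => x.2

/-- Evaluation of a family of multilinear maps `f n : A^n → W` on a word. -/
def evalWord {W : Type*} [AddCommGroup W] [Module ℂ W]
    (f : ∀ n : ℕ, MultilinearMap ℂ (fun _ : Fin n => A) W) (l : List (Letter 𝒜)) : W :=
  f l.length fun i => ((l.get i).2 : A)

end Words

section AInfinity

variable {m : ℕ}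

/-- An `A_∞`-algebra structure on the graded vector space `A = ⨁ 𝒜 g`: linear maps
`r n : A[1]^{⊗ n} → A[1]` of degree `1`, for `n ≥ 1`, with
`∑ r_{n-j+1} ∘ (1^{⊗ i} ⊗ r_j ⊗ 1^{⊗ (n-i-j)}) = 0`, written out on homogeneous elements with the
Koszul rule. The component `r 0` is a dummy. -/
structure AInf {A : Type*} [AddCommGroup A] [Module ℂ A] (𝒜 : ZMod m → Submodule ℂ A) where
  internal : DirectSum.IsInternal 𝒜
  r : ∀ n : ℕ, MultilinearMap ℂ (fun _ : Fin n => A) A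
  r_zero : r 0 = 0
  degree : ∀ l : List (Letter 𝒜), evalWord r l ∈ 𝒜 (tdeg l + 1 + 1)
  relation : ∀ l : List (Letter 𝒜),
    ∑ i ∈ Finset.range l.length, ∑ j ∈ Finset.Icc 1 (l.length - i),
      sgn (tdeg (l.take i)) •
        evalWord r (l.take i ++
          (⟨tdeg ((l.drop i).take j) + 1, ⟨evalWord r ((l.drop i).take j), degree _⟩⟩ : Letter 𝒜) ::
          l.drop (i + j)) = 0

variable {A : Type*} [AddCommGroup A] [Module ℂ A] {𝒜 : ZMod m → Submodule ℂ A}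
  {B : Type*} [AddCommGroup B] [Module ℂ B] {ℬ : ZMod m → Submodule ℂ B}

/-- `r_n(a_1 ⊗ ⋯ ⊗ a_n)` as a homogeneous element of `A[1]`. -/
def AInf.op (X : AInf 𝒜) (l : List (Letter 𝒜)) : Letter 𝒜 :=
  ⟨tdeg l + 1, ⟨evalWord X.r l, X.degree l⟩⟩

/-- The differential `r_1`. -/
def AInf.r₁ (X : AInf 𝒜) : A →ₗ[ℂ] A :=
  (MultilinearMap.ofSubsingleton ℂ A A (0 : Fin 1)).symm (X.r 1)

/-- An `A_∞`-algebra is minimal if `r_1 = 0`. -/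
def AInf.Minimal (X : AInf 𝒜) : Prop := X.r₁ = 0

/-- The cohomology `H_{r_1}(A) = ker r_1 / im r_1`. -/
abbrev AInf.Coh (X : AInf 𝒜) : Type _ :=
  LinearMap.ker X.r₁ ⧸ (LinearMap.range X.r₁).submoduleOf (LinearMap.ker X.r₁)

/-- The class of a cocycle. -/
def AInf.cls (X : AInf 𝒜) (x : A) (hx : X.r₁ x = 0) : X.Coh :=
  Submodule.Quotient.mk ⟨x, hx⟩

/-- The grading of `H_{r_1}(A)`: classes of homogeneous cocycles. -/
def AInf.cohGrading (X : AInf 𝒜) (g : ZMod m) : Submodule ℂ X.Coh :=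
  ((𝒜 g).submoduleOf (LinearMap.ker X.r₁)).map
    ((LinearMap.range X.r₁).submoduleOf (LinearMap.ker X.r₁)).mkQ

/-- An `A_∞`-morphism `X → Y`: linear maps `F n : A[1]^{⊗ n} → B[1]` of degree `0`, for `n ≥ 1`,
with `∑ r_p ∘ (F_{i_1} ⊗ ⋯ ⊗ F_{i_p}) = ∑ F_{n-j+1} ∘ (1^{⊗ i} ⊗ r_j ⊗ 1^{⊗ (n-i-j)})`.
The component `F 0` is a dummy. -/
structure AInfHom (X : AInf 𝒜) (Y : AInf ℬ) where
  F : ∀ n : ℕ, MultilinearMap ℂ (fun _ : Fin n => A) B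
  F_zero : F 0 = 0
  degree : ∀ l : List (Letter 𝒜), evalWord F l ∈ ℬ (tdeg l + 1)
  relation : ∀ l : List (Letter 𝒜),
    ∑ c : Composition l.length,
      evalWord Y.r ((l.splitWrtComposition c).map fun b =>
        (⟨tdeg b, ⟨evalWord F b, degree b⟩⟩ : Letter ℬ)) =
    ∑ i ∈ Finset.range l.length, ∑ j ∈ Finset.Icc 1 (l.length - i),
      sgn (tdeg (l.take i)) •
        evalWord F (l.take i ++ X.op ((l.drop i).take j) :: l.drop (i + j))

variable {X : AInf 𝒜} {Y : AInf ℬ}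

/-- `F_n(a_1 ⊗ ⋯ ⊗ a_n)` as a homogeneous element of `B[1]`. -/
def AInfHom.op (F : AInfHom X Y) (l : List (Letter 𝒜)) : Letter ℬ :=
  ⟨tdeg l, ⟨evalWord F.F l, F.degree l⟩⟩

/-- The linear part `F_1`. -/
def AInfHom.F₁ (F : AInfHom X Y) : A →ₗ[ℂ] B :=
  (MultilinearMap.ofSubsingleton ℂ A B (0 : Fin 1)).symm (F.F 1)

/-- `A_∞`-isomorphism: `F_1` is bijective. -/
def AInfHom.IsIso (F : AInfHom X Y) : Prop := Function.Bijective F.F₁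

/-- `A_∞`-quasi-isomorphism: `F_1` is injective and surjective on `r_1`-cohomology. -/
def AInfHom.IsQuasiIso (F : AInfHom X Y) : Prop :=
  (∀ x, X.r₁ x = 0 → (∃ y, Y.r₁ y = F.F₁ x) → ∃ z, X.r₁ z = x) ∧
  (∀ y, Y.r₁ y = 0 → ∃ x, X.r₁ x = 0 ∧ ∃ z, Y.r₁ z = y - F.F₁ x)

end AInfinity

section Forms

variable {m : ℕ} {A : Type*} [AddCommGroup A] [Module ℂ A] {𝒜 : ZMod m → Submodule ℂ A}
  {B : Type*} [AddCommGroup B] [Module ℂ B] {ℬ : ZMod m → Submodule ℂ B}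

/-! Non-commutative forms. `B_A` is the (completed) tensor algebra on `A[1]^*`, with coordinates
`s^a` dual to a homogeneous basis `e_a`. Its universal algebra of forms is the free algebra on the
letters `s^a` and `ds^a`, so a (formal) form is the family of its coefficients. The coefficient of a
word `s^{a_1} … ds^{a_i} …` is the value of the form at `[(false, e_{a_1}), …, (true, e_{a_i}), …]`,
extended linearly in every slot; this makes everything independent of bases. -/

/-- The completed algebra of forms `Ω(B_A)`, inside all functions on words: the functions that
are linear in every slot. -/
def forms (𝒜 : ZMod m → Submodule ℂ A) : Submodule ℂ (List (DLetter 𝒜) → ℂ) where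
  carrier := {ω | ∀ (u v : List (DLetter 𝒜)) (b : Bool) (g : ZMod m) (c : ℂ) (x y : 𝒜 (g + 1)),
    ω (u ++ (b, ⟨g, c • x + y⟩) :: v) =
      c * ω (u ++ (b, ⟨g, x⟩) :: v) + ω (u ++ (b, ⟨g, y⟩) :: v)}
  zero_mem' := by intro u v b g c x y; simp
  add_mem' := by
    intro ω η hω hη u v b g c x y
    simp only [Pi.add_apply, hω u v b g c x y, hη u v b g c x y]
    ring
  smul_mem' := by
    intro t ω hω u v b g c x y
    simp only [Pi.smul_apply, smul_eq_mul, hω u v b g c x y]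
    ring

/-- Forms of form degree `p` that are homogeneous of tilde degree `k`. (The coordinate `s^a`,
dual to `e_a`, has the tilde degree opposite to that of `e_a`.) -/
def formsOf (𝒜 : ZMod m → Submodule ℂ A) (p : ℕ) (k : ZMod m) :
    Submodule ℂ (List (DLetter 𝒜) → ℂ) where
  carrier := {ω | ω ∈ forms 𝒜 ∧ ∀ l, ω l ≠ 0 → marks l = p ∧ tdeg (plain l) = -k}
  zero_mem' := ⟨(forms 𝒜).zero_mem, fun l h => (h rfl).elim⟩
  add_mem' := by
    rintro ω η ⟨hω, hω'⟩ ⟨hη, hη'⟩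
    refine ⟨(forms 𝒜).add_mem hω hη, fun l h => ?_⟩
    by_cases h0 : ω l = 0
    · exact hη' l (by simpa [h0] using h)
    · exact hω' l h0
  smul_mem' := by
    rintro t ω ⟨hω, hω'⟩
    refine ⟨(forms 𝒜).smul_mem t hω, fun l h => hω' l fun h0 => h ?_⟩
    simp [h0]

/-- The signed rotation `x w ↦ ± w x` of words, for a letter `x`. The sign is
`(-1)^{deg x deg w + |x| |w|}`, with tilde degrees `deg` and form degrees `|·|`. -/
def rot (𝒜 : ZMod m → Submodule ℂ A) :
    (List (DLetter 𝒜) → ℂ) →ₗ[ℂ] (List (DLetter 𝒜) → ℂ) where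
  toFun ω l :=
    if h : l = [] then ω [] else
      koszul (l.getLast h).2.1 (tdeg (plain l.dropLast)) *
        (-1) ^ (marks [l.getLast h] * marks l.dropLast) * ω (l.getLast h :: l.dropLast)
  map_add' ω η := by
    funext l
    by_cases h : l = []
    · simp [h]
    · simp [h, mul_add]
  map_smul' t ω := by
    funext l
    by_cases h : l = []
    · simp [h]
    · simp only [h, dite_false, Pi.smul_apply, smul_eq_mul, RingHom.id_apply]
      ring

/-- The (closed) span `[Ω(B_A), Ω(B_A)]` of the graded commutators. Since a commutator of words is a
sum of commutators `x w - ± w x` with letters `x`, it is the image of `1 - rot`. The Karoubi complex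
is `𝒞(B_A) = Ω(B_A) / [Ω(B_A), Ω(B_A)]`; its elements are represented by forms, and are equal iff the
difference of representatives is in `commutators`. -/
def commutators (𝒜 : ZMod m → Submodule ℂ A) : Submodule ℂ (List (DLetter 𝒜) → ℂ) :=
  (forms 𝒜).map (LinearMap.id - rot 𝒜)

/-- The de Rham differential: the derivation of form degree `1` with `s ↦ ds` and `ds ↦ 0`. -/
def dR (𝒜 : ZMod m → Submodule ℂ A) :
    (List (DLetter 𝒜) → ℂ) →ₗ[ℂ] (List (DLetter 𝒜) → ℂ) where
  toFun ω l := ∑ i : Fin l.length,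
    if (l.get i).1 then (-1) ^ marks (l.take i) * ω (l.set i (false, (l.get i).2)) else 0
  map_add' ω η := by
    funext l
    simp only [Pi.add_apply, ← Finset.sum_add_distrib]
    refine Finset.sum_congr rfl fun i _ => ?_
    split_ifs <;> ring
  map_smul' t ω := by
    funext l
    simp only [Pi.smul_apply, smul_eq_mul, RingHom.id_apply, Finset.mul_sum]
    refine Finset.sum_congr rfl fun i _ => ?_
    split_ifs <;> ring

/-- The Lie derivative `L_Q`: the derivation of tilde degree `1` and form degree `0` with
`s ↦ Q(s)` and `ds ↦ d(Q(s))`. Here `Q(s^a) = ∑ Q^a_{a_1 … a_n} s^{a_1} ⋯ s^{a_n}` with the structure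
constants `r_n(e_{a_1}, …, e_{a_n}) = ∑ Q^a_{a_1 … a_n} e_a`. -/
def lieQ (X : AInf 𝒜) :
    (List (DLetter 𝒜) → ℂ) →ₗ[ℂ] (List (DLetter 𝒜) → ℂ) where
  toFun ω l := ∑ i ∈ Finset.range l.length, ∑ j ∈ Finset.Icc 1 (l.length - i),
    if marks ((l.drop i).take j) ≤ 1 then
      sgn (tdeg (plain (l.take i))) *
        ω (l.take i ++
          (decide (marks ((l.drop i).take j) = 1), X.op (plain ((l.drop i).take j))) ::
          l.drop (i + j))
    else 0
  map_add' ω η := by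
    funext l
    simp only [Pi.add_apply, ← Finset.sum_add_distrib]
    refine Finset.sum_congr rfl fun i _ => Finset.sum_congr rfl fun j _ => ?_
    split_ifs <;> ring
  map_smul' t ω := by
    funext l
    simp only [Pi.smul_apply, smul_eq_mul, RingHom.id_apply, Finset.mul_sum]
    refine Finset.sum_congr rfl fun i _ => Finset.sum_congr rfl fun j _ => ?_
    split_ifs <;> ring

/-- The push-forward of forms along the algebra map `B_B → B_A` given by an `A_∞`-morphism
`F : A → B`: it substitutes `F(s)` for `s` and `d(F(s))` for `ds`, where
`F(s^b) = ∑ F^b_{a_1 … a_n} s^{a_1} ⋯ s^{a_n}`. -/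
def push {X : AInf 𝒜} {Y : AInf ℬ} (F : AInfHom X Y) (ω : List (DLetter ℬ) → ℂ) :
    List (DLetter 𝒜) → ℂ := fun l =>
  ∑ c : Composition l.length,
    if ∀ b ∈ l.splitWrtComposition c, marks b ≤ 1 then
      ω ((l.splitWrtComposition c).map fun b => (decide (marks b = 1), F.op (plain b)))
    else 0

/-- Forms representing `d`-closed elements of `𝒞²(B_A)` of tilde degree `k`. -/
def closedForms (𝒜 : ZMod m → Submodule ℂ A) (k : ZMod m) :
    Submodule ℂ (List (DLetter 𝒜) → ℂ) :=
  formsOf 𝒜 2 k ⊓ (commutators 𝒜).comap (dR 𝒜)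

/-- Forms representing the `L_Q`-cocycles in `𝒞²(B_A)_cl`. -/
def cocycles (X : AInf 𝒜) (k : ZMod m) : Submodule ℂ (List (DLetter 𝒜) → ℂ) :=
  closedForms 𝒜 k ⊓ (commutators 𝒜).comap (lieQ X)

/-- Forms that represent `L_Q(η)` with `η ∈ 𝒞²(B_A)_cl`. -/
def coboundaries (X : AInf 𝒜) (k : ZMod m) : Submodule ℂ (List (DLetter 𝒜) → ℂ) :=
  commutators 𝒜 ⊔ (closedForms 𝒜 (k - 1)).map (lieQ X)

/-- The cohomology `H_{L_Q}(𝒞²(B_A)_cl)` in tilde degree `k`. -/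
abbrev H2 (X : AInf 𝒜) (k : ZMod m) : Type _ :=
  cocycles X k ⧸ (coboundaries X k).submoduleOf (cocycles X k)

/-- The matrix `ω_{ab}` of the flat part `ω_{ab} (ds^a ds^b)_c` of a `2`-form, normalised by
`ω_{ab} = (-1)^{deg a deg b + 1} ω_{ba}`. -/
def flatPart (ω : List (DLetter 𝒜) → ℂ) (a b : Letter 𝒜) : ℂ :=
  (1 / 2) * (ω [(true, a), (true, b)] - koszul a.1 b.1 * ω [(true, b), (true, a)])

/-- The bilinear form `β` is the pairing `⟨e_a, e_b⟩ = (-1)^{deg a + 1} ω_{ab}` associated to the flat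
part of `ω`. -/
def IsFlatPairing (ω : List (DLetter 𝒜) → ℂ) (β : A →ₗ[ℂ] A →ₗ[ℂ] ℂ) : Prop :=
  ∀ a b : Letter 𝒜, β a.2 b.2 = -sgn a.1 * flatPart ω a b

/-- The flat form `ω_{ab} (ds^a ds^b)_c` with `⟨e_a, e_b⟩ = (-1)^{deg a + 1} ω_{ab}`. -/
def flatForm (𝒜 : ZMod m → Submodule ℂ A) (β : A →ₗ[ℂ] A →ₗ[ℂ] ℂ) : List (DLetter 𝒜) → ℂ
  | [(true, a), (true, b)] => -sgn a.1 * β a.2 b.2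
  | _ => 0

/-- Non-degeneracy of a bilinear form that pairs the tilde degrees `g` and `h` with `g + h = -k`: all
these parts are perfect pairings. For finite-dimensional `A` this says that the matrix of the form is
invertible. -/
def NonDeg (𝒜 : ZMod m → Submodule ℂ A) (k : ZMod m) (β : A →ₗ[ℂ] A →ₗ[ℂ] ℂ) : Prop :=
  ∀ g h : ZMod m, g + h = -k → Function.Bijective
    fun a : 𝒜 (g + 1) => ((β (a : A)).comp (𝒜 (h + 1)).subtype : Module.Dual ℂ (𝒜 (h + 1)))

/-- Homological non-degeneracy of a `2`-form of tilde degree `k`: its flat part induces a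
non-degenerate pairing on `H_{r_1}(A)`. -/
def HomNonDeg (X : AInf 𝒜) (k : ZMod m) (ω : List (DLetter 𝒜) → ℂ) : Prop :=
  ∃ β : X.Coh →ₗ[ℂ] X.Coh →ₗ[ℂ] ℂ,
    (∀ (a b : Letter 𝒜) (ha : X.r₁ a.2 = 0) (hb : X.r₁ b.2 = 0),
      β (X.cls a.2 ha) (X.cls b.2 hb) = -sgn a.1 * flatPart ω a b) ∧
    NonDeg X.cohGrading k β

/-- The set `ℋ = H_{L_Q}(𝒞²(B_A)_{cl,hnd})` in tilde degree `k`: the cohomology classes of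
homologically non-degenerate closed `2`-forms. -/
def ScrH (X : AInf 𝒜) (k : ZMod m) : Type _ :=
  {c : H2 X k // ∃ ω : cocycles X k, Submodule.Quotient.mk ω = c ∧ HomNonDeg X k ω}

/-- The class of a form in `ℋ`. -/
def ScrH.mk {X : AInf 𝒜} {k : ZMod m} (ω : cocycles X k) (h : HomNonDeg X k ω) : ScrH X k :=
  ⟨Submodule.Quotient.mk ω, ω, rfl, h⟩

/-- Two classes in `ℋ` are `A_∞`-quasi-isomorphic if an `A_∞`-quasi-isomorphism `F : A → A`
pushes one forward to the other. -/
def ScrH.QuasiIsomorphic {X : AInf 𝒜} {k : ZMod m} (c c' : ScrH X k) : Prop :=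
  ∃ F : AInfHom X X, F.IsQuasiIso ∧
    ∃ ω ω' : cocycles X k, Submodule.Quotient.mk ω = c.1 ∧ Submodule.Quotient.mk ω' = c'.1 ∧
      push F ω' - (ω : List (DLetter 𝒜) → ℂ) ∈ coboundaries X k

/-- The `A_∞`-algebra `Y` is cyclic with respect to `β`. -/
def AInf.IsCyclic (Y : AInf 𝒜) (β : A →ₗ[ℂ] A →ₗ[ℂ] ℂ) : Prop :=
  ∀ (a₀ a₁ : Letter 𝒜) (l : List (Letter 𝒜)),
    β a₀.2 (evalWord Y.r (a₁ :: l)) =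
      koszul a₀.1 (tdeg (a₁ :: l)) * β a₁.2 (evalWord Y.r (l ++ [a₀]))

/-- A non-degenerate cyclic structure on a minimal model of `A`: a minimal `A_∞`-structure on
`H_{r_1}(A)` that is `A_∞`-quasi-isomorphic to `A`, and a non-degenerate homogeneous pairing, graded
symmetric for the unsuspended degree, with respect to which it is cyclic. The parameter `k` is
the tilde degree of the corresponding flat `2`-form. -/
structure CyclicMinimalModel (X : AInf 𝒜) (k : ZMod m) where
  alg : AInf X.cohGrading
  minimal : alg.Minimal
  isModel : ∃ F : AInfHom alg X, F.IsQuasiIso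
  pairing : X.Coh →ₗ[ℂ] X.Coh →ₗ[ℂ] ℂ
  pairing_degree : ∀ a b : Letter X.cohGrading, pairing a.2 b.2 ≠ 0 → a.1 + b.1 = -k
  pairing_symm : ∀ a b : Letter X.cohGrading,
    pairing a.2 b.2 = koszul (a.1 + 1) (b.1 + 1) * pairing b.2 a.2
  nonDeg : NonDeg X.cohGrading k pairing
  cyclic : alg.IsCyclic pairing

/-- Two cyclic minimal models agree up to a change of basis (a formal change of coordinates of the
non-commutative manifold) if an `A_∞`-isomorphism between them pushes the flat form of one pairing
forward to the flat form of the other, as elements of `𝒞²`. -/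
def CyclicMinimalModel.Isomorphic {X : AInf 𝒜} {k : ZMod m}
    (M N : CyclicMinimalModel X k) : Prop :=
  ∃ φ : AInfHom M.alg N.alg, φ.IsIso ∧
    push φ (flatForm X.cohGrading N.pairing) - flatForm X.cohGrading M.pairing ∈ commutators X.cohGrading

end Forms

end

/-! Sum the coefficients of a form, with signs, over all rotations of a word (`cyc`). In
characteristic 0 the image of `1 - rot` is the kernel of this sum, so a form vanishes in the Karoubi
complex iff it vanishes on the empty word and its cyclic sum is zero (`mem_commutators`). For a form
that is closed modulo commutators, the cyclic sum is determined by its values on words `ds s ⋯ s ds`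
(`cyc_two_marks`). These values form a scalar series `pot` on `A` whose only constraint, besides
degree and multilinearity, is that its own cyclic sum vanishes (`Good`). Conversely such a series is
`T - rot T`, and comes from the closed form `ds · d(⋯)` with coefficients `T` (`exists_closedForm`).
This is the classical isomorphism between closed non-commutative 2-forms and commutators in the
tensor algebra.

In this picture push-forward along an `A_∞`-morphism is composition of formal series (`pot_push`),
the Lie derivative is the action of a coderivation (`pot_lieQ`), the flat form of a pairing is a
quadratic series, and cyclicity of an `A_∞`-structure says that this quadratic series is closed
(`isCyclic_iff`). What remains is formal symplectic geometry, in three steps.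

Minimal models. A homotopy `η` for `r₁` splits `A` into harmonic elements and an acyclic part.
Homotopy transfer makes `X` isomorphic to a structure that is `r₁` plus operations living on the
harmonic elements (`exists_transfer`). The derivation extending `η` on series, divided by the number
of non-harmonic inputs, is a Poincaré-type homotopy (`contr_cod`), so a closed series is
cohomologous to its restriction to cohomology. Hence quasi-isomorphisms act bijectively on classes
of closed forms (`exists_inverse`). On a minimal algebra exact forms have no flat part, which makes
homological non-degeneracy a property of the class.

Darboux. If the quadratic part of a closed form on `H` is non-degenerate, a series `y` with
vanishing cyclic sum can be written as the derivative of the quadratic form along a unique-order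
vector field (`cod_sol`), and a recursion on word length yields coordinates in which the form is
flat (`exists_darboux`). Transporting the `A_∞`-structure to these coordinates produces a cyclic
minimal model.

Moser. If two closed non-degenerate forms on a minimal algebra differ by `L_Q u`, there is an odd
vector field `v` such that the exponential of `[Q, v]`, an `A_∞`-automorphism, carries one to the
other (`exists_moser`). So two cyclic minimal models that represent the same class are isomorphic.

Inverse series, transfer, Darboux and Moser are all fixed points of operators whose value on words
of length `n` depends only on shorter words. The bijection of the theorem is then formal: the
relation "`M` represents `ω`" is total on both sides and determines each side up to its equivalence
relation (`exists_quot_equiv`). -/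

open scoped BigOperators

set_option linter.unusedSectionVars false

/-! ### Sums over the splittings of a word -/

section Deconcatenation

variable {Λ Λ' W W' : Type*}

/-- `dsum g l = ∑_{l = x ++ y} g x y`. -/
def dsum [AddCommMonoid W] : (List Λ → List Λ → W) → List Λ → W
  | g, [] => g [] []
  | g, a :: l => g [] (a :: l) + dsum (fun x y => g (a :: x) y) l

/-- `dsum₁ g l = ∑_{l = x ++ y, x ≠ []} g x y`. -/
def dsum₁ [AddCommMonoid W] (g : List Λ → List Λ → W) : List Λ → W
  | [] => 0
  | a :: l => dsum (fun x y => g (a :: x) y) l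

section
variable [AddCommMonoid W] [AddCommMonoid W']

@[simp] theorem dsum_nil (g : List Λ → List Λ → W) : dsum g [] = g [] [] := rfl

theorem dsum_cons (g : List Λ → List Λ → W) (a : Λ) (l : List Λ) :
    dsum g (a :: l) = g [] (a :: l) + dsum (fun x y => g (a :: x) y) l := rfl

@[simp] theorem dsum₁_nil (g : List Λ → List Λ → W) : dsum₁ g [] = 0 := rfl

theorem dsum₁_cons (g : List Λ → List Λ → W) (a : Λ) (l : List Λ) :
    dsum₁ g (a :: l) = dsum (fun x y => g (a :: x) y) l := rfl

theorem dsum_eq_add_dsum₁ (g : List Λ → List Λ → W) (l : List Λ) :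
    dsum g l = g [] l + dsum₁ g l := by
  cases l <;> simp [dsum_cons, dsum₁_cons]

theorem dsum_congr {g g' : List Λ → List Λ → W} {l : List Λ}
    (h : ∀ x y, x ++ y = l → g x y = g' x y) : dsum g l = dsum g' l := by
  induction l generalizing g g' with
  | nil => exact h [] [] rfl
  | cons a l ih =>
    rw [dsum_cons, dsum_cons, h [] (a :: l) rfl, ih fun x y e => h (a :: x) y (by simp [e])]

theorem dsum₁_congr {g g' : List Λ → List Λ → W} {l : List Λ}
    (h : ∀ x y, x ≠ [] → x ++ y = l → g x y = g' x y) : dsum₁ g l = dsum₁ g' l := by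
  cases l with
  | nil => rfl
  | cons a l => exact dsum_congr fun x y e => h (a :: x) y (by simp) (by simp [e])

theorem dsum_add (g g' : List Λ → List Λ → W) (l : List Λ) :
    dsum (fun x y => g x y + g' x y) l = dsum g l + dsum g' l := by
  induction l generalizing g g' with
  | nil => rfl
  | cons a l ih => simp only [dsum_cons, ih]; exact add_add_add_comm _ _ _ _

@[simp] theorem dsum_zero (l : List Λ) : dsum (fun _ _ => (0 : W)) l = 0 := by
  induction l with
  | nil => rfl
  | cons a l ih => simp only [dsum_cons, ih, add_zero]

theorem dsum_eq_zero {g : List Λ → List Λ → W} {l : List Λ}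
    (h : ∀ x y, x ++ y = l → g x y = 0) : dsum g l = 0 :=
  (dsum_congr h).trans (dsum_zero l)

theorem dsum₁_eq_zero {g : List Λ → List Λ → W} {l : List Λ}
    (h : ∀ x y, x ≠ [] → x ++ y = l → g x y = 0) : dsum₁ g l = 0 := by
  cases l with
  | nil => rfl
  | cons a l => exact dsum_eq_zero fun x y e => h (a :: x) y (by simp) (by simp [e])

theorem dsum₁_add (g g' : List Λ → List Λ → W) (l : List Λ) :
    dsum₁ (fun x y => g x y + g' x y) l = dsum₁ g l + dsum₁ g' l := by
  cases l with
  | nil => simp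
  | cons a l => exact dsum_add _ _ _

theorem map_dsum (φ : W →+ W') (g : List Λ → List Λ → W) (l : List Λ) :
    φ (dsum g l) = dsum (fun x y => φ (g x y)) l := by
  induction l generalizing g with
  | nil => rfl
  | cons a l ih => simp only [dsum_cons, map_add, ih]

theorem map_dsum₁ (φ : W →+ W') (g : List Λ → List Λ → W) (l : List Λ) :
    φ (dsum₁ g l) = dsum₁ (fun x y => φ (g x y)) l := by
  cases l with
  | nil => exact map_zero φ
  | cons a l => exact map_dsum φ _ _

theorem dsum_append_cons (g : List Λ → List Λ → W) (u v : List Λ) (z : Λ) :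
    dsum g (u ++ z :: v) =
      dsum (fun x y => g x (y ++ z :: v)) u + dsum (fun x y => g (u ++ z :: x) y) v := by
  induction u generalizing g with
  | nil => simp [dsum_cons]
  | cons a u ih => simp only [List.cons_append, dsum_cons, ih, add_assoc]

theorem dsum_concat (g : List Λ → List Λ → W) (u : List Λ) (z : Λ) :
    dsum g (u ++ [z]) = dsum (fun x y => g x (y ++ [z])) u + g (u ++ [z]) [] := by
  simp [dsum_append_cons]

/-- Coassociativity of deconcatenation: both sides run over the splittings of the word in three
pieces. -/
theorem dsum_assoc (g : List Λ → List Λ → List Λ → W) (l : List Λ) :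
    dsum (fun u t => dsum (fun x y => g x y t) u) l =
      dsum (fun x t => dsum (fun y v => g x y v) t) l := by
  induction l generalizing g with
  | nil => rfl
  | cons a l ih =>
    simp only [dsum_cons, dsum_nil, dsum_add, ih, add_assoc]

theorem dsum₁_assoc (g : List Λ → List Λ → List Λ → W) (l : List Λ) :
    dsum₁ (fun u t => dsum₁ (fun x y => g x y t) u) l =
      dsum₁ (fun x t => dsum (fun y v => g x y v) t) l := by
  cases l with
  | nil => rfl
  | cons a l => exact dsum_assoc (fun x y t => g (a :: x) y t) l

theorem dsum_map (c : Λ → Λ') (g : List Λ' → List Λ' → W) (l : List Λ) :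
    dsum g (l.map c) = dsum (fun x y => g (x.map c) (y.map c)) l := by
  induction l generalizing g with
  | nil => rfl
  | cons a l ih => simp [dsum_cons, ih]

theorem dsum₁_map (c : Λ → Λ') (g : List Λ' → List Λ' → W) (l : List Λ) :
    dsum₁ g (l.map c) = dsum₁ (fun x y => g (x.map c) (y.map c)) l := by
  cases l with
  | nil => rfl
  | cons a l => exact dsum_map c (fun x y => g (c a :: x) y) l

theorem sum_range_eq_dsum (g : List Λ → List Λ → W) (l : List Λ) :
    ∑ i ∈ Finset.range (l.length + 1), g (l.take i) (l.drop i) = dsum g l := by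
  induction l generalizing g with
  | nil => simp
  | cons a l ih =>
    rw [List.length_cons, Finset.sum_range_succ', dsum_cons, ← ih, add_comm]
    simp

theorem sum_Icc_eq_dsum₁ (g : List Λ → List Λ → W) (l : List Λ) :
    ∑ j ∈ Finset.Icc 1 l.length, g (l.take j) (l.drop j) = dsum₁ g l := by
  cases l with
  | nil => simp
  | cons a l =>
    rw [dsum₁_cons, ← sum_range_eq_dsum, List.length_cons, ← Finset.Ico_add_one_right_eq_Icc,
      Finset.sum_Ico_eq_sum_range]
    refine Finset.sum_congr rfl fun i _ => ?_
    rw [add_comm 1 i]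
    rfl

/-- Translates the index sums in the definitions of `A_∞`-structures and of `lieQ` into sums over a
prefix, a non-empty block and a suffix. -/
theorem sum_blocks_eq_dsum (g : List Λ → List Λ → List Λ → W) (l : List Λ) :
    ∑ i ∈ Finset.range l.length, ∑ j ∈ Finset.Icc 1 (l.length - i),
      g (l.take i) ((l.drop i).take j) (l.drop (i + j)) =
      dsum (fun u t => dsum₁ (fun b v => g u b v) t) l := by
  rw [← sum_range_eq_dsum, Finset.sum_range_succ]
  simp only [List.drop_length, dsum₁_nil, add_zero]
  refine Finset.sum_congr rfl fun i _ => ?_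
  rw [← sum_Icc_eq_dsum₁]
  simp only [List.length_drop, List.drop_drop]

end

/-! ### Substitution of blocks -/

section Substitution

variable [AddCommMonoid W] [AddCommMonoid W'] (ok : List Λ → Prop) [DecidablePred ok]
  (op : List Λ → Λ')

/-- Auxiliary function of `subst`; `acc` is the block that is being read. -/
def substAux : (List Λ' → W) → List Λ → List Λ → W
  | f, acc, [] => if ok acc then f [op acc] else 0
  | f, acc, a :: l => substAux f (acc ++ [a]) l +
      if ok acc then substAux (fun w => f (op acc :: w)) [a] l else 0

/-- The sum of `f [op b₁, …, op bₚ]` over all decompositions of a word in non-empty blocks `bᵢ`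
that satisfy `ok`. -/
def subst (f : List Λ' → W) : List Λ → W
  | [] => f []
  | a :: l => substAux ok op f [a] l

/-- Insertion of a first block. -/
def blk (f : List Λ' → W) (b : List Λ) : List Λ' → W := fun w => if ok b then f (op b :: w) else 0

theorem substAux_zero (acc l : List Λ) :
    substAux ok op (fun _ => (0 : W)) acc l = 0 := by
  induction l generalizing acc with
  | nil => simp [substAux]
  | cons a l ih => simp [substAux, ih]

@[simp] theorem subst_zero (l : List Λ) : subst ok op (fun _ => (0 : W)) l = 0 := by
  cases l <;> simp [subst, substAux_zero]

@[simp] theorem subst_nil (f : List Λ' → W) : subst ok op f [] = f [] := rfl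

theorem subst_blk (f : List Λ' → W) (b l : List Λ) :
    subst ok op (blk ok op f b) l = if ok b then subst ok op (fun w => f (op b :: w)) l else 0 := by
  unfold blk
  split_ifs <;> simp

theorem substAux_eq (f : List Λ' → W) (acc l : List Λ) :
    substAux ok op f acc l = dsum (fun x v => subst ok op (blk ok op f (acc ++ x)) v) l := by
  induction l generalizing f acc with
  | nil => simp [substAux, subst_blk]
  | cons a l ih =>
    rw [substAux, dsum_cons, ih, subst_blk, List.append_nil, add_comm]
    congr 1
    simp

theorem subst_cons (f : List Λ' → W) (a : Λ) (l : List Λ) :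
    subst ok op f (a :: l) = dsum (fun x v => subst ok op (blk ok op f (a :: x)) v) l := by
  rw [subst, substAux_eq]
  rfl

theorem subst_eq_dsum₁ (f : List Λ' → W) {l : List Λ} (hl : l ≠ []) :
    subst ok op f l = dsum₁ (fun b v => subst ok op (blk ok op f b) v) l := by
  cases l with
  | nil => exact (hl rfl).elim
  | cons a l => exact subst_cons ok op f a l

/-- Induction principle on words by their length. -/
theorem length_induction {p : List Λ → Prop}
    (h : ∀ l, (∀ l', l'.length < l.length → p l') → p l) (l : List Λ) : p l :=
  (measure (List.length (α := Λ))).wf.induction l h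

theorem subst_congr {f f' : List Λ' → W} (h : ∀ w, f w = f' w) (l : List Λ) :
    subst ok op f l = subst ok op f' l := by
  rw [funext h]

theorem subst_add (f f' : List Λ' → W) (l : List Λ) :
    subst ok op (fun w => f w + f' w) l = subst ok op f l + subst ok op f' l := by
  induction l using length_induction generalizing f f' with
  | h l ih =>
    cases l with
    | nil => rfl
    | cons a l =>
      simp only [subst_cons]
      rw [← dsum_add]
      refine dsum_congr fun x y e => ?_
      rw [← ih y (by simp [← e])]
      refine subst_congr ok op (fun w => ?_) _
      unfold blk; split_ifs <;> simp

theorem map_subst (φ : W →+ W') (f : List Λ' → W) (l : List Λ) :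
    φ (subst ok op f l) = subst ok op (fun w => φ (f w)) l := by
  induction l using length_induction generalizing f with
  | h l ih =>
    cases l with
    | nil => rfl
    | cons a l =>
      simp only [subst_cons]
      rw [map_dsum]
      refine dsum_congr fun x y e => ?_
      rw [ih y (by simp [← e])]
      refine subst_congr ok op (fun w => ?_) _
      unfold blk; split_ifs <;> simp

theorem subst_dsum_comm {Λ'' : Type*} (g : List Λ'' → List Λ'' → List Λ' → W) (l : List Λ'')
    (v : List Λ) :
    subst ok op (fun w => dsum (fun x y => g x y w) l) v =
      dsum (fun x y => subst ok op (g x y) v) l := by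
  induction l generalizing g with
  | nil => rfl
  | cons a l ih => simp only [dsum_cons, subst_add, ih]

/-- Multiplicativity of substitution: a cut of the word of blocks is a cut of the original word
between two blocks. -/
theorem subst_dsum (g : List Λ' → List Λ' → W) (l : List Λ) :
    subst ok op (fun w => dsum g w) l =
      dsum (fun x y => subst ok op (fun p => subst ok op (fun q => g p q) y) x) l := by
  induction l using length_induction generalizing g with
  | h l ih =>
    cases l with
    | nil => rfl
    | cons a l =>
      rw [subst_cons, dsum_cons, subst_nil]
      simp only [subst_cons]
      -- The cut in the word of blocks lies either before its first letter or after it.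
      have e1 : ∀ b : List Λ, blk ok op (fun w => dsum g w) b =
          fun w => blk ok op (g []) b w + dsum (fun p q => if ok b then g (op b :: p) q else 0) w := by
        intro b; funext w; unfold blk
        split_ifs with hb
        · simp [dsum_cons]
        · simp
      simp only [e1, subst_add, dsum_add]
      congr 1
      rw [dsum_assoc (fun x y t => subst ok op (blk ok op
        (fun p => subst ok op (fun q => g p q) t) (a :: x)) y)]
      refine dsum_congr fun x y e => ?_
      rw [ih y (by simp [← e])]
      refine dsum_congr fun x' y' _ => subst_congr ok op (fun w => ?_) _
      unfold blk; split_ifs <;> simp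

end Substitution

/-! ### Replacement of one block: the action of a coderivation -/

section Coderivation

variable [AddCommMonoid W] [AddCommMonoid W'] (tw : Λ → Λ) (ok : List Λ → Prop) [DecidablePred ok]
  (op : List Λ → Λ)

/-- The sum of `f (tw u ++ op b :: v)` over all decompositions `u ++ b ++ v` of a word with a
non-empty block `b` that satisfies `ok`. -/
def coder : (List Λ → W) → List Λ → W
  | _, [] => 0
  | f, a :: l => dsum (fun x v => if ok (a :: x) then f (op (a :: x) :: v) else 0) l +
      coder (fun w => f (tw a :: w)) l

@[simp] theorem coder_nil (f : List Λ → W) : coder tw ok op f [] = 0 := rfl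

theorem coder_cons (f : List Λ → W) (a : Λ) (l : List Λ) :
    coder tw ok op f (a :: l) =
      dsum (fun x v => if ok (a :: x) then f (op (a :: x) :: v) else 0) l +
      coder tw ok op (fun w => f (tw a :: w)) l := rfl

theorem coder_cons' (f : List Λ → W) (a : Λ) (l : List Λ) :
    coder tw ok op f (a :: l) =
      dsum₁ (fun b v => if ok b then f (op b :: v) else 0) (a :: l) +
      coder tw ok op (fun w => f (tw a :: w)) l := rfl

theorem coder_eq_dsum (f : List Λ → W) (l : List Λ) :
    coder tw ok op f l = dsum (fun u t => dsum₁ (fun b v =>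
      if ok b then f (u.map tw ++ op b :: v) else 0) t) l := by
  induction l generalizing f with
  | nil => rfl
  | cons a l ih => rw [coder_cons', dsum_cons, ih]; simp

theorem coder_add (f f' : List Λ → W) (l : List Λ) :
    coder tw ok op (fun w => f w + f' w) l = coder tw ok op f l + coder tw ok op f' l := by
  induction l generalizing f f' with
  | nil => simp
  | cons a l ih =>
    simp only [coder_cons, ih]
    rw [add_add_add_comm, ← dsum_add]
    congr 1
    refine dsum_congr fun x y _ => ?_
    split_ifs <;> simp

@[simp] theorem coder_zero (l : List Λ) : coder tw ok op (fun _ => (0 : W)) l = 0 := by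
  induction l with
  | nil => rfl
  | cons a l ih => simp [coder_cons, ih]

theorem map_coder (φ : W →+ W') (f : List Λ → W) (l : List Λ) :
    φ (coder tw ok op f l) = coder tw ok op (fun w => φ (f w)) l := by
  induction l generalizing f with
  | nil => exact map_zero φ
  | cons a l ih =>
    simp only [coder_cons, ih, map_add, map_dsum]
    congr 1
    refine dsum_congr fun x y _ => ?_
    split_ifs <;> simp

theorem coder_congr {f f' : List Λ → W} {l : List Λ}
    (h : ∀ w, w.length ≤ l.length → f w = f' w) :
    coder tw ok op f l = coder tw ok op f' l := by
  induction l generalizing f f' with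
  | nil => rfl
  | cons a l ih =>
    simp only [coder_cons]
    rw [ih fun w hw => h _ (by simpa using hw)]
    congr 1
    refine dsum_congr fun x y e => ?_
    rw [h _ (by simp [← e])]

/-- Leibniz rule. The replaced block lies in the left or in the right factor; in the second case the
whole left factor is passed and gets twisted. -/
theorem coder_dsum (g : List Λ → List Λ → W) (l : List Λ) :
    coder tw ok op (fun w => dsum g w) l =
      dsum (fun x y => coder tw ok op (fun p => g p y) x) l +
      dsum (fun x y => coder tw ok op (fun q => g (x.map tw) q) y) l := by
  induction l generalizing g with
  | nil => simp
  | cons a l ih =>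
    have e1 : ∀ x v, (if ok (a :: x) then dsum g (op (a :: x) :: v) else 0) =
        (if ok (a :: x) then g [] (op (a :: x) :: v) else 0) +
        dsum (fun p q => if ok (a :: x) then g (op (a :: x) :: p) q else 0) v := by
      intro x v
      split_ifs with hb
      · simp [dsum_cons]
      · simp
    have e2 : coder tw ok op (fun w => dsum g (tw a :: w)) l =
      coder tw ok op (fun w => g [] (tw a :: w)) l +
        coder tw ok op (fun w => dsum (fun p q => g (tw a :: p) q) w) l := by
      rw [← coder_add]; simp only [dsum_cons]
    rw [coder_cons, e2, ih]
    simp only [e1, dsum_add]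
    rw [dsum_cons, dsum_cons, coder_nil, zero_add]
    simp only [coder_cons, dsum_add, List.map_nil, List.map_cons]
    rw [dsum_assoc (fun x v y => if ok (a :: x) then g (op (a :: x) :: v) y else 0)]
    abel

end Coderivation

end Deconcatenation

/-! ### Linearity in every letter -/

section SlotLinear

variable {Λ Λ' W : Type*} [AddCommGroup W] [Module ℂ W]

/-- Linearity of a function on words in every slot; `R c x y z` says that the letter `z` is the
combination `c • x + y` of the letters `x` and `y`. -/
def SlotLinear (R : ℂ → Λ → Λ → Λ → Prop) (f : List Λ → W) : Prop :=
  ∀ c x y z, R c x y z → ∀ u v, f (u ++ z :: v) = c • f (u ++ x :: v) + f (u ++ y :: v)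

theorem SlotLinear.append_left {R : ℂ → Λ → Λ → Λ → Prop} {f : List Λ → W} (h : SlotLinear R f)
    (p : List Λ) : SlotLinear R fun w => f (p ++ w) := by
  intro c x y z hR u v
  simpa using h c x y z hR (p ++ u) v

theorem SlotLinear.cons {R : ℂ → Λ → Λ → Λ → Prop} {f : List Λ → W} (h : SlotLinear R f)
    (a : Λ) : SlotLinear R fun w => f (a :: w) := h.append_left [a]

theorem SlotLinear.append_right {R : ℂ → Λ → Λ → Λ → Prop} {f : List Λ → W} (h : SlotLinear R f)
    (p : List Λ) : SlotLinear R fun w => f (w ++ p) := by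
  intro c x y z hR u v
  simpa using h c x y z hR u (v ++ p)

theorem dsum_smul (c : ℂ) (g : List Λ → List Λ → W) (l : List Λ) :
    dsum (fun x y => c • g x y) l = c • dsum g l :=
  (map_dsum (DistribSMul.toAddMonoidHom W c) g l).symm

theorem dsum_neg (g : List Λ → List Λ → W) (l : List Λ) :
    dsum (fun x y => - g x y) l = - dsum g l :=
  (map_dsum (negAddMonoidHom (α := W)) g l).symm

theorem dsum_sub (g g' : List Λ → List Λ → W) (l : List Λ) :
    dsum (fun x y => g x y - g' x y) l = dsum g l - dsum g' l := by
  simp only [sub_eq_add_neg, dsum_add, dsum_neg]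

theorem dsum₁_smul (c : ℂ) (g : List Λ → List Λ → W) (l : List Λ) :
    dsum₁ (fun x y => c • g x y) l = c • dsum₁ g l :=
  (map_dsum₁ (DistribSMul.toAddMonoidHom W c) g l).symm

theorem dsum₁_append_cons (g : List Λ → List Λ → W) (u v : List Λ) (z : Λ) :
    dsum₁ g (u ++ z :: v) =
      dsum₁ (fun x y => g x (y ++ z :: v)) u + dsum (fun x y => g (u ++ z :: x) y) v := by
  cases u with
  | nil => simp [dsum₁_cons]
  | cons a u => simpa [dsum₁_cons] using dsum_append_cons (fun x y => g (a :: x) y) u v z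

section
variable (ok : List Λ → Prop) [DecidablePred ok] (op : List Λ → Λ')

theorem subst_smul (c : ℂ) (f : List Λ' → W) (l : List Λ) :
    subst ok op (fun w => c • f w) l = c • subst ok op f l :=
  (map_subst ok op (DistribSMul.toAddMonoidHom W c) f l).symm

theorem subst_neg (f : List Λ' → W) (l : List Λ) :
    subst ok op (fun w => - f w) l = - subst ok op f l :=
  (map_subst ok op (negAddMonoidHom (α := W)) f l).symm

theorem subst_sub (f g : List Λ' → W) (l : List Λ) :
    subst ok op (fun w => f w - g w) l = subst ok op f l - subst ok op g l := by
  simp only [sub_eq_add_neg, subst_add, subst_neg]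

variable {ok op} in
theorem SlotLinear.subst {R : ℂ → Λ → Λ → Λ → Prop} {R' : ℂ → Λ' → Λ' → Λ' → Prop}
    {f : List Λ' → W} (hf : SlotLinear R' f)
    (hok : ∀ c x y z, R c x y z → ∀ u v, (ok (u ++ x :: v) ↔ ok (u ++ z :: v)) ∧
      (ok (u ++ y :: v) ↔ ok (u ++ z :: v)))
    (hop : ∀ c x y z, R c x y z → ∀ u v, ok (u ++ z :: v) →
      R' c (op (u ++ x :: v)) (op (u ++ y :: v)) (op (u ++ z :: v))) :
    SlotLinear R (subst ok op f) := by
  intro c x y z hR u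
  induction u using length_induction generalizing f with
  | h u ih =>
    intro v
    have hne : ∀ t : Λ, u ++ t :: v ≠ [] := by simp
    rw [subst_eq_dsum₁ _ _ _ (hne _), subst_eq_dsum₁ _ _ _ (hne _), subst_eq_dsum₁ _ _ _ (hne _)]
    simp only [dsum₁_append_cons]
    rw [smul_add, add_add_add_comm]
    congr 1
    · rw [← dsum₁_smul, ← dsum₁_add]
      refine dsum₁_congr fun p q hp e => ?_
      refine ih q (by simpa [← e] using List.length_pos_iff.2 hp) ?_ v
      intro c' x' y' z' hR' u' v'
      unfold blk
      split_ifs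
      · exact hf.cons _ c' x' y' z' hR' u' v'
      · simp
    · rw [← dsum_smul, ← dsum_add]
      refine dsum_congr fun p q _ => ?_
      rw [subst_blk, subst_blk, subst_blk]
      simp only [(hok c x y z hR u p).1, (hok c x y z hR u p).2]
      split_ifs with h
      · rw [← subst_smul, ← subst_add]
        exact subst_congr _ _ (fun w => hf _ _ _ _ (hop c x y z hR u p h) [] w) _
      · simp

end

section
variable (tw : Λ → Λ) (ok : List Λ → Prop) [DecidablePred ok] (op : List Λ → Λ)

theorem coder_smul (c : ℂ) (f : List Λ → W) (l : List Λ) :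
    coder tw ok op (fun w => c • f w) l = c • coder tw ok op f l :=
  (map_coder tw ok op (DistribSMul.toAddMonoidHom W c) f l).symm

theorem coder_neg (f : List Λ → W) (l : List Λ) :
    coder tw ok op (fun w => - f w) l = - coder tw ok op f l :=
  (map_coder tw ok op (negAddMonoidHom (α := W)) f l).symm

theorem coder_sub (f g : List Λ → W) (l : List Λ) :
    coder tw ok op (fun w => f w - g w) l = coder tw ok op f l - coder tw ok op g l := by
  simp only [sub_eq_add_neg, coder_add, coder_neg]

theorem coder_congr' {f f' : List Λ → W} {l : List Λ}
    (h : ∀ w, w ≠ [] → w.length ≤ l.length → f w = f' w) :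
    coder tw ok op f l = coder tw ok op f' l := by
  induction l generalizing f f' with
  | nil => rfl
  | cons a l ih =>
    simp only [coder_cons]
    rw [ih fun w _ hw => h _ (by simp) (by simpa using hw)]
    congr 1
    refine dsum_congr fun x y e => ?_
    rw [h _ (by simp) (by simp [← e])]

variable {tw ok op} in
theorem SlotLinear.coder {R : ℂ → Λ → Λ → Λ → Prop}
    {f : List Λ → W} (hf : SlotLinear R f)
    (htw : ∀ c x y z, R c x y z → R c (tw x) (tw y) (tw z))
    (hok : ∀ c x y z, R c x y z → ∀ u v, (ok (u ++ x :: v) ↔ ok (u ++ z :: v)) ∧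
      (ok (u ++ y :: v) ↔ ok (u ++ z :: v)))
    (hop : ∀ c x y z, R c x y z → ∀ u v, ok (u ++ z :: v) →
      R c (op (u ++ x :: v)) (op (u ++ y :: v)) (op (u ++ z :: v))) :
    SlotLinear R (coder tw ok op f) := by
  intro c x y z hR u
  induction u generalizing f with
  | nil =>
    intro v
    simp only [List.nil_append, coder_cons]
    rw [smul_add, add_add_add_comm, ← coder_smul, ← coder_add, ← dsum_smul, ← dsum_add]
    congr 1
    · refine dsum_congr fun p q _ => ?_
      have h1 := hok c x y z hR [] p
      simp only [List.nil_append] at h1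
      simp only [h1.1, h1.2]
      split_ifs with h
      · exact hf _ _ _ _ (hop c x y z hR [] p h) [] q
      · simp
    · exact coder_congr _ _ _ fun w _ => hf _ _ _ _ (htw c x y z hR) [] w
  | cons a u ih =>
    intro v
    simp only [List.cons_append, coder_cons, dsum_append_cons]
    rw [ih (hf.cons _)]
    have hA : dsum (fun p q => if ok (a :: p) then f (op (a :: p) :: (q ++ z :: v)) else 0) u =
        c • dsum (fun p q => if ok (a :: p) then f (op (a :: p) :: (q ++ x :: v)) else 0) u +
        dsum (fun p q => if ok (a :: p) then f (op (a :: p) :: (q ++ y :: v)) else 0) u := by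
      rw [← dsum_smul, ← dsum_add]
      refine dsum_congr fun p q _ => ?_
      split_ifs with h
      · exact hf.cons _ _ _ _ _ hR q v
      · simp
    have hB : dsum (fun p q => if ok (a :: (u ++ z :: p)) then f (op (a :: (u ++ z :: p)) :: q)
          else 0) v =
        c • dsum (fun p q => if ok (a :: (u ++ x :: p)) then f (op (a :: (u ++ x :: p)) :: q)
          else 0) v +
        dsum (fun p q => if ok (a :: (u ++ y :: p)) then f (op (a :: (u ++ y :: p)) :: q)
          else 0) v := by
      rw [← dsum_smul, ← dsum_add]
      refine dsum_congr fun p q _ => ?_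
      have h1 := hok c x y z hR (a :: u) p
      simp only [List.cons_append] at h1
      simp only [h1.1, h1.2]
      split_ifs with h
      · exact hf _ _ _ _ (hop c x y z hR (a :: u) p h) [] q
      · simp
    rw [hA, hB]
    simp only [smul_add]
    abel

end

end SlotLinear

/-! ### Multilinear series: composition and coderivations -/

section Series

variable {A B C W W' : Type*} [AddCommGroup A] [Module ℂ A] [AddCommGroup B] [Module ℂ B]
  [AddCommGroup C] [Module ℂ C] [AddCommGroup W] [Module ℂ W] [AddCommGroup W'] [Module ℂ W']

/-- A formal power series of multilinear maps, as a function on words. -/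
def ML (f : List A → W) : Prop := SlotLinear (fun c (x y z : A) => z = c • x + y) f

theorem ML.smul_add {f : List A → W} (h : ML f) (u v : List A) (c : ℂ) (x y : A) :
    f (u ++ (c • x + y) :: v) = c • f (u ++ x :: v) + f (u ++ y :: v) := h c x y _ rfl u v

theorem ML.add {f : List A → W} (h : ML f) (u v : List A) (x y : A) :
    f (u ++ (x + y) :: v) = f (u ++ x :: v) + f (u ++ y :: v) := by
  simpa using h.smul_add u v 1 x y

theorem ML.zero {f : List A → W} (h : ML f) (u v : List A) : f (u ++ 0 :: v) = 0 := by
  simpa using h.smul_add u v 1 0 0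

theorem ML.smul {f : List A → W} (h : ML f) (u v : List A) (c : ℂ) (x : A) :
    f (u ++ (c • x) :: v) = c • f (u ++ x :: v) := by
  simpa [h.zero] using h.smul_add u v c x 0

theorem ML.cons {f : List A → W} (h : ML f) (a : A) : ML fun w => f (a :: w) := SlotLinear.cons h a

/-- A multilinear series as a linear map of one of its arguments. -/
def ML.slot {f : List A → W} (h : ML f) (u v : List A) : A →ₗ[ℂ] W where
  toFun x := f (u ++ x :: v)
  map_add' x y := h.add u v x y
  map_smul' c x := h.smul u v c x

theorem ML.slot_apply {f : List A → W} (h : ML f) (u v : List A) (x : A) :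
    h.slot u v x = f (u ++ x :: v) := rfl

theorem ML.zero_fun : ML (fun _ : List A => (0 : W)) := by
  intro c x y z _ u v; simp

theorem ML.map {f : List A → W} (h : ML f) (φ : W →ₗ[ℂ] W') : ML fun l => φ (f l) := by
  intro c x y z hR u v; simp [h c x y z hR u v]

theorem ML.fun_add {f g : List A → W} (hf : ML f) (hg : ML g) : ML fun l => f l + g l := by
  intro c x y z hR u v
  simp only [hf c x y z hR u v, hg c x y z hR u v, _root_.smul_add]; abel

theorem ML.fun_smul {f : List A → W} (h : ML f) (c : ℂ) : ML fun l => c • f l :=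
  h.map (c • LinearMap.id)

theorem ML.fun_neg {f : List A → W} (h : ML f) : ML fun l => - f l :=
  h.map (-LinearMap.id)

theorem ML.fun_sub {f g : List A → W} (hf : ML f) (hg : ML g) : ML fun l => f l - g l := by
  simpa only [sub_eq_add_neg] using hf.fun_add hg.fun_neg

theorem ML.comp_map {f : List A → W} (h : ML f) (φ : B →ₗ[ℂ] A) : ML fun l => f (l.map φ) := by
  intro c x y z hR u v
  have := h.smul_add (u.map φ) (v.map φ) c (φ x) (φ y)
  simpa [hR] using this

theorem ML.of_length {f : List A → W}
    (h : ∀ n : ℕ, ∃ g : List A → W, ML g ∧ ∀ l, l.length ≤ n → f l = g l) : ML f := by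
  intro c x y z hR u v
  obtain ⟨g, hg, e⟩ := h (u.length + v.length + 1)
  rw [e _ (by simp; omega), e _ (by simp; omega), e _ (by simp; omega)]
  exact hg c x y z hR u v

theorem ML.truncate {f : List A → W} (h : ML f) (p : ℕ → Prop) [DecidablePred p] :
    ML fun l => if p l.length then f l else 0 := by
  intro c x y z hR u v
  simp only [List.length_append, List.length_cons]
  split_ifs
  · exact h c x y z hR u v
  · simp

/-- Substitution of the series `F` in the series `f`. -/
def comp (f : List B → W) (F : List A → B) : List A → W := subst (fun _ => True) F f

/-- The right action of the coderivation with components `r` on series; `σ` is the parity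
involution if `r` is odd, and the identity if `r` is even. -/
def cod (σ : A →ₗ[ℂ] A) (r : List A → A) (f : List A → W) : List A → W :=
  coder σ (fun _ => True) r f

@[simp] theorem comp_nil (f : List B → W) (F : List A → B) : comp f F [] = f [] := rfl

theorem comp_cons (f : List B → W) (F : List A → B) (a : A) (l : List A) :
    comp f F (a :: l) = dsum (fun x v => comp (fun w => f (F (a :: x) :: w)) F v) l := by
  unfold comp; rw [subst_cons]; simp [subst_blk]

theorem comp_eq_dsum₁ (f : List B → W) (F : List A → B) {l : List A} (hl : l ≠ []) :
    comp f F l = dsum₁ (fun b v => comp (fun w => f (F b :: w)) F v) l := by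
  cases l with
  | nil => exact (hl rfl).elim
  | cons a l => exact comp_cons f F a l

@[simp] theorem cod_nil (σ : A →ₗ[ℂ] A) (r : List A → A) (f : List A → W) : cod σ r f [] = 0 := rfl

theorem cod_cons (σ : A →ₗ[ℂ] A) (r : List A → A) (f : List A → W) (a : A) (l : List A) :
    cod σ r f (a :: l) = dsum (fun x v => f (r (a :: x) :: v)) l +
      cod σ r (fun w => f (σ a :: w)) l := by
  unfold cod; rw [coder_cons]; simp

theorem cod_eq_dsum (σ : A →ₗ[ℂ] A) (r : List A → A) (f : List A → W) (l : List A) :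
    cod σ r f l = dsum (fun u t => dsum₁ (fun b v => f (u.map σ ++ r b :: v)) t) l := by
  unfold cod; rw [coder_eq_dsum]; simp

theorem ML.comp {f : List B → W} {F : List A → B} (hf : ML f) (hF : ML F) : ML (comp f F) :=
  SlotLinear.subst hf (fun _ _ _ _ _ _ _ => by simp) fun c x y z hR u v _ => hF c x y z hR u v

theorem ML.cod {σ : A →ₗ[ℂ] A} {r : List A → A} {f : List A → W} (hf : ML f) (hr : ML r) :
    ML (cod σ r f) :=
  SlotLinear.coder hf (fun c x y z hR => by simp [hR]) (fun _ _ _ _ _ _ _ => by simp)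
    fun c x y z hR u v _ => hr c x y z hR u v

theorem comp_add (f g : List B → W) (F : List A → B) (l : List A) :
    comp (fun w => f w + g w) F l = comp f F l + comp g F l := subst_add _ _ _ _ _

theorem comp_sub (f g : List B → W) (F : List A → B) (l : List A) :
    comp (fun w => f w - g w) F l = comp f F l - comp g F l := subst_sub _ _ _ _ _

theorem comp_smul (c : ℂ) (f : List B → W) (F : List A → B) (l : List A) :
    comp (fun w => c • f w) F l = c • comp f F l := subst_smul _ _ _ _ _

theorem map_comp (φ : W →ₗ[ℂ] W') (f : List B → W) (F : List A → B) (l : List A) :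
    φ (comp f F l) = comp (fun w => φ (f w)) F l := map_subst _ _ φ.toAddMonoidHom _ _

@[simp] theorem comp_zero (F : List A → B) (l : List A) : comp (fun _ => (0 : W)) F l = 0 :=
  subst_zero _ _ _

theorem cod_add (σ : A →ₗ[ℂ] A) (r : List A → A) (f g : List A → W) (l : List A) :
    cod σ r (fun w => f w + g w) l = cod σ r f l + cod σ r g l := coder_add _ _ _ _ _ _

theorem cod_sub (σ : A →ₗ[ℂ] A) (r : List A → A) (f g : List A → W) (l : List A) :
    cod σ r (fun w => f w - g w) l = cod σ r f l - cod σ r g l := coder_sub _ _ _ _ _ _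

theorem cod_neg (σ : A →ₗ[ℂ] A) (r : List A → A) (f : List A → W) (l : List A) :
    cod σ r (fun w => - f w) l = - cod σ r f l := coder_neg _ _ _ _ _

theorem cod_smul (σ : A →ₗ[ℂ] A) (r : List A → A) (c : ℂ) (f : List A → W) (l : List A) :
    cod σ r (fun w => c • f w) l = c • cod σ r f l := coder_smul _ _ _ _ _ _

theorem map_cod (φ : W →ₗ[ℂ] W') (σ : A →ₗ[ℂ] A) (r : List A → A) (f : List A → W) (l : List A) :
    φ (cod σ r f l) = cod σ r (fun w => φ (f w)) l := map_coder _ _ _ φ.toAddMonoidHom _ _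

@[simp] theorem cod_zero (σ : A →ₗ[ℂ] A) (r : List A → A) (l : List A) :
    cod σ r (fun _ => (0 : W)) l = 0 := coder_zero _ _ _ _

theorem cod_congr {σ : A →ₗ[ℂ] A} {r : List A → A} {f g : List A → W} {l : List A}
    (h : ∀ w, w ≠ [] → w.length ≤ l.length → f w = g w) : cod σ r f l = cod σ r g l :=
  coder_congr' _ _ _ h

theorem comp_dsum (g : List B → List B → W) (F : List A → B) (l : List A) :
    comp (fun w => dsum g w) F l =
      dsum (fun x y => comp (fun p => comp (fun q => g p q) F y) F x) l := subst_dsum _ _ _ _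

theorem cod_dsum (σ : A →ₗ[ℂ] A) (r : List A → A) (g : List A → List A → W) (l : List A) :
    cod σ r (fun w => dsum g w) l =
      dsum (fun x y => cod σ r (fun p => g p y) x) l +
      dsum (fun x y => cod σ r (fun q => g (x.map σ) q) y) l := coder_dsum _ _ _ _ _

/-- `comp (f (x :: ·)) F l` is linear in `x`. -/
def ML.headComp {f : List B → W} (hf : ML f) (F : List A → B) (l : List A) : B →ₗ[ℂ] W where
  toFun x := _root_.comp (fun w => f (x :: w)) F l
  map_add' x y := by rw [← comp_add]; congr 1; funext w; exact hf.add [] w x y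
  map_smul' c x := by rw [RingHom.id_apply, ← comp_smul]; congr 1; funext w; exact hf.smul [] w c x

theorem ML.headComp_apply {f : List B → W} (hf : ML f) (F : List A → B) (l : List A) (x : B) :
    hf.headComp F l x = _root_.comp (fun w => f (x :: w)) F l := rfl

/-- Both sides sum over nested decompositions in blocks. Multilinearity of `f` is needed to pull the
inner sum out of the first argument; that of `F` and `G` is not. -/
theorem comp_assoc {f : List C → W} (hf : ML f) (F : List B → C) (G : List A → B) (l : List A) :
    comp (comp f F) G l = comp f (comp F G) l := by
  induction l using length_induction generalizing f with
  | h l ih =>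
    cases l with
    | nil => rfl
    | cons a l =>
      simp only [comp_cons, comp_dsum]
      have e1 : ∀ c v, comp (fun w => f (dsum (fun x v1 => comp (fun w => F (G (a :: x) :: w)) G v1) c
          :: w)) (comp F G) v = dsum (fun x v1 => comp (fun p => comp (fun w =>
            f (F (G (a :: x) :: p) :: w)) (comp F G) v) G v1) c := by
        intro c v
        rw [← hf.headComp_apply, ← LinearMap.toAddMonoidHom_coe, map_dsum]
        refine dsum_congr fun x y _ => ?_
        rw [LinearMap.toAddMonoidHom_coe, map_comp]
        rfl
      simp only [e1]
      rw [dsum_assoc (fun x v1 v => comp (fun p => comp (fun w =>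
            f (F (G (a :: x) :: p) :: w)) (comp F G) v) G v1)]
      refine dsum_congr fun x v e => dsum_congr fun v1 v2 e' => ?_
      congr 1
      funext p
      exact ih v2 (by simp [← e, ← e']; omega) (hf.cons _)

/-- The operation `r` acts inside the first block, or passes it; in the second case `hF` moves the
involution from the letters of the block to the value of `F`. -/
theorem cod_comp {σ : A →ₗ[ℂ] A} {σ' : B →ₗ[ℂ] B} {r : List A → A} {f : List B → W}
    {F : List A → B} (hf : ML f) (hF : ∀ b, F (b.map σ) = σ' (F b)) (l : List A) :
    cod σ r (comp f F) l =
      dsum₁ (fun b v => comp (fun w => f (cod σ r F b :: w)) F v) l +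
      dsum₁ (fun b v => cod σ r (comp (fun w => f (σ' (F b) :: w)) F) v) l := by
  -- The value 0 on an empty first block turns the sum over non-empty blocks into a full `dsum`, to
  -- which the Leibniz rule applies.
  let g : List A → List A → W := fun b v => if b = [] then 0 else comp (fun w => f (F b :: w)) F v
  have h1 : cod σ r (comp f F) l = cod σ r (fun w => dsum g w) l := by
    refine cod_congr fun w hw _ => ?_
    rw [comp_eq_dsum₁ f F hw, dsum_eq_add_dsum₁]
    simp only [g, ↓reduceIte, zero_add]
    exact dsum₁_congr fun x y hx _ => by rw [if_neg hx]
  rw [h1, cod_dsum, dsum_eq_add_dsum₁, dsum_eq_add_dsum₁]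
  simp only [cod_nil, zero_add]
  have h2 : cod σ r (fun q => g ([].map σ) q) l = 0 := by
    simp [g]
  rw [h2, zero_add]
  congr 1
  · refine dsum₁_congr fun x y _ _ => ?_
    rw [← hf.headComp_apply, map_cod]
    refine cod_congr fun w hw _ => ?_
    simp only [g, if_neg hw]; rfl
  · refine dsum₁_congr fun x y hx _ => ?_
    have : x.map σ ≠ [] := by simpa using hx
    simp only [g, if_neg this, hF]

/-- If `s` consumes the first blocks, these together form a longer piece `b` of the word and
contribute `comp s F b`; otherwise the first block is passed. -/
theorem comp_cod {σ' : B →ₗ[ℂ] B} {s : List B → B} {f : List B → W}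
    {F : List A → B} (hf : ML f) (l : List A) :
    comp (cod σ' s f) F l =
      dsum₁ (fun b v => comp (fun w => f (comp s F b :: w)) F v) l +
      dsum₁ (fun b v => comp (cod σ' s (fun w => f (σ' (F b) :: w))) F v) l := by
  rcases eq_or_ne l [] with rfl | hl
  · simp
  rw [comp_eq_dsum₁ _ F hl, ← dsum₁_add]
  have e2 : dsum₁ (fun b v => comp (fun w => f (comp s F b :: w)) F v) l =
      dsum₁ (fun b v => dsum₁ (fun x v1 => comp (fun p => comp (fun w => f (s (F x :: p) :: w)) F v)
        F v1) b) l := by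
    refine dsum₁_congr fun b v hb _ => ?_
    rw [← hf.headComp_apply, comp_eq_dsum₁ s F hb, ← LinearMap.toAddMonoidHom_coe, map_dsum₁]
    refine dsum₁_congr fun x y _ _ => ?_
    rw [LinearMap.toAddMonoidHom_coe, map_comp]
    rfl
  rw [dsum₁_add, e2, dsum₁_assoc, ← dsum₁_add]
  refine dsum₁_congr fun b v _ _ => ?_
  simp only [cod_cons, comp_add, comp_dsum]

/-- Chain rule with a defect. When `F` satisfies the morphism equation on words shorter than `n`,
the equation at length `n` is used only in the term where the whole word is a single block, so the
failure is the linear term of `f` applied to the failure of `F`. Inverses and homotopy transfer both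
rest on this. -/
theorem cod_comp_eq_of_length_le {σ : A →ₗ[ℂ] A} {σ' : B →ₗ[ℂ] B} {r : List A → A}
    {s : List B → B} {f : List B → W}
    {F : List A → B} (hf : ML f) (hF : ∀ b, F (b.map σ) = σ' (F b)) {n : ℕ}
    (hE : ∀ b, b ≠ [] → b.length < n → cod σ r F b = comp s F b) {l : List A} (hl : l ≠ [])
    (hn : l.length ≤ n) :
    cod σ r (comp f F) l = comp (cod σ' s f) F l + (f [cod σ r F l] - f [comp s F l]) := by
  induction l using length_induction generalizing f with
  | h l ih =>
    rw [cod_comp hf hF, comp_cod hf, add_assoc, add_comm (dsum₁ _ _) (_ - _), ← add_assoc]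
    congr 1
    · obtain ⟨a, l, rfl⟩ := List.exists_cons_of_ne_nil hl
      -- If `v` is non-empty then `x` is shorter than `n` and `hE` applies; only `v = []` leaves a
      -- defect.
      have key : ∀ x v, x ++ v = a :: l → x ≠ [] → comp (fun w => f (cod σ r F x :: w)) F v =
          comp (fun w => f (comp s F x :: w)) F v +
            if v = [] then f [cod σ r F x] - f [comp s F x] else 0 := by
        intro x v e hx
        split_ifs with hv
        · subst hv; simp
        · rw [hE x hx, add_zero]
          have h1 : x.length + v.length = (a :: l).length := by rw [← List.length_append, e]
          have := List.length_pos_iff.2 hv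
          omega
      rw [dsum₁_congr fun x v hx e => key x v e hx, dsum₁_add]
      congr 1
      rcases List.eq_nil_or_concat (a :: l) with h | ⟨L, z, h⟩
      · simp at h
      · rw [h]
        simp only [List.concat_eq_append, dsum₁_append_cons]
        rw [dsum₁_eq_zero (fun x y _ _ => by simp)]
        simp
    · refine dsum₁_congr fun x v hx e => ?_
      rcases eq_or_ne v [] with rfl | hv
      · simp
      have h1 : x.length + v.length = l.length := by rw [← List.length_append, e]
      have h2 := List.length_pos_iff.2 hx
      rw [ih v (by omega) (hf.cons _) hv (by omega), hE v hv (by omega)]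
      simp

theorem cod_comp_of_eq {σ : A →ₗ[ℂ] A} {σ' : B →ₗ[ℂ] B} {r : List A → A}
    {s : List B → B} {f : List B → W}
    {F : List A → B} (hf : ML f) (hF : ∀ b, F (b.map σ) = σ' (F b))
    (hE : ∀ b, b ≠ [] → cod σ r F b = comp s F b) (l : List A) :
    cod σ r (comp f F) l = comp (cod σ' s f) F l := by
  rcases eq_or_ne l [] with rfl | hl
  · simp
  rw [cod_comp_eq_of_length_le hf hF (fun b hb _ => hE b hb) hl le_rfl, hE l hl]
  simp

/-- The anticommutator of two odd coderivations. -/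
theorem cod_cod {σ τ : A →ₗ[ℂ] A} (hτ : ∀ a, σ (σ a) = τ a) {r s : List A → A}
    (hr : ∀ b, r (b.map σ) = - σ (r b)) (hs : ∀ b, s (b.map σ) = - σ (s b))
    {f : List A → W} (hf : ML f) (l : List A) :
    cod σ s (cod σ r f) l + cod σ r (cod σ s f) l =
      cod τ (fun b => cod σ s r b + cod σ r s b) f l := by
  induction l generalizing f with
  | nil => simp
  | cons a l ih =>
    -- Either `s` feeds into `r`, or the two act on disjoint blocks, or neither touches the first
    -- letter. The disjoint terms are antisymmetric in `r` and `s`, so they cancel in the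
    -- anticommutator.
    have key : ∀ {r s : List A → A}, (∀ b, r (b.map σ) = - σ (r b)) →
        cod σ s (cod σ r f) (a :: l) =
        dsum (fun x v => f (cod σ s r (a :: x) :: v)) l +
        (dsum (fun x v => cod σ r (fun w => f (σ (s (a :: x)) :: w)) v) l
          - dsum (fun x v => cod σ s (fun w => f (σ (r (a :: x)) :: w)) v) l) +
        cod σ s (cod σ r (fun w => f (σ (σ a) :: w))) l := by
      intro r s hr
      rw [cod_cons]
      simp only [cod_cons, cod_add, dsum_add, cod_dsum]
      have e1 : dsum (fun x v => f ((dsum (fun p q => r (s (a :: p) :: q)) x +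
          cod σ s (fun w => r (σ a :: w)) x) :: v)) l =
          dsum (fun x v => dsum (fun p q => f (r (s (a :: x) :: p) :: q)) v) l +
          dsum (fun x v => cod σ s (fun p => f (r (σ a :: p) :: v)) x) l := by
        have : ∀ x v, f ((dsum (fun p q => r (s (a :: p) :: q)) x +
          cod σ s (fun w => r (σ a :: w)) x) :: v) =
            dsum (fun p q => f (r (s (a :: p) :: q) :: v)) x +
              cod σ s (fun p => f (r (σ a :: p) :: v)) x := by
          intro x v
          rw [← List.nil_append (_ :: v), ← hf.slot_apply, map_add, map_cod,
            ← LinearMap.toAddMonoidHom_coe, map_dsum]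
          rfl
        simp only [this, dsum_add]
        rw [dsum_assoc (fun p q v => f (r (s (a :: p) :: q) :: v))]
      have e2 : dsum (fun x v => cod σ s (fun q => f (r (σ a :: x.map σ) :: q)) v) l =
          - dsum (fun x v => cod σ s (fun w => f (σ (r (a :: x)) :: w)) v) l := by
        rw [← dsum_neg]
        refine dsum_congr fun x v _ => ?_
        rw [← cod_neg]
        congr 1
        funext w
        have := hr (a :: x)
        rw [List.map_cons] at this
        rw [this]
        have := hf.smul [] w (-1) (σ (r (a :: x)))
        simpa using this
      rw [e1, e2]
      abel
    rw [key hr, key hs, cod_cons]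
    have e3 : dsum (fun x v => f ((cod σ s r (a :: x) + cod σ r s (a :: x)) :: v)) l =
        dsum (fun x v => f (cod σ s r (a :: x) :: v)) l +
        dsum (fun x v => f (cod σ r s (a :: x) :: v)) l := by
      rw [← dsum_add]
      exact dsum_congr fun x v _ => hf.add [] v _ _
    rw [e3, ← ih (hf.cons _)]
    simp only [hτ]
    abel

/-- The anticommutator of an odd coderivation with itself is twice its square, and its components
are twice `cod σ r r`; divide by 2. -/
theorem cod_cod_self {σ : A →ₗ[ℂ] A} {r : List A → A}
    (hr : ∀ b, r (b.map σ) = - σ (r b)) {f : List A → W} (hf : ML f) {l : List A}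
    (h0 : ∀ b, b ≠ [] → b.length ≤ l.length → cod σ r r b = 0) :
    cod σ r (cod σ r f) l = 0 := by
  have h := cod_cod (τ := σ ∘ₗ σ) (fun _ => rfl) hr hr hf l
  have h2 : cod (σ ∘ₗ σ) (fun b => cod σ r r b + cod σ r r b) f l = 0 := by
    rw [cod_eq_dsum]
    refine dsum_eq_zero fun u t e => dsum₁_eq_zero fun b v hb e' => ?_
    rw [h0 b hb (by simp [← e, ← e']; omega), add_zero]
    exact hf.zero _ _
  rw [h2, ← two_smul ℂ, smul_eq_zero] at h
  exact h.resolve_left two_ne_zero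

end Series

/-! ### Sums over `Composition` and relabelling of letters -/

section CompositionSums

variable {Λ Λ' W : Type*} [AddCommMonoid W]

theorem sum_composition_succ (n : ℕ) (G : List ℕ → W) :
    ∑ c : Composition (n + 1), G c.blocks =
      ∑ j ∈ Finset.range (n + 1), ∑ c : Composition (n - j), G ((j + 1) :: c.blocks) := by
  rw [← Fin.sum_univ_eq_sum_range (fun j => ∑ c : Composition (n - j), G ((j + 1) :: c.blocks)),
    ← Fintype.sum_sigma' (fun (j : Fin (n + 1)) (c : Composition (n - j)) =>
      G ((j + 1) :: c.blocks))]
  symm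
  refine Fintype.sum_bijective (fun p : Σ j : Fin (n + 1), Composition (n - j) =>
    (⟨(p.1 + 1) :: p.2.blocks, ?_, ?_⟩ : Composition (n + 1))) ⟨?_, ?_⟩ _ _ fun _ => rfl
  · intro i hi
    rcases List.mem_cons.1 hi with rfl | hi
    · omega
    · exact p.2.blocks_pos hi
  · rw [List.sum_cons, p.2.blocks_sum]; have := p.1.2; omega
  · rintro ⟨⟨j, hj⟩, c⟩ ⟨⟨j', hj'⟩, c'⟩ h
    simp only [Composition.mk.injEq, List.cons.injEq, add_left_inj] at h
    obtain ⟨rfl, h⟩ := h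
    obtain rfl : c = c' := Composition.ext h
    rfl
  · intro c
    obtain ⟨b, bs, e⟩ : ∃ b bs, c.blocks = b :: bs := by
      cases h : c.blocks with
      | nil => have := c.blocks_sum; simp [h] at this
      | cons b bs => exact ⟨b, bs, rfl⟩
    have hb : 0 < b := c.blocks_pos (by simp [e])
    have hs := c.blocks_sum
    rw [e, List.sum_cons] at hs
    refine ⟨⟨⟨b - 1, by omega⟩, ⟨bs, fun {i} hi => c.blocks_pos (by simp [e, hi]),
      by simp only; omega⟩⟩, ?_⟩
    apply Composition.ext
    simp only [e, List.cons.injEq, and_true]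
    omega

/-- Splitting off the first part of the composition gives the recursion of `subst`; this connects
the definitions of morphisms and push-forward with substitution. -/
theorem sum_composition_eq_subst (G : List (List Λ) → W) (l : List Λ) :
    ∑ c : Composition l.length, G (l.splitWrtComposition c) =
      subst (fun _ => True) (fun b : List Λ => b) G l := by
  have : ∀ l : List Λ, ∀ G : List (List Λ) → W, ∑ c : Composition l.length,
      G (l.splitWrtCompositionAux c.blocks) = subst (fun _ => True) (fun b : List Λ => b) G l := by
    intro l
    induction l using length_induction with
    | h l ih =>
      intro G
      cases l with
      | nil =>
        rw [subst_nil]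
        have : ∀ c : Composition ([] : List Λ).length, c.blocks = [] := by
          intro c
          cases h : c.blocks with
          | nil => rfl
          | cons b bs =>
            have h1 := c.blocks_sum
            have h2 : 0 < b := c.blocks_pos (by simp [h])
            simp [h] at h1; omega
        simp only [this]
        rw [Finset.sum_const, Finset.card_univ]
        simp [List.splitWrtCompositionAux, composition_card]
      | cons a l =>
        rw [subst_cons, ← sum_range_eq_dsum, List.length_cons,
          sum_composition_succ l.length fun ns => G ((a :: l).splitWrtCompositionAux ns)]
        refine Finset.sum_congr rfl fun j _ => ?_
        rw [subst_blk, if_pos trivial, ← ih (l.drop j) (by simp), List.length_drop]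
        refine Finset.sum_congr rfl fun c _ => ?_
        rw [List.splitWrtCompositionAux_cons]
        rfl
  exact this l G

theorem subst_id_eq (ok : List Λ → Prop) [DecidablePred ok] (op : List Λ → Λ') (f : List Λ' → W)
    (l : List Λ) :
    subst (fun _ => True) (fun b : List Λ => b)
      (fun p => if ∀ b ∈ p, ok b then f (p.map op) else 0) l = subst ok op f l := by
  induction l using length_induction generalizing f with
  | h l ih =>
    cases l with
    | nil => simp
    | cons a l =>
      rw [subst_cons, subst_cons]
      refine dsum_congr fun x y e => ?_
      rw [← ih y (by simp [← e])]
      refine subst_congr _ _ (fun w => ?_) _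
      simp only [blk, List.mem_cons, forall_eq_or_imp, List.map_cons, if_true]
      split_ifs <;> simp_all

theorem sum_composition_subst (ok : List Λ → Prop) [DecidablePred ok] (op : List Λ → Λ')
    (f : List Λ' → W) (l : List Λ) :
    ∑ c : Composition l.length, (if ∀ b ∈ l.splitWrtComposition c, ok b then
      f ((l.splitWrtComposition c).map op) else 0) = subst ok op f l := by
  rw [← subst_id_eq, sum_composition_eq_subst
    (fun p => if ∀ b ∈ p, ok b then f (p.map op) else 0)]

theorem subst_map {Γ Γ' : Type*} (ok : List Λ → Prop) [DecidablePred ok] (op : List Λ → Λ')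
    (ok' : List Γ → Prop) [DecidablePred ok'] (op' : List Γ → Γ') (c : Γ → Λ) (c' : Γ' → Λ')
    (hok : ∀ b, b ≠ [] → (ok (b.map c) ↔ ok' b)) (hop : ∀ b, b ≠ [] → op (b.map c) = c' (op' b))
    (f : List Λ' → W) (l : List Γ) :
    subst ok op f (l.map c) = subst ok' op' (fun w => f (w.map c')) l := by
  induction l using length_induction generalizing f with
  | h l ih =>
    cases l with
    | nil => rfl
    | cons a l =>
      rw [List.map_cons, subst_cons, subst_cons, dsum_map]
      refine dsum_congr fun x y e => ?_
      rw [ih y (by simp [← e])]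
      refine subst_congr _ _ (fun w => ?_) _
      have h1 := hok (a :: x) (by simp)
      have h2 := hop (a :: x) (by simp)
      rw [List.map_cons] at h1 h2
      simp only [blk, h1, h2, List.map_cons]

theorem coder_map {Γ : Type*} (tw : Λ → Λ) (ok : List Λ → Prop) [DecidablePred ok]
    (op : List Λ → Λ) (tw' : Γ → Γ)
    (ok' : List Γ → Prop) [DecidablePred ok'] (op' : List Γ → Γ) (c : Γ → Λ)
    (htw : ∀ a, tw (c a) = c (tw' a))
    (hok : ∀ b, b ≠ [] → (ok (b.map c) ↔ ok' b)) (hop : ∀ b, b ≠ [] → op (b.map c) = c (op' b))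
    (f : List Λ → W) (l : List Γ) :
    coder tw ok op f (l.map c) = coder tw' ok' op' (fun w => f (w.map c)) l := by
  induction l generalizing f with
  | nil => rfl
  | cons a l ih =>
    rw [List.map_cons, coder_cons, coder_cons, dsum_map, ih, htw]
    congr 1
    refine dsum_congr fun x y e => ?_
    have h1 := hok (a :: x) (by simp)
    have h2 := hop (a :: x) (by simp)
    rw [List.map_cons] at h1 h2
    simp only [h1, h2, List.map_cons]

end CompositionSums

/-! ### Linear series, and fixed points by word length -/

section LinearSeries

variable {A B C W : Type*} [AddCommGroup A] [Module ℂ A] [AddCommGroup B] [Module ℂ B]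
  [AddCommGroup C] [Module ℂ C] [AddCommGroup W] [Module ℂ W]

theorem dsum_eq_last {Λ : Type*} {g : List Λ → List Λ → W} {l : List Λ}
    (h : ∀ x y, x ++ y = l → y ≠ [] → g x y = 0) : dsum g l = g l [] := by
  induction l generalizing g with
  | nil => rfl
  | cons a l ih =>
    rw [dsum_cons, h [] _ rfl (by simp), zero_add, ih fun x y e hy => h (a :: x) y (by simp [e]) hy]

theorem dsum_eq_first {Λ : Type*} {g : List Λ → List Λ → W} {l : List Λ}
    (h : ∀ x y, x ++ y = l → x ≠ [] → g x y = 0) : dsum g l = g [] l := by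
  rw [dsum_eq_add_dsum₁, dsum₁_eq_zero fun x y hx e => h x y e hx, add_zero]

theorem comp_congr {f g : List B → W} {F : List A → B} {l : List A} (hl : l ≠ [])
    (h : ∀ w, w ≠ [] → w.length ≤ l.length → f w = g w) : comp f F l = comp g F l := by
  induction l using length_induction generalizing f g with
  | h l ih =>
    rw [comp_eq_dsum₁ _ _ hl, comp_eq_dsum₁ _ _ hl]
    refine dsum₁_congr fun x y hx e => ?_
    have h1 : x.length + y.length = l.length := by rw [← List.length_append, e]
    have := List.length_pos_iff.2 hx
    rcases eq_or_ne y [] with rfl | hy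
    · simpa using h [F x] (by simp) (by simp; simp at h1; omega)
    · exact ih y (by omega) hy fun w hw hw' => h _ (by simp) (by simp; omega)

theorem comp_congr_right {f : List B → W} {F G : List A → B} {l : List A}
    (h : ∀ b, b ≠ [] → b.length ≤ l.length → F b = G b) : comp f F l = comp f G l := by
  induction l using length_induction generalizing f with
  | h l ih =>
    rcases eq_or_ne l [] with rfl | hl
    · simp
    rw [comp_eq_dsum₁ _ _ hl, comp_eq_dsum₁ _ _ hl]
    refine dsum₁_congr fun x y hx e => ?_
    have h1 : x.length + y.length = l.length := by rw [← List.length_append, e]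
    have := List.length_pos_iff.2 hx
    rw [h x hx (by omega)]
    exact ih y (by omega) fun b hb hb' => h b hb (by omega)

theorem cod_congr_op {σ : A →ₗ[ℂ] A} {r s : List A → A} {f : List A → W} {l : List A}
    (h : ∀ b, b ≠ [] → b.length ≤ l.length → r b = s b) : cod σ r f l = cod σ s f l := by
  rw [cod_eq_dsum, cod_eq_dsum]
  refine dsum_congr fun u t e => dsum₁_congr fun b v hb e' => ?_
  rw [h b hb (by simp [← e, ← e']; omega)]

theorem cod_op_add {σ : A →ₗ[ℂ] A} (r s : List A → A) {f : List A → W} (hf : ML f) (l : List A) :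
    cod σ (fun b => r b + s b) f l = cod σ r f l + cod σ s f l := by
  simp only [cod_eq_dsum, hf.add, dsum₁_add, dsum_add]

/-- The series with linear part `φ` and no other terms. -/
def lin (φ : A →ₗ[ℂ] B) : List A → B
  | [a] => φ a
  | _ => 0

@[simp] theorem lin_nil (φ : A →ₗ[ℂ] B) : lin φ [] = 0 := rfl
@[simp] theorem lin_singleton (φ : A →ₗ[ℂ] B) (a : A) : lin φ [a] = φ a := rfl
@[simp] theorem lin_cons_cons (φ : A →ₗ[ℂ] B) (a b : A) (l : List A) : lin φ (a :: b :: l) = 0 := rfl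

theorem lin_of_length_ne {φ : A →ₗ[ℂ] B} {l : List A} (h : l.length ≠ 1) : lin φ l = 0 := by
  match l, h with
  | [], _ => rfl
  | [a], h => simp at h
  | a :: b :: l, _ => rfl

theorem ML.lin (φ : A →ₗ[ℂ] B) : ML (lin φ) := by
  rintro c x y z hR u v
  rcases eq_or_ne (u ++ z :: v).length 1 with h | h
  · obtain ⟨rfl, rfl⟩ : u = [] ∧ v = [] := by
      simp at h
      exact ⟨by simpa using List.length_eq_zero_iff.1 (by omega : u.length = 0),
        by simpa using List.length_eq_zero_iff.1 (by omega : v.length = 0)⟩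
    simp [hR]
  · rw [lin_of_length_ne h, lin_of_length_ne (by simpa using h), lin_of_length_ne (by simpa using h)]
    simp

theorem comp_lin_left (φ : B →ₗ[ℂ] C) (F : List A → B) {l : List A} (hl : l ≠ []) :
    comp (lin φ) F l = φ (F l) := by
  obtain ⟨a, l, rfl⟩ := List.exists_cons_of_ne_nil hl
  rw [comp_cons, dsum_eq_last]
  · simp
  · intro x y _ hy
    rw [comp_congr hy (g := fun _ => 0), comp_zero]
    intro w hw _
    exact lin_of_length_ne (by simpa using hw)

theorem comp_lin_right {f : List B → W} (hf : ML f) (φ : A →ₗ[ℂ] B) (l : List A) :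
    comp f (lin φ) l = f (l.map φ) := by
  induction l generalizing f with
  | nil => rfl
  | cons a l ih =>
    rw [comp_cons, dsum_eq_first]
    · simpa using ih (hf.cons _)
    · intro x y _ hx
      rw [lin_of_length_ne (by simpa using hx)]
      have : (fun w => f (0 :: w)) = fun _ => 0 := by funext w; exact hf.zero [] w
      rw [this, comp_zero]

theorem comp_lin_id {f : List A → W} (hf : ML f) (l : List A) : comp f (lin LinearMap.id) l = f l := by
  simp [comp_lin_right hf]

theorem cod_lin_left (σ : A →ₗ[ℂ] A) (φ : A →ₗ[ℂ] B) (r : List A → A) {l : List A} (hl : l ≠ []) :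
    cod σ r (lin φ) l = φ (r l) := by
  obtain ⟨a, l, rfl⟩ := List.exists_cons_of_ne_nil hl
  rw [cod_cons, dsum_eq_last]
  · rw [cod_congr (g := fun _ => 0)]
    · simp
    · intro w hw _
      exact lin_of_length_ne (by simpa using hw)
  · intro x y _ hy
    exact lin_of_length_ne (by simpa using hy)

theorem cod_lin_cons (σ δ : A →ₗ[ℂ] A) {f : List A → W} (hf : ML f) (a : A) (l : List A) :
    cod σ (lin δ) f (a :: l) = f (δ a :: l) + cod σ (lin δ) (fun w => f (σ a :: w)) l := by
  rw [cod_cons, dsum_eq_first]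
  · simp
  · intro x y _ hx
    rw [lin_of_length_ne (by simpa using hx)]
    exact hf.zero [] y

/-- Fixed points of operators that strictly increase the order of agreement. -/
theorem exists_fixedPoint {Λ W : Type*} [Zero W] (Θ : (List Λ → W) → List Λ → W)
    (hΘ : ∀ f g n, (∀ l, l.length < n → f l = g l) → ∀ l, l.length = n → Θ f l = Θ g l) :
    ∃ f, Θ f = f ∧ ∀ P : (List Λ → W) → Prop, P (fun _ => 0) → (∀ f, P f → P (Θ f)) →
      ∀ n, ∃ g, P g ∧ ∀ l, l.length ≤ n → f l = g l := by
  -- On words of length `n` the iterates are constant from the `(n + 1)`-st on, so the diagonal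
  -- choice `Θ^[l.length + 1]` is their limit.
  have key : ∀ n k j, n < k → n < j → ∀ l : List Λ, l.length = n →
      Θ^[k] (fun _ => 0) l = Θ^[j] (fun _ => 0) l := by
    intro n
    induction n using Nat.strong_induction_on with
    | h n ih =>
      intro k j hk hj l hl
      obtain ⟨k, rfl⟩ : ∃ i, k = i + 1 := ⟨k - 1, by omega⟩
      obtain ⟨j, rfl⟩ : ∃ i, j = i + 1 := ⟨j - 1, by omega⟩
      rw [Function.iterate_succ_apply', Function.iterate_succ_apply']
      exact hΘ _ _ n (fun l' hl' => ih _ hl' k j (by omega) (by omega) l' rfl) l hl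
  refine ⟨fun l => Θ^[l.length + 1] (fun _ => 0) l, ?_, ?_⟩
  · funext l
    rw [Function.iterate_succ_apply']
    exact hΘ _ _ l.length (fun l' hl' => key _ _ _ (by omega) hl' l' rfl) l rfl
  · intro P h0 hP n
    refine ⟨Θ^[n + 1] fun _ => 0, ?_, fun l hl => key l.length _ _ (by omega) (by omega) l rfl⟩
    have : ∀ k, P (Θ^[k] fun _ => 0) := by
      intro k
      induction k with
      | zero => exact h0
      | succ k ih => rw [Function.iterate_succ_apply']; exact hP _ ih
    exact this _

end LinearSeries

noncomputable section

/-! ### Koszul signs for gradings by ℤ and ℤ₂ -/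

section Signs

variable {m : ℕ} [hm : Fact (m = 0 ∨ m = 2)]

/-- For `m = 0` the value `ZMod.val` is the absolute value of an integer, so its parity is additive.
For odd `m` this would fail, because reduction modulo `m` changes parity. -/
theorem even_val_add (g h : ZMod m) : (g + h).val % 2 = (g.val + h.val) % 2 := by
  rcases hm.out with rfl | rfl
  · change Int.natAbs ((g : ℤ) + (h : ℤ)) % 2 = (Int.natAbs g + Int.natAbs h) % 2
    generalize (g : ℤ) = a
    generalize (h : ℤ) = b
    omega
  · revert g h; decide

theorem neg_one_pow_eq_of_mod {a b : ℕ} (h : a % 2 = b % 2) : (-1 : ℂ) ^ a = (-1) ^ b := by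
  rw [neg_one_pow_eq_pow_mod_two, h, ← neg_one_pow_eq_pow_mod_two]

theorem sgn_add (g h : ZMod m) : sgn (g + h) = sgn g * sgn h := by
  unfold sgn; rw [← pow_add]; exact neg_one_pow_eq_of_mod (even_val_add g h)

omit hm in
@[simp] theorem sgn_zero : sgn (0 : ZMod m) = 1 := by simp [sgn]

@[simp] theorem sgn_one : sgn (1 : ZMod m) = -1 := by
  unfold sgn
  rcases hm.out with rfl | rfl
  · change (-1 : ℂ) ^ Int.natAbs 1 = -1; simp
  · change (-1 : ℂ) ^ 1 = -1; simp

omit hm in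
@[simp] theorem sgn_mul_self (g : ZMod m) : sgn g * sgn g = 1 := by
  unfold sgn; rw [← mul_pow]; simp

omit hm in
theorem sgn_ne_zero (g : ZMod m) : sgn g ≠ 0 := by
  intro h; simpa [h] using sgn_mul_self g

theorem sgn_neg (g : ZMod m) : sgn (-g) = sgn g := by
  have h1 : sgn (-g) * sgn g = 1 := by rw [← sgn_add]; simp
  calc sgn (-g) = sgn (-g) * (sgn g * sgn g) := by simp
    _ = sgn g := by rw [← mul_assoc, h1, one_mul]

theorem sgn_sub (g h : ZMod m) : sgn (g - h) = sgn g * sgn h := by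
  rw [sub_eq_add_neg, sgn_add, sgn_neg]

theorem koszul_add_right (g h h' : ZMod m) : koszul g (h + h') = koszul g h * koszul g h' := by
  unfold koszul
  rw [← pow_add, ← mul_add]
  refine neg_one_pow_eq_of_mod ?_
  rw [Nat.mul_mod, even_val_add, ← Nat.mul_mod]

omit hm in
theorem koszul_comm (g h : ZMod m) : koszul g h = koszul h g := by
  unfold koszul; rw [mul_comm]

theorem koszul_add_left (g g' h : ZMod m) : koszul (g + g') h = koszul g h * koszul g' h := by
  rw [koszul_comm, koszul_add_right, koszul_comm h, koszul_comm h]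

omit hm in
@[simp] theorem koszul_mul_self (g h : ZMod m) : koszul g h * koszul g h = 1 := by
  unfold koszul; rw [← mul_pow]; simp

omit hm in
@[simp] theorem koszul_zero_right (g : ZMod m) : koszul g 0 = 1 := by simp [koszul]

omit hm in
@[simp] theorem koszul_zero_left (g : ZMod m) : koszul 0 g = 1 := by simp [koszul]

@[simp] theorem koszul_one_right (g : ZMod m) : koszul g 1 = sgn g := by
  unfold koszul sgn
  rcases hm.out with rfl | rfl
  · change (-1 : ℂ) ^ (Int.natAbs g * Int.natAbs 1) = _; simp; rfl
  · change (-1 : ℂ) ^ (g.val * 1) = _; simp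

@[simp] theorem koszul_one_left (g : ZMod m) : koszul 1 g = sgn g := by
  rw [koszul_comm, koszul_one_right]

theorem koszul_neg_right (g h : ZMod m) : koszul g (-h) = koszul g h := by
  have h1 : koszul g (-h) * koszul g h = 1 := by rw [← koszul_add_right]; simp
  calc koszul g (-h) = koszul g (-h) * (koszul g h * koszul g h) := by simp
    _ = koszul g h := by rw [← mul_assoc, h1, one_mul]

end Signs

/-! ### Homogeneous vectors and series, parity -/

section Graded

variable {m : ℕ} {A B C W : Type*} [AddCommGroup A] [Module ℂ A] [AddCommGroup B] [Module ℂ B]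
  [AddCommGroup C] [Module ℂ C] [AddCommGroup W] [Module ℂ W]
  {𝒜 : ZMod m → Submodule ℂ A} {ℬ : ZMod m → Submodule ℂ B} {𝒞 : ZMod m → Submodule ℂ C}

/-- The word of vectors underlying a word of homogeneous letters. -/
def coeW (l : List (Letter 𝒜)) : List A := l.map fun a => (a.2 : A)

@[simp] theorem coeW_nil : coeW ([] : List (Letter 𝒜)) = [] := rfl
@[simp] theorem coeW_cons (a : Letter 𝒜) (l : List (Letter 𝒜)) : coeW (a :: l) = (a.2 : A) :: coeW l := rfl
@[simp] theorem coeW_append (l l' : List (Letter 𝒜)) : coeW (l ++ l') = coeW l ++ coeW l' :=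
  List.map_append
@[simp] theorem length_coeW (l : List (Letter 𝒜)) : (coeW l).length = l.length := List.length_map _
@[simp] theorem tdeg_nil : tdeg ([] : List (Letter 𝒜)) = 0 := rfl
@[simp] theorem tdeg_cons (a : Letter 𝒜) (l : List (Letter 𝒜)) : tdeg (a :: l) = a.1 + tdeg l := by
  simp [tdeg]
@[simp] theorem tdeg_append (l l' : List (Letter 𝒜)) : tdeg (l ++ l') = tdeg l + tdeg l' := by
  simp [tdeg]

theorem Letter.ext {a b : Letter 𝒜} (h : a.1 = b.1) (h' : (a.2 : A) = b.2) : a = b := by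
  obtain ⟨g, x, hx⟩ := a
  obtain ⟨g', x', hx'⟩ := b
  simp only at h h'
  subst h h'
  rfl

/-- A homogeneous vector as a letter. -/
def toLetter (g : ZMod m) (x : A) (hx : x ∈ 𝒜 (g + 1)) : Letter 𝒜 := ⟨g, x, hx⟩

theorem exists_letter {g : ZMod m} {x : A} (hx : x ∈ 𝒜 g) : ∃ a : Letter 𝒜, a.1 = g - 1 ∧ (a.2 : A) = x :=
  ⟨⟨g - 1, x, by simpa using hx⟩, rfl, rfl⟩

/-- The decomposition of vectors in homogeneous components. -/
def decomp (h : DirectSum.IsInternal 𝒜) : A ≃ₗ[ℂ] DirectSum (ZMod m) fun g => 𝒜 g :=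
  (LinearEquiv.ofBijective (DirectSum.coeLinearMap 𝒜)
    (show Function.Bijective (DirectSum.coeLinearMap 𝒜) from h)).symm

theorem decomp_coe (h : DirectSum.IsInternal 𝒜) (g : ZMod m) (x : 𝒜 g) :
    decomp h x = DirectSum.lof ℂ (ZMod m) (fun g => 𝒜 g) g x := by
  rw [decomp, LinearEquiv.symm_apply_eq]
  exact (DirectSum.coeLinearMap_lof 𝒜 g x).symm

theorem linearMap_ext (h : DirectSum.IsInternal 𝒜) {φ ψ : A →ₗ[ℂ] W}
    (e : ∀ a : Letter 𝒜, φ a.2 = ψ a.2) : φ = ψ := by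
  refine LinearMap.ext fun x => ?_
  have hx : x ∈ ⨆ g, 𝒜 g := by rw [h.submodule_iSup_eq_top]; trivial
  induction hx using Submodule.iSup_induction' with
  | mem g x hx =>
    obtain ⟨a, _, rfl⟩ := exists_letter hx
    exact e a
  | zero => simp
  | add x y _ _ hx hy => simp [hx, hy]

theorem exists_linearMap (h : DirectSum.IsInternal 𝒜) (s : ∀ g, 𝒜 g →ₗ[ℂ] W) :
    ∃ φ : A →ₗ[ℂ] W, ∀ g (x : 𝒜 g), φ x = s g x :=
  ⟨DirectSum.toModule ℂ (ZMod m) W s ∘ₗ (decomp h).toLinearMap, fun g x => by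
    simp [decomp_coe]⟩

/-- The parity involution of `A[1]`. -/
def parity (h : DirectSum.IsInternal 𝒜) : A →ₗ[ℂ] A :=
  (exists_linearMap h fun g => sgn (g - 1) • (𝒜 g).subtype).choose

theorem parity_coe (h : DirectSum.IsInternal 𝒜) (a : Letter 𝒜) :
    parity h (a.2 : A) = sgn a.1 • (a.2 : A) := by
  have := (exists_linearMap h fun g => sgn (g - 1) • (𝒜 g).subtype).choose_spec (a.1 + 1) a.2
  rw [parity, this]; simp

theorem parity_of_mem (h : DirectSum.IsInternal 𝒜) {g : ZMod m} {x : A} (hx : x ∈ 𝒜 (g + 1)) :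
    parity h x = sgn g • x := parity_coe h (toLetter g x hx)

theorem parity_parity (h : DirectSum.IsInternal 𝒜) (x : A) : parity h (parity h x) = x := by
  have : parity h ∘ₗ parity h = LinearMap.id := linearMap_ext h fun a => by
    simp [parity_coe, smul_smul]
  exact congrArg (fun φ : A →ₗ[ℂ] A => φ x) this

theorem ML.ext (h : DirectSum.IsInternal 𝒜) {f g : List A → W} (hf : ML f) (hg : ML g)
    (e : ∀ l : List (Letter 𝒜), f (coeW l) = g (coeW l)) (l : List A) : f l = g l := by
  induction l generalizing f g with
  | nil => exact e []
  | cons a l ih =>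
    have : hf.slot [] l = hg.slot [] l := linearMap_ext h fun a =>
      ih (hf.cons a.2) (hg.cons a.2) fun l => e (a :: l)
    exact congrArg (fun φ : A →ₗ[ℂ] W => φ a) this

/-- Applying the involution to each letter of a prefix produces the Koszul sign of an odd operation
moved past that prefix. This lets `cod` carry signs without mentioning degrees. -/
theorem ML.map_parity [Fact (m = 0 ∨ m = 2)] (h : DirectSum.IsInternal 𝒜) {f : List A → W}
    (hf : ML f) (u : List (Letter 𝒜)) (v : List A) :
    f ((coeW u).map (parity h) ++ v) = sgn (tdeg u) • f (coeW u ++ v) := by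
  induction u generalizing f with
  | nil => simp
  | cons a u ih =>
    have h1 := ih (hf.cons (parity h a.2))
    have h2 := hf.smul [] (coeW u ++ v) (sgn a.1) a.2
    simp only [coeW_cons, List.map_cons, List.cons_append, List.nil_append] at h1 h2 ⊢
    rw [h1, parity_coe, h2, smul_smul, tdeg_cons, sgn_add, mul_comm]

/-- `F` is homogeneous of tilde degree `d`. -/
def Deg (𝒜 : ZMod m → Submodule ℂ A) (ℬ : ZMod m → Submodule ℂ B) (d : ZMod m)
    (F : List A → B) : Prop :=
  ∀ l : List (Letter 𝒜), F (coeW l) ∈ ℬ (tdeg l + d + 1)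

/-- A homogeneous series as a map on words of letters. -/
def Deg.op {d : ZMod m} {F : List A → B} (h : Deg 𝒜 ℬ d F) (l : List (Letter 𝒜)) : Letter ℬ :=
  ⟨tdeg l + d, F (coeW l), h l⟩

/-- The scalar series `w` is homogeneous of tilde degree `k` (in the coordinates). -/
def DegF (𝒜 : ZMod m → Submodule ℂ A) (k : ZMod m) (w : List A → ℂ) : Prop :=
  ∀ l : List (Letter 𝒜), w (coeW l) ≠ 0 → tdeg l = -k

theorem dsum_mem {Λ : Type*} (p : Submodule ℂ W) {g : List Λ → List Λ → W} {l : List Λ}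
    (h : ∀ x y, x ++ y = l → g x y ∈ p) : dsum g l ∈ p := by
  induction l generalizing g with
  | nil => exact h [] [] rfl
  | cons a l ih =>
    exact p.add_mem (h [] _ rfl) (ih fun x y e => h (a :: x) y (by simp [e]))

theorem dsum₁_mem {Λ : Type*} (p : Submodule ℂ W) {g : List Λ → List Λ → W} {l : List Λ}
    (h : ∀ x y, x ≠ [] → x ++ y = l → g x y ∈ p) : dsum₁ g l ∈ p := by
  cases l with
  | nil => exact p.zero_mem
  | cons a l => exact dsum_mem p fun x y e => h (a :: x) y (by simp) (by simp [e])

theorem comp_mem (p : Submodule ℂ W) {f : List B → W} {F : List A → B} (hF : Deg 𝒜 ℬ 0 F)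
    (l : List (Letter 𝒜))
    (h : ∀ w : List (Letter ℬ), tdeg w = tdeg l → f (coeW w) ∈ p) :
    comp f F (coeW l) ∈ p := by
  induction l using length_induction generalizing f with
  | h l ih =>
    rcases eq_or_ne l [] with rfl | hl
    · exact h [] rfl
    rw [comp_eq_dsum₁ _ _ (by rwa [← List.length_pos_iff, length_coeW, List.length_pos_iff]), coeW,
      dsum₁_map]
    refine dsum₁_mem p fun x y hx e => ih y ?_ fun w hw => h (hF.op x :: w) ?_
    · have := List.length_pos_iff.2 hx
      rw [← e, List.length_append]; omega
    · simp [Deg.op, hw, ← e]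

theorem cod_mem (p : Submodule ℂ W) {σ : A →ₗ[ℂ] A} (hσ : ∀ g, ∀ x ∈ 𝒜 g, σ x ∈ 𝒜 g)
    {r : List A → A} {d : ZMod m} (hr : Deg 𝒜 𝒜 d r) {f : List A → W} (l : List (Letter 𝒜))
    (h : ∀ w : List (Letter 𝒜), tdeg w = tdeg l + d → f (coeW w) ∈ p) :
    cod σ r f (coeW l) ∈ p := by
  induction l generalizing f with
  | nil => exact p.zero_mem
  | cons a l ih =>
    rw [coeW_cons, cod_cons, coeW, dsum_map]
    refine p.add_mem (dsum_mem p fun x y e => h (hr.op (a :: x) :: y) ?_) (ih fun w hw =>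
      h ((⟨a.1, σ a.2, hσ _ _ a.2.2⟩ : Letter 𝒜) :: w) ?_)
    · simp [Deg.op, ← e]; abel
    · simp [hw, add_assoc]

theorem parity_mem (h : DirectSum.IsInternal 𝒜) (g : ZMod m) (x : A) (hx : x ∈ 𝒜 g) :
    parity h x ∈ 𝒜 g := by
  obtain ⟨a, ha, rfl⟩ := exists_letter hx
  rw [parity_coe]
  exact (𝒜 g).smul_mem _ hx

theorem Deg.congr {d d' : ZMod m} {F : List A → B} (h : Deg 𝒜 ℬ d F) (e : d = d') : Deg 𝒜 ℬ d' F :=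
  e ▸ h

theorem Deg.comp {d : ZMod m} {f : List B → C} {F : List A → B} (hf : Deg ℬ 𝒞 d f)
    (hF : Deg 𝒜 ℬ 0 F) : Deg 𝒜 𝒞 d (comp f F) :=
  fun l => comp_mem _ hF l fun w hw => hw ▸ hf w

theorem Deg.cod {d e : ZMod m} {σ : A →ₗ[ℂ] A} (hσ : ∀ g, ∀ x ∈ 𝒜 g, σ x ∈ 𝒜 g) {r : List A → A}
    {f : List A → C} (hf : Deg 𝒜 𝒞 e f) (hr : Deg 𝒜 𝒜 d r) : Deg 𝒜 𝒞 (d + e) (cod σ r f) :=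
  fun l => cod_mem _ hσ hr l fun w hw => by
    have := hf w
    rwa [hw, add_assoc (tdeg l)] at this

theorem Deg.lin {d : ZMod m} {φ : A →ₗ[ℂ] B} (h : ∀ g, ∀ x ∈ 𝒜 (g + 1), φ x ∈ ℬ (g + d + 1)) :
    Deg 𝒜 ℬ d (lin φ) := by
  intro l
  match l with
  | [] => exact Submodule.zero_mem _
  | [a] => simpa using h a.1 a.2 a.2.2
  | a :: b :: l => exact Submodule.zero_mem _

theorem Deg.add {d : ZMod m} {F G : List A → B} (hF : Deg 𝒜 ℬ d F) (hG : Deg 𝒜 ℬ d G) :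
    Deg 𝒜 ℬ d fun l => F l + G l := fun l => Submodule.add_mem _ (hF l) (hG l)

theorem Deg.sub {d : ZMod m} {F G : List A → B} (hF : Deg 𝒜 ℬ d F) (hG : Deg 𝒜 ℬ d G) :
    Deg 𝒜 ℬ d fun l => F l - G l := fun l => Submodule.sub_mem _ (hF l) (hG l)

theorem Deg.smul {d : ZMod m} {F : List A → B} (c : ℂ) (hF : Deg 𝒜 ℬ d F) :
    Deg 𝒜 ℬ d fun l => c • F l := fun l => Submodule.smul_mem _ c (hF l)

theorem Deg.zero {d : ZMod m} : Deg 𝒜 ℬ d fun _ => 0 := fun _ => Submodule.zero_mem _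

theorem Deg.of_length {d : ZMod m} {f : List A → B}
    (h : ∀ n : ℕ, ∃ g : List A → B, Deg 𝒜 ℬ d g ∧ ∀ l, l.length ≤ n → f l = g l) : Deg 𝒜 ℬ d f := by
  intro l
  obtain ⟨g, hg, e⟩ := h l.length
  rw [e _ (by simp)]
  exact hg l

theorem Deg.truncate {d : ZMod m} {f : List A → B} (h : Deg 𝒜 ℬ d f) (p : ℕ → Prop)
    [DecidablePred p] : Deg 𝒜 ℬ d fun l => if p l.length then f l else 0 := by
  intro l
  simp only
  split_ifs
  · exact h l
  · exact Submodule.zero_mem _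

theorem degF_iff {k : ZMod m} {w : List A → ℂ} :
    DegF 𝒜 k w ↔ ∀ l : List (Letter 𝒜), tdeg l ≠ -k → w (coeW l) ∈ (⊥ : Submodule ℂ ℂ) := by
  refine forall_congr' fun l => ?_
  rw [Submodule.mem_bot]; exact not_imp_comm

theorem DegF.comp {k : ZMod m} {w : List B → ℂ} {F : List A → B} (hw : DegF ℬ k w)
    (hF : Deg 𝒜 ℬ 0 F) : DegF 𝒜 k (comp w F) := by
  rw [degF_iff] at hw ⊢
  exact fun l hl => comp_mem _ hF l fun w' h => hw w' (h ▸ hl)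

theorem DegF.cod {k d : ZMod m} {σ : A →ₗ[ℂ] A} (hσ : ∀ g, ∀ x ∈ 𝒜 g, σ x ∈ 𝒜 g) {r : List A → A}
    {w : List A → ℂ} (hw : DegF 𝒜 k w) (hr : Deg 𝒜 𝒜 d r) : DegF 𝒜 (k + d) (cod σ r w) := by
  rw [degF_iff] at hw ⊢
  refine fun l hl => cod_mem _ hσ hr l fun w' h => hw w' (h ▸ fun h' => hl ?_)
  rw [neg_add, ← h']; abel

theorem DegF.add {k : ZMod m} {w w' : List A → ℂ} (hw : DegF 𝒜 k w) (hw' : DegF 𝒜 k w') :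
    DegF 𝒜 k fun l => w l + w' l := by
  rw [degF_iff] at *
  exact fun l hl => Submodule.add_mem _ (hw l hl) (hw' l hl)

theorem DegF.smul {k : ZMod m} {w : List A → ℂ} (c : ℂ) (hw : DegF 𝒜 k w) :
    DegF 𝒜 k fun l => c • w l := by
  rw [degF_iff] at *
  exact fun l hl => Submodule.smul_mem _ c (hw l hl)

theorem Deg.map_parity [Fact (m = 0 ∨ m = 2)] (hA : DirectSum.IsInternal 𝒜)
    (hB : DirectSum.IsInternal ℬ) {d : ZMod m} {F : List A → B} (hF : ML F) (hd : Deg 𝒜 ℬ d F)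
    (l : List A) : F (l.map (parity hA)) = sgn d • parity hB (F l) := by
  refine ML.ext hA (hF.comp_map (parity hA)) ((hF.map (parity hB)).fun_smul (sgn d)) (fun l => ?_) l
  have h1 := hF.map_parity hA l []
  simp only [List.append_nil] at h1
  rw [h1, parity_of_mem hB (hd l), smul_smul, sgn_add, mul_comm (sgn d), mul_assoc,
    sgn_mul_self, mul_one]

theorem Deg.map_parity_zero [Fact (m = 0 ∨ m = 2)] (hA : DirectSum.IsInternal 𝒜)
    (hB : DirectSum.IsInternal ℬ) {F : List A → B} (hF : ML F) (hd : Deg 𝒜 ℬ 0 F)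
    (l : List A) : F (l.map (parity hA)) = parity hB (F l) := by
  simpa using hd.map_parity hA hB hF l

theorem Deg.map_parity_odd [Fact (m = 0 ∨ m = 2)] (hA : DirectSum.IsInternal 𝒜)
    (hB : DirectSum.IsInternal ℬ) {d : ZMod m} (hd' : sgn d = -1) {F : List A → B} (hF : ML F)
    (hd : Deg 𝒜 ℬ d F)
    (l : List A) : F (l.map (parity hA)) = - parity hB (F l) := by
  simpa [hd'] using hd.map_parity hA hB hF l

/-- Linear relations between homogeneous letters. -/
def LetterRel (𝒜 : ZMod m → Submodule ℂ A) (c : ℂ) (x y z : Letter 𝒜) : Prop :=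
  ∃ (g : ZMod m) (a b : 𝒜 (g + 1)), x = ⟨g, a⟩ ∧ y = ⟨g, b⟩ ∧ z = ⟨g, c • a + b⟩

/-- A homogeneous component as a letter. -/
def letterOf (g : ZMod m) (x : 𝒜 g) : Letter 𝒜 := ⟨g - 1, x, by simp⟩

open Classical in
/-- Extension of a function on words of homogeneous letters. -/
def extend (h : DirectSum.IsInternal 𝒜) : (List (Letter 𝒜) → W) → List A → W
  | f, [] => f []
  | f, a :: l => (decomp h a).sum fun g x =>
      extend h (fun w => f (letterOf g x :: w)) l

theorem extend_zero (h : DirectSum.IsInternal 𝒜) (l : List A) :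
    extend h (fun _ => (0 : W)) l = 0 := by
  induction l with
  | nil => rfl
  | cons a l ih => simp [extend, ih, DFinsupp.sum]

theorem extend_add (h : DirectSum.IsInternal 𝒜) (f f' : List (Letter 𝒜) → W) (l : List A) :
    extend h (fun w => f w + f' w) l = extend h f l + extend h f' l := by
  induction l generalizing f f' with
  | nil => rfl
  | cons a l ih => simp only [extend, ih, DFinsupp.sum, Finset.sum_add_distrib]

theorem extend_smul (h : DirectSum.IsInternal 𝒜) (c : ℂ) (f : List (Letter 𝒜) → W) (l : List A) :
    extend h (fun w => c • f w) l = c • extend h f l := by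
  induction l generalizing f with
  | nil => rfl
  | cons a l ih => simp only [extend, ih, DFinsupp.sum, Finset.smul_sum]

open Classical in
/-- `extend` as a function of the decomposition of the first letter. -/
theorem extend_cons_eq (h : DirectSum.IsInternal 𝒜) {f : List (Letter 𝒜) → W}
    (hf : SlotLinear (LetterRel 𝒜) f) (l : List A) : ∃ φ : A →ₗ[ℂ] W,
    (∀ x, φ x = extend h f (x :: l)) ∧
    ∀ a : Letter 𝒜, φ a.2 = extend h (fun w => f (a :: w)) l := by
  have hl : ∀ (g : ZMod m) (c : ℂ) (x y : 𝒜 g),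
      extend h (fun w => f (letterOf g (c • x + y) :: w)) l =
      c • extend h (fun w => f (letterOf g x :: w)) l +
      extend h (fun w => f (letterOf g y :: w)) l := by
    intro g c x y
    rw [← extend_smul, ← extend_add]
    congr 1
    funext w
    exact hf c _ _ _ ⟨g - 1, ⟨x, by simp⟩, ⟨y, by simp⟩, rfl, rfl, rfl⟩ [] w
  have h0 : ∀ g : ZMod m,
      extend h (fun w => f (letterOf g 0 :: w)) l = 0 := by
    intro g
    have := hl g 1 0 0
    simpa using this
  let s : ∀ g, 𝒜 g →ₗ[ℂ] W := fun g =>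
    { toFun := fun x => extend h (fun w => f (letterOf g x :: w)) l
      map_add' := fun x y => by simpa using hl g 1 x y
      map_smul' := fun c x => by
        have := hl g c x 0
        rw [h0, add_zero] at this
        simpa using this }
  have e : ∀ x, (DirectSum.toModule ℂ (ZMod m) W s ∘ₗ (decomp h).toLinearMap) x =
      extend h f (x :: l) := by
    intro x
    rw [extend, LinearMap.comp_apply, DirectSum.toModule, DFinsupp.lsum_apply_apply,
      DFinsupp.sumAddHom_apply]
    rfl
  refine ⟨_, e, fun a => ?_⟩
  rw [LinearMap.comp_apply, LinearEquiv.coe_coe, decomp_coe, DirectSum.toModule_lof]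
  change extend h (fun w => f (letterOf (a.1 + 1) a.2 :: w)) l = _
  congr 1
  funext w
  congr 2
  exact Letter.ext (by simp [letterOf]) rfl

theorem extend_coeW (h : DirectSum.IsInternal 𝒜) {f : List (Letter 𝒜) → W}
    (hf : SlotLinear (LetterRel 𝒜) f) (l : List (Letter 𝒜)) : extend h f (coeW l) = f l := by
  induction l generalizing f with
  | nil => rfl
  | cons a l ih =>
    obtain ⟨φ, h1, h2⟩ := extend_cons_eq h hf (coeW l)
    rw [coeW_cons, ← h1, h2, ih (hf.cons a)]

theorem ML.extend (h : DirectSum.IsInternal 𝒜) {f : List (Letter 𝒜) → W}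
    (hf : SlotLinear (LetterRel 𝒜) f) : ML (extend h f) := by
  rintro c x y z rfl u
  induction u generalizing f with
  | nil =>
    intro v
    obtain ⟨φ, h1, _⟩ := extend_cons_eq h hf v
    simp [← h1]
  | cons a u ih =>
    intro v
    obtain ⟨φ, h1, h2⟩ := extend_cons_eq h hf (u ++ (c • x + y) :: v)
    obtain ⟨φ', h1', h2'⟩ := extend_cons_eq h hf (u ++ x :: v)
    obtain ⟨φ'', h1'', h2''⟩ := extend_cons_eq h hf (u ++ y :: v)
    rw [List.cons_append, List.cons_append, List.cons_append, ← h1, ← h1', ← h1'']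
    have : φ = c • φ' + φ'' := linearMap_ext h fun a => by
      simp only [LinearMap.add_apply, LinearMap.smul_apply, h2, h2', h2'']
      exact ih (hf.cons a) v
    rw [this]; rfl

theorem ML.letterRel {f : List A → W} (hf : ML f) :
    SlotLinear (LetterRel 𝒜) fun l => f (coeW l) := by
  rintro c _ _ _ ⟨g, a, b, rfl, rfl, rfl⟩ u v
  simpa using hf.smul_add (coeW u) (coeW v) c a b

end Graded
end

noncomputable section

/-! ### Homogeneous projections, inverse series, multilinear families as series -/

section Graded

variable {m : ℕ} {A B C W : Type*} [AddCommGroup A] [Module ℂ A] [AddCommGroup B] [Module ℂ B]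
  [AddCommGroup C] [Module ℂ C] [AddCommGroup W] [Module ℂ W]
  {𝒜 : ZMod m → Submodule ℂ A} {ℬ : ZMod m → Submodule ℂ B} {𝒞 : ZMod m → Submodule ℂ C}

theorem exists_proj (h : DirectSum.IsInternal 𝒜) (g : ZMod m) : ∃ P : A →ₗ[ℂ] A,
    (∀ x ∈ 𝒜 g, P x = x) ∧ (∀ g', g' ≠ g → ∀ x ∈ 𝒜 g', P x = 0) ∧ ∀ x, P x ∈ 𝒜 g := by
  obtain ⟨P, hP⟩ := exists_linearMap h fun g' => if g' = g then (𝒜 g').subtype else 0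
  have h1 : ∀ x ∈ 𝒜 g, P x = x := fun x hx => by simpa using hP g ⟨x, hx⟩
  have h2 : ∀ g', g' ≠ g → ∀ x ∈ 𝒜 g', P x = 0 := fun g' hg x hx => by
    simpa [hg] using hP g' ⟨x, hx⟩
  refine ⟨P, h1, h2, fun x => ?_⟩
  have : (𝒜 g).mkQ ∘ₗ P = 0 := linearMap_ext h fun a => by
    by_cases hg : a.1 + 1 = g
    · subst hg
      simp [h1 a.2 a.2.2]
    · simp [h2 _ hg a.2 a.2.2]
  have := congrArg (fun φ : A →ₗ[ℂ] _ => φ x) this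
  simpa using this

/-- The projection to a homogeneous component. -/
def proj (h : DirectSum.IsInternal 𝒜) (g : ZMod m) : A →ₗ[ℂ] A := (exists_proj h g).choose

theorem proj_of_mem (h : DirectSum.IsInternal 𝒜) {g : ZMod m} {x : A} (hx : x ∈ 𝒜 g) :
    proj h g x = x := (exists_proj h g).choose_spec.1 x hx

theorem proj_of_ne (h : DirectSum.IsInternal 𝒜) {g g' : ZMod m} (hg : g' ≠ g) {x : A}
    (hx : x ∈ 𝒜 g') : proj h g x = 0 := (exists_proj h g).choose_spec.2.1 g' hg x hx

theorem proj_mem (h : DirectSum.IsInternal 𝒜) (g : ZMod m) (x : A) : proj h g x ∈ 𝒜 g :=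
  (exists_proj h g).choose_spec.2.2 x

theorem map_proj (hA : DirectSum.IsInternal 𝒜) (hB : DirectSum.IsInternal ℬ) {φ : A →ₗ[ℂ] B}
    {d : ZMod m} (hφ : ∀ g, ∀ x ∈ 𝒜 g, φ x ∈ ℬ (g + d)) (g : ZMod m) (x : A) :
    φ (proj hA g x) = proj hB (g + d) (φ x) := by
  have : φ ∘ₗ proj hA g = proj hB (g + d) ∘ₗ φ := linearMap_ext hA fun a => by
    simp only [LinearMap.comp_apply]
    by_cases hg : a.1 + 1 = g
    · subst hg
      rw [proj_of_mem hA a.2.2, proj_of_mem hB (hφ _ _ a.2.2)]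
    · rw [proj_of_ne hA hg a.2.2, proj_of_ne hB (fun h => hg (by simpa using h)) (hφ _ _ a.2.2),
        map_zero]
  exact congrArg (fun φ : A →ₗ[ℂ] _ => φ x) this

theorem mem_of_map_mem (hA : DirectSum.IsInternal 𝒜) (hB : DirectSum.IsInternal ℬ) {φ : A →ₗ[ℂ] B}
    (hφ : ∀ g, ∀ x ∈ 𝒜 g, φ x ∈ ℬ g) (hi : Function.Injective φ) {g : ZMod m} {x : A}
    (hx : φ x ∈ ℬ g) : x ∈ 𝒜 g := by
  have h1 := map_proj hA hB (d := 0) (fun g x hx => by simpa using hφ g x hx) g x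
  rw [add_zero, proj_of_mem hB hx] at h1
  rw [← hi h1]
  exact proj_mem hA g x

theorem cod_coeW [Fact (m = 0 ∨ m = 2)] (h : DirectSum.IsInternal 𝒜) (r : List A → A)
    {f : List A → W} (hf : ML f) (l : List (Letter 𝒜)) :
    cod (parity h) r f (coeW l) = dsum (fun u t => dsum₁ (fun b v =>
      sgn (tdeg u) • f (coeW u ++ r (coeW b) :: coeW v)) t) l := by
  rw [cod_eq_dsum, coeW, dsum_map]
  refine dsum_congr fun u t _ => ?_
  rw [dsum₁_map]
  exact dsum₁_congr fun b v _ _ => hf.map_parity h u _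

/-! ### Inversion of series -/

/-- The terms of order at least two. -/
def tail (f : List A → W) : List A → W := fun l => if 2 ≤ l.length then f l else 0

theorem ML.tail {f : List A → W} (hf : ML f) : ML (tail f) := hf.truncate (2 ≤ ·)

theorem Deg.tail {d : ZMod m} {f : List A → B} (h : Deg 𝒜 ℬ d f) : Deg 𝒜 ℬ d (tail f) :=
  h.truncate (2 ≤ ·)

theorem comp_congr_right_of_tail {f : List B → W} (hf : ∀ a, f [a] = 0) {F G : List A → B}
    {l : List A} (h : ∀ b, b ≠ [] → b.length < l.length → F b = G b) : comp f F l = comp f G l := by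
  rcases eq_or_ne l [] with rfl | hl
  · simp
  rw [comp_eq_dsum₁ _ _ hl, comp_eq_dsum₁ _ _ hl]
  refine dsum₁_congr fun x y hx e => ?_
  have h1 : x.length + y.length = l.length := by rw [← List.length_append, e]
  have h2 := List.length_pos_iff.2 hx
  rcases eq_or_ne y [] with rfl | hy
  · simp [hf]
  have h3 := List.length_pos_iff.2 hy
  rw [h x hx (by omega)]
  exact comp_congr_right fun b hb hb' => h b hb (by omega)

theorem comp_eq_add_tail {f : List B → W} (hf : ML f) (F : List A → B) {l : List A} (hl : l ≠ []) :
    comp f F l = f [F l] + comp (tail f) F l := by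
  rw [show f [F l] = (hf.slot [] []) (F l) from rfl, ← comp_lin_left _ F hl, ← comp_add]
  refine comp_congr hl fun w hw _ => ?_
  match w, hw with
  | [a], _ => simp [tail, ML.slot_apply]
  | a :: b :: w, _ => simp [tail]

/-- The equation reads `F₁ G = id - (tail F) ∘ G`. Every term of `tail F` uses at least two blocks,
so the right side on a word involves `G` on shorter words only, and `F₁` is invertible: a
fixed-point problem. -/
theorem exists_rightInverse (hA : DirectSum.IsInternal 𝒜) (hB : DirectSum.IsInternal ℬ)
    {F : List A → B} (hF : ML F) (h0 : F [] = 0) (hd : Deg 𝒜 ℬ 0 F)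
    (hb : Function.Bijective (hF.slot [] [])) :
    ∃ G : List B → A, ML G ∧ G [] = 0 ∧ Deg ℬ 𝒜 0 G ∧ (∀ l, comp F G l = lin LinearMap.id l) ∧
      ∀ b, F [G [b]] = b := by
  let e : A ≃ₗ[ℂ] B := LinearEquiv.ofBijective _ hb
  have he : ∀ a, e a = F [a] := fun a => rfl
  have hg : ∀ g, ∀ x ∈ 𝒜 g, e.toLinearMap x ∈ ℬ g := fun g x hx => by
    obtain ⟨a, ha, rfl⟩ := exists_letter hx
    have := hd [a]
    rw [tdeg_cons, ha, tdeg_nil] at this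
    simpa [he] using this
  have hg' : ∀ g, ∀ x ∈ ℬ g, e.symm x ∈ 𝒜 g := fun g x hx =>
    mem_of_map_mem hA hB hg e.injective (by simpa using hx)
  obtain ⟨G, hG, hP⟩ := exists_fixedPoint (fun G : List B → A => fun l =>
    if 1 ≤ l.length then e.symm (lin LinearMap.id l - comp (tail F) G l) else 0) (by
      intro f g n h l hl
      have := comp_congr_right_of_tail (f := tail F) (by simp [tail]) fun b _ hb =>
        h b (hl ▸ hb)
      simp only [this])
  have hML : ML G := ML.of_length (hP ML ML.zero_fun fun f hf =>
    (((ML.lin LinearMap.id).fun_sub (hF.tail.comp hf)).map e.symm.toLinearMap).truncate (1 ≤ ·))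
  have hDeg : Deg ℬ 𝒜 0 G := Deg.of_length (hP (Deg ℬ 𝒜 0) Deg.zero fun f hf => by
    refine Deg.truncate (p := (1 ≤ ·)) fun l => hg' _ _ ?_
    refine ((Deg.lin fun g x hx => ?_ : Deg ℬ ℬ 0 (lin LinearMap.id)).sub (hd.tail.comp hf)) l
    simpa using hx)
  have h1 : ∀ l, l ≠ [] → G l = e.symm (lin LinearMap.id l - comp (tail F) G l) := by
    intro l hl
    conv_lhs => rw [← hG]
    exact if_pos (List.length_pos_iff.2 hl)
  have hn : G [] = 0 := by rw [← hG]; rfl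
  have hc : ∀ l, comp F G l = lin LinearMap.id l := by
    intro l
    rcases eq_or_ne l [] with rfl | hl
    · simp [h0]
    · rw [comp_eq_add_tail hF _ hl, ← he, h1 l hl, LinearEquiv.apply_symm_apply, sub_add_cancel]
  refine ⟨G, hML, hn, hDeg, hc, fun b => ?_⟩
  have := hc [b]
  rwa [comp_cons] at this

/-- The right inverse `G` also has bijective linear part, so it has a right inverse `F'`;
associativity gives `F = F'`, as in a group. -/
theorem exists_inverse (hA : DirectSum.IsInternal 𝒜) (hB : DirectSum.IsInternal ℬ)
    {F : List A → B} (hF : ML F) (h0 : F [] = 0) (hd : Deg 𝒜 ℬ 0 F)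
    (hb : Function.Bijective (hF.slot [] [])) :
    ∃ G : List B → A, ML G ∧ G [] = 0 ∧ Deg ℬ 𝒜 0 G ∧ (∀ l, comp F G l = lin LinearMap.id l) ∧
      (∀ l, comp G F l = lin LinearMap.id l) ∧ (∀ a, G [F [a]] = a) ∧ ∀ b, F [G [b]] = b := by
  obtain ⟨G, h1, h2, h3, h4, h5⟩ := exists_rightInverse hA hB hF h0 hd hb
  have h6 : ∀ a, G [F [a]] = a := fun a => hb.1 (by simpa [ML.slot_apply] using h5 (F [a]))
  have hb' : Function.Bijective (h1.slot [] []) :=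
    ⟨fun x y h => by
      have := congrArg (fun a => F [a]) h
      simpa [ML.slot_apply, h5] using this, fun a => ⟨F [a], h6 a⟩⟩
  obtain ⟨F', k1, k2, k3, k4, k5⟩ := exists_rightInverse hB hA h1 h2 h3 hb'
  have e : F = F' := by
    funext l
    calc F l = comp F (lin LinearMap.id) l := (comp_lin_id hF l).symm
      _ = comp F (comp G F') l := by rw [funext k4]
      _ = comp (comp F G) F' l := (comp_assoc hF _ _ _).symm
      _ = comp (lin LinearMap.id) F' l := by rw [funext h4]
      _ = F' l := by
        rcases eq_or_ne l [] with rfl | hl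
        · simp [k2]
        · exact comp_lin_left _ _ hl
  exact ⟨G, h1, h2, h3, h4, by rw [e]; exact k4, h6, h5⟩

/-- Induction on length: the chain rule with defect, applied to `F ∘ G = id`, says that `F₁` maps
the defect of `G` to 0, and `F₁` is injective. -/
theorem inverse_intertwines {σ : A →ₗ[ℂ] A} {σ' : B →ₗ[ℂ] B} {r : List A → A} {s : List B → B}
    {F : List A → B} {G : List B → A} (hF : ML F) (hs : ML s)
    (hGσ : ∀ b, G (b.map σ') = σ (G b)) (hi : ∀ x y, F [x] = F [y] → x = y)
    (hFG : ∀ l, comp F G l = lin LinearMap.id l) (hr : ∀ l, cod σ r F l = comp s F l) (l : List B)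
    (hl : l ≠ []) : cod σ' s G l = comp r G l := by
  induction l using length_induction with
  | h l ih =>
    have := cod_comp_eq_of_length_le hF hGσ (r := s) (s := r) (fun b hb h => ih b h hb) hl le_rfl
    rw [funext hFG, cod_lin_left _ _ _ hl, funext hr, comp_assoc hs, funext hFG, comp_lin_id hs,
      LinearMap.id_apply, left_eq_add, sub_eq_zero] at this
    exact hi _ _ this

/-! ### Multilinear families and series -/

/-- A family of multilinear maps as a series. -/
def mser (f : ∀ n : ℕ, MultilinearMap ℂ (fun _ : Fin n => A) W) : List A → W :=
  fun l => f l.length l.get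

theorem mser_eq (f : ∀ n : ℕ, MultilinearMap ℂ (fun _ : Fin n => A) W) (l : List A) {n : ℕ}
    (hn : l.length = n) (a : Fin n → A) (h : ∀ i (hi : i < n), l[i]'(hn ▸ hi) = a ⟨i, hi⟩) :
    mser f l = f n a := by
  subst hn
  exact congrArg (f l.length) (funext fun i => h i.1 i.2)

theorem ML.mser (f : ∀ n : ℕ, MultilinearMap ℂ (fun _ : Fin n => A) W) : ML (mser f) := by
  rintro c x y z rfl u v
  have key : ∀ t : A, _root_.mser f (u ++ t :: v) = f (u.length + (v.length + 1))
      (Function.update (fun i => (u ++ 0 :: v)[i.1]'(by simp)) ⟨u.length, by omega⟩ t) := by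
    intro t
    refine mser_eq f _ (by simp) _ fun i hi => ?_
    rcases lt_trichotomy i u.length with h | rfl | h
    · rw [Function.update_of_ne (by simp [h.ne]), List.getElem_append_left h,
        List.getElem_append_left h]
    · simp
    · rw [Function.update_of_ne (by simp [h.ne']), List.getElem_append_right h.le,
        List.getElem_append_right h.le]
      obtain ⟨j, rfl⟩ : ∃ j, i = u.length + (j + 1) := ⟨i - u.length - 1, by omega⟩
      simp
  rw [key, key, key, MultilinearMap.map_update_add, MultilinearMap.map_update_smul]

theorem ofFn_update {n : ℕ} [DecidableEq (Fin n)] (a : Fin n → A) (i : Fin n) (t : A) :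
    List.ofFn (Function.update a i t) =
      (List.ofFn a).take i ++ t :: (List.ofFn a).drop (i + 1) := by
  rw [← List.set_eq_take_append_cons_drop (i := i) (a := t) |>.trans (if_pos (by simp))]
  refine List.ext_getElem (by simp) fun j h1 h2 => ?_
  simp only [List.getElem_ofFn, List.getElem_set, Function.update_apply]
  simp only [Fin.ext_iff, eq_comm (a := j)]

/-- A series as a family of multilinear maps. -/
def ML.toMulti {f : List A → W} (hf : ML f) (n : ℕ) : MultilinearMap ℂ (fun _ : Fin n => A) W where
  toFun a := f (List.ofFn a)
  map_update_add' {_} a i x y := by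
    rw [ofFn_update, ofFn_update, ofFn_update, hf.add]
  map_update_smul' {_} a i c x := by
    rw [ofFn_update, ofFn_update, hf.smul]

theorem evalWord_eq (f : ∀ n : ℕ, MultilinearMap ℂ (fun _ : Fin n => A) W) (l : List (Letter 𝒜)) :
    evalWord f l = mser f (coeW l) :=
  (mser_eq f (coeW l) (by simp) _ fun i hi => by simp [coeW]).symm

theorem mser_toMulti {f : List A → W} (hf : ML f) (l : List A) : mser hf.toMulti l = f l := by
  change f (List.ofFn l.get) = f l
  rw [List.ofFn_get]

end Graded

/-! ### `A_∞`-algebras and morphisms as series -/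

section AInfSeries

variable {m : ℕ} [hm : Fact (m = 0 ∨ m = 2)] {A B C W : Type*} [AddCommGroup A] [Module ℂ A]
  [AddCommGroup B] [Module ℂ B]
  [AddCommGroup C] [Module ℂ C] [AddCommGroup W] [Module ℂ W]
  {𝒜 : ZMod m → Submodule ℂ A} {ℬ : ZMod m → Submodule ℂ B} {𝒞 : ZMod m → Submodule ℂ C}

namespace AInf

/-- The structure maps of an `A_∞`-algebra as a series. -/
def ser (X : AInf 𝒜) : List A → A := mser X.r

/-- The parity involution. -/
abbrev σ (X : AInf 𝒜) : A →ₗ[ℂ] A := parity X.internal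

omit hm in
theorem ml (X : AInf 𝒜) : ML X.ser := ML.mser X.r

omit hm in
@[simp] theorem ser_nil (X : AInf 𝒜) : X.ser [] = 0 := by
  change X.r 0 _ = 0
  rw [X.r_zero]; rfl

omit hm in
theorem deg (X : AInf 𝒜) : Deg 𝒜 𝒜 1 X.ser := fun l => by
  have := X.degree l
  rwa [evalWord_eq] at this

omit hm in
theorem r₁_apply (X : AInf 𝒜) (x : A) : X.r₁ x = X.ser [x] :=
  (mser_eq X.r [x] rfl (fun _ => x) fun i hi => by
    obtain rfl : i = 0 := by simpa using hi
    rfl).symm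

omit hm in
theorem coe_op (X : AInf 𝒜) (l : List (Letter 𝒜)) : ((X.op l).2 : A) = X.ser (coeW l) :=
  evalWord_eq X.r l

theorem map_σ (X : AInf 𝒜) (l : List A) : X.ser (l.map X.σ) = - X.σ (X.ser l) :=
  X.deg.map_parity_odd X.internal X.internal (by simp) X.ml l

theorem rel (X : AInf 𝒜) (l : List A) : cod X.σ X.ser X.ser l = 0 := by
  refine ML.ext X.internal (X.ml.cod X.ml) ML.zero_fun (fun l => ?_) l
  rw [cod_coeW X.internal _ X.ml, ← sum_blocks_eq_dsum, ← X.relation l]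
  refine Finset.sum_congr rfl fun i _ => Finset.sum_congr rfl fun j _ => ?_
  rw [evalWord_eq]
  simp only [coeW_append, coeW_cons, evalWord_eq]
  rfl

theorem cod_cod (X : AInf 𝒜) {f : List A → W} (hf : ML f) (l : List A) :
    cod X.σ X.ser (cod X.σ X.ser f) l = 0 :=
  cod_cod_self X.map_σ hf fun b _ _ => X.rel b

/-- An `A_∞`-structure from a series. -/
def ofSer (h : DirectSum.IsInternal 𝒜) {r : List A → A} (hr : ML r) (h0 : r [] = 0)
    (hd : Deg 𝒜 𝒜 1 r) (hrel : ∀ l, cod (parity h) r r l = 0) : AInf 𝒜 where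
  internal := h
  r := hr.toMulti
  r_zero := by ext a; simpa [ML.toMulti] using h0
  degree l := by rw [evalWord_eq, mser_toMulti]; exact hd l
  relation l := by
    rw [← hrel (coeW l), cod_coeW h _ hr, ← sum_blocks_eq_dsum]
    refine Finset.sum_congr rfl fun i _ => Finset.sum_congr rfl fun j _ => ?_
    rw [evalWord_eq, mser_toMulti]
    simp only [coeW_append, coeW_cons, evalWord_eq, mser_toMulti]

theorem ser_ofSer (h : DirectSum.IsInternal 𝒜) {r : List A → A} (hr : ML r) (h0 : r [] = 0)
    (hd : Deg 𝒜 𝒜 1 r) (hrel : ∀ l, cod (parity h) r r l = 0) : (ofSer h hr h0 hd hrel).ser = r :=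
  funext fun l => mser_toMulti hr l

end AInf

namespace AInfHom

variable {X : AInf 𝒜} {Y : AInf ℬ} {Z : AInf 𝒞}

/-- The components of an `A_∞`-morphism as a series. -/
def ser (F : AInfHom X Y) : List A → B := mser F.F

omit hm in
theorem ml (F : AInfHom X Y) : ML F.ser := ML.mser F.F

omit hm in
@[simp] theorem ser_nil (F : AInfHom X Y) : F.ser [] = 0 := by
  change F.F 0 _ = 0
  rw [F.F_zero]; rfl

omit hm in
theorem deg (F : AInfHom X Y) : Deg 𝒜 ℬ 0 F.ser := fun l => by
  have := F.degree l
  rw [evalWord_eq] at this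
  rwa [add_zero]

omit hm in
theorem F₁_apply (F : AInfHom X Y) (x : A) : F.F₁ x = F.ser [x] :=
  (mser_eq F.F [x] rfl (fun _ => x) fun i hi => by
    obtain rfl : i = 0 := by simpa using hi
    rfl).symm

omit hm in
theorem coe_op (F : AInfHom X Y) (l : List (Letter 𝒜)) : ((F.op l).2 : B) = F.ser (coeW l) :=
  evalWord_eq F.F l

theorem map_σ (F : AInfHom X Y) (l : List A) : F.ser (l.map X.σ) = Y.σ (F.ser l) :=
  F.deg.map_parity_zero X.internal Y.internal F.ml l

omit hm in
theorem comp_coeW {G : List A → B} (op : List (Letter 𝒜) → Letter ℬ)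
    (hop : ∀ l, ((op l).2 : B) = G (coeW l)) (f : List B → W) (l : List (Letter 𝒜)) :
    comp f G (coeW l) = subst (fun _ => True) op (fun w => f (coeW w)) l :=
  subst_map _ _ _ _ _ _ (fun _ _ => by simp) (fun b _ => (hop b).symm) f l

omit hm in
theorem sum_composition_eq_comp {G : List A → B} (op : List (Letter 𝒜) → Letter ℬ)
    (hop : ∀ l, ((op l).2 : B) = G (coeW l)) (f : List B → W) (l : List (Letter 𝒜)) :
    ∑ c : Composition l.length, f (coeW ((l.splitWrtComposition c).map op)) =
      comp f G (coeW l) := by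
  rw [comp_coeW op hop, ← sum_composition_subst]
  simp

theorem rel (F : AInfHom X Y) (l : List A) : cod X.σ X.ser F.ser l = comp Y.ser F.ser l := by
  refine ML.ext X.internal (F.ml.cod X.ml) (Y.ml.comp F.ml) (fun l => ?_) l
  rw [cod_coeW X.internal _ F.ml, ← sum_blocks_eq_dsum, ← sum_composition_eq_comp F.op F.coe_op]
  have h1 := F.relation l
  simp only [evalWord_eq] at h1
  refine Eq.trans ?_ (h1.symm.trans ?_)
  · refine Finset.sum_congr rfl fun i _ => Finset.sum_congr rfl fun j _ => ?_
    rw [coeW_append, coeW_cons, X.coe_op]; rfl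
  · refine Finset.sum_congr rfl fun c _ => ?_
    change Y.ser _ = _
    congr 2
    refine List.map_congr_left fun b _ => ?_
    exact Letter.ext rfl (F.coe_op b).symm

/-- An `A_∞`-morphism from a series. -/
def ofSer {F : List A → B} (hF : ML F) (h0 : F [] = 0) (hd : Deg 𝒜 ℬ 0 F)
    (hrel : ∀ l, l ≠ [] → cod X.σ X.ser F l = comp Y.ser F l) : AInfHom X Y where
  F := hF.toMulti
  F_zero := by ext a; simpa [ML.toMulti] using h0
  degree l := by
    rw [evalWord_eq, mser_toMulti]
    simpa using hd l
  relation l := by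
    have h1 : cod X.σ X.ser F (coeW l) = comp Y.ser F (coeW l) := by
      rcases eq_or_ne l [] with rfl | hl
      · simp
      · exact hrel _ (by simpa [coeW] using hl)
    rw [cod_coeW X.internal _ hF, ← sum_blocks_eq_dsum] at h1
    refine Eq.trans ?_ (h1.symm.trans ?_)
    · rw [← sum_composition_eq_comp (fun l => (⟨tdeg l, F (coeW l), by simpa using hd l⟩ : Letter ℬ))
        (fun l => rfl)]
      refine Finset.sum_congr rfl fun c _ => ?_
      rw [evalWord_eq]
      change Y.ser _ = _
      congr 2
      refine List.map_congr_left fun b _ => ?_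
      exact Letter.ext rfl (by simp [evalWord_eq, mser_toMulti])
    · refine Finset.sum_congr rfl fun i _ => Finset.sum_congr rfl fun j _ => ?_
      rw [evalWord_eq, mser_toMulti, coeW_append, coeW_cons, X.coe_op]

theorem ser_ofSer {F : List A → B} (hF : ML F) (h0 : F [] = 0) (hd : Deg 𝒜 ℬ 0 F)
    (hrel : ∀ l, l ≠ [] → cod X.σ X.ser F l = comp Y.ser F l) :
    (ofSer hF h0 hd hrel : AInfHom X Y).ser = F :=
  funext fun l => mser_toMulti hF l

theorem cod_comp (F : AInfHom X Y) {f : List B → W} (hf : ML f) (l : List A) :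
    cod X.σ X.ser (comp f F.ser) l = comp (cod Y.σ Y.ser f) F.ser l :=
  cod_comp_of_eq hf F.map_σ (fun b _ => F.rel b) l

/-- Composition of `A_∞`-morphisms. -/
def trans (F : AInfHom X Y) (G : AInfHom Y Z) : AInfHom X Z :=
  ofSer (G.ml.comp F.ml) (by simp) (G.deg.comp F.deg) fun l _ => by
    rw [F.cod_comp G.ml, funext G.rel, comp_assoc Z.ml]

theorem ser_trans (F : AInfHom X Y) (G : AInfHom Y Z) : (F.trans G).ser = comp G.ser F.ser :=
  ser_ofSer _ _ _ _

theorem comp_trans (F : AInfHom X Y) (G : AInfHom Y Z) {f : List C → W} (hf : ML f) (l : List A) :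
    comp f (F.trans G).ser l = comp (comp f G.ser) F.ser l := by
  rw [ser_trans, comp_assoc hf]

theorem trans_F₁ (F : AInfHom X Y) (G : AInfHom Y Z) (x : A) : (F.trans G).F₁ x = G.F₁ (F.F₁ x) := by
  rw [F₁_apply, ser_trans, F₁_apply, F₁_apply, comp_cons]
  rfl

/-- The strict `A_∞`-morphism with linear part `φ`. -/
def strict (φ : A →ₗ[ℂ] B) (hφ : ∀ g, ∀ x ∈ 𝒜 g, φ x ∈ ℬ g)
    (h : ∀ l, l ≠ [] → φ (X.ser l) = Y.ser (l.map φ)) : AInfHom X Y :=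
  ofSer (ML.lin φ) rfl (Deg.lin fun g x hx => by simpa using hφ _ x hx) fun l hl => by
    rw [cod_lin_left _ _ _ hl, comp_lin_right Y.ml, h l hl]

theorem ser_strict (φ : A →ₗ[ℂ] B) (hφ : ∀ g, ∀ x ∈ 𝒜 g, φ x ∈ ℬ g)
    (h : ∀ l, l ≠ [] → φ (X.ser l) = Y.ser (l.map φ)) :
    (strict φ hφ h : AInfHom X Y).ser = lin φ := ser_ofSer _ _ _ _

/-- The identity morphism. -/
def refl (X : AInf 𝒜) : AInfHom X X := strict LinearMap.id (fun _ _ h => h) fun l _ => by simp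

theorem ser_refl (X : AInf 𝒜) : (refl X).ser = lin LinearMap.id := ser_strict _ _ _

theorem exists_symm (F : AInfHom X Y) (h : F.IsIso) : ∃ G : AInfHom Y X,
    G.IsIso ∧ comp F.ser G.ser = lin LinearMap.id ∧ comp G.ser F.ser = lin LinearMap.id := by
  have hs : ∀ x, F.ml.slot [] [] x = F.F₁ x := fun x => (F.F₁_apply x).symm
  have hb : Function.Bijective (F.ml.slot [] []) := by
    rwa [show ⇑(F.ml.slot [] []) = F.F₁ from funext hs]
  obtain ⟨G, h1, h2, h3, h4, h5, h6, h7⟩ :=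
    exists_inverse X.internal Y.internal F.ml F.ser_nil F.deg hb
  refine ⟨ofSer h1 h2 h3 fun l hl => inverse_intertwines F.ml Y.ml
    (h3.map_parity_zero Y.internal X.internal h1) (fun x y e => hb.1 e) h4 F.rel l hl, ?_, ?_, ?_⟩
  · constructor
    · intro x y e
      rw [F₁_apply, F₁_apply, ser_ofSer] at e
      rw [← h7 x, ← h7 y, e]
    · intro a
      exact ⟨F.ser [a], by rw [F₁_apply, ser_ofSer, h6]⟩
  · rw [ser_ofSer]; exact funext h4
  · rw [ser_ofSer]; exact funext h5

end AInfHom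

/-- Transport of an `A_∞`-structure along an invertible series. -/
theorem AInf.exists_transport (X : AInf 𝒜) {ψ : List A → A} (hψ : ML ψ) (h0 : ψ [] = 0)
    (hd : Deg 𝒜 𝒜 0 ψ) (h1 : ∀ a, ψ [a] = a) : ∃ (Y : AInf 𝒜) (F : AInfHom X Y) (G : AInfHom Y X),
      F.ser = ψ ∧ comp F.ser G.ser = lin LinearMap.id ∧ comp G.ser F.ser = lin LinearMap.id ∧
      (∀ a, Y.ser [a] = X.ser [a]) ∧ G.F₁ = LinearMap.id := by
  have hb : Function.Bijective (hψ.slot [] []) := by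
    rw [show ⇑(hψ.slot [] []) = id from funext h1]; exact Function.bijective_id
  obtain ⟨φ, k1, k2, k3, k4, k5, k6, k7⟩ :=
    exists_inverse X.internal X.internal hψ h0 hd hb
  have hmem := parity_mem X.internal
  -- The conjugate of the coderivation of `X` by the coordinate change `ψ`, with `φ` the inverse of
  -- `ψ`.
  let s : List A → A := comp (cod X.σ X.ser ψ) φ
  have hs : ML s := (hψ.cod X.ml).comp k1
  have hsd : Deg 𝒜 𝒜 1 s := ((hd.cod hmem X.deg).comp k3).congr (by simp)
  have hrel : ∀ l, comp s ψ l = cod X.σ X.ser ψ l := fun l => by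
    rw [comp_assoc (hψ.cod X.ml), funext k5, comp_lin_id (hψ.cod X.ml)]
  have hsq : ∀ l, cod (parity X.internal) s s l = 0 := by
    intro l
    -- The square of the new coderivation vanishes after pulling back along `ψ`, where it becomes
    -- the square of the old one; `ψ` is invertible.
    have e1 : ∀ l, comp (cod (parity X.internal) s s) ψ l = 0 := fun l => by
      rw [← cod_comp_of_eq (r := X.ser) hs (hd.map_parity_zero X.internal X.internal hψ)
        (fun b _ => (hrel b).symm), funext hrel]
      exact X.cod_cod hψ l
    rw [← comp_lin_id (hs.cod hs), ← funext k4, ← comp_assoc (hs.cod hs), funext e1, comp_zero]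
  let Y : AInf 𝒜 := AInf.ofSer X.internal hs (by simp [s]) hsd hsq
  have hY : Y.ser = s := AInf.ser_ofSer _ _ _ _ _
  let F : AInfHom X Y := AInfHom.ofSer hψ h0 hd fun l _ => by rw [hY]; exact (hrel l).symm
  have hFs : F.ser = ψ := AInfHom.ser_ofSer _ _ _ _
  have hF : F.IsIso := by
    rw [AInfHom.IsIso, show ⇑F.F₁ = id from funext fun a => by
      rw [F.F₁_apply, hFs, h1]; rfl]
    exact Function.bijective_id
  obtain ⟨G, g1, g2, g3⟩ := F.exists_symm hF
  refine ⟨Y, F, G, hFs, g2, g3, fun a => ?_, LinearMap.ext fun a => ?_⟩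
  · rw [hY]
    have : φ [a] = a := by have := k6 a; rwa [h1] at this
    simp only [s, comp_cons, dsum_nil, comp_nil, this, cod_cons, cod_nil, add_zero, h1]
  · have := congrFun g3 [a]
    rw [comp_cons] at this
    simp only [hFs, dsum_nil, comp_nil, h1, lin_singleton] at this
    rw [G.F₁_apply, this]

end AInfSeries

end

noncomputable section

/-! ### Signed rotations and cyclic sums -/

section Rotation

variable {Λ Λ' : Type*}

/-- The product of the signs `κ x y` over the letters `x` of `u` and `y` of `v`. -/
def kw (κ : Λ → Λ → ℂ) (u v : List Λ) : ℂ := (u.map fun x => (v.map (κ x)).prod).prod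

section
variable (κ : Λ → Λ → ℂ)

@[simp] theorem kw_nil_left (v : List Λ) : kw κ [] v = 1 := rfl
@[simp] theorem kw_nil_right (u : List Λ) : kw κ u [] = 1 := by simp [kw]
theorem kw_append_left (u u' v : List Λ) : kw κ (u ++ u') v = kw κ u v * kw κ u' v := by simp [kw]
theorem kw_append_right (u v v' : List Λ) : kw κ u (v ++ v') = kw κ u v * kw κ u v' := by
  simp [kw, List.prod_map_mul]
theorem kw_cons_left (x : Λ) (u v : List Λ) : kw κ (x :: u) v = kw κ [x] v * kw κ u v :=
  kw_append_left κ [x] u v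
theorem kw_cons_right (u : List Λ) (x : Λ) (v : List Λ) : kw κ u (x :: v) = kw κ u [x] * kw κ u v :=
  kw_append_right κ u [x] v
theorem kw_singleton (x y : Λ) : kw κ [x] [y] = κ x y := by simp [kw]

variable {κ}

theorem kw_mul_kw (hκ : ∀ x y, κ x y * κ y x = 1) (u v : List Λ) : kw κ u v * kw κ v u = 1 := by
  have h1 : ∀ (x : Λ) (v : List Λ), kw κ [x] v * kw κ v [x] = 1 := by
    intro x v
    induction v with
    | nil => simp
    | cons y v ih =>
      rw [kw_cons_right, kw_cons_left κ y v, kw_singleton, kw_singleton]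
      linear_combination κ x y * κ y x * ih + hκ x y
  induction u with
  | nil => simp
  | cons x u ih =>
    rw [kw_cons_left κ x u, kw_cons_right κ v x]
    linear_combination kw κ [x] v * kw κ v [x] * ih + h1 x v

end

variable (κ : Λ → Λ → ℂ)

/-- The signed rotation of functions on words. -/
def rotW (f : List Λ → ℂ) (l : List Λ) : ℂ :=
  if h : l = [] then f [] else kw κ [l.getLast h] l.dropLast * f (l.getLast h :: l.dropLast)

/-- The signed sum over all rotations of a word. -/
def cyc (f : List Λ → ℂ) (l : List Λ) : ℂ :=
  dsum (fun u v => if v = [] then 0 else kw κ v u * f (v ++ u)) l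

theorem rotW_concat (f : List Λ → ℂ) (u : List Λ) (x : Λ) :
    rotW κ f (u ++ [x]) = kw κ [x] u * f (x :: u) := by
  simp [rotW]

@[simp] theorem cyc_nil (f : List Λ → ℂ) : cyc κ f [] = 0 := by simp [cyc]

variable {κ}

theorem rotW_iterate (hκ : ∀ x y, κ x y * κ y x = 1) (f : List Λ → ℂ) (u v : List Λ) :
    (rotW κ)^[v.length] f (u ++ v) = kw κ v u * f (v ++ u) := by
  induction v generalizing u f with
  | nil => simp
  | cons x v ih =>
    have e : u ++ x :: v = (u ++ [x]) ++ v := by simp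
    rw [List.length_cons, Function.iterate_succ_apply, e, ih, ← List.append_assoc, rotW_concat,
      kw_append_right, kw_append_right, kw_cons_left κ x v u]
    have := kw_mul_kw hκ v [x]
    rw [List.cons_append]
    linear_combination (kw κ v u * kw κ [x] u * f (x :: (v ++ u))) * this

theorem rotW_iterate_length (hκ : ∀ x y, κ x y * κ y x = 1) (f : List Λ → ℂ) (l : List Λ) :
    (rotW κ)^[l.length] f l = f l := by
  simpa using rotW_iterate hκ f [] l

theorem cyc_eq_sum (hκ : ∀ x y, κ x y * κ y x = 1) (f : List Λ → ℂ) (l : List Λ) :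
    cyc κ f l = ∑ i ∈ Finset.range l.length, (rotW κ)^[i + 1] f l := by
  rw [cyc, ← sum_range_eq_dsum, Finset.sum_range_succ, List.drop_length, if_pos rfl, add_zero,
    ← Finset.sum_range_reflect]
  refine Finset.sum_congr rfl fun i hi => ?_
  have hi' := Finset.mem_range.1 hi
  have h1 := rotW_iterate hκ f (l.take (l.length - 1 - i)) (l.drop (l.length - 1 - i))
  have hlen : (l.drop (l.length - 1 - i)).length = i + 1 := by
    rw [List.length_drop]; omega
  have hn : l.drop (l.length - 1 - i) ≠ [] := by
    intro h; rw [h] at hlen; simp at hlen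
  rw [List.take_append_drop, hlen] at h1
  rw [if_neg hn, h1]

theorem cyc_rotW (hκ : ∀ x y, κ x y * κ y x = 1) (f : List Λ → ℂ) (l : List Λ) :
    cyc κ (rotW κ f) l = cyc κ f l := by
  rw [cyc_eq_sum hκ, cyc_eq_sum hκ]
  have h1 := Finset.sum_range_succ (fun i => (rotW κ)^[i + 1] f l) l.length
  have h2 := Finset.sum_range_succ' (fun i => (rotW κ)^[i + 1] f l) l.length
  have h3 : (rotW κ)^[l.length + 1] f l = (rotW κ)^[0 + 1] f l := by
    rw [Function.iterate_succ_apply, rotW_iterate_length hκ]; rfl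
  rw [h1, h3] at h2
  exact (add_right_cancel h2).symm

theorem cyc_congr {f g : List Λ → ℂ} {l : List Λ} (h : ∀ w, w.length = l.length → f w = g w) :
    cyc κ f l = cyc κ g l := by
  refine dsum_congr fun u v e => ?_
  rw [h _ (by rw [← e, List.length_append, List.length_append, add_comm])]

theorem rotW_congr {f g : List Λ → ℂ} {l : List Λ} (h : ∀ w, w.length = l.length → f w = g w) :
    rotW κ f l = rotW κ g l := by
  unfold rotW
  split_ifs with hl
  · exact h _ (by simp [hl])
  · rw [h _ (by
      have := List.length_pos_iff.2 hl
      simp; omega)]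

theorem cyc_sub (f g : List Λ → ℂ) (l : List Λ) :
    cyc κ (fun w => f w - g w) l = cyc κ f l - cyc κ g l := by
  rw [cyc, cyc, cyc, ← dsum_sub]
  refine dsum_congr fun u v _ => ?_
  split_ifs <;> ring

theorem cyc_add (f g : List Λ → ℂ) (l : List Λ) :
    cyc κ (fun w => f w + g w) l = cyc κ f l + cyc κ g l := by
  rw [cyc, cyc, cyc, ← dsum_add]
  refine dsum_congr fun u v _ => ?_
  split_ifs <;> ring

theorem cyc_smul (c : ℂ) (f : List Λ → ℂ) (l : List Λ) :
    cyc κ (fun w => c * f w) l = c * cyc κ f l := by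
  have := dsum_smul c (fun u v => if v = [] then 0 else kw κ v u * f (v ++ u)) l
  rw [smul_eq_mul] at this
  rw [cyc, cyc, ← this]
  refine dsum_congr fun u v _ => ?_
  split_ifs
  · simp
  · rw [smul_eq_mul]; ring

@[simp] theorem cyc_zero (l : List Λ) : cyc κ (fun _ => 0) l = 0 := by
  simp [cyc]

theorem cyc_sum {ι : Type*} (s : Finset ι) (f : ι → List Λ → ℂ) (l : List Λ) :
    cyc κ (fun w => ∑ i ∈ s, f i w) l = ∑ i ∈ s, cyc κ (f i) l := by
  classical
  induction s using Finset.induction_on with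
  | empty => simp
  | insert a s ha ih => simp only [Finset.sum_insert ha, cyc_add, ih]

theorem rotW_cyc (hκ : ∀ x y, κ x y * κ y x = 1) (f : List Λ → ℂ) (l : List Λ) :
    rotW κ (cyc κ f) l = cyc κ f l := by
  have h1 : rotW κ (cyc κ f) l = ∑ i ∈ Finset.range l.length, (rotW κ)^[i + 2] f l := by
    rcases List.eq_nil_or_concat l with rfl | ⟨u, x, rfl⟩
    · simp [rotW]
    · rw [List.concat_eq_append, rotW_concat, cyc_eq_sum hκ, Finset.mul_sum]
      refine Finset.sum_congr (by simp) fun i _ => ?_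
      rw [Function.iterate_succ_apply' (rotW κ) (i + 1), rotW_concat]
  rw [h1, ← cyc_rotW hκ, cyc_eq_sum hκ]
  rfl

/-- A solution of `T - rot T = f`. -/
def rotPrimitive (κ : Λ → Λ → ℂ) (f : List Λ → ℂ) (l : List Λ) : ℂ :=
  - (l.length : ℂ)⁻¹ * ∑ i ∈ Finset.range l.length, (i : ℂ) * (rotW κ)^[i] f l

/-- On words of length `N` the rotation `R` satisfies `R^N = 1`, and summation by parts gives `T - R
T = f - N⁻¹ ∑ R^i f` for `T = -N⁻¹ ∑ i R^i f`. So in characteristic 0 the kernel of the cyclic sum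
is the image of `1 - R`. -/
theorem rotPrimitive_sub (hκ : ∀ x y, κ x y * κ y x = 1) {f : List Λ → ℂ} (h0 : f [] = 0)
    (hf : ∀ l, cyc κ f l = 0) (l : List Λ) :
    rotPrimitive κ f l - rotW κ (rotPrimitive κ f) l = f l := by
  rcases List.eq_nil_or_concat l with rfl | ⟨u, x, rfl⟩
  · simp [rotPrimitive, rotW, h0]
  rw [List.concat_eq_append]
  set l := u ++ [x] with hl
  have hlen : l.length = u.length + 1 := by simp [hl]
  have h1 : rotW κ (rotPrimitive κ f) l =
      - (l.length : ℂ)⁻¹ * ∑ i ∈ Finset.range l.length, (i : ℂ) * (rotW κ)^[i + 1] f l := by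
    rw [hl, rotW_concat, rotPrimitive, mul_left_comm, Finset.mul_sum]
    congr 1
    · simp
    refine Finset.sum_congr (by simp) fun i _ => ?_
    rw [Function.iterate_succ_apply' (rotW κ) i, rotW_concat]; ring
  have h2 : ∑ i ∈ Finset.range l.length, (rotW κ)^[i + 1] f l = 0 := by
    rw [← cyc_eq_sum hκ, hf]
  have h3 := Finset.sum_range_succ (fun i : ℕ => (i : ℂ) * (rotW κ)^[i] f l) l.length
  have h4 := Finset.sum_range_succ' (fun i : ℕ => (i : ℂ) * (rotW κ)^[i] f l) l.length
  rw [h3, rotW_iterate_length hκ] at h4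
  simp only [Nat.cast_add, Nat.cast_one, add_mul, one_mul, Finset.sum_add_distrib, h2] at h4
  have hn : (l.length : ℂ) ≠ 0 := by rw [hlen]; push_cast; exact Nat.cast_add_one_ne_zero _
  rw [h1, rotPrimitive, ← mul_sub, eq_sub_of_add_eq h4]
  field_simp
  simp

theorem SlotLinear.rotW {R : ℂ → Λ → Λ → Λ → Prop}
    (hR : ∀ c x y z, R c x y z → ∀ t, κ x t = κ z t ∧ κ y t = κ z t)
    (hR' : ∀ c x y z, R c x y z → ∀ t, κ t x = κ t z ∧ κ t y = κ t z)
    {f : List Λ → ℂ} (hf : SlotLinear R f) : SlotLinear R (rotW κ f) := by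
  intro c x y z h u v
  rcases List.eq_nil_or_concat v with rfl | ⟨v, t, rfl⟩
  · rw [rotW_concat, rotW_concat, rotW_concat, ← List.nil_append (z :: u), hf c x y z h [] u]
    have e1 : ∀ w : List Λ, kw κ [x] w = kw κ [z] w := fun w => by
      simp only [kw, List.map_cons, List.map_nil, (funext fun t => (hR c x y z h t).1 : κ x = κ z)]
    have e2 : ∀ w : List Λ, kw κ [y] w = kw κ [z] w := fun w => by
      simp only [kw, List.map_cons, List.map_nil, (funext fun t => (hR c x y z h t).2 : κ y = κ z)]
    simp only [e1, e2, smul_eq_mul, List.nil_append]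
    ring
  · have e : ∀ s : Λ, u ++ s :: v.concat t = (u ++ s :: v) ++ [t] := by simp
    have h5 := hf c x y z h (t :: u) v
    simp only [List.cons_append] at h5
    rw [e, e, e, rotW_concat, rotW_concat, rotW_concat, h5]
    simp only [kw_append_right, kw_cons_right κ [t] _ v, kw_singleton, (hR' c x y z h t).1,
      (hR' c x y z h t).2, smul_eq_mul]
    ring

theorem SlotLinear.length_mul {R : ℂ → Λ → Λ → Λ → Prop} {f : List Λ → ℂ} (hf : SlotLinear R f)
    (c : ℕ → ℂ) : SlotLinear R fun l => c l.length * f l := by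
  intro a x y z h u v
  simp only [List.length_append, List.length_cons, hf a x y z h u v, smul_eq_mul]
  ring

theorem SlotLinear.sum_range {R : ℂ → Λ → Λ → Λ → Prop} {f : ℕ → List Λ → ℂ}
    (hf : ∀ i, SlotLinear R (f i)) :
    SlotLinear R fun l => ∑ i ∈ Finset.range l.length, f i l := by
  intro a x y z h u v
  simp only [List.length_append, List.length_cons, hf _ a x y z h u v, Finset.sum_add_distrib,
    Finset.smul_sum]

theorem SlotLinear.rotPrimitive {R : ℂ → Λ → Λ → Λ → Prop}
    (hR : ∀ c x y z, R c x y z → ∀ t, κ x t = κ z t ∧ κ y t = κ z t)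
    (hR' : ∀ c x y z, R c x y z → ∀ t, κ t x = κ t z ∧ κ t y = κ t z)
    {f : List Λ → ℂ} (hf : SlotLinear R f) : SlotLinear R (rotPrimitive κ f) := by
  refine SlotLinear.length_mul (SlotLinear.sum_range fun i => ?_) fun n => - (n : ℂ)⁻¹
  have : ∀ i, SlotLinear R ((_root_.rotW κ)^[i] f) := fun i => by
    induction i with
    | zero => exact hf
    | succ i ih => rw [Function.iterate_succ_apply']; exact ih.rotW hR hR'
  exact (this i).length_mul fun _ => (i : ℂ)

/-- Moving the first block to the end is a power of the rotation, which the cyclic sum does not see.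
-/
theorem cyc_dsum₁ (hκ : ∀ x y, κ x y * κ y x = 1) (Θ : List Λ → List Λ → ℂ) (l : List Λ) :
    cyc κ (fun l => dsum₁ Θ l) l =
      cyc κ (fun l => dsum (fun u b => if b = [] then 0 else kw κ b u * Θ b u) l) l := by
  let T : ℕ → List Λ → ℂ := fun j w => Θ (w.take j) (w.drop j)
  have h1 : ∀ w : List Λ, w.length = l.length → dsum₁ Θ w = ∑ j ∈ Finset.range l.length, T (j + 1) w := by
    intro w hw
    rw [← sum_Icc_eq_dsum₁, hw, ← Finset.Ico_add_one_right_eq_Icc,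
      Finset.sum_Ico_eq_sum_range]
    refine Finset.sum_congr rfl fun i _ => ?_
    rw [add_comm 1 i]
  have h2 : ∀ w : List Λ, w.length = l.length →
      dsum (fun u b => if b = [] then 0 else kw κ b u * Θ b u) w =
      ∑ j ∈ Finset.range l.length, (rotW κ)^[j + 1] (T (j + 1)) w := by
    intro w hw
    rw [← sum_range_eq_dsum, Finset.sum_range_succ, List.drop_length, if_pos rfl, add_zero,
      ← Finset.sum_range_reflect, hw]
    refine Finset.sum_congr rfl fun i hi => ?_
    have hi' := Finset.mem_range.1 hi
    have hlen : (w.drop (l.length - 1 - i)).length = i + 1 := by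
      rw [List.length_drop, hw]; omega
    have h1 := rotW_iterate hκ (T (i + 1)) (w.take (l.length - 1 - i)) (w.drop (l.length - 1 - i))
    have hn : w.drop (l.length - 1 - i) ≠ [] := by
      intro h; rw [h] at hlen; simp at hlen
    rw [List.take_append_drop, hlen] at h1
    rw [if_neg hn, h1]
    congr 1
    simp only [T]
    rw [List.take_left' hlen, List.drop_left' hlen]
  rw [cyc_congr h1, cyc_congr h2, cyc_sum, cyc_sum]
  refine Finset.sum_congr rfl fun j _ => ?_
  have : ∀ k (f : List Λ → ℂ), cyc κ ((rotW κ)^[k] f) l = cyc κ f l := by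
    intro k f
    induction k with
    | zero => rfl
    | succ k ih => rw [Function.iterate_succ_apply', cyc_rotW hκ, ih]
  rw [this]

section
variable (ok : List Λ → Prop) [DecidablePred ok] (op : List Λ → Λ')

theorem subst_eq_dsum_last (f : List Λ' → ℂ) {l : List Λ} (hl : l ≠ []) :
    subst ok op f l = dsum (fun u b => if b = [] then 0 else if ok b then
      subst ok op (fun w => f (w ++ [op b])) u else 0) l := by
  induction l using length_induction generalizing f with
  | h l ih =>
    have e1 : subst ok op f l = dsum₁ (fun b v => (if v = [] then (if ok b then f [op b] else 0) else 0)
        + dsum (fun u b' => if b' = [] then 0 else if ok b' then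
          subst ok op (blk ok op (fun w => f (w ++ [op b'])) b) u else 0) v) l := by
      rw [subst_eq_dsum₁ _ _ _ hl]
      refine dsum₁_congr fun b v hb e => ?_
      have h1 : b.length + v.length = l.length := by rw [← List.length_append, e]
      have h2 := List.length_pos_iff.2 hb
      rcases eq_or_ne v [] with rfl | hv
      · simp [blk]
      · rw [if_neg hv, zero_add, ih v (by omega) _ hv]
        rfl
    have e2 : dsum₁ (fun b v => (if v = [] then (if ok b then f [op b] else 0) else 0)) l =
        if ok l then f [op l] else 0 := by
      obtain ⟨a, l, rfl⟩ := List.exists_cons_of_ne_nil hl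
      rw [dsum₁_cons, dsum_eq_last fun x y _ hy => if_neg hy]
      simp
    rw [e1, dsum₁_add, e2, dsum_eq_add_dsum₁, if_neg hl]
    congr 1
    rw [← dsum₁_assoc (fun b u b' => if b' = [] then 0 else if ok b' then
          subst ok op (blk ok op (fun w => f (w ++ [op b'])) b) u else 0)]
    refine dsum₁_congr fun u b' hu _ => ?_
    split_ifs
    · exact dsum₁_eq_zero fun _ _ _ _ => rfl
    · exact (subst_eq_dsum₁ _ _ _ hu).symm
    · exact dsum₁_eq_zero fun _ _ _ _ => rfl

/-- A multiplicative weight that is compatible with the formation of blocks factors out of a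
substitution. It is applied to the sign of moving a letter or a block past the rest of the word. -/
theorem subst_char (χ : List Λ → ℂ) (χ' : List Λ' → ℂ) (h0 : χ [] = 1) (h0' : χ' [] = 1)
    (hχ : ∀ u v, χ (u ++ v) = χ u * χ v) (hχ' : ∀ a w, χ' (a :: w) = χ' [a] * χ' w)
    (hop : ∀ b, b ≠ [] → ok b → χ' [op b] = χ b) (f : List Λ' → ℂ) (l : List Λ) :
    subst ok op (fun w => χ' w * f w) l = χ l * subst ok op f l := by
  induction l using length_induction generalizing f with
  | h l ih =>
    cases l with
    | nil => simp [h0, h0']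
    | cons a l =>
      rw [subst_cons, subst_cons, ← smul_eq_mul, ← dsum_smul]
      refine dsum_congr fun x v e => ?_
      have : blk ok op (fun w => χ' w * f w) (a :: x) =
          fun w => χ' w * (χ (a :: x) * blk ok op f (a :: x) w) := by
        funext w
        unfold blk
        split_ifs with hb
        · change χ' (op (a :: x) :: w) * f (op (a :: x) :: w) = _
          rw [hχ', hop _ (by simp) hb]; ring
        · simp
      rw [this, ih v (by simp [← e])]
      have h2 := subst_smul ok op (χ (a :: x)) (blk ok op f (a :: x)) v
      simp only [smul_eq_mul] at h2
      rw [h2, ← e, ← List.cons_append, hχ, smul_eq_mul]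
      ring

/-- Rotating a letter after substitution rotates its whole block before it, and that is invisible to
the cyclic sum. Hence substitution preserves the image of `1 - rot`. -/
theorem cyc_subst_rotW (hκ : ∀ x y, κ x y * κ y x = 1) {κ' : Λ' → Λ' → ℂ}
    (hop : ∀ b b', b ≠ [] → b' ≠ [] → ok b → ok b' → κ' (op b) (op b') = kw κ b b')
    (f : List Λ' → ℂ) (l : List Λ) :
    cyc κ (subst ok op (rotW κ' f)) l = cyc κ (subst ok op f) l := by
  rcases eq_or_ne l [] with rfl | hl
  · simp
  have hne : ∀ w : List Λ, w.length = l.length → w ≠ [] := by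
    rintro w hw rfl
    exact hl (List.length_eq_zero_iff.1 hw.symm)
  have h1 := cyc_dsum₁ hκ (fun b v => subst ok op (blk ok op f b) v) l
  rw [cyc_congr fun w hw => subst_eq_dsum₁ ok op f (hne w hw), h1]
  refine cyc_congr fun w hw => ?_
  rw [subst_eq_dsum_last ok op _ (hne w hw)]
  refine dsum_congr fun u b _ => ?_
  rcases eq_or_ne b [] with rfl | hb
  · simp
  rw [if_neg hb, if_neg hb, subst_blk]
  split_ifs with h
  · simp only [rotW_concat]
    refine subst_char ok op (kw κ b) (kw κ' [op b]) (by simp) (by simp) (fun _ _ => kw_append_right _ _ _ _)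
      (fun _ _ => kw_cons_right _ _ _ _) (fun b' hb' h' => ?_) _ u
    rw [kw_singleton, hop b b' hb hb' h h']
  · simp

end

section
variable (tw : Λ → Λ) (ok : List Λ → Prop) [DecidablePred ok] (op : List Λ → Λ)

theorem coder_concat (f : List Λ → ℂ) (l : List Λ) (x : Λ) :
    coder tw ok op f (l ++ [x]) = coder tw ok op (fun w => f (w ++ [x])) l +
      dsum (fun u b => if ok (b ++ [x]) then f (u.map tw ++ [op (b ++ [x])]) else 0) l := by
  induction l generalizing f with
  | nil => simp [coder_cons]
  | cons a l ih =>
    rw [List.cons_append, coder_cons, coder_cons, dsum_concat, ih, dsum_cons]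
    simp only [List.cons_append, List.map_nil, List.map_cons, List.nil_append]
    ring

theorem coder_char (χ : List Λ → ℂ) (c : ℂ) (hχ : ∀ u v, χ (u ++ v) = χ u * χ v)
    (htw : ∀ a, χ [tw a] = χ [a])
    (hop : ∀ b, b ≠ [] → ok b → χ [op b] = c * χ b) (f : List Λ → ℂ) (l : List Λ) :
    coder tw ok op (fun w => χ w * f w) l = c * χ l * coder tw ok op f l := by
  have hc : ∀ a w, χ (a :: w) = χ [a] * χ w := fun a w => hχ [a] w
  induction l generalizing f with
  | nil => simp
  | cons a l ih =>
    rw [coder_cons, coder_cons, mul_add, ← smul_eq_mul (c * _), ← smul_eq_mul (c * _), ← dsum_smul]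
    congr 1
    · refine dsum_congr fun x v e => ?_
      split_ifs with h
      · rw [hc, hop _ (by simp) h, ← e, ← List.cons_append, hχ, smul_eq_mul]; ring
      · simp
    · have : (fun w => χ (tw a :: w) * f (tw a :: w)) = fun w => χ w * (χ [a] * f (tw a :: w)) := by
        funext w; rw [hc, htw]; ring
      rw [this, ih]
      have h2 := coder_smul tw ok op (χ [a]) (fun w => f (tw a :: w)) l
      simp only [smul_eq_mul] at h2
      rw [h2, hc a l, smul_eq_mul]; ring

theorem map_tw_eq {s : List Λ → ℂ} (h0 : s [] = 1) (hs : ∀ u v, s (u ++ v) = s u * s v)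
    {f : List Λ → ℂ} (hf : ∀ p a w, f (p ++ tw a :: w) = s [a] * f (p ++ a :: w)) (p u w : List Λ) :
    f (p ++ (u.map tw ++ w)) = s u * f (p ++ (u ++ w)) := by
  induction u generalizing p with
  | nil => simp [h0]
  | cons a u ih =>
    have := ih (p ++ [a])
    simp only [List.append_assoc, List.cons_append, List.nil_append] at this
    rw [List.map_cons, List.cons_append, hf, this, hs [a] u |> fun h => (h : s (a :: u) = _),
      List.cons_append]
    ring

/-- A coderivation commutes with the rotation except for blocks touching the letter that moves; the
exceptional terms differ by rotations of a block and cancel in the cyclic sum. -/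
theorem cyc_coder_rotW (hκ : ∀ x y, κ x y * κ y x = 1) (htwκ : ∀ x y, κ x (tw y) = κ x y)
    {s : List Λ → ℂ} (h0 : s [] = 1) (hs : ∀ u v, s (u ++ v) = s u * s v)
    (hs1 : ∀ u, s u * s u = 1)
    (hop : ∀ b x, b ≠ [] → ok b → κ (op b) x = kw κ b [x] * s [x])
    (hop' : ∀ b x, b ≠ [] → ok b → κ x (op b) = kw κ [x] b * s [x])
    {f : List Λ → ℂ} (hf : ∀ p a w, f (p ++ tw a :: w) = s [a] * f (p ++ a :: w)) (l : List Λ) :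
    cyc κ (coder tw ok op (rotW κ f)) l = cyc κ (coder tw ok op f) l := by
  have hop2 : ∀ b w, b ≠ [] → ok b → kw κ [op b] w = kw κ b w * s w := by
    intro b w hb h
    induction w with
    | nil => simp [h0]
    | cons x w ih =>
      rw [kw_cons_right, ih, kw_singleton, hop b x hb h, kw_cons_right κ b x w,
        show s (x :: w) = s [x] * s w from hs [x] w]
      ring
  let Θ : List Λ → List Λ → ℂ := fun b u => if ok b then f (op b :: u) else 0
  -- The two orders differ in the blocks that contain the rotated letter: ending with it before the
  -- rotation, beginning with it after.
  have key : ∀ w : List Λ, coder tw ok op (rotW κ f) w = rotW κ (coder tw ok op f) w +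
      (dsum (fun u b => if b = [] then 0 else kw κ b u * Θ b u) w - rotW κ (dsum₁ Θ) w) := by
    intro w
    rcases List.eq_nil_or_concat w with rfl | ⟨w, x, rfl⟩
    · simp [rotW]
    rw [List.concat_eq_append, coder_concat, rotW_concat, rotW_concat, dsum_concat, if_pos rfl,
      add_zero, coder_cons, dsum₁_cons]
    have e1 : coder tw ok op (fun w => rotW κ f (w ++ [x])) w =
        kw κ [x] w * coder tw ok op (fun w => f (tw x :: w)) w := by
      simp only [rotW_concat]
      rw [coder_char tw ok op (kw κ [x]) (s [x]) (fun _ _ => kw_append_right _ _ _ _)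
        (fun a => by rw [kw_singleton, kw_singleton, htwκ])
        (fun b hb h => by rw [kw_singleton, hop' b x hb h]; ring)]
      have : (fun w => f (tw x :: w)) = fun w => s [x] * f (x :: w) := by
        funext w; exact hf [] x w
      have h2 := coder_smul tw ok op (s [x]) (fun w => f (x :: w)) w
      simp only [smul_eq_mul] at h2
      rw [this, h2]; ring
    have e2 : dsum (fun u b => if ok (b ++ [x]) then rotW κ f (u.map tw ++ [op (b ++ [x])]) else 0) w =
        dsum (fun u b => if b ++ [x] = [] then 0 else kw κ (b ++ [x]) u * Θ (b ++ [x]) u) w := by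
      refine dsum_congr fun u b _ => ?_
      rw [if_neg (by simp : b ++ [x] ≠ [])]
      simp only [Θ]
      split_ifs with h
      · have h3 : kw κ [op (b ++ [x])] (u.map tw) = kw κ [op (b ++ [x])] u := by
          have : κ (op (b ++ [x])) ∘ tw = κ (op (b ++ [x])) := funext fun t => htwκ _ _
          simp only [kw, List.map_map, List.map_cons, List.map_nil, this]
        have h4 := map_tw_eq tw h0 hs hf [op (b ++ [x])] u []
        simp only [List.append_nil, List.cons_append, List.nil_append] at h4
        rw [rotW_concat, h3, hop2 _ _ (by simp) h, h4]
        linear_combination (kw κ (b ++ [x]) u * f (op (b ++ [x]) :: u)) * hs1 u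
      · simp
    rw [e1, e2]
    ring
  rw [cyc_congr fun w _ => key w, cyc_add, cyc_sub, cyc_rotW hκ, cyc_rotW hκ, ← cyc_dsum₁ hκ]
  simp

end

end Rotation

end

noncomputable section

/-! ### Words with a cut that no admissible block crosses -/

section

variable {Λ Λ' W : Type*}

theorem dsum_append [AddCommMonoid W] (g : List Λ → List Λ → W) (u v : List Λ) :
    dsum g (u ++ v) = dsum (fun x y => g x (y ++ v)) u + dsum₁ (fun x y => g (u ++ x) y) v := by
  cases v with
  | nil => simp
  | cons z v => exact dsum_append_cons g u v z

theorem subst_append_of_not_ok [AddCommMonoid W] (ok : List Λ → Prop) [DecidablePred ok]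
    (op : List Λ → Λ') (f : List Λ' → W) (v u : List Λ)
    (h : ∀ b b' s t, b ≠ [] → b' ≠ [] → v = s ++ b → u = b' ++ t → ¬ ok (b ++ b')) :
    subst ok op f (v ++ u) = subst ok op (fun p => subst ok op (fun q => f (p ++ q)) u) v := by
  induction v using length_induction generalizing f with
  | h v ih =>
    cases v with
    | nil => rfl
    | cons a v =>
      rw [List.cons_append, subst_cons, subst_cons, dsum_append, dsum₁_eq_zero, add_zero]
      · refine dsum_congr fun x y e => ?_
        have h2 : ∀ b b' s t, b ≠ [] → b' ≠ [] → y = s ++ b → u = b' ++ t → ¬ ok (b ++ b') :=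
          fun b b' s t hb hb' e1 e2 => h b b' (a :: x ++ s) t hb hb' (by simp [← e, e1]) e2
        rw [ih y (by simp [← e]) _ h2]
        refine subst_congr _ _ (fun p => ?_) _
        unfold blk
        split_ifs <;> simp
      · intro x y hx e
        rw [subst_blk, if_neg]
        exact h (a :: v) x [] y (by simp) hx rfl e.symm

theorem coder_append_of_not_ok [AddCommMonoid W] (tw : Λ → Λ) (ok : List Λ → Prop) [DecidablePred ok]
    (op : List Λ → Λ) (f : List Λ → W) (v u : List Λ)
    (h : ∀ b b' s t, b ≠ [] → b' ≠ [] → v = s ++ b → u = b' ++ t → ¬ ok (b ++ b')) :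
    coder tw ok op f (v ++ u) = coder tw ok op (fun p => f (p ++ u)) v +
      coder tw ok op (fun q => f (v.map tw ++ q)) u := by
  induction v generalizing f with
  | nil => simp
  | cons a v ih =>
    rw [List.cons_append, coder_cons, coder_cons, dsum_append, dsum₁_eq_zero, add_zero, ih]
    · simp [add_assoc]
    · exact fun b b' s t hb hb' e1 e2 => h b b' (a :: s) t hb hb' (by simp [e1]) e2
    · intro x y hx e
      rw [if_neg]
      exact h (a :: v) x [] y (by simp) hx rfl e.symm

end

/-! ### Words of forms and the de Rham differential -/

section FormWords

variable {m : ℕ} {A B : Type*} [AddCommGroup A] [Module ℂ A] [AddCommGroup B] [Module ℂ B]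
  {𝒜 : ZMod m → Submodule ℂ A} {ℬ : ZMod m → Submodule ℂ B}

@[simp] theorem marks_nil : marks ([] : List (DLetter 𝒜)) = 0 := rfl
theorem marks_cons (x : DLetter 𝒜) (l : List (DLetter 𝒜)) :
    marks (x :: l) = marks [x] + marks l := by
  rcases x with ⟨b, x⟩; cases b <;> simp [marks, add_comm]
@[simp] theorem marks_true (x : Letter 𝒜) : marks [(true, x)] = 1 := rfl
@[simp] theorem marks_false (x : Letter 𝒜) : marks [(false, x)] = 0 := rfl
@[simp] theorem marks_true_cons (x : Letter 𝒜) (l : List (DLetter 𝒜)) :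
    marks ((true, x) :: l) = 1 + marks l := marks_cons _ _
@[simp] theorem marks_false_cons (x : Letter 𝒜) (l : List (DLetter 𝒜)) :
    marks ((false, x) :: l) = marks l := by rw [marks_cons]; simp
@[simp] theorem marks_append (l l' : List (DLetter 𝒜)) : marks (l ++ l') = marks l + marks l' := by
  simp [marks]
@[simp] theorem plain_nil : plain ([] : List (DLetter 𝒜)) = [] := rfl
@[simp] theorem plain_cons (x : DLetter 𝒜) (l : List (DLetter 𝒜)) :
    plain (x :: l) = x.2 :: plain l := rfl
@[simp] theorem plain_append (l l' : List (DLetter 𝒜)) : plain (l ++ l') = plain l ++ plain l' := by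
  simp [plain]

/-- The word in the letters `s` with given letters. -/
def unmarked (l : List (Letter 𝒜)) : List (DLetter 𝒜) := l.map fun a => (false, a)

@[simp] theorem unmarked_nil : unmarked ([] : List (Letter 𝒜)) = [] := rfl
@[simp] theorem unmarked_cons (a : Letter 𝒜) (l : List (Letter 𝒜)) :
    unmarked (a :: l) = (false, a) :: unmarked l := rfl
@[simp] theorem unmarked_append (l l' : List (Letter 𝒜)) :
    unmarked (l ++ l') = unmarked l ++ unmarked l' := by simp [unmarked]
@[simp] theorem plain_unmarked (l : List (Letter 𝒜)) : plain (unmarked l) = l := by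
  simp [plain, unmarked, Function.comp_def]
@[simp] theorem marks_unmarked (l : List (Letter 𝒜)) : marks (unmarked l) = 0 := by
  simp [marks, unmarked]

theorem eq_unmarked_of_marks {l : List (DLetter 𝒜)} (h : marks l = 0) : l = unmarked (plain l) := by
  induction l with
  | nil => rfl
  | cons x l ih =>
    obtain ⟨b, x⟩ := x
    rw [marks_cons] at h
    cases b
    · rw [plain_cons, unmarked_cons, ← ih (by omega)]
    · simp at h

theorem exists_of_marks_pos {l : List (DLetter 𝒜)} (h : marks l ≠ 0) :
    ∃ u a v, l = u ++ (true, a) :: v ∧ marks u = 0 := by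
  induction l with
  | nil => simp at h
  | cons x l ih =>
    obtain ⟨b, x⟩ := x
    cases b
    · rw [marks_cons] at h
      obtain ⟨u, a, v, e, hu⟩ := ih (by simpa using h)
      refine ⟨(false, x) :: u, a, v, by simp [e], by rw [marks_cons, hu]; rfl⟩
    · exact ⟨[], x, l, rfl, rfl⟩

/-- The sign of the exchange of two letters. -/
def koszulL (x y : Letter 𝒜) : ℂ := koszul x.1 y.1

/-- The sign of the exchange of two letters of forms. -/
def koszulD (x y : DLetter 𝒜) : ℂ := koszul x.2.1 y.2.1 * (-1) ^ (marks [x] * marks [y])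

theorem koszulL_mul (x y : Letter 𝒜) : koszulL x y * koszulL y x = 1 := by
  rw [koszulL, koszulL, koszul_comm y.1, koszul_mul_self]

theorem koszulD_mul (x y : DLetter 𝒜) : koszulD x y * koszulD y x = 1 := by
  have : ((-1 : ℂ) ^ (marks [x] * marks [y])) * (-1) ^ (marks [y] * marks [x]) = 1 := by
    rw [mul_comm (marks [y]), ← mul_pow]; simp
  rw [koszulD, koszulD, koszul_comm y.2.1]
  linear_combination this + ((-1 : ℂ) ^ (marks [x] * marks [y])) * (-1) ^ (marks [y] * marks [x]) *
    koszul_mul_self x.2.1 y.2.1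

/-! ### The de Rham differential -/

theorem dR_nil (f : List (DLetter 𝒜) → ℂ) : dR 𝒜 f [] = 0 := by
  simp [dR]

theorem dR_cons (f : List (DLetter 𝒜) → ℂ) (x : DLetter 𝒜) (l : List (DLetter 𝒜)) :
    dR 𝒜 f (x :: l) = (if x.1 then f ((false, x.2) :: l) else 0) +
      (-1) ^ marks [x] * dR 𝒜 (fun w => f (x :: w)) l := by
  change (∑ i : Fin (l.length + 1), _) = _
  rw [Fin.sum_univ_succ]
  congr 1
  · simp
  · change _ = (-1) ^ marks [x] * ∑ i : Fin l.length, _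
    rw [Finset.mul_sum]
    refine Finset.sum_congr rfl fun i _ => ?_
    have h1 : (x :: l).get i.succ = l.get i := rfl
    have h2 : (x :: l).take i.succ.val = x :: l.take i := rfl
    have h3 : (x :: l).set i.succ.val = fun y => x :: l.set i y := rfl
    simp only [h1, h2, h3, mul_ite, mul_zero]
    rw [marks_cons, pow_add, mul_assoc]

theorem dR_append (f : List (DLetter 𝒜) → ℂ) (u v : List (DLetter 𝒜)) :
    dR 𝒜 f (u ++ v) = dR 𝒜 (fun p => f (p ++ v)) u + (-1) ^ marks u * dR 𝒜 (fun q => f (u ++ q)) v := by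
  induction u generalizing f with
  | nil => simp [dR_nil]
  | cons x u ih =>
    rw [List.cons_append, dR_cons, ih, dR_cons, marks_cons x u, pow_add]
    simp only [List.cons_append]
    ring

theorem dR_add (f g : List (DLetter 𝒜) → ℂ) (l : List (DLetter 𝒜)) :
    dR 𝒜 (fun w => f w + g w) l = dR 𝒜 f l + dR 𝒜 g l :=
  congrFun (map_add (dR 𝒜) f g) l

theorem dR_smul (c : ℂ) (f : List (DLetter 𝒜) → ℂ) (l : List (DLetter 𝒜)) :
    dR 𝒜 (fun w => c * f w) l = c * dR 𝒜 f l :=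
  congrFun (map_smul (dR 𝒜) c f) l

theorem dR_zero (l : List (DLetter 𝒜)) : dR 𝒜 (fun _ => 0) l = 0 :=
  congrFun (map_zero (dR 𝒜)) l

theorem dR_sum {ι : Type*} (s : Finset ι) (f : ι → List (DLetter 𝒜) → ℂ) (l : List (DLetter 𝒜)) :
    dR 𝒜 (fun w => ∑ i ∈ s, f i w) l = ∑ i ∈ s, dR 𝒜 (f i) l := by
  have := congrFun (map_sum (dR 𝒜) f s) l
  rw [Finset.sum_apply] at this
  rw [← this]
  exact congrFun (congrArg (dR 𝒜) (funext fun w => (Finset.sum_apply w s f).symm)) l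

theorem dR_congr {f g : List (DLetter 𝒜) → ℂ} {l : List (DLetter 𝒜)}
    (h : ∀ w, w.length = l.length → f w = g w) : dR 𝒜 f l = dR 𝒜 g l := by
  change (∑ i : Fin l.length, _) = ∑ i : Fin l.length, _
  refine Finset.sum_congr rfl fun i _ => ?_
  rw [h _ (by simp)]

theorem dR_dsum (g : List (DLetter 𝒜) → List (DLetter 𝒜) → ℂ) (l : List (DLetter 𝒜)) :
    dR 𝒜 (fun w => dsum g w) l =
      dsum (fun x y => dR 𝒜 (fun p => g p y) x + (-1) ^ marks x * dR 𝒜 (g x) y) l := by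
  induction l generalizing g with
  | nil => simp [dR_nil]
  | cons a l ih =>
    rw [dR_cons, dsum_cons]
    simp only [dsum_cons, dR_add, ih, dR_nil, marks_nil, pow_zero, one_mul, zero_add]
    rw [dR_cons]
    have e : ∀ x y, dR 𝒜 (fun p => g p y) (a :: x) + (-1) ^ marks (a :: x) * dR 𝒜 (g (a :: x)) y =
        (if a.1 then g ((false, a.2) :: x) y else 0) +
        (-1) ^ marks [a] * (dR 𝒜 (fun p => g (a :: p) y) x + (-1) ^ marks x * dR 𝒜 (g (a :: x)) y) := by
      intro x y
      rw [dR_cons, marks_cons a x, pow_add]; ring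
    simp only [e, dsum_add]
    have h1 := dsum_smul ((-1 : ℂ) ^ marks [a]) (fun x y => dR 𝒜 (fun p => g (a :: p) y) x +
      (-1) ^ marks x * dR 𝒜 (g (a :: x)) y) l
    simp only [smul_eq_mul, dsum_add] at h1
    have h2 : dsum (fun x y => (-1 : ℂ) ^ marks [a] * (dR 𝒜 (fun p => g (a :: p) y) x +
      (-1) ^ marks x * dR 𝒜 (g (a :: x)) y)) l = _ := h1
    rw [h2]
    split_ifs
    · ring
    · simp only [dsum_zero]; ring

theorem dR_dsum₁ {g : List (DLetter 𝒜) → List (DLetter 𝒜) → ℂ} (hg : ∀ y, g [] y = 0)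
    (l : List (DLetter 𝒜)) :
    dR 𝒜 (fun w => dsum₁ g w) l =
      dsum₁ (fun x y => dR 𝒜 (fun p => g p y) x + (-1) ^ marks x * dR 𝒜 (g x) y) l := by
  have h1 : ∀ w, dsum₁ g w = dsum g w := fun w => by rw [dsum_eq_add_dsum₁, hg, zero_add]
  simp only [h1]
  rw [dR_dsum, dsum_eq_add_dsum₁, dR_nil, show g [] = fun _ => 0 from funext hg, dR_zero]
  simp

theorem dR_marks_zero (g : List (Letter 𝒜) → ℂ) (l : List (DLetter 𝒜)) :
    dR 𝒜 (fun w => if marks w = 0 then g (plain w) else 0) l =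
      if marks l = 1 then g (plain l) else 0 := by
  induction l generalizing g with
  | nil => simp [dR_nil]
  | cons x l ih =>
    obtain ⟨b, x⟩ := x
    rw [dR_cons]
    cases b
    · have h1 := ih fun w => g (x :: w)
      simp only [marks_false_cons, plain_cons]
      simp [h1]
    · have h2 : ∀ w : List (DLetter 𝒜), ¬ (1 + marks w = 0) := fun w => by omega
      simp only [marks_true_cons, marks_false_cons, plain_cons, h2, if_false, dR_zero]
      simp [add_comm 1]

/-- In view of `dR_marks_zero` this is `d² = 0` on functions. -/
theorem dR_marks_one (g : List (Letter 𝒜) → ℂ) (l : List (DLetter 𝒜)) :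
    dR 𝒜 (fun w => if marks w = 1 then g (plain w) else 0) l = 0 := by
  induction l generalizing g with
  | nil => simp [dR_nil]
  | cons x l ih =>
    obtain ⟨b, x⟩ := x
    rw [dR_cons]
    cases b
    · have h1 := ih fun w => g (x :: w)
      simp only [marks_false_cons, plain_cons]
      simp [h1]
    · have h1 := dR_marks_zero (fun w => g (x :: w)) l
      have h2 : ∀ w : List (DLetter 𝒜), (1 + marks w = 1) ↔ marks w = 0 := fun w => by omega
      simp only [marks_true_cons, marks_false_cons, plain_cons, h2, h1]
      split_ifs <;> simp_all

theorem dR_char {χ : List (DLetter 𝒜) → ℂ} {c : ℂ} (hχ : ∀ u v, χ (u ++ v) = χ u * χ v)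
    (hc : ∀ a, χ [(false, a)] = c * χ [(true, a)]) (f : List (DLetter 𝒜) → ℂ)
    (l : List (DLetter 𝒜)) :
    dR 𝒜 (fun w => χ w * f w) l = c * χ l * dR 𝒜 f l := by
  have h1 : ∀ a w, χ (a :: w) = χ [a] * χ w := fun a w => hχ [a] w
  induction l generalizing f with
  | nil => simp [dR_nil]
  | cons x l ih =>
    obtain ⟨b, x⟩ := x
    have : (fun w => χ ((b, x) :: w) * f ((b, x) :: w)) = fun w => χ w * (χ [(b, x)] * f ((b, x) :: w)) := by
      funext w; rw [h1]; ring
    rw [dR_cons, dR_cons, this, ih, dR_smul, h1 (b, x) l, h1 (false, x)]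
    cases b
    · simp; ring
    · rw [hc]; simp; ring

theorem kw_koszulD_false (a : Letter 𝒜) (x : DLetter 𝒜) :
    kw koszulD [x] [(false, a)] = (-1) ^ marks [x] * kw koszulD [x] [(true, a)] := by
  simp only [kw_singleton, koszulD, marks_false, marks_true, mul_zero, mul_one, pow_zero]
  have : ((-1 : ℂ) ^ marks [x]) * (-1) ^ marks [x] = 1 := by rw [← mul_pow]; simp
  linear_combination (- koszul x.2.1 a.1) * this

/-- The form-degree part of `koszulD` is what makes the signed rotation compatible with `d`:
changing a letter from `ds` to `s` changes its exchange sign exactly by the sign of passing the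
word. -/
theorem dR_rotW (f : List (DLetter 𝒜) → ℂ) (l : List (DLetter 𝒜)) :
    dR 𝒜 (rotW koszulD f) l = rotW koszulD (dR 𝒜 f) l := by
  rcases List.eq_nil_or_concat l with rfl | ⟨u, x, rfl⟩
  · simp [dR_nil, rotW]
  rw [List.concat_eq_append, dR_append, rotW_concat]
  simp only [rotW_concat]
  rw [dR_char (c := (-1) ^ marks [x]) (fun _ _ => kw_append_right _ _ _ _)
    (fun a => kw_koszulD_false a x), dR_cons, dR_cons, dR_nil, mul_zero, add_zero]
  obtain ⟨b, x⟩ := x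
  cases b
  · simp
  · have : ∀ u : List (DLetter 𝒜), (-1) ^ marks u * kw koszulD [(false, x)] u = kw koszulD [(true, x)] u := by
      intro u
      induction u with
      | nil => simp
      | cons y u ih =>
        rw [kw_cons_right, kw_cons_right koszulD [(true, x)], ← ih, marks_cons, pow_add, kw_singleton,
          kw_singleton]
        simp only [koszulD, marks_false, marks_true, zero_mul, one_mul, pow_zero]
        ring
    simp only [if_true, rotW_concat]
    rw [← this]; ring

theorem dR_cyc (f : List (DLetter 𝒜) → ℂ) (l : List (DLetter 𝒜)) :
    dR 𝒜 (cyc koszulD f) l = cyc koszulD (dR 𝒜 f) l := by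
  have h1 : ∀ i, dR 𝒜 ((rotW koszulD)^[i] f) = (rotW koszulD)^[i] (dR 𝒜 f) := by
    intro i
    induction i with
    | zero => rfl
    | succ i ih => rw [Function.iterate_succ_apply', Function.iterate_succ_apply', ← ih]; exact funext (dR_rotW _)
  rw [cyc_eq_sum koszulD_mul]
  simp only [← h1]
  rw [← dR_sum]
  exact dR_congr fun w hw => by rw [cyc_eq_sum koszulD_mul, hw]

/-! ### Substitutions of forms -/

section
variable (op : List (Letter 𝒜) → Letter ℬ)

/-- The letter of a form obtained from a block with at most one mark. -/
def opD (b : List (DLetter 𝒜)) : DLetter ℬ := (decide (marks b = 1), op (plain b))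

theorem marks_opD {b : List (DLetter 𝒜)} (hb : marks b ≤ 1) : marks [opD op b] = marks b := by
  unfold opD
  obtain h | h : marks b = 0 ∨ marks b = 1 := by omega
  · simp [h]
  · simp [h]

theorem dR_block (h : DLetter ℬ → ℂ) (b : List (DLetter 𝒜)) :
    dR 𝒜 (fun b => if marks b ≤ 1 then h (opD op b) else 0) b =
      if marks b = 1 then h (false, op (plain b)) else 0 := by
  have e : (fun b : List (DLetter 𝒜) => if marks b ≤ 1 then h (opD op b) else 0) = fun b =>
      (if marks b = 0 then h (false, op (plain b)) else 0) +
      (if marks b = 1 then h (true, op (plain b)) else 0) := by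
    funext b
    unfold opD
    by_cases h0 : marks b = 0
    · simp [h0]
    by_cases h1 : marks b = 1
    · simp [h1]
    · simp [h0, h1, show ¬ marks b ≤ 1 by omega]
  rw [e, dR_add, dR_marks_zero (fun w => h (false, op w)), dR_marks_one (fun w => h (true, op w)), add_zero]

/-- A block with one mark stands for `d(F(s))`, so the substitution is a morphism of differential
algebras. The Leibniz rule peels off the first block, where `dR_block` expresses `d(F(s)) = F(ds)`
and `d(d(F(s))) = 0`. -/
theorem dR_subst (f : List (DLetter ℬ) → ℂ) (l : List (DLetter 𝒜)) :
    dR 𝒜 (subst (fun b => marks b ≤ 1) (opD op) f) l =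
      subst (fun b => marks b ≤ 1) (opD op) (dR ℬ f) l := by
  induction l using length_induction generalizing f with
  | h l ih =>
    rcases eq_or_ne l [] with rfl | hl
    · simp [dR_nil]
    let Θ : List (DLetter 𝒜) → List (DLetter 𝒜) → ℂ := fun b v => if b = [] then 0 else
      subst (fun b => marks b ≤ 1) (opD op) (blk (fun b => marks b ≤ 1) (opD op) f b) v
    have e : dR 𝒜 (subst (fun b => marks b ≤ 1) (opD op) f) l = dR 𝒜 (fun w => dsum₁ Θ w) l := by
      refine dR_congr fun w hw => ?_
      rw [subst_eq_dsum₁ _ _ _ (by rintro rfl; exact hl (List.length_eq_zero_iff.1 hw.symm))]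
      exact dsum₁_congr fun x y hx _ => (if_neg hx).symm
    rw [e, dR_dsum₁ (fun _ => if_pos rfl), subst_eq_dsum₁ _ _ _ hl]
    refine dsum₁_congr fun b v hb e' => ?_
    have hlen : v.length < l.length := by
      have := List.length_pos_iff.2 hb
      rw [← e', List.length_append]; omega
    have e1 : dR 𝒜 (fun p => Θ p v) b = if marks b = 1 then
        subst (fun b => marks b ≤ 1) (opD op) (fun w => f ((false, op (plain b)) :: w)) v else 0 := by
      rw [← dR_block op (fun z => subst (fun b => marks b ≤ 1) (opD op) (fun w => f (z :: w)) v)]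
      refine dR_congr fun w hw => ?_
      simp only [Θ]
      rw [if_neg (by rintro rfl; exact hb (List.length_eq_zero_iff.1 hw.symm)), subst_blk]
    have e2 : Θ b = subst (fun b => marks b ≤ 1) (opD op) (blk (fun b => marks b ≤ 1) (opD op) f b) :=
      funext fun v => if_neg hb
    rw [e1, e2, ih v hlen, ← smul_eq_mul ((-1) ^ _), ← subst_smul]
    by_cases h2 : marks b ≤ 1
    · have e3 : ∀ f : List (DLetter ℬ) → ℂ, blk (fun b => marks b ≤ 1) (opD op) f b = fun w => f (opD op b :: w) :=
        fun f => funext fun w => if_pos h2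
      simp only [e3, dR_cons]
      rw [subst_add, marks_opD op h2]
      simp only [opD, smul_eq_mul]
      congr 1
      by_cases h1 : marks b = 1 <;> simp [h1]
    · have e3 : ∀ f : List (DLetter ℬ) → ℂ, blk (fun b => marks b ≤ 1) (opD op) f b = fun w => 0 :=
        fun f => funext fun w => if_neg h2
      simp only [e3, dR_zero, show ¬ marks b = 1 by omega, if_false]
      simp

end

section
variable (op : List (Letter 𝒜) → Letter 𝒜) (tw : Letter 𝒜 → Letter 𝒜)

/-- The action of a map of letters on letters of forms. -/
def twD (x : DLetter 𝒜) : DLetter 𝒜 := (x.1, tw x.2)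

theorem dR_coder (f : List (DLetter 𝒜) → ℂ) (l : List (DLetter 𝒜)) :
    dR 𝒜 (coder (twD tw) (fun b => marks b ≤ 1) (opD op) f) l =
      coder (twD tw) (fun b => marks b ≤ 1) (opD op) (dR 𝒜 f) l := by
  induction l generalizing f with
  | nil => simp [dR_nil]
  | cons a l ih =>
    let Θ : List (DLetter 𝒜) → List (DLetter 𝒜) → ℂ := fun b v => if b = [] then 0 else
      if marks b ≤ 1 then f (opD op b :: v) else 0
    -- The terms in which the first letter is passed, as a function of the whole word, so that `dR`
    -- can be applied to it.
    let S : List (DLetter 𝒜) → ℂ := fun w => match w with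
      | [] => 0
      | a :: l => coder (twD tw) (fun b => marks b ≤ 1) (opD op) (fun w => f (twD tw a :: w)) l
    have e : dR 𝒜 (coder (twD tw) (fun b => marks b ≤ 1) (opD op) f) (a :: l) =
        dR 𝒜 (fun w => dsum₁ Θ w + S w) (a :: l) := by
      refine dR_congr fun w hw => ?_
      match w, hw with
      | b :: w, _ =>
        rw [coder_cons']
        congr 1
    rw [e, dR_add, dR_dsum₁ (fun _ => if_pos rfl), coder_cons']
    congr 1
    · refine dsum₁_congr fun b v hb e' => ?_
      have e1 : dR 𝒜 (fun p => Θ p v) b = if marks b = 1 then f ((false, op (plain b)) :: v) else 0 := by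
        rw [← dR_block op (fun z => f (z :: v))]
        refine dR_congr fun w hw => ?_
        simp only [Θ]
        rw [if_neg (by rintro rfl; exact hb (List.length_eq_zero_iff.1 hw.symm))]
      have e2 : Θ b = fun v => if marks b ≤ 1 then f (opD op b :: v) else 0 :=
        funext fun v => if_neg hb
      rw [e1, e2]
      by_cases h2 : marks b ≤ 1
      · simp only [h2, if_true, dR_cons]
        rw [marks_opD op h2]
        simp only [opD, decide_eq_true_eq]
      · simp only [h2, if_false, show ¬ marks b = 1 by omega, dR_zero]
        simp
    · have hm : marks [twD tw a] = marks [a] := by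
        obtain ⟨b, a⟩ := a; cases b <;> rfl
      rw [dR_cons]
      simp only [S, dR_cons, coder_add, ih, hm]
      have := coder_smul (twD tw) (fun b => marks b ≤ 1) (opD op) ((-1 : ℂ) ^ marks [a])
        (dR 𝒜 fun w => f (twD tw a :: w)) l
      simp only [smul_eq_mul] at this
      rw [this]
      congr 1
      obtain ⟨b, a⟩ := a
      cases b <;> simp [twD]

end

end FormWords

end

noncomputable section

/-! ### Additive invariants preserved by substitutions and shifted by coderivations -/

section

variable {Λ Λ' W M : Type*} [AddCommMonoid W] [AddCommMonoid M]

/-- Only words with the same value of the invariant as `l` occur in the substitution. With bidegree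
as invariant this makes Koszul signs constant inside the sum. -/
theorem subst_congr_inv {ok : List Λ → Prop} [DecidablePred ok] {op : List Λ → Λ'}
    {φ : List Λ → M} {φ' : List Λ' → M} (hφ : ∀ u v, φ (u ++ v) = φ u + φ v) (h0 : φ' [] = φ [])
    (hφ' : ∀ u v, φ' (u ++ v) = φ' u + φ' v) (hop : ∀ b, b ≠ [] → ok b → φ' [op b] = φ b)
    {f f' : List Λ' → W} {l : List Λ}
    (h : ∀ w, (w = [] ↔ l = []) → φ' w = φ l → f w = f' w) :
    subst ok op f l = subst ok op f' l := by
  induction l using length_induction generalizing f f' with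
  | h l ih =>
    cases l with
    | nil => exact h [] (by simp) h0
    | cons a l =>
      rw [subst_cons, subst_cons]
      refine dsum_congr fun x y e => ih y (by simp [← e]) fun w _ hw => ?_
      unfold blk
      split_ifs with hb
      · refine h _ (by simp) ?_
        rw [← List.singleton_append, hφ', hop _ (by simp) hb, hw, ← hφ, ← e, List.cons_append]
      · rfl

theorem coder_congr_inv {tw : Λ → Λ} {ok : List Λ → Prop} [DecidablePred ok] {op : List Λ → Λ}
    {φ : List Λ → M} (d : M) (hφ : ∀ u v, φ (u ++ v) = φ u + φ v) (htw : ∀ a, φ [tw a] = φ [a])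
    (hop : ∀ b, b ≠ [] → ok b → φ [op b] = φ b + d)
    {f f' : List Λ → W} {l : List Λ}
    (h : ∀ w, w ≠ [] → φ w = φ l + d → f w = f' w) :
    coder tw ok op f l = coder tw ok op f' l := by
  induction l generalizing f f' with
  | nil => rfl
  | cons a l ih =>
    rw [coder_cons, coder_cons]
    congr 1
    · refine dsum_congr fun x y e => ?_
      split_ifs with hb
      · refine h _ (by simp) ?_
        rw [← List.singleton_append, hφ, hop _ (by simp) hb, ← e, ← List.cons_append, hφ]
        abel
      · rfl
    · refine ih fun w _ hw => h _ (by simp) ?_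
      rw [← List.singleton_append, hφ, htw, hw, show φ (a :: l) = φ [a] + φ l from hφ [a] l, add_assoc]

theorem subst_subst_comm {Γ Γ' : Type*} (ok : List Λ → Prop) [DecidablePred ok] (op : List Λ → Λ')
    (ok' : List Γ → Prop) [DecidablePred ok'] (op' : List Γ → Γ') (g : List Λ' → List Γ' → W)
    (u : List Λ) (v : List Γ) :
    subst ok op (fun p => subst ok' op' (g p) v) u =
      subst ok' op' (fun q => subst ok op (fun p => g p q) u) v := by
  induction u using length_induction generalizing g with
  | h u ih =>
    cases u with
    | nil => rfl
    | cons a u =>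
      simp only [subst_cons]
      rw [subst_dsum_comm]
      refine dsum_congr fun x y e => ?_
      have := ih y (by simp [← e]) fun p q => if ok (a :: x) then g (op (a :: x) :: p) q else 0
      refine Eq.trans ?_ (this.trans ?_)
      · refine subst_congr _ _ (fun w => ?_) _
        unfold blk; split_ifs <;> simp
      · rfl

end

/-! ### Commutators as the kernel of the cyclic sum -/

section FormWords

variable {m : ℕ} {A B : Type*} [AddCommGroup A] [Module ℂ A] [AddCommGroup B] [Module ℂ B]
  {𝒜 : ZMod m → Submodule ℂ A} {ℬ : ZMod m → Submodule ℂ B}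

/-- Linear relations between letters of forms. -/
def FormRel (𝒜 : ZMod m → Submodule ℂ A) (c : ℂ) (x y z : DLetter 𝒜) : Prop :=
  x.1 = z.1 ∧ y.1 = z.1 ∧ LetterRel 𝒜 c x.2 y.2 z.2

theorem LetterRel.degs {c : ℂ} {x y z : Letter 𝒜} (h : LetterRel 𝒜 c x y z) :
    x.1 = z.1 ∧ y.1 = z.1 := by
  obtain ⟨g, a, b, rfl, rfl, rfl⟩ := h
  exact ⟨rfl, rfl⟩

theorem LetterRel.coe {c : ℂ} {x y z : Letter 𝒜} (h : LetterRel 𝒜 c x y z) :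
    (z.2 : A) = c • (x.2 : A) + y.2 := by
  obtain ⟨g, a, b, rfl, rfl, rfl⟩ := h
  rfl

theorem LetterRel.of {c : ℂ} {x y z : Letter 𝒜} (h1 : x.1 = z.1) (h2 : y.1 = z.1)
    (h : (z.2 : A) = c • (x.2 : A) + y.2) : LetterRel 𝒜 c x y z := by
  obtain ⟨g, x⟩ := x
  obtain ⟨g', y⟩ := y
  obtain ⟨g'', z⟩ := z
  simp only at h1 h2
  subst h1 h2
  exact ⟨g', x, y, rfl, rfl, Letter.ext rfl h⟩

theorem mem_forms {f : List (DLetter 𝒜) → ℂ} : f ∈ forms 𝒜 ↔ SlotLinear (FormRel 𝒜) f := by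
  constructor
  · rintro h c ⟨b, x⟩ ⟨b', y⟩ ⟨b'', z⟩ ⟨h1, h2, g, a, a', h3, h4, h5⟩ u v
    simp only at h1 h2 h3 h4 h5
    subst h1 h2 h3 h4 h5
    exact h u v _ g c a a'
  · exact fun h u v b g c x y => h c (b, ⟨g, x⟩) (b, ⟨g, y⟩) (b, ⟨g, c • x + y⟩)
      ⟨rfl, rfl, g, x, y, rfl, rfl, rfl⟩ u v

theorem FormRel.marks {c : ℂ} {x y z : DLetter 𝒜} (h : FormRel 𝒜 c x y z) :
    marks [x] = marks [z] ∧ marks [y] = marks [z] := by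
  obtain ⟨b, x⟩ := x
  obtain ⟨b', y⟩ := y
  obtain ⟨b'', z⟩ := z
  obtain ⟨h1, h2, _⟩ := h
  simp only at h1 h2
  subst h1 h2
  exact ⟨by cases b' <;> rfl, rfl⟩

theorem FormRel.koszulD {c : ℂ} {x y z : DLetter 𝒜} (h : FormRel 𝒜 c x y z) (t : DLetter 𝒜) :
    koszulD x t = koszulD z t ∧ koszulD y t = koszulD z t := by
  unfold _root_.koszulD
  rw [h.marks.1, h.marks.2, h.2.2.degs.1, h.2.2.degs.2]
  exact ⟨rfl, rfl⟩

theorem FormRel.koszulD' {c : ℂ} {x y z : DLetter 𝒜} (h : FormRel 𝒜 c x y z) (t : DLetter 𝒜) :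
    _root_.koszulD t x = _root_.koszulD t z ∧ _root_.koszulD t y = _root_.koszulD t z := by
  unfold _root_.koszulD
  rw [h.marks.1, h.marks.2, h.2.2.degs.1, h.2.2.degs.2]
  exact ⟨rfl, rfl⟩

theorem SlotLinear.rotD {f : List (DLetter 𝒜) → ℂ} (hf : SlotLinear (FormRel 𝒜) f) :
    SlotLinear (FormRel 𝒜) (_root_.rotW koszulD f) :=
  hf.rotW (fun _ _ _ _ h => h.koszulD) fun _ _ _ _ h => h.koszulD'

theorem SlotLinear.cycD {f : List (DLetter 𝒜) → ℂ} (hf : SlotLinear (FormRel 𝒜) f) :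
    SlotLinear (FormRel 𝒜) (cyc koszulD f) := by
  have h1 : ∀ i, SlotLinear (FormRel 𝒜) ((_root_.rotW koszulD)^[i] f) := fun i => by
    induction i with
    | zero => exact hf
    | succ i ih => rw [Function.iterate_succ_apply']; exact ih.rotD
  rw [show cyc koszulD f = _ from funext (cyc_eq_sum koszulD_mul f)]
  exact SlotLinear.sum_range fun i => h1 (i + 1)

section
variable [hm : Fact (m = 0 ∨ m = 2)]

/-- Tilde degree and form degree. -/
def bideg (l : List (DLetter 𝒜)) : ZMod m × ℕ := (tdeg (plain l), marks l)

omit hm in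
theorem bideg_append (u v : List (DLetter 𝒜)) : bideg (u ++ v) = bideg u + bideg v := by
  simp [bideg]

theorem kw_koszulL (u v : List (Letter 𝒜)) : kw koszulL u v = koszul (tdeg u) (tdeg v) := by
  have h : ∀ (x : Letter 𝒜) (v : List (Letter 𝒜)), kw koszulL [x] v = koszul x.1 (tdeg v) := by
    intro x v
    induction v with
    | nil => simp
    | cons y v ih => rw [kw_cons_right, ih, kw_singleton, tdeg_cons, koszul_add_right]; rfl
  induction u with
  | nil => simp
  | cons x u ih => rw [kw_cons_left, ih, h, tdeg_cons, koszul_add_left]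

theorem kw_koszulD (u v : List (DLetter 𝒜)) :
    kw koszulD u v = koszul (bideg u).1 (bideg v).1 * (-1) ^ ((bideg u).2 * (bideg v).2) := by
  have h : ∀ (x : DLetter 𝒜) (v : List (DLetter 𝒜)),
      kw koszulD [x] v = koszul x.2.1 (tdeg (plain v)) * (-1) ^ (marks [x] * marks v) := by
    intro x v
    induction v with
    | nil => simp
    | cons y v ih =>
      rw [kw_cons_right, ih, kw_singleton, plain_cons, tdeg_cons, koszul_add_right, marks_cons y,
        mul_add, pow_add, koszulD]
      ring
  simp only [bideg]
  induction u with
  | nil => simp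
  | cons x u ih =>
    rw [kw_cons_left, ih, h, plain_cons, tdeg_cons, koszul_add_left, marks_cons x u, add_mul, pow_add]
    ring

omit hm in
theorem tdeg_singleton (a : Letter 𝒜) : tdeg [a] = a.1 := by simp

theorem rot_eq (f : List (DLetter 𝒜) → ℂ) : rot 𝒜 f = rotW koszulD f := by
  funext l
  rcases List.eq_nil_or_concat l with rfl | ⟨u, x, rfl⟩
  · rfl
  rw [List.concat_eq_append, rotW_concat, kw_koszulD]
  simp [rot, bideg]

/-- Averaging over the cyclic group: `rotPrimitive` inverts `1 - rot` on the kernel of the cyclic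
sum, and it preserves slot-linearity. The empty word is a separate condition, since `cyc` vanishes
on it by definition. -/
theorem mem_commutators {f : List (DLetter 𝒜) → ℂ} :
    f ∈ commutators 𝒜 ↔ f ∈ forms 𝒜 ∧ f [] = 0 ∧ ∀ l, cyc koszulD f l = 0 := by
  constructor
  · rintro ⟨T, hT, rfl⟩
    have e : (LinearMap.id - rot 𝒜 : (List (DLetter 𝒜) → ℂ) →ₗ[ℂ] _) T = fun l => T l - rotW koszulD T l := by
      rw [LinearMap.sub_apply, rot_eq]; rfl
    rw [e]
    refine ⟨?_, by simp [rotW], fun l => ?_⟩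
    · have h1 : rotW koszulD T ∈ forms 𝒜 := mem_forms.2 (mem_forms.1 hT).rotD
      exact (forms 𝒜).sub_mem hT h1
    · rw [cyc_sub, cyc_rotW koszulD_mul, sub_self]
  · rintro ⟨h1, h2, h3⟩
    refine ⟨rotPrimitive koszulD f, mem_forms.2 ((mem_forms.1 h1).rotPrimitive
      (fun _ _ _ _ h => h.koszulD) fun _ _ _ _ h => h.koszulD'), ?_⟩
    funext l
    rw [LinearMap.sub_apply, rot_eq]
    exact rotPrimitive_sub koszulD_mul h2 h3 l

end

/-! ### Words with marked ends -/

/-- Marks the last letter. -/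
def markLast : List (Letter 𝒜) → List (DLetter 𝒜)
  | [] => []
  | [z] => [(true, z)]
  | a :: b :: l => (false, a) :: markLast (b :: l)

/-- Marks the first and the last letter. -/
def markEnds : List (Letter 𝒜) → List (DLetter 𝒜)
  | [] => []
  | a :: l => (true, a) :: markLast l

@[simp] theorem markLast_concat (p : List (Letter 𝒜)) (z : Letter 𝒜) :
    markLast (p ++ [z]) = unmarked p ++ [(true, z)] := by
  induction p with
  | nil => rfl
  | cons a p ih =>
    cases p with
    | nil => rfl
    | cons b p => simpa [markLast] using ih

@[simp] theorem markEnds_cons_concat (a : Letter 𝒜) (p : List (Letter 𝒜)) (z : Letter 𝒜) :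
    markEnds (a :: (p ++ [z])) = (true, a) :: (unmarked p ++ [(true, z)]) := by
  rw [markEnds, markLast_concat]

theorem eq_cons_concat {Λ : Type*} (l : List Λ) :
    l = [] ∨ (∃ a, l = [a]) ∨ ∃ a p z, l = a :: (p ++ [z]) := by
  match l with
  | [] => exact Or.inl rfl
  | a :: l =>
    rcases List.eq_nil_or_concat l with rfl | ⟨p, z, rfl⟩
    · exact Or.inr (Or.inl ⟨a, rfl⟩)
    · exact Or.inr (Or.inr ⟨a, p, z, by simp⟩)

@[simp] theorem plain_markEnds (l : List (Letter 𝒜)) : plain (markEnds l) = l := by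
  rcases eq_cons_concat l with rfl | ⟨a, rfl⟩ | ⟨a, p, z, rfl⟩ <;> simp [markEnds, markLast]

theorem markLast_slot (u v : List (Letter 𝒜)) : ∃ U V b, ∀ x, markLast (u ++ x :: v) =
    U ++ (b, x) :: (V : List (DLetter 𝒜)) := by
  rcases List.eq_nil_or_concat v with rfl | ⟨v, z, rfl⟩
  · exact ⟨unmarked u, [], true, fun x => by simp⟩
  · refine ⟨unmarked u, unmarked v ++ [(true, z)], false, fun x => ?_⟩
    rw [show u ++ x :: v.concat z = (u ++ x :: v) ++ [z] by simp, markLast_concat]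
    simp

theorem SlotLinear.markEnds {f : List (DLetter 𝒜) → ℂ} (hf : SlotLinear (FormRel 𝒜) f) :
    SlotLinear (LetterRel 𝒜) fun l => f (markEnds l) := by
  intro c x y z h u v
  obtain ⟨U, V, b, e⟩ : ∃ U V b, ∀ x, _root_.markEnds (u ++ x :: v) =
      U ++ (b, x) :: (V : List (DLetter 𝒜)) := by
    cases u with
    | nil => exact ⟨[], markLast v, true, fun x => rfl⟩
    | cons a u =>
      obtain ⟨U, V, b, e⟩ := markLast_slot u v
      exact ⟨(true, a) :: U, V, b, fun x => by rw [List.cons_append, _root_.markEnds, e]; rfl⟩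
  simp only [e]
  exact hf c (b, x) (b, y) (b, z) ⟨rfl, rfl, h⟩ U V

/-- Rotating a word with marked ends makes these two ends meet. A block across the seam would
contain both marks, hence is not admissible; so rotations of such words commute with everything done
blockwise. -/
theorem markEnds_split {l : List (Letter 𝒜)} {u v : List (DLetter 𝒜)} (e : u ++ v = markEnds l)
    (b b' s t : List (DLetter 𝒜)) (hb : b ≠ []) (hb' : b' ≠ []) (h1 : v = s ++ b) (h2 : u = b' ++ t) :
    ¬ marks (b ++ b') ≤ 1 := by
  obtain ⟨x, b', rfl⟩ := List.exists_cons_of_ne_nil hb'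
  rcases List.eq_nil_or_concat b with rfl | ⟨b, y, rfl⟩
  · exact (hb rfl).elim
  subst h1 h2
  have h3 : x.1 = true ∧ y.1 = true := by
    rcases eq_cons_concat l with rfl | ⟨a, rfl⟩ | ⟨a, p, z, rfl⟩
    · simp [markEnds] at e
    · have := congrArg List.length e; simp [markEnds, markLast] at this
    · rw [markEnds_cons_concat, List.cons_append, List.cons_append, List.cons.injEq] at e
      refine ⟨by rw [e.1], ?_⟩
      have e2 := e.2
      rw [List.concat_eq_append, ← List.append_assoc, ← List.append_assoc] at e2
      have := List.append_inj_right' e2 rfl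
      simp only [List.cons.injEq, and_true] at this
      rw [this]
  obtain ⟨c, x⟩ := x
  obtain ⟨d, y⟩ := y
  simp only at h3
  rw [h3.1, h3.2]
  simp
  omega

section
variable (op : List (Letter 𝒜) → Letter ℬ)

theorem opD_unmarked (b : List (Letter 𝒜)) : opD op (unmarked b) = (false, op b) := by simp [opD]

theorem subst_unmarked (c : List (DLetter ℬ) → ℂ) (l : List (Letter 𝒜)) :
    subst (fun b => marks b ≤ 1) (opD op) c (unmarked l) =
      subst (fun _ => True) op (fun w => c (unmarked w)) l :=
  subst_map _ _ _ _ _ _ (fun b _ => by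
    change marks (unmarked b) ≤ 1 ↔ _; simp) (fun b _ => opD_unmarked op b) c l

theorem subst_markLast (c : List (DLetter ℬ) → ℂ) (p : List (Letter 𝒜)) (z : Letter 𝒜) :
    subst (fun b => marks b ≤ 1) (opD op) c (unmarked p ++ [(true, z)]) =
      subst (fun _ => True) op (fun w => c (markLast w)) (p ++ [z]) := by
  rw [subst_eq_dsum_last _ _ _ (by simp), subst_eq_dsum_last _ _ _ (by simp), dsum_concat, dsum_concat,
    unmarked, dsum_map]
  congr 1
  refine dsum_congr fun u b _ => ?_
  have h1 : marks (unmarked b ++ [(true, z)]) = 1 := by simp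
  have h2 : opD op (unmarked b ++ [(true, z)]) = (true, op (b ++ [z])) := by simp [opD]
  change (if unmarked b ++ [(true, z)] = [] then 0 else if marks (unmarked b ++ [(true, z)]) ≤ 1 then
    subst (fun b => marks b ≤ 1) (opD op) (fun w => c (w ++ [opD op (unmarked b ++ [(true, z)])]))
      (unmarked u) else 0) = _
  rw [if_neg (by simp), if_pos h1.le, if_neg (by simp), if_pos trivial, subst_unmarked, h2]
  simp only [markLast_concat]

/-- The first and last blocks carry one mark each, so they yield the marked ends of the new word.
The exception is the whole word as a single block: it has two marks and is forbidden on the left but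
occurs on the right, where `hc` removes it. -/
theorem subst_markEnds {c : List (DLetter ℬ) → ℂ} (hc : ∀ a, c [(true, a)] = 0)
    (l : List (Letter 𝒜)) :
    subst (fun b => marks b ≤ 1) (opD op) c (markEnds l) =
      subst (fun _ => True) op (fun w => c (markEnds w)) l := by
  rcases eq_cons_concat l with rfl | ⟨a, rfl⟩ | ⟨a, p, z, rfl⟩
  · rfl
  · simp [markEnds, markLast, subst_cons, blk, opD, hc]
  rw [markEnds_cons_concat, subst_cons, subst_cons, dsum_concat, dsum_concat, unmarked, dsum_map]
  congr 1
  · refine dsum_congr fun x y _ => ?_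
    have h1 : marks ((true, a) :: unmarked x) = 1 := by simp
    have h2 : opD op ((true, a) :: unmarked x) = (true, op (a :: x)) := by simp [opD]
    change subst _ _ _ (unmarked y ++ _) = _
    rw [subst_markLast, subst_blk, if_pos trivial]
    refine subst_congr _ _ (fun w => ?_) _
    change (if marks ((true, a) :: unmarked x) ≤ 1 then
      c (opD op ((true, a) :: unmarked x) :: _) else 0) = _
    rw [if_pos h1.le, h2]
    rfl
  · have h1 : marks ((true, a) :: (unmarked p ++ [(true, z)])) = 2 := by simp
    rw [subst_nil, subst_nil]
    unfold blk
    rw [if_neg (by change ¬ marks ((true, a) :: (unmarked p ++ [(true, z)])) ≤ 1; rw [h1]; simp),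
      if_pos trivial]
    exact (hc _).symm

end

section
variable (op : List (Letter 𝒜) → Letter 𝒜) (tw : Letter 𝒜 → Letter 𝒜)

theorem coder_unmarked (c : List (DLetter 𝒜) → ℂ) (l : List (Letter 𝒜)) :
    coder (twD tw) (fun b => marks b ≤ 1) (opD op) c (unmarked l) =
      coder tw (fun _ => True) op (fun w => c (unmarked w)) l :=
  coder_map (twD tw) (fun b => marks b ≤ 1) (opD op) tw (fun _ => True) op (fun a => (false, a)) (fun _ => rfl) (fun b _ => by
    change marks (unmarked b) ≤ 1 ↔ _; simp) (fun b _ => opD_unmarked op b) c l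

theorem map_twD_unmarked (u : List (Letter 𝒜)) : (unmarked u).map (twD tw) = unmarked (u.map tw) := by
  simp [unmarked, twD]

theorem coder_markLast (c : List (DLetter 𝒜) → ℂ) (p : List (Letter 𝒜)) (z : Letter 𝒜) :
    coder (twD tw) (fun b => marks b ≤ 1) (opD op) c (unmarked p ++ [(true, z)]) =
      coder tw (fun _ => True) op (fun w => c (markLast w)) (p ++ [z]) := by
  rw [coder_concat, coder_concat, coder_unmarked, unmarked, dsum_map]
  simp only [markLast_concat]
  congr 1
  refine dsum_congr fun u b _ => ?_
  have h1 : marks (unmarked b ++ [(true, z)]) = 1 := by simp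
  have h2 : opD op (unmarked b ++ [(true, z)]) = (true, op (b ++ [z])) := by simp [opD]
  change (if marks (unmarked b ++ [(true, z)]) ≤ 1 then
    c ((unmarked u).map (twD tw) ++ [opD op (unmarked b ++ [(true, z)])]) else 0) = _
  rw [if_pos h1.le, if_pos trivial, h2, map_twD_unmarked]

/-- As for `subst_markEnds`: a replaced block inherits the mark of the end it contains, and the
block equal to the whole word is excluded on the left and killed by `hc` on the right. -/
theorem coder_markEnds {c : List (DLetter 𝒜) → ℂ} (hc : ∀ a, c [(true, a)] = 0)
    (l : List (Letter 𝒜)) :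
    coder (twD tw) (fun b => marks b ≤ 1) (opD op) c (markEnds l) =
      coder tw (fun _ => True) op (fun w => c (markEnds w)) l := by
  rcases eq_cons_concat l with rfl | ⟨a, rfl⟩ | ⟨a, p, z, rfl⟩
  · rfl
  · simp [markEnds, markLast, coder_cons, opD, hc]
  rw [markEnds_cons_concat, coder_cons, coder_cons, dsum_concat, dsum_concat, coder_markLast, unmarked,
    dsum_map]
  congr 2
  · refine dsum_congr fun x y _ => ?_
    have h1 : marks ((true, a) :: unmarked x) = 1 := by simp
    have h2 : opD op ((true, a) :: unmarked x) = (true, op (a :: x)) := by simp [opD]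
    change (if marks ((true, a) :: unmarked x) ≤ 1 then
      c (opD op ((true, a) :: unmarked x) :: (unmarked y ++ _)) else 0) = _
    rw [if_pos h1.le, if_pos trivial, h2, markEnds, markLast_concat]
  · have h1 : marks ((true, a) :: (unmarked p ++ [(true, z)])) = 2 := by simp
    change (if marks ((true, a) :: (unmarked p ++ [(true, z)])) ≤ 1 then _ else 0) = _
    rw [if_neg (by rw [h1]; simp), if_pos trivial]
    exact (hc _).symm

end

section
variable [hm : Fact (m = 0 ∨ m = 2)]

/-- By multiplicativity of substitution each rotation of the new word cuts the old word between two
blocks, and by `markEnds_split` no block is lost at the seam. Preservation of the bidegree matches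
the signs. -/
theorem cyc_subst_markEnds {op : List (Letter 𝒜) → Letter ℬ} (hop : ∀ b, (op b).1 = tdeg b)
    {f : List (DLetter ℬ) → ℂ} (l : List (Letter 𝒜)) :
    cyc koszulD (subst (fun b => marks b ≤ 1) (opD op) f) (markEnds l) =
      subst (fun b => marks b ≤ 1) (opD op) (cyc koszulD f) (markEnds l) := by
  have hop' : ∀ b : List (DLetter 𝒜), b ≠ [] → marks b ≤ 1 → bideg [opD op b] = bideg b := by
    intro b _ hb
    rw [bideg, marks_opD op hb, bideg, plain_cons, plain_nil, tdeg_singleton, opD, hop]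
  unfold cyc
  rw [subst_dsum]
  refine dsum_congr fun u v e => ?_
  have e1 : ∀ p : List (DLetter ℬ), subst (fun b => marks b ≤ 1) (opD op)
      (fun q => if q = [] then 0 else kw koszulD q p * f (q ++ p)) v =
      subst (fun b => marks b ≤ 1) (opD op)
      (fun q => (if v = [] then 0 else koszul (bideg v).1 (bideg p).1 *
        (-1) ^ ((bideg v).2 * (bideg p).2)) • f (q ++ p)) v := by
    refine fun p => subst_congr_inv (φ := bideg (𝒜 := 𝒜)) (φ' := bideg (𝒜 := ℬ)) bideg_append rfl bideg_append hop' fun w hw h => ?_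
    simp only [hw, kw_koszulD, h, smul_eq_mul]
    split_ifs <;> simp
  simp only [e1, subst_smul]
  have e2 : subst (fun b => marks b ≤ 1) (opD op) (fun p => (if v = [] then (0 : ℂ) else
        koszul (bideg v).1 (bideg p).1 * (-1) ^ ((bideg v).2 * (bideg p).2)) •
        subst (fun b => marks b ≤ 1) (opD op) (fun q => f (q ++ p)) v) u =
      subst (fun b => marks b ≤ 1) (opD op) (fun p => (if v = [] then (0 : ℂ) else
        koszul (bideg v).1 (bideg u).1 * (-1) ^ ((bideg v).2 * (bideg u).2)) •
        subst (fun b => marks b ≤ 1) (opD op) (fun q => f (q ++ p)) v) u := by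
    refine subst_congr_inv (φ := bideg (𝒜 := 𝒜)) (φ' := bideg (𝒜 := ℬ)) bideg_append rfl bideg_append hop' fun w hw h => ?_
    rw [h]
  rw [e2, subst_smul, subst_subst_comm, subst_append_of_not_ok _ _ _ _ _ (markEnds_split e)]
  simp only [kw_koszulD, smul_eq_mul]
  split_ifs <;> simp

/-- The argument of `cyc_subst_markEnds` with the Leibniz rule; the degree 1 of the operation is
compensated by the twist of the letters that it passes (`hf`). -/
theorem cyc_coder_markEnds {op : List (Letter 𝒜) → Letter 𝒜} {tw : Letter 𝒜 → Letter 𝒜}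
    (htw : ∀ a, (tw a).1 = a.1) (hop : ∀ b, (op b).1 = tdeg b + 1)
    {f : List (DLetter 𝒜) → ℂ}
    (hf : ∀ p a w, f (p ++ twD tw a :: w) = sgn a.2.1 * f (p ++ a :: w)) (l : List (Letter 𝒜)) :
    cyc koszulD (coder (twD tw) (fun b => marks b ≤ 1) (opD op) f) (markEnds l) =
      coder (twD tw) (fun b => marks b ≤ 1) (opD op) (cyc koszulD f) (markEnds l) := by
  have hop' : ∀ b : List (DLetter 𝒜), b ≠ [] → marks b ≤ 1 → bideg [opD op b] = bideg b + (1, 0) := by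
    intro b _ hb
    rw [bideg, marks_opD op hb, bideg, plain_cons, plain_nil, tdeg_singleton, opD, hop]
    simp
  have htw' : ∀ a : DLetter 𝒜, bideg [twD tw a] = bideg [a] := by
    rintro ⟨b, a⟩
    cases b <;> simp [bideg, twD, htw]
  have htw2 : ∀ u : List (DLetter 𝒜), bideg (u.map (twD tw)) = bideg u := by
    intro u
    induction u with
    | nil => rfl
    | cons a u ih =>
      rw [List.map_cons, ← List.singleton_append, bideg_append, ih, htw', ← bideg_append]; rfl
  have hmap : ∀ p u w, f (p ++ (u.map (twD tw) ++ w)) = sgn (bideg u).1 * f (p ++ (u ++ w)) :=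
    map_tw_eq (twD tw) (s := fun u => sgn (bideg u).1) sgn_zero
      (fun u v => by rw [bideg_append, Prod.fst_add, sgn_add])
      (fun p a w => by rw [hf]; simp [bideg])
  unfold cyc
  rw [coder_dsum, ← dsum_add]
  refine dsum_congr fun u v e => ?_
  have e1 : coder (twD tw) (fun b => marks b ≤ 1) (opD op)
      (fun p => if v = [] then 0 else kw koszulD v p * f (v ++ p)) u =
      coder (twD tw) (fun b => marks b ≤ 1) (opD op) (fun p =>
        (if v = [] then 0 else koszul (bideg v).1 (bideg u).1 *
        (-1) ^ ((bideg v).2 * (bideg u).2)) • f (v.map (twD tw) ++ p)) u := by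
    refine coder_congr_inv (1, 0) bideg_append htw' hop' fun w _ h => ?_
    have h3 := hmap [] v w
    rw [List.nil_append, List.nil_append] at h3
    rw [kw_koszulD, h, h3]
    simp only [smul_eq_mul, Prod.fst_add, Prod.snd_add, koszul_add_right,
      koszul_one_right, add_zero]
    split_ifs <;> ring
  have e2 : coder (twD tw) (fun b => marks b ≤ 1) (opD op)
      (fun q => if q = [] then 0 else kw koszulD q (u.map (twD tw)) * f (q ++ u.map (twD tw))) v =
      coder (twD tw) (fun b => marks b ≤ 1) (opD op) (fun q =>
        (koszul (bideg v).1 (bideg u).1 *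
        (-1) ^ ((bideg v).2 * (bideg u).2)) • f (q ++ u)) v := by
    refine coder_congr_inv (1, 0) bideg_append htw' hop' fun w hw h => ?_
    have h3 := hmap w u []
    rw [List.append_nil, List.append_nil] at h3
    rw [if_neg hw, kw_koszulD, h, h3, htw2]
    simp only [smul_eq_mul, Prod.fst_add, Prod.snd_add, koszul_add_left,
      koszul_one_left, add_zero]
    linear_combination (koszul (bideg v).1 (bideg u).1 * (-1) ^ ((bideg v).2 * (bideg u).2) *
      f (w ++ u)) * sgn_mul_self (bideg u).1
  rw [e1, e2, coder_smul, coder_smul, coder_append_of_not_ok _ _ _ _ _ _ (markEnds_split e), kw_koszulD]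
  rcases eq_or_ne v [] with rfl | hv
  · simp
  · simp only [hv, if_false, smul_eq_mul]; ring

end

end FormWords

end

noncomputable section

/-! ### Closed 2-forms as cyclically trivial scalar series -/

section Potentials

variable {m : ℕ} {A B : Type*} [AddCommGroup A] [Module ℂ A] [AddCommGroup B] [Module ℂ B]
  {𝒜 : ZMod m → Submodule ℂ A} {ℬ : ZMod m → Submodule ℂ B}

section
variable [hm : Fact (m = 0 ∨ m = 2)]

theorem dR_of_marks {f : List (DLetter 𝒜) → ℂ} {l : List (DLetter 𝒜)} (h : marks l = 0) :
    dR 𝒜 f l = 0 := by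
  induction l generalizing f with
  | nil => exact dR_nil f
  | cons x l ih =>
    obtain ⟨b, x⟩ := x
    cases b
    · rw [dR_cons, ih (by simpa using h)]; simp
    · simp at h

theorem cyc_eq_zero_of {f : List (DLetter 𝒜) → ℂ} {l : List (DLetter 𝒜)}
    (h : ∀ w, bideg w = bideg l → f w = 0) : cyc koszulD f l = 0 := by
  refine dsum_eq_zero fun u v e => ?_
  rw [h _ (by rw [← e, bideg_append, bideg_append, add_comm]), mul_zero, ite_self]

theorem cyc_eq_zero_of_marks {p : ℕ} {k : ZMod m} {f : List (DLetter 𝒜) → ℂ} (hf : f ∈ formsOf 𝒜 p k)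
    {l : List (DLetter 𝒜)} (h : marks l ≠ p) : cyc koszulD f l = 0 :=
  cyc_eq_zero_of fun w hw => by
    by_contra h'
    exact h (by rw [← (hf.2 w h').1]; exact (congrArg Prod.snd hw).symm)

theorem cyc_eq_zero_of_tdeg {p : ℕ} {k : ZMod m} {f : List (DLetter 𝒜) → ℂ} (hf : f ∈ formsOf 𝒜 p k)
    {l : List (DLetter 𝒜)} (h : tdeg (plain l) ≠ -k) : cyc koszulD f l = 0 :=
  cyc_eq_zero_of fun w hw => by
    by_contra h'
    exact h (by rw [← (hf.2 w h').2]; exact (congrArg Prod.fst hw).symm)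

theorem dR_cyc_eq_zero {k : ZMod m} {f : List (DLetter 𝒜) → ℂ} (hf : f ∈ closedForms 𝒜 k)
    (l : List (DLetter 𝒜)) : dR 𝒜 (cyc koszulD f) l = 0 := by
  rw [dR_cyc]
  exact (mem_commutators.1 hf.2).2.2 l

theorem cyc_rotate {Λ : Type*} {κ : Λ → Λ → ℂ} (hκ : ∀ x y, κ x y * κ y x = 1) (f : List Λ → ℂ)
    (u v : List Λ) : cyc κ f (u ++ v) = kw κ v u * cyc κ f (v ++ u) := by
  rw [← rotW_iterate hκ]
  have : ∀ i, (rotW κ)^[i] (cyc κ f) = cyc κ f := fun i => by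
    induction i with
    | zero => rfl
    | succ i ih => rw [Function.iterate_succ_apply', ih]; exact funext (rotW_cyc hκ f)
  rw [this]

/-- A closed `2`-form is determined by its values on words with marked ends. -/
theorem cyc_two_marks {k : ZMod m} {f : List (DLetter 𝒜) → ℂ} (hf : f ∈ closedForms 𝒜 k)
    (a : Letter 𝒜) (p : List (Letter 𝒜)) (b : Letter 𝒜) (q : List (Letter 𝒜)) :
    cyc koszulD f ((true, a) :: (unmarked p ++ (true, b) :: unmarked q)) =
      dsum (fun x y => koszul (tdeg y) (tdeg (a :: (p ++ b :: x))) *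
        cyc koszulD f (markEnds (y ++ a :: (p ++ b :: x)))) q := by
  induction q using List.reverseRecOn generalizing a p with
  | nil => simp
  | append_singleton q z ih =>
    -- Closedness on a word with the three marks `a`, `b`, `z` expresses the coefficient with marks
    -- `a`, `b` by one with marked ends and one with marks `b`, `z`; the latter rotates to a word
    -- with marks `z`, `a` to which the induction hypothesis applies.
    have h1 := dR_cyc_eq_zero hf
      ((true, a) :: (unmarked p ++ (true, b) :: (unmarked q ++ [(true, z)])))
    rw [dR_cons, dR_append, dR_of_marks (marks_unmarked p), dR_cons, dR_append,
      dR_of_marks (marks_unmarked q), dR_cons, dR_nil] at h1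
    simp only [if_true, marks_true, marks_unmarked, pow_zero, pow_one, mul_zero, add_zero, zero_add,
      one_mul] at h1
    have h2 := cyc_rotate koszulD_mul f ((false, a) :: (unmarked p ++ (true, b) :: unmarked q)) [(true, z)]
    have h3 := ih z (a :: p)
    have e1 : unmarked q ++ [(false, z)] = unmarked (q ++ [z]) := by simp
    have e2 : markEnds (a :: (p ++ b :: (q ++ [z]))) =
        (true, a) :: (unmarked p ++ (false, b) :: (unmarked q ++ [(true, z)])) := by
      rw [show a :: (p ++ b :: (q ++ [z])) = a :: ((p ++ b :: q) ++ [z]) by simp, markEnds_cons_concat]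
      simp
    simp only [unmarked_cons, List.cons_append, List.append_assoc, List.nil_append] at h2 h3
    rw [e1, ← e2, h2, h3] at h1
    have h4 : kw koszulD [(true, z)] ((false, a) :: (unmarked p ++ (true, b) :: unmarked q)) =
        - koszul z.1 (tdeg (a :: (p ++ b :: q))) := by
      rw [kw_koszulD]; simp [bideg]
    have h5 : dsum (fun x y => koszul (tdeg (y ++ [z])) (tdeg (a :: (p ++ b :: x))) *
        cyc koszulD f (markEnds (y ++ [z] ++ a :: (p ++ b :: x)))) q =
        koszul z.1 (tdeg (a :: (p ++ b :: q))) * dsum (fun x y =>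
          koszul (tdeg y) (tdeg (z :: a :: (p ++ b :: x))) *
          cyc koszulD f (markEnds (y ++ z :: a :: (p ++ b :: x)))) q := by
      rw [← smul_eq_mul, ← dsum_smul]
      refine dsum_congr fun x y e => ?_
      rw [← e, smul_eq_mul]
      simp only [tdeg_append, tdeg_cons, tdeg_nil, koszul_add_left, koszul_add_right, List.append_assoc,
        List.cons_append, List.nil_append, add_zero]
      rw [koszul_comm (tdeg y) z.1]
      linear_combination (- koszul (tdeg y) a.1 * koszul (tdeg y) (tdeg p) * koszul (tdeg y) b.1 *
        koszul (tdeg y) (tdeg x) * koszul z.1 a.1 * koszul z.1 (tdeg p) * koszul z.1 b.1 *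
        koszul z.1 (tdeg x) * cyc koszulD f (markEnds (y ++ z :: a :: (p ++ b :: x)))) *
        koszul_mul_self z.1 (tdeg y)
    rw [dsum_concat, h5]
    rw [h4] at h1
    simp only [tdeg_nil, koszul_zero_left, one_mul, List.nil_append]
    linear_combination h1

/-- The coefficient of `ds^a ds^b s ⋯ s` is computed in two ways: by `cyc_two_marks`, and by
rotating `ds^a` to the end, which gives a word with marked ends. Their equality is the vanishing of
the cyclic sum. -/
theorem cyc_markEnds_eq_zero {k : ZMod m} {f : List (DLetter 𝒜) → ℂ} (hf : f ∈ closedForms 𝒜 k)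
    (l : List (Letter 𝒜)) :
    cyc koszulL (fun w => cyc koszulD f (markEnds w)) l = 0 := by
  match l with
  | [] => simp
  | [a] =>
    have : cyc koszulD f [(true, a)] = 0 := cyc_eq_zero_of_marks hf.1 (by simp)
    simp [cyc, dsum_cons, markEnds, markLast] at this ⊢
    exact this
  | a :: b :: q =>
    rw [cyc, dsum_cons, dsum_cons]
    have h1 := cyc_two_marks hf a [] b q
    have h2 : markEnds (b :: (q ++ [a])) = (true, b) :: unmarked q ++ [(true, a)] := by simp
    have h3 := cyc_rotate koszulD_mul f ((true, b) :: unmarked q) [(true, a)]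
    simp only [unmarked_nil, List.nil_append, List.cons_append] at h1 h3
    have h4 : kw koszulD [(true, a)] ((true, b) :: unmarked q) = - koszul a.1 (tdeg (b :: q)) := by
      rw [kw_koszulD]; simp [bideg]
    have h5 : dsum (fun x y => if y = [] then 0 else kw koszulL y (a :: b :: x) *
        cyc koszulD f (markEnds (y ++ a :: b :: x))) q =
        dsum (fun x y => koszul (tdeg y) (tdeg (a :: b :: x)) *
          cyc koszulD f (markEnds (y ++ a :: b :: x))) q - cyc koszulD f (markEnds (a :: b :: q)) := by
      have h6 : dsum (fun x y : List (Letter 𝒜) => if y = [] then cyc koszulD f (markEnds (a :: b :: x)) else 0) q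
          = cyc koszulD f (markEnds (a :: b :: q)) := by
        rw [dsum_eq_last fun x y _ hy => if_neg hy, if_pos rfl]
      rw [← h6, ← dsum_sub]
      refine dsum_congr fun x y _ => ?_
      rcases eq_or_ne y [] with rfl | hy
      · simp
      · rw [if_neg hy, if_neg hy, kw_koszulL, sub_zero]
    rw [h5, ← h1, if_neg (by simp), if_neg (by simp), kw_koszulL, kw_koszulL]
    rw [show (b :: q) ++ [a] = b :: (q ++ [a]) from rfl, h2, List.cons_append (bs := [(true, a)]), h3, h4, tdeg_singleton,
      koszul_comm (tdeg (b :: q))]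
    simp only [tdeg_nil, koszul_zero_right, one_mul, List.append_nil]
    linear_combination (- cyc koszulD f ((true, a) :: (true, b) :: unmarked q)) *
      koszul_mul_self a.1 (tdeg (b :: q))

/-- Any word with two marks can be rotated to begin with a mark, and then `cyc_two_marks` applies.
-/
theorem cyc_eq_zero_of_markEnds {k : ZMod m} {f : List (DLetter 𝒜) → ℂ} (hf : f ∈ closedForms 𝒜 k)
    (h : ∀ l, cyc koszulD f (markEnds l) = 0) (l : List (DLetter 𝒜)) : cyc koszulD f l = 0 := by
  by_cases hl : marks l = 2
  · obtain ⟨u, a, v, rfl, hu⟩ := exists_of_marks_pos (l := l) (by omega)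
    rw [cyc_rotate koszulD_mul]
    have h2 : marks (v ++ u) = 1 := by
      simp [hu] at hl ⊢; omega
    obtain ⟨p, b, q, e, hp⟩ := exists_of_marks_pos (l := v ++ u) (by omega)
    have hq : marks q = 0 := by
      rw [e] at h2; simp [hp] at h2; exact h2
    rw [List.cons_append, e, eq_unmarked_of_marks hp, eq_unmarked_of_marks hq, cyc_two_marks hf]
    simp [h]
  · exact cyc_eq_zero_of_marks hf.1 hl

theorem mem_commutators_iff {k : ZMod m} {f : List (DLetter 𝒜) → ℂ} (hf : f ∈ closedForms 𝒜 k) :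
    f ∈ commutators 𝒜 ↔ ∀ l, cyc koszulD f (markEnds l) = 0 := by
  refine ⟨fun h l => (mem_commutators.1 h).2.2 _, fun h => mem_commutators.2 ⟨hf.1.1, ?_,
    cyc_eq_zero_of_markEnds hf h⟩⟩
  by_contra h'
  simpa using (hf.1.2 [] h').1

/-- The scalar series that correspond to closed `2`-forms of tilde degree `k`. -/
structure Good (𝒜 : ZMod m → Submodule ℂ A) (k : ZMod m) (w : List A → ℂ) : Prop where
  ml : ML w
  deg : DegF 𝒜 k w
  nil : w [] = 0
  cyc : ∀ l : List (Letter 𝒜), cyc koszulL (fun l => w (coeW l)) l = 0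

/-- The scalar series that corresponds to a `2`-form. -/
def pot (h : DirectSum.IsInternal 𝒜) (f : List (DLetter 𝒜) → ℂ) : List A → ℂ :=
  extend h fun l => cyc koszulD f (markEnds l)

theorem pot_coeW (h : DirectSum.IsInternal 𝒜) {f : List (DLetter 𝒜) → ℂ} (hf : f ∈ forms 𝒜)
    (l : List (Letter 𝒜)) : pot h f (coeW l) = cyc koszulD f (markEnds l) :=
  extend_coeW h (mem_forms.1 hf).cycD.markEnds l

theorem ML.pot (h : DirectSum.IsInternal 𝒜) {f : List (DLetter 𝒜) → ℂ} (hf : f ∈ forms 𝒜) :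
    ML (pot h f) := ML.extend h (mem_forms.1 hf).cycD.markEnds

theorem pot_eq (h : DirectSum.IsInternal 𝒜) {f : List (DLetter 𝒜) → ℂ} (hf : f ∈ forms 𝒜)
    {w : List A → ℂ} (hw : ML w) (e : ∀ l, cyc koszulD f (markEnds l) = w (coeW l)) :
    pot h f = w :=
  funext (ML.ext h (ML.pot h hf) hw fun l => by rw [pot_coeW h hf, e])

theorem Good.pot (h : DirectSum.IsInternal 𝒜) {k : ZMod m} {f : List (DLetter 𝒜) → ℂ}
    (hf : f ∈ closedForms 𝒜 k) : Good 𝒜 k (pot h f) where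
  ml := ML.pot h hf.1.1
  deg l hl := by
    rw [pot_coeW h hf.1.1] at hl
    by_contra h'
    exact hl (cyc_eq_zero_of_tdeg hf.1 (by simpa using h'))
  nil := (pot_coeW h hf.1.1 []).trans (cyc_nil _ _)
  cyc l := by
    simp only [pot_coeW h hf.1.1]
    exact cyc_markEnds_eq_zero hf l

theorem pot_sub (h : DirectSum.IsInternal 𝒜) {f g : List (DLetter 𝒜) → ℂ} (hf : f ∈ forms 𝒜)
    (hg : g ∈ forms 𝒜) : pot h (f - g) = fun l => pot h f l - pot h g l :=
  pot_eq h ((forms 𝒜).sub_mem hf hg) ((ML.pot h hf).fun_sub (ML.pot h hg)) fun l => by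
    rw [pot_coeW h hf, pot_coeW h hg]
    exact cyc_sub _ _ _

theorem sub_mem_commutators_iff (h : DirectSum.IsInternal 𝒜) {k : ZMod m}
    {f g : List (DLetter 𝒜) → ℂ} (hf : f ∈ closedForms 𝒜 k) (hg : g ∈ closedForms 𝒜 k) :
    f - g ∈ commutators 𝒜 ↔ pot h f = pot h g := by
  have hs := (closedForms 𝒜 k).sub_mem hf hg
  rw [mem_commutators_iff hs]
  constructor
  · intro e
    refine pot_eq h hf.1.1 (ML.pot h hg.1.1) fun l => ?_
    rw [pot_coeW h hg.1.1, ← sub_eq_zero, ← e l]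
    exact (cyc_sub _ _ _).symm
  · intro e l
    rw [← pot_coeW h hs.1.1, pot_sub h hf.1.1 hg.1.1, e]
    exact sub_self _

theorem flatPart_eq (h : DirectSum.IsInternal 𝒜) {f : List (DLetter 𝒜) → ℂ} (hf : f ∈ forms 𝒜)
    (a b : Letter 𝒜) : flatPart f a b = 1 / 2 * pot h f [(a.2 : A), (b.2 : A)] := by
  have h1 := pot_coeW h hf [a, b]
  simp only [coeW_cons, coeW_nil] at h1
  rw [h1, flatPart]
  simp [cyc, dsum_cons, markEnds, markLast, kw_singleton, koszulD, koszul_comm b.1]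
  ring

/-- Cyclic triviality gives `w = T - rot T`. The form `∑ T ds · d(s ⋯ s)` is closed, and on a word
with marked ends its cyclic sum has just the two terms `T` and `-rot T`. -/
theorem exists_closedForm (h : DirectSum.IsInternal 𝒜) {k : ZMod m} {w : List A → ℂ}
    (hw : Good 𝒜 k w) : ∃ f ∈ closedForms 𝒜 k, pot h f = w := by
  let T : List (Letter 𝒜) → ℂ := rotPrimitive koszulL fun l => w (coeW l)
  have hT : ∀ l, T l - rotW koszulL T l = w (coeW l) := fun l =>
    rotPrimitive_sub koszulL_mul hw.nil hw.cyc l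
  have hTl : SlotLinear (LetterRel 𝒜) T := by
    refine hw.ml.letterRel.rotPrimitive (fun c x y z h t => ?_) fun c x y z h t => ?_
    · simp [koszulL, h.degs.1, h.degs.2]
    · simp [koszulL, h.degs.1, h.degs.2]
  have hTd : ∀ l, tdeg l ≠ -k → T l = 0 := by
    intro l hl
    have : ∀ (i : ℕ) (l : List (Letter 𝒜)), tdeg l ≠ -k → (rotW koszulL)^[i] (fun l => w (coeW l)) l = 0 := by
      intro i
      induction i with
      | zero => intro l hl; by_contra h'; exact hl (hw.deg l h')
      | succ i ih =>
        intro l hl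
        rw [Function.iterate_succ_apply']
        rcases List.eq_nil_or_concat l with rfl | ⟨u, x, rfl⟩
        · exact ih [] hl
        · rw [List.concat_eq_append] at hl ⊢
          rw [rotW_concat, ih _ (by simpa [add_comm] using hl), mul_zero]
    simp only [T, rotPrimitive, this _ l hl]
    simp
  -- The form `∑ T(a₀, …, aₙ) ds^{a₀} d(s^{a₁} ⋯ s^{aₙ})`; the differential of a word is the sum
  -- over the positions of a single mark.
  let f : List (DLetter 𝒜) → ℂ := fun l => match l with
    | [] => 0
    | x :: l => if x.1 = true ∧ marks l = 1 then T (x.2 :: plain l) else 0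
  have hmk : ∀ (c : ℂ) (x y z : DLetter 𝒜), FormRel 𝒜 c x y z → ∀ u v : List (DLetter 𝒜),
      marks (u ++ x :: v) = marks (u ++ z :: v) ∧ marks (u ++ y :: v) = marks (u ++ z :: v) := by
    intro c x y z h u v
    rw [marks_append, marks_append, marks_append, marks_cons x, marks_cons y, marks_cons z, h.marks.1,
      h.marks.2]
    exact ⟨rfl, rfl⟩
  have hf1 : f ∈ forms 𝒜 := by
    rw [mem_forms]
    intro c x y z h u v
    cases u with
    | nil =>
      simp only [f, List.nil_append, h.1, h.2.1]
      split_ifs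
      · exact hTl c _ _ _ h.2.2 [] _
      · simp
    | cons t u =>
      simp only [f, List.cons_append, (hmk c x y z h u v).1, (hmk c x y z h u v).2]
      split_ifs
      · simpa using hTl c _ _ _ h.2.2 (t.2 :: plain u) (plain v)
      · simp
  have hf2 : f ∈ formsOf 𝒜 2 k := by
    refine ⟨hf1, fun l hl => ?_⟩
    match l, hl with
    | [], hl => exact (hl rfl).elim
    | (b, x) :: l, hl =>
      simp only [f] at hl
      split_ifs at hl with hb
      · obtain ⟨rfl, hb⟩ := hb
        refine ⟨by simp [hb], ?_⟩
        by_contra h'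
        exact hl (hTd _ (by simpa using h'))
      · exact (hl rfl).elim
  have hd : dR 𝒜 f = 0 := by
    funext l
    match l with
    | [] => exact dR_nil f
    | (false, x) :: l =>
      have : (fun w => f ((false, x) :: w)) = fun _ => 0 := by funext w; simp [f]
      rw [dR_cons, this, dR_zero]; simp
    | (true, x) :: l =>
      have : (fun w => f ((true, x) :: w)) = fun w => if marks w = 1 then T (x :: plain w) else 0 := by
        funext w; simp [f]
      rw [dR_cons, this, dR_marks_one fun w => T (x :: w)]; simp [f]
  refine ⟨f, ⟨hf2, ?_⟩, pot_eq h hf1 hw.ml fun l => ?_⟩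
  · change dR 𝒜 f ∈ commutators 𝒜
    rw [hd]; exact Submodule.zero_mem _
  · rcases eq_cons_concat l with rfl | ⟨a, rfl⟩ | ⟨a, p, z, rfl⟩
    · exact (cyc_nil _ _).trans hw.nil.symm
    · have h1 := hw.cyc [a]
      simp [cyc, dsum_cons] at h1
      simp [markEnds, markLast, cyc, dsum_cons, f, h1]
    -- Since `f` vanishes on words with an unmarked first letter, only the rotations beginning with
    -- `a` or with `z` contribute.
    · rw [markEnds_cons_concat, cyc, dsum_cons, dsum_concat, dsum_eq_last]
      · have h2 : kw koszulD [(true, z)] ((true, a) :: unmarked p) = - koszul z.1 (tdeg (a :: p)) := by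
          rw [kw_koszulD]; simp [bideg]
        have h3 := hT (a :: p ++ [z])
        rw [rotW_concat, kw_koszulL, tdeg_singleton] at h3
        simp only [List.nil_append, if_neg (List.cons_ne_nil _ _)]
        rw [h2]
        simp only [List.cons_append] at h3
        rw [← h3]
        simp [f, sub_eq_add_neg]
      · intro x y e hy
        obtain ⟨t, y, rfl⟩ := List.exists_cons_of_ne_nil hy
        have ht : t.1 = false := by
          have : t ∈ unmarked p := by rw [← e]; simp
          obtain ⟨s, _, rfl⟩ := List.mem_map.1 this
          rfl
        simp [f, ht]

end

end Potentials

end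

noncomputable section

/-! ### Operations on cyclically trivial series -/

section GoodSeries

variable {m : ℕ} [hm : Fact (m = 0 ∨ m = 2)] {A B : Type*} [AddCommGroup A] [Module ℂ A]
  [AddCommGroup B] [Module ℂ B]
  {𝒜 : ZMod m → Submodule ℂ A} {ℬ : ZMod m → Submodule ℂ B}

/-- Write `w = T - rot T`; by `cyc_subst_rotW` both terms have the same cyclic sum after
substitution. -/
theorem Good.comp {k : ZMod m} {w : List B → ℂ} (hw : Good ℬ k w) {F : List A → B} (hF : ML F)
    (hd : Deg 𝒜 ℬ 0 F) : Good 𝒜 k (comp w F) where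
  ml := hw.ml.comp hF
  deg := hw.deg.comp hd
  nil := hw.nil
  cyc l := by
    have h1 : ∀ l : List (Letter 𝒜), _root_.comp w F (coeW l) =
        subst (fun _ => True) hd.op (fun w' => w (coeW w')) l :=
      AInfHom.comp_coeW hd.op (fun _ => rfl) w
    have h2 : ∀ l : List (Letter ℬ), w (coeW l) =
        rotPrimitive koszulL (fun l => w (coeW l)) l -
        rotW koszulL (rotPrimitive koszulL fun l => w (coeW l)) l := fun l =>
      (rotPrimitive_sub koszulL_mul hw.nil hw.cyc l).symm
    simp only [h1]
    simp only [subst_congr _ _ h2, subst_sub, cyc_sub]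
    rw [sub_eq_zero]
    refine (cyc_subst_rotW _ _ koszulL_mul (fun b b' _ _ _ _ => ?_) _ l).symm
    rw [kw_koszulL]
    simp [koszulL, Deg.op]

/-- Write `w = T - rot T` and use `cyc_coder_rotW`. The degree `e` is arbitrary, with the
corresponding twist `hσ`: it is 1 for the structure maps, -1 for homotopies and 0 for vector fields
of coordinate changes. -/
theorem Good.cod {k e : ZMod m} {w : List A → ℂ} (hw : Good 𝒜 k w) {σ : A →ₗ[ℂ] A}
    (hσ : ∀ a : Letter 𝒜, σ a.2 = koszul e a.1 • (a.2 : A)) {r : List A → A} (hr : ML r)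
    (hd : Deg 𝒜 𝒜 e r) : Good 𝒜 (k + e) (cod σ r w) where
  ml := hw.ml.cod hr
  deg := hw.deg.cod (fun g x hx => by
    obtain ⟨a, ha, rfl⟩ := exists_letter hx
    rw [hσ]; exact (𝒜 g).smul_mem _ hx) hd
  nil := rfl
  cyc l := by
    let tw : Letter 𝒜 → Letter 𝒜 := fun a => ⟨a.1, koszul e a.1 • a.2⟩
    have h1 : ∀ l : List (Letter 𝒜), _root_.cod σ r w (coeW l) =
        coder tw (fun _ => True) hd.op (fun w' => w (coeW w')) l := fun l =>
      coder_map _ _ _ tw (fun _ => True) hd.op _ (fun a => hσ a) (fun _ _ => by simp) (fun _ _ => rfl) w l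
    let T : List (Letter 𝒜) → ℂ := rotPrimitive koszulL fun l => w (coeW l)
    have h2 : ∀ l : List (Letter 𝒜), w (coeW l) = T l - rotW koszulL T l := fun l =>
      (rotPrimitive_sub koszulL_mul hw.nil hw.cyc l).symm
    have hTl : SlotLinear (LetterRel 𝒜) T := by
      refine hw.ml.letterRel.rotPrimitive (fun c x y z h t => ?_) fun c x y z h t => ?_
      · simp [koszulL, h.degs.1, h.degs.2]
      · simp [koszulL, h.degs.1, h.degs.2]
    have hT : ∀ p a w, T (p ++ tw a :: w) = koszul e (tdeg [a]) * T (p ++ a :: w) := by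
      intro p a w
      have h3 := hTl 1 ⟨a.1, 0⟩ ⟨a.1, 0⟩ ⟨a.1, 0⟩ (LetterRel.of rfl rfl (by simp)) p w
      have h4 := hTl (koszul e a.1) a ⟨a.1, 0⟩ (tw a) (LetterRel.of rfl rfl (by simp [tw])) p w
      rw [one_smul, left_eq_add] at h3
      rw [h4, h3]
      simp
    simp only [h1, h2, coder_sub, cyc_sub]
    rw [sub_eq_zero]
    refine (cyc_coder_rotW tw (fun _ => True) hd.op koszulL_mul (fun x y => rfl)
      (s := fun u => koszul e (tdeg u)) (by simp) (fun u v => by rw [tdeg_append, koszul_add_right])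
      (fun u => koszul_mul_self _ _) (fun b x _ _ => ?_) (fun b x _ _ => ?_) hT l).symm
    · rw [kw_koszulL]; simp [koszulL, Deg.op, koszul_add_left]
    · rw [kw_koszulL]; simp [koszulL, Deg.op, koszul_add_right, koszul_comm e]

theorem Good.add {k : ZMod m} {w w' : List A → ℂ} (hw : Good 𝒜 k w) (hw' : Good 𝒜 k w') :
    Good 𝒜 k fun l => w l + w' l where
  ml := hw.ml.fun_add hw'.ml
  deg := hw.deg.add hw'.deg
  nil := by rw [hw.nil, hw'.nil, add_zero]
  cyc l := by rw [cyc_add, hw.cyc, hw'.cyc, add_zero]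

theorem Good.smul {k : ZMod m} {w : List A → ℂ} (c : ℂ) (hw : Good 𝒜 k w) :
    Good 𝒜 k fun l => c • w l where
  ml := hw.ml.fun_smul c
  deg := hw.deg.smul c
  nil := by rw [hw.nil, smul_zero]
  cyc l := by simp only [smul_eq_mul, cyc_smul, hw.cyc, mul_zero]

theorem Good.zero {k : ZMod m} : Good 𝒜 k fun _ => 0 where
  ml := ML.zero_fun
  deg _ h := (h rfl).elim
  nil := rfl
  cyc l := cyc_zero l

theorem Good.neg {k : ZMod m} {w : List A → ℂ} (hw : Good 𝒜 k w) : Good 𝒜 k fun l => - w l := by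
  simpa using hw.smul (-1)

theorem Good.sub {k : ZMod m} {w w' : List A → ℂ} (hw : Good 𝒜 k w) (hw' : Good 𝒜 k w') :
    Good 𝒜 k fun l => w l - w' l := by
  simpa [sub_eq_add_neg] using hw.add hw'.neg

theorem Good.congr_deg {k k' : ZMod m} {w : List A → ℂ} (hw : Good 𝒜 k w) (h : k = k') :
    Good 𝒜 k' w := h ▸ hw

theorem Good.truncate {k : ZMod m} {w : List A → ℂ} (hw : Good 𝒜 k w) (p : ℕ → Prop)
    [DecidablePred p] : Good 𝒜 k fun l => if p l.length then w l else 0 where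
  ml := hw.ml.truncate p
  deg l h := hw.deg l fun h' => h (by simp [h'])
  nil := by simp [hw.nil]
  cyc l := by
    by_cases hp : p l.length
    · rw [← hw.cyc l]
      exact cyc_congr fun w hw => by rw [length_coeW, hw, if_pos hp]
    · exact (cyc_congr (g := fun _ => 0) fun w hw => by rw [length_coeW, hw, if_neg hp]).trans (cyc_zero l)

theorem Good.of_length {k : ZMod m} {f : List A → ℂ}
    (h : ∀ n : ℕ, ∃ g : List A → ℂ, Good 𝒜 k g ∧ ∀ l, l.length ≤ n → f l = g l) : Good 𝒜 k f where
  ml := ML.of_length fun n => (h n).imp fun _ hg => ⟨hg.1.ml, hg.2⟩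
  deg l hl := by
    obtain ⟨g, hg, e⟩ := h l.length
    rw [e _ (by simp)] at hl
    exact hg.deg l hl
  nil := by
    obtain ⟨g, hg, e⟩ := h 0
    rw [e _ (by simp), hg.nil]
  cyc l := by
    obtain ⟨g, hg, e⟩ := h l.length
    rw [← hg.cyc l]
    exact cyc_congr fun w hw => e _ (by simp [hw])

theorem Good.singleton {k : ZMod m} {w : List A → ℂ} (hw : Good 𝒜 k w)
    (h : DirectSum.IsInternal 𝒜) (a : A) : w [a] = 0 := by
  have : hw.ml.slot [] [] = 0 := linearMap_ext h fun a => by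
    simpa [_root_.cyc, dsum_cons, ML.slot_apply] using hw.cyc [a]
  exact congrArg (fun φ : A →ₗ[ℂ] ℂ => φ a) this

end GoodSeries

/-! ### Push-forward and Lie derivative on scalar series -/

section Functoriality

variable {m : ℕ} [hm : Fact (m = 0 ∨ m = 2)] {A B : Type*} [AddCommGroup A] [Module ℂ A]
  [AddCommGroup B] [Module ℂ B]
  {𝒜 : ZMod m → Submodule ℂ A} {ℬ : ZMod m → Submodule ℂ B}

theorem opD_rel {d : ZMod m} {G : List A → B} (hG : ML G) {op : List (Letter 𝒜) → Letter ℬ}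
    (hop : ∀ l, (op l).1 = tdeg l + d) (hop' : ∀ l, ((op l).2 : B) = G (coeW l)) (c : ℂ)
    (x y z : DLetter 𝒜) (h : FormRel 𝒜 c x y z) (u v : List (DLetter 𝒜)) :
    ((marks (u ++ x :: v) ≤ 1 ↔ marks (u ++ z :: v) ≤ 1) ∧
      (marks (u ++ y :: v) ≤ 1 ↔ marks (u ++ z :: v) ≤ 1)) ∧
    FormRel ℬ c (opD op (u ++ x :: v)) (opD op (u ++ y :: v)) (opD op (u ++ z :: v)) := by
  have h1 : marks (u ++ x :: v) = marks (u ++ z :: v) := by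
    rw [marks_append, marks_append, marks_cons x, marks_cons z, h.marks.1]
  have h2 : marks (u ++ y :: v) = marks (u ++ z :: v) := by
    rw [marks_append, marks_append, marks_cons y, marks_cons z, h.marks.2]
  refine ⟨by rw [h1, h2]; exact ⟨Iff.rfl, Iff.rfl⟩, by simp [opD, h1], by simp [opD, h2], ?_⟩
  refine LetterRel.of ?_ ?_ ?_
  · simp [opD, hop, h.2.2.degs.1]
  · simp [opD, hop, h.2.2.degs.2]
  · simp only [opD, hop', plain_append, plain_cons, coeW_append, coeW_cons, h.2.2.coe]
    exact hG.smul_add _ _ c _ _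

theorem mem_commutators_map {f : List (DLetter 𝒜) → ℂ} (hf : f ∈ commutators 𝒜) :
    ∃ T ∈ forms 𝒜, f = fun l => T l - rotW koszulD T l := by
  obtain ⟨T, hT, rfl⟩ := hf
  refine ⟨T, hT, ?_⟩
  rw [← rot_eq]; rfl

section Push

variable {X : AInf 𝒜} {Y : AInf ℬ} (F : AInfHom X Y)

omit hm in
theorem push_eq (f : List (DLetter ℬ) → ℂ) :
    push F f = subst (fun b => marks b ≤ 1) (opD F.op) f :=
  funext fun l => sum_composition_subst (fun b => marks b ≤ 1) (opD F.op) f l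

omit hm in
theorem bideg_opD_push {b : List (DLetter 𝒜)} (hb : marks b ≤ 1) : bideg [opD F.op b] = bideg b := by
  rw [bideg, marks_opD F.op hb, bideg, plain_cons, plain_nil, tdeg_singleton]
  rfl

theorem push_mem_forms {f : List (DLetter ℬ) → ℂ} (hf : f ∈ forms ℬ) : push F f ∈ forms 𝒜 := by
  have h1 := opD_rel (d := 0) F.ml (op := F.op) (fun l => (add_zero _).symm) F.coe_op
  rw [mem_forms, push_eq]
  exact (mem_forms.1 hf).subst (fun c x y z h u v => (h1 c x y z h u v).1)
    fun c x y z h u v _ => (h1 c x y z h u v).2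

theorem push_mem_formsOf {p : ℕ} {k : ZMod m} {f : List (DLetter ℬ) → ℂ} (hf : f ∈ formsOf ℬ p k) :
    push F f ∈ formsOf 𝒜 p k := by
  refine ⟨push_mem_forms F hf.1, fun l hl => ?_⟩
  by_contra h'
  refine hl ?_
  rw [push_eq, ← subst_zero (W := ℂ) (fun b => marks b ≤ 1) (opD F.op) l]
  refine subst_congr_inv (φ := bideg (𝒜 := 𝒜)) (φ' := bideg (𝒜 := ℬ)) bideg_append rfl bideg_append
    (fun b _ => bideg_opD_push F) fun w _ hw => ?_
  by_contra h
  have := hf.2 w h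
  simp only [bideg, Prod.mk.injEq] at hw
  rw [hw.1, hw.2] at this
  exact h' this

theorem push_mem_commutators {f : List (DLetter ℬ) → ℂ} (hf : f ∈ commutators ℬ) :
    push F f ∈ commutators 𝒜 := by
  have h0 := mem_commutators.1 hf
  refine mem_commutators.2 ⟨push_mem_forms F h0.1, by rw [push_eq, subst_nil, h0.2.1], fun l => ?_⟩
  obtain ⟨T, hT, rfl⟩ := mem_commutators_map hf
  rw [push_eq, show subst (fun b => marks b ≤ 1) (opD F.op) (fun l => T l - rotW koszulD T l) = _ from
    funext (subst_sub _ _ _ _), cyc_sub, sub_eq_zero]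
  refine (cyc_subst_rotW _ _ koszulD_mul (fun b b' _ _ hb hb' => ?_) _ l).symm
  rw [← kw_singleton koszulD, kw_koszulD, kw_koszulD, bideg_opD_push F hb, bideg_opD_push F hb']

theorem push_mem_closedForms {k : ZMod m} {f : List (DLetter ℬ) → ℂ} (hf : f ∈ closedForms ℬ k) :
    push F f ∈ closedForms 𝒜 k := by
  refine ⟨push_mem_formsOf F hf.1, ?_⟩
  change dR 𝒜 (push F f) ∈ commutators 𝒜
  rw [push_eq, show dR 𝒜 (subst (fun b => marks b ≤ 1) (opD F.op) f) = _ from funext (dR_subst _ _),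
    ← push_eq]
  exact push_mem_commutators F hf.2

/-- On words with marked ends the cyclic sum commutes with substitution and the marks are carried
along passively, so what is left is composition of series. -/
theorem pot_push {k : ZMod m} {f : List (DLetter ℬ) → ℂ} (hf : f ∈ closedForms ℬ k) :
    pot X.internal (push F f) = comp (pot Y.internal f) F.ser := by
  refine pot_eq _ (push_mem_forms F hf.1.1) ((ML.pot _ hf.1.1).comp F.ml) fun l => ?_
  rw [push_eq, cyc_subst_markEnds (fun _ => rfl),
    subst_markEnds _ (fun a => cyc_eq_zero_of_marks hf.1 (by simp)),
    AInfHom.comp_coeW F.op F.coe_op]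
  exact subst_congr _ _ (fun w => (pot_coeW _ hf.1.1 w).symm) _

end Push

section Lie

variable (X : AInf 𝒜)

/-- The parity involution on letters. -/
def parityL (a : Letter 𝒜) : Letter 𝒜 := ⟨a.1, sgn a.1 • a.2⟩

omit hm in
theorem map_parityL {f : List (DLetter 𝒜) → ℂ} (hf : f ∈ forms 𝒜) (p : List (DLetter 𝒜))
    (a : DLetter 𝒜) (w : List (DLetter 𝒜)) :
    f (p ++ twD parityL a :: w) = sgn a.2.1 * f (p ++ a :: w) := by
  rw [mem_forms] at hf
  have h3 := hf 1 (a.1, ⟨a.2.1, 0⟩) (a.1, ⟨a.2.1, 0⟩) (a.1, ⟨a.2.1, 0⟩)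
    ⟨rfl, rfl, LetterRel.of rfl rfl (by simp)⟩ p w
  have h4 := hf (sgn a.2.1) a (a.1, ⟨a.2.1, 0⟩) (twD parityL a)
    ⟨rfl, rfl, LetterRel.of rfl rfl (by simp [twD, parityL])⟩ p w
  rw [one_smul, left_eq_add] at h3
  rw [h4, h3]
  simp

/-- Slot-linearity turns the Koszul sign of the prefix into a twist of its letters by `parityL`, so
the Lie derivative becomes an instance of `coder`. -/
theorem lieQ_eq {f : List (DLetter 𝒜) → ℂ} (hf : f ∈ forms 𝒜) :
    lieQ X f = coder (twD parityL) (fun b => marks b ≤ 1) (opD X.op) f := by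
  funext l
  have h1 : lieQ X f l = dsum (fun u t => dsum₁ (fun b v => if marks b ≤ 1 then
      sgn (tdeg (plain u)) * f (u ++ opD X.op b :: v) else 0) t) l :=
    sum_blocks_eq_dsum (fun u b v => if marks b ≤ 1 then
      sgn (tdeg (plain u)) * f (u ++ opD X.op b :: v) else 0) l
  rw [h1, coder_eq_dsum]
  refine dsum_congr fun u t _ => dsum₁_congr fun b v _ _ => ?_
  have h2 := map_tw_eq (twD parityL) (s := fun u => sgn (tdeg (plain u))) sgn_zero
      (fun u v => by rw [plain_append, tdeg_append, sgn_add])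
      (f := f) (fun p a w => by rw [map_parityL hf]; simp) [] u (opD X.op b :: v)
  split_ifs
  · exact h2.symm
  · rfl

theorem bideg_opD_lie {b : List (DLetter 𝒜)} (hb : marks b ≤ 1) :
    bideg [opD X.op b] = bideg b + (1, 0) := by
  rw [bideg, marks_opD X.op hb, bideg, plain_cons, plain_nil, tdeg_singleton]
  simp [opD, AInf.op]

omit hm in
theorem bideg_twD (a : DLetter 𝒜) : bideg [twD parityL a] = bideg [a] := by
  obtain ⟨b, a⟩ := a
  cases b <;> simp [bideg, twD, parityL]

theorem lieQ_mem_forms {f : List (DLetter 𝒜) → ℂ} (hf : f ∈ forms 𝒜) : lieQ X f ∈ forms 𝒜 := by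
  have h1 := opD_rel (d := 1) X.ml (op := X.op) (fun l => rfl) X.coe_op
  rw [lieQ_eq X hf, mem_forms]
  refine (mem_forms.1 hf).coder (fun c x y z h => ⟨h.1, h.2.1, LetterRel.of h.2.2.degs.1 h.2.2.degs.2 ?_⟩)
    (fun c x y z h u v => (h1 c x y z h u v).1)
    fun c x y z h u v _ => (h1 c x y z h u v).2
  simp only [twD, parityL, h.2.2.degs.1, h.2.2.degs.2, SetLike.val_smul, h.2.2.coe, smul_add]
  rw [smul_comm]

theorem lieQ_mem_formsOf {p : ℕ} {k : ZMod m} {f : List (DLetter 𝒜) → ℂ} (hf : f ∈ formsOf 𝒜 p k) :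
    lieQ X f ∈ formsOf 𝒜 p (k + 1) := by
  refine ⟨lieQ_mem_forms X hf.1, fun l hl => ?_⟩
  by_contra h'
  refine hl ?_
  rw [lieQ_eq X hf.1, ← coder_zero (W := ℂ) (twD parityL) (fun b => marks b ≤ 1) (opD X.op) l]
  refine coder_congr_inv (φ := bideg (𝒜 := 𝒜)) (1, 0) bideg_append bideg_twD
    (fun b _ => bideg_opD_lie X) fun w _ hw => ?_
  by_contra h
  have := hf.2 w h
  simp only [bideg, Prod.mk_add_mk, Prod.mk.injEq] at hw
  rw [hw.1, hw.2] at this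
  exact h' ⟨by simpa using this.1, by rw [neg_add, ← this.2]; abel⟩

theorem lieQ_mem_commutators {f : List (DLetter 𝒜) → ℂ} (hf : f ∈ commutators 𝒜) :
    lieQ X f ∈ commutators 𝒜 := by
  have h0 := mem_commutators.1 hf
  refine mem_commutators.2 ⟨lieQ_mem_forms X h0.1, by rw [lieQ_eq X h0.1]; rfl, fun l => ?_⟩
  rw [lieQ_eq X h0.1]
  obtain ⟨T, hT, rfl⟩ := mem_commutators_map hf
  rw [show coder (twD parityL) (fun b => marks b ≤ 1) (opD X.op) (fun l => T l - rotW koszulD T l) = _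
    from funext (coder_sub _ _ _ _ _), cyc_sub, sub_eq_zero]
  refine (cyc_coder_rotW _ _ _ koszulD_mul (fun x y => ?_) (s := fun u => sgn (bideg u).1)
    sgn_zero (fun u v => by rw [bideg_append, Prod.fst_add, sgn_add]) (fun u => sgn_mul_self _)
    (fun b x _ hb => ?_) (fun b x _ hb => ?_)
    (fun p a w => by rw [map_parityL hT]; simp [bideg]) l).symm
  · rw [← kw_singleton koszulD, ← kw_singleton koszulD, kw_koszulD, kw_koszulD, bideg_twD]
  · rw [← kw_singleton koszulD, kw_koszulD, kw_koszulD, bideg_opD_lie X hb]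
    simp only [Prod.fst_add, Prod.snd_add, koszul_add_left, koszul_one_left, add_zero]
    ring
  · rw [← kw_singleton koszulD, kw_koszulD, kw_koszulD, bideg_opD_lie X hb]
    simp only [Prod.fst_add, Prod.snd_add, koszul_add_right, koszul_one_right, add_zero]
    ring

theorem lieQ_mem_closedForms {k : ZMod m} {f : List (DLetter 𝒜) → ℂ} (hf : f ∈ closedForms 𝒜 k) :
    lieQ X f ∈ closedForms 𝒜 (k + 1) := by
  refine ⟨lieQ_mem_formsOf X hf.1, ?_⟩
  change dR 𝒜 (lieQ X f) ∈ commutators 𝒜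
  have h0 : dR 𝒜 f ∈ commutators 𝒜 := hf.2
  rw [lieQ_eq X hf.1.1, show dR 𝒜 (coder (twD parityL) (fun b => marks b ≤ 1) (opD X.op) f) = _ from
    funext (dR_coder _ _ _), ← lieQ_eq X (mem_commutators.1 h0).1]
  exact lieQ_mem_commutators X h0

/-- The counterpart of `pot_push` for coderivations, through `cyc_coder_markEnds` and
`coder_markEnds`. -/
theorem pot_lieQ {k : ZMod m} {f : List (DLetter 𝒜) → ℂ} (hf : f ∈ closedForms 𝒜 k) :
    pot X.internal (lieQ X f) = cod X.σ X.ser (pot X.internal f) := by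
  refine pot_eq _ (lieQ_mem_forms X hf.1.1) ((ML.pot _ hf.1.1).cod X.ml) fun l => ?_
  rw [lieQ_eq X hf.1.1, cyc_coder_markEnds (tw := parityL) (fun _ => rfl) (fun _ => rfl) (map_parityL hf.1.1),
    coder_markEnds _ _ (fun a => cyc_eq_zero_of_marks hf.1 (by simp))]
  refine Eq.trans ?_ (coder_map _ _ _ parityL (fun _ => True) X.op _ (fun a => parity_coe X.internal a)
    (fun _ _ => by simp) (fun b _ => (X.coe_op b).symm) _ l).symm
  exact coder_congr _ _ _ fun w _ => (pot_coeW _ hf.1.1 w).symm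

theorem mem_cocycles_iff {k : ZMod m} {f : List (DLetter 𝒜) → ℂ} :
    f ∈ cocycles X k ↔ f ∈ closedForms 𝒜 k ∧ ∀ l, cod X.σ X.ser (pot X.internal f) l = 0 := by
  refine and_congr_right fun hf => ?_
  change lieQ X f ∈ commutators 𝒜 ↔ _
  have h1 := lieQ_mem_closedForms X hf
  rw [mem_commutators_iff h1, ← pot_lieQ X hf]
  constructor
  · exact fun h => ML.ext X.internal (ML.pot _ h1.1.1) ML.zero_fun fun l => by
      rw [pot_coeW _ h1.1.1, h]
  · exact fun h l => by rw [← pot_coeW X.internal h1.1.1, h]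

/-- A primitive on the level of series lifts to a closed form by `exists_closedForm`; so no
information on cohomology is lost by passing to series. -/
theorem sub_mem_coboundaries_iff {k : ZMod m} {f g : List (DLetter 𝒜) → ℂ}
    (hf : f ∈ closedForms 𝒜 k) (hg : g ∈ closedForms 𝒜 k) :
    f - g ∈ coboundaries X k ↔ ∃ u, Good 𝒜 (k - 1) u ∧
      ∀ l, pot X.internal f l = pot X.internal g l + cod X.σ X.ser u l := by
  have key : ∀ η ∈ closedForms 𝒜 (k - 1), (f - g) - lieQ X η ∈ commutators 𝒜 ↔
      ∀ l, pot X.internal f l = pot X.internal g l + cod X.σ X.ser (pot X.internal η) l := by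
    intro η hη
    have h1 : lieQ X η ∈ closedForms 𝒜 k := by simpa using lieQ_mem_closedForms X hη
    rw [sub_mem_commutators_iff X.internal ((closedForms 𝒜 k).sub_mem hf hg) h1, pot_lieQ X hη,
      pot_sub _ hf.1.1 hg.1.1, funext_iff]
    exact forall_congr' fun l => sub_eq_iff_eq_add'
  constructor
  · intro h
    obtain ⟨c, hc, _, ⟨η, hη, rfl⟩, e⟩ := Submodule.mem_sup.1 h
    refine ⟨pot X.internal η, Good.pot _ hη, (key η hη).1 ?_⟩
    rw [← e, add_sub_cancel_right]
    exact hc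
  · rintro ⟨u, hu, e⟩
    obtain ⟨η, hη, rfl⟩ := exists_closedForm X.internal hu
    have := (key η hη).2 e
    rw [← sub_add_cancel (f - g) (lieQ X η)]
    exact Submodule.add_mem_sup this ⟨η, hη, rfl⟩

end Lie

/-! ### Flat forms -/

/-- The quadratic series of a bilinear form. -/
def quad (b : A →ₗ[ℂ] A →ₗ[ℂ] ℂ) : List A → ℂ
  | [x, y] => b x y
  | _ => 0

omit hm in
theorem quad_of_length_ne (b : A →ₗ[ℂ] A →ₗ[ℂ] ℂ) {l : List A} (h : l.length ≠ 2) : quad b l = 0 := by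
  match l, h with
  | [], _ => rfl
  | [_], _ => rfl
  | [_, _], h => simp at h
  | _ :: _ :: _ :: _, _ => rfl

omit hm in
theorem ML.quad (b : A →ₗ[ℂ] A →ₗ[ℂ] ℂ) : ML (quad b) := by
  rintro c x y z rfl u v
  by_cases h : u.length + v.length = 1
  · rcases u with _ | ⟨t, _ | ⟨t', u⟩⟩
    · obtain ⟨t, rfl⟩ := List.length_eq_one_iff.1 (by simpa using h)
      simp [_root_.quad]
    · obtain rfl : v = [] := List.eq_nil_of_length_eq_zero (by simpa using h)
      simp [_root_.quad]
    · simp at h; omega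
  · rw [quad_of_length_ne, quad_of_length_ne, quad_of_length_ne]
    · simp
    all_goals simp only [List.length_append, List.length_cons]; omega

omit hm in
theorem flatForm_eq_zero (β : A →ₗ[ℂ] A →ₗ[ℂ] ℂ) {l : List (DLetter 𝒜)}
    (h : ∀ a b, l ≠ [(true, a), (true, b)]) : flatForm 𝒜 β l = 0 := by
  unfold flatForm
  split
  · exact (h _ _ rfl).elim
  · rfl

theorem flatForm_mem_closedForms {k : ZMod m} {β : A →ₗ[ℂ] A →ₗ[ℂ] ℂ}
    (hd : ∀ a b : Letter 𝒜, β a.2 b.2 ≠ 0 → a.1 + b.1 = -k) : flatForm 𝒜 β ∈ closedForms 𝒜 k := by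
  have hne : ∀ l : List (DLetter 𝒜), flatForm 𝒜 β l ≠ 0 → ∃ a b, l = [(true, a), (true, b)] := by
    intro l hl
    by_contra! h
    exact hl (flatForm_eq_zero β h)
  refine ⟨⟨?_, fun l hl => ?_⟩, ?_⟩
  · rw [mem_forms]
    rintro c ⟨b, x⟩ ⟨b', y⟩ ⟨b'', z⟩ ⟨h1, h2, h⟩ u v
    simp only at h1 h2 h
    subst h1 h2
    by_cases hl : u.length + v.length = 1
    · rcases u with _ | ⟨⟨t, s⟩, _ | ⟨t', u⟩⟩
      · obtain ⟨⟨t, s⟩, rfl⟩ := List.length_eq_one_iff.1 (by simpa using hl)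
        cases b' <;> cases t <;> simp [flatForm, h.coe, h.degs.1, h.degs.2]
        ring
      · obtain rfl : v = [] := List.eq_nil_of_length_eq_zero (by simpa using hl)
        cases b' <;> cases t <;> simp [flatForm, h.coe]
        ring
      · simp at hl; omega
    · rw [flatForm_eq_zero, flatForm_eq_zero, flatForm_eq_zero]
      · simp
      all_goals
        intro a b h
        have := congrArg List.length h
        simp at this
        omega
  · obtain ⟨a, b, rfl⟩ := hne l hl
    refine ⟨rfl, ?_⟩
    have : β a.2 b.2 ≠ 0 := by
      intro h; simp [flatForm, h] at hl
    simpa using hd a b this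
  · change dR 𝒜 (flatForm 𝒜 β) ∈ commutators 𝒜
    have : dR 𝒜 (flatForm 𝒜 β) = 0 := by
      funext l
      change (∑ i : Fin l.length, _) = (0 : ℂ)
      refine Finset.sum_eq_zero fun i _ => ?_
      split_ifs
      · rw [flatForm_eq_zero, mul_zero]
        intro a b h
        have h1 : (false, (l.get i).2) ∈ l.set i (false, (l.get i).2) := List.mem_set i.2 _
        rw [h] at h1
        simp at h1
      · rfl
    rw [this]; exact Submodule.zero_mem _

/-- Both rotations of `ds^a ds^b` contribute the same by the symmetry `hs`, whence the factor 2; the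
sign `-(-1)^{deg a}` of the flat form is absorbed in `-1` and the parity involution. -/
theorem pot_flatForm (h : DirectSum.IsInternal 𝒜) {k : ZMod m} {β : A →ₗ[ℂ] A →ₗ[ℂ] ℂ}
    (hd : ∀ a b : Letter 𝒜, β a.2 b.2 ≠ 0 → a.1 + b.1 = -k)
    (hs : ∀ a b : Letter 𝒜, β a.2 b.2 = koszul (a.1 + 1) (b.1 + 1) * β b.2 a.2) :
    pot h (flatForm 𝒜 β) = quad ((-2 : ℂ) • β ∘ₗ parity h) := by
  have hf := flatForm_mem_closedForms hd
  refine pot_eq h hf.1.1 (ML.quad _) fun l => ?_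
  by_cases hl : l.length = 2
  · match l, hl with
    | [a, b], _ =>
      have h1 := hs a b
      simp only [koszul_add_left, koszul_add_right, koszul_one_left, koszul_one_right, sgn_add, sgn_one] at h1
      simp [cyc, dsum_cons, markEnds, markLast, kw_singleton, koszulD, koszul_comm b.1, flatForm, quad,
        parity_coe]
      linear_combination (sgn a.1) * h1 - koszul a.1 b.1 * sgn b.1 * β b.2 a.2 * sgn_mul_self a.1
  · rw [quad_of_length_ne _ (by simpa using hl)]
    refine dsum_eq_zero fun u v e => ?_
    rw [flatForm_eq_zero, mul_zero, ite_self]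
    intro a b h
    have h1 := congrArg List.length h
    have h2 := congrArg List.length (congrArg plain e)
    rw [plain_markEnds] at h2
    simp [plain] at h1 h2
    omega

end Functoriality

end

noncomputable section

/-! ### Weighted parts of series and the contracting homotopy -/

section Weights

variable {A W W' : Type*} [AddCommGroup A] [Module ℂ A] [AddCommGroup W] [Module ℂ W]
  [AddCommGroup W'] [Module ℂ W']

/-- The part of a series with `m` inputs in the image of `1 - p`, and the others in that of `p`,
weighted by `g m`. -/
def wt (p : A →ₗ[ℂ] A) : (ℕ → ℂ) → (List A → W) → List A → W
  | g, f, [] => g 0 • f []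
  | g, f, a :: l => wt p g (fun w => f (p a :: w)) l +
      wt p (fun m => g (m + 1)) (fun w => f ((a - p a) :: w)) l

/-- The dilation by `t` of the image of `1 - p`. -/
def dilate (p : A →ₗ[ℂ] A) (t : ℂ) : A →ₗ[ℂ] A := p + t • (LinearMap.id - p)

variable (p : A →ₗ[ℂ] A)

theorem dilate_apply (t : ℂ) (a : A) : dilate p t a = p a + t • (a - p a) := rfl

theorem wt_zero (g : ℕ → ℂ) (l : List A) : wt p g (fun _ => (0 : W)) l = 0 := by
  induction l generalizing g with
  | nil => simp [wt]
  | cons a l ih => simp [wt, ih]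

theorem wt_add (g : ℕ → ℂ) (f f' : List A → W) (l : List A) :
    wt p g (fun w => f w + f' w) l = wt p g f l + wt p g f' l := by
  induction l generalizing g f f' with
  | nil => simp [wt]
  | cons a l ih => simp only [wt, ih]; abel

theorem wt_sum (s : Finset ℕ) (c : ℕ → ℂ) (g : ℕ → ℕ → ℂ) (f : List A → W) (l : List A) :
    wt p (fun m => ∑ i ∈ s, c i * g i m) f l = ∑ i ∈ s, c i • wt p (g i) f l := by
  induction l generalizing g f with
  | nil => simp [wt, Finset.sum_smul, mul_smul]
  | cons a l ih => simp only [wt, smul_add, Finset.sum_add_distrib, ih]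

theorem wt_congr_weight {g g' : ℕ → ℂ} (f : List A → W) {l : List A} (h : ∀ m ≤ l.length, g m = g' m) :
    wt p g f l = wt p g' f l := by
  induction l generalizing g g' f with
  | nil => simp [wt, h]
  | cons a l ih =>
    rw [wt, wt, ih _ fun m hm => h m (by simp; omega), ih _ fun m hm => h (m + 1) (by simpa using hm)]

theorem wt_pow (t : ℂ) {f : List A → W} (hf : ML f) (l : List A) :
    wt p (fun m => t ^ m) f l = f (l.map (dilate p t)) := by
  induction l generalizing f with
  | nil => simp [wt]
  | cons a l ih =>
    have h1 : wt p (fun m => t ^ (m + 1)) (fun w => f ((a - p a) :: w)) l =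
        t • wt p (fun m => t ^ m) (fun w => f ((a - p a) :: w)) l := by
      have := wt_sum p {0} (fun _ => t) (fun _ m => t ^ m) (fun w => f ((a - p a) :: w)) l
      simp only [Finset.sum_singleton] at this
      rw [← this]
      exact wt_congr_weight p _ fun m _ => pow_succ' t m
    rw [wt, h1, ih (hf.cons _), ih (hf.cons _), List.map_cons, dilate_apply]
    rw [show f ((p a + t • (a - p a)) :: l.map (dilate p t)) =
      (hf.slot [] (l.map (dilate p t))) (p a + t • (a - p a)) from rfl, map_add, map_smul]
    rfl

/-- Vandermonde at the nodes `0, …, n`. On words of bounded length every weight is thus a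
combination of geometric weights, that is, of substitutions of dilations, and inherits whatever
those preserve. -/
theorem exists_interpolation (g : ℕ → ℂ) (n : ℕ) :
    ∃ c : ℕ → ℂ, ∀ m ≤ n, g m = ∑ t ∈ Finset.range (n + 1), c t * (t : ℂ) ^ m := by
  let V : Matrix (Fin (n + 1)) (Fin (n + 1)) ℂ := Matrix.vandermonde fun i => ((i : ℕ) : ℂ)
  have hV : IsUnit V.transpose.det := by
    rw [Matrix.det_transpose, isUnit_iff_ne_zero, Matrix.det_vandermonde_ne_zero_iff]
    intro i j h
    simpa [Fin.ext_iff] using h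
  let y : Fin (n + 1) → ℂ := fun i => g (i : ℕ)
  let x : Fin (n + 1) → ℂ := V.transpose⁻¹.mulVec y
  have hx : V.transpose.mulVec x = y := by
    simp [x, Matrix.mulVec_mulVec, Matrix.mul_nonsing_inv _ hV]
  refine ⟨fun t => if h : t < n + 1 then x ⟨t, h⟩ else 0, fun m hm => ?_⟩
  have := congrFun hx ⟨m, by omega⟩
  simp only [Matrix.mulVec, dotProduct, Matrix.transpose_apply, V, Matrix.vandermonde_apply] at this
  rw [show g m = y ⟨m, by omega⟩ from rfl, ← this, ← Fin.sum_univ_eq_sum_range (fun t => (if h : t < n + 1 then x ⟨t, h⟩ else 0) * (t : ℂ) ^ m)]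
  refine Finset.sum_congr rfl fun i _ => ?_
  rw [dif_pos i.2, mul_comm]

theorem exists_wt_eq (g : ℕ → ℂ) (n : ℕ) : ∃ c : ℕ → ℂ, ∀ {W : Type _} [AddCommGroup W] [Module ℂ W]
    {f : List A → W}, ML f → ∀ l, l.length ≤ n →
      wt p g f l = ∑ t ∈ Finset.range (n + 1), c t • comp f (lin (dilate p t)) l := by
  obtain ⟨c, hc⟩ := exists_interpolation g n
  refine ⟨c, fun {W} _ _ f hf l hl => ?_⟩
  rw [wt_congr_weight p f (g' := fun m => ∑ t ∈ Finset.range (n + 1), c t * (t : ℂ) ^ m)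
    fun m hm => hc m (hm.trans hl), wt_sum]
  refine Finset.sum_congr rfl fun t _ => ?_
  rw [wt_pow p _ hf, comp_lin_right hf]

theorem sum_smul_induction {P : (List A → W) → Prop} (h0 : P fun _ => 0)
    (ha : ∀ f g, P f → P g → P fun l => f l + g l) (hc : ∀ (c : ℂ) f, P f → P fun l => c • f l)
    (s : Finset ℕ) (c : ℕ → ℂ) (f : ℕ → List A → W) (hf : ∀ i, P (f i)) :
    P fun l => ∑ i ∈ s, c i • f i l := by
  classical
  induction s using Finset.induction_on with
  | empty => simpa using h0
  | insert i s hi ih =>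
    simp only [Finset.sum_insert hi]
    exact ha _ _ (hc _ _ (hf i)) ih

theorem ML.wt {g : ℕ → ℂ} {f : List A → W} (hf : ML f) : ML (wt p g f) :=
  ML.of_length fun n => by
    obtain ⟨c, hc⟩ := exists_wt_eq p g n
    exact ⟨_, sum_smul_induction (P := ML) ML.zero_fun (fun _ _ => ML.fun_add)
      (fun c _ h => h.fun_smul c) _ c _ fun t => hf.comp (ML.lin (dilate p t)),
      fun l hl => hc hf l hl⟩

theorem cod_sum_smul (σ : A →ₗ[ℂ] A) (r : List A → A) (s : Finset ℕ) (c : ℕ → ℂ)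
    (f : ℕ → List A → W) (l : List A) :
    cod σ r (fun w => ∑ i ∈ s, c i • f i w) l = ∑ i ∈ s, c i • cod σ r (f i) l := by
  classical
  induction s using Finset.induction_on with
  | empty => simp
  | insert i s hi ih => simp only [Finset.sum_insert hi, cod_add, cod_smul, ih]

/-- `hp` says that the coderivation commutes with each dilation, and weights are combinations of
dilations. -/
theorem cod_wt {σ : A →ₗ[ℂ] A} {r : List A → A} (hr : ML r) (hσ : ∀ a, σ (p a) = p (σ a))
    (hp : ∀ (t : ℂ) b, b ≠ [] → r (b.map (dilate p t)) = dilate p t (r b)) (g : ℕ → ℂ) {f : List A → W}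
    (hf : ML f) (l : List A) : cod σ r (wt p g f) l = wt p g (cod σ r f) l := by
  obtain ⟨c, hc⟩ := exists_wt_eq p g l.length
  rw [cod_congr fun w _ hw => hc hf w hw, hc (hf.cod hr) l le_rfl, cod_sum_smul]
  refine Finset.sum_congr rfl fun t _ => ?_
  rw [cod_comp_of_eq hf (σ' := σ) (s := r)]
  · intro b
    match b with
    | [] => simp
    | [a] => simp [dilate_apply, hσ]
    | a :: a' :: b => simp
  · intro b hb
    rw [cod_lin_left _ _ _ hb, comp_lin_right hr, hp _ _ hb]

/-- Euler's identity: the derivation extending the projection `1 - p` counts the inputs in its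
image. -/
theorem wt_cod_lin (hpp : ∀ a, p (p a) = p a) (g : ℕ → ℂ) {f : List A → W} (hf : ML f) (l : List A) :
    wt p g (cod LinearMap.id (lin (LinearMap.id - p)) f) l = wt p (fun m => m * g m) f l := by
  induction l generalizing g f with
  | nil => simp [wt]
  | cons a l ih =>
    simp only [wt, cod_lin_cons _ _ hf, wt_add, LinearMap.sub_apply, LinearMap.id_apply, map_sub, hpp,
      sub_self, sub_zero]
    rw [ih _ (hf.cons _), ih _ (hf.cons _)]
    have h0 : wt p g (fun w => f ((0 : A) :: w)) l = 0 := by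
      rw [show (fun w => f ((0 : A) :: w)) = fun _ => 0 from funext fun w => hf.zero [] w, wt_zero]
    have h1 := wt_sum p (Finset.range 2) (fun _ => 1)
      (fun i m => if i = 0 then g (m + 1) else m * g (m + 1)) (fun w => f ((a - p a) :: w)) l
    simp only [Finset.sum_range_succ, Finset.sum_range_zero] at h1
    simp only [zero_add, one_mul, one_smul, if_true, one_ne_zero, if_false] at h1
    rw [h0, zero_add, ← h1]
    congr 1
    refine wt_congr_weight p _ fun m _ => ?_
    push_cast; ring

theorem wt_map (φ : W →ₗ[ℂ] W') (g : ℕ → ℂ) (f : List A → W) (l : List A) :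
    φ (wt p g f l) = wt p g (fun w => φ (f w)) l := by
  induction l generalizing g f with
  | nil => simp [wt]
  | cons a l ih => simp [wt, ih]

theorem wt_congr {g : ℕ → ℂ} {f f' : List A → W} {l : List A}
    (h : ∀ w, w.length = l.length → f w = f' w) : wt p g f l = wt p g f' l := by
  induction l generalizing g f f' with
  | nil => simp [wt, h]
  | cons a l ih =>
    rw [wt, wt, ih fun w hw => h _ (by simp [hw]), ih fun w hw => h _ (by simp [hw])]

theorem cod_congr_of_length {σ : A →ₗ[ℂ] A} (δ : A →ₗ[ℂ] A) {f f' : List A → W} (hf : ML f) (hf' : ML f')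
    {l : List A} (h : ∀ w, w.length = l.length → f w = f' w) :
    cod σ (lin δ) f l = cod σ (lin δ) f' l := by
  induction l generalizing f f' with
  | nil => simp
  | cons a l ih =>
    rw [cod_lin_cons _ _ hf, cod_lin_cons _ _ hf', h _ (by simp),
      ih (hf.cons _) (hf'.cons _) fun w hw => h _ (by simp [hw])]

/-- The contraction of series by the homotopy `η` from `p` to the identity. -/
def contr (σ p η : A →ₗ[ℂ] A) (f : List A → W) : List A → W :=
  wt p (fun m => (m : ℂ)⁻¹) (cod σ (lin η) f)

variable {p} {σ η : A →ₗ[ℂ] A}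

theorem ML.contr {f : List A → W} (hf : ML f) : ML (contr σ p η f) := (hf.cod (ML.lin η)).wt p

theorem contr_congr {f f' : List A → W} (hf : ML f) (hf' : ML f') {l : List A}
    (h : ∀ w, w.length = l.length → f w = f' w) : contr σ p η f l = contr σ p η f' l :=
  wt_congr p fun _ hw => cod_congr_of_length η hf hf' fun w' hw' => h w' (hw'.trans hw)

theorem contr_add (f f' : List A → W) (l : List A) :
    contr σ p η (fun w => f w + f' w) l = contr σ p η f l + contr σ p η f' l := by
  rw [contr, show cod σ (lin η) (fun w => f w + f' w) = _ from funext (cod_add _ _ _ _), wt_add]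
  rfl

theorem contr_map (φ : W →ₗ[ℂ] W') (f : List A → W) (l : List A) :
    φ (contr σ p η f l) = contr σ p η (fun w => φ (f w)) l := by
  rw [contr, wt_map, contr]
  congr 1
  exact funext fun w => map_cod _ _ _ _ _

theorem contr_eq_zero (hpp : ∀ a, p (p a) = p a) (hη : ∀ a, p (η a) = 0) {f : List A → W} (hf : ML f)
    (h : ∀ l, f (l.map p) = f l) (l : List A) : contr σ p η f l = 0 := by
  have h1 : ∀ l : List A, ∀ f : List A → W, ML f → (∀ l, f (l.map p) = f l) →
      cod σ (lin η) f l = 0 := by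
    intro l
    induction l with
    | nil => intro f _ _; simp
    | cons a l ih =>
      intro f hf h
      have hp2 : ∀ l : List A, (l.map p).map p = l.map p := fun l => by
        rw [List.map_map]; exact List.map_congr_left fun a _ => hpp a
      have e2 : ∀ (a : A) l, f (a :: l.map p) = f (a :: l) := fun a l => by
        rw [← h (a :: l.map p), ← h (a :: l), List.map_cons, List.map_cons, hp2]
      rw [cod_lin_cons _ _ hf, ← h, List.map_cons, hη, ih _ (hf.cons _) fun l => e2 _ _]
      simpa using hf.zero [] _
  rw [contr, funext fun w => h1 w f hf h, wt_zero]

theorem contr_congr_of_le {f f' : List A → W} {l : List A}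
    (h : ∀ w, w.length ≤ l.length → f w = f' w) : contr σ p η f l = contr σ p η f' l :=
  wt_congr p fun _ hw => cod_congr fun w' _ hw' => h w' (hw'.trans hw.le)

/-- The data of a contraction of `ser` to the image of `p`. -/
structure Contraction (σ p η : A →ₗ[ℂ] A) (r : List A → A) : Prop where
  pp : ∀ a, p (p a) = p a
  σp : ∀ a, σ (p a) = p (σ a)
  ση : ∀ a, η (σ a) = - σ (η a)
  σσ : ∀ a, σ (σ a) = a
  ml : ML r
  map_σ : ∀ b, r (b.map σ) = - σ (r b)
  map_dilate : ∀ (t : ℂ) b, b ≠ [] → r (b.map (dilate p t)) = dilate p t (r b)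
  htpy : ∀ b, b ≠ [] → cod σ (lin η) r b + cod σ r (lin η) b = lin (LinearMap.id - p) b

theorem lin_map_σ (ση : ∀ a, η (σ a) = - σ (η a)) (b : List A) : lin η (b.map σ) = - σ (lin η b) := by
  match b with
  | [] => simp
  | [a] => simp [ση]
  | a :: a' :: b => simp

/-- Poincaré lemma. By `htpy` the anticommutator of the derivations of `η` and `r` is the Euler
derivation of `1 - p`; the weight `m⁻¹`, which commutes with `r`, inverts it where `m > 0` and
leaves the restriction to the image of `p`. -/
theorem Contraction.contr_cod {r : List A → A} (H : Contraction σ p η r) {f : List A → W} (hf : ML f)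
    (l : List A) :
    contr σ p η (cod σ r f) l + cod σ r (contr σ p η f) l = f l - f (l.map p) := by
  rw [contr, contr, cod_wt p H.ml H.σp H.map_dilate _ (hf.cod (ML.lin η)), ← wt_add]
  have h1 : (fun w => cod σ (lin η) (cod σ r f) w + cod σ r (cod σ (lin η) f) w) =
      cod LinearMap.id (lin (LinearMap.id - p)) f := by
    funext w
    rw [cod_cod (τ := LinearMap.id) H.σσ H.map_σ (lin_map_σ H.ση) hf]
    exact cod_congr_op fun b hb _ => H.htpy b hb
  rw [h1, wt_cod_lin p H.pp _ hf]
  have h2 := wt_sum p (Finset.range 2) (fun i => if i = 0 then 1 else -1)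
    (fun i m => if i = 0 then 1 ^ m else 0 ^ m) f l
  simp only [Finset.sum_range_succ, Finset.sum_range_zero] at h2
  simp only [zero_add, one_smul, if_true, one_ne_zero, if_false, wt_pow p _ hf] at h2
  rw [show dilate p 1 = LinearMap.id by ext a; simp [dilate_apply],
    show dilate p 0 = p by ext a; simp [dilate_apply], show l.map (LinearMap.id : A →ₗ[ℂ] A) = l by simp, neg_one_smul,
    ← sub_eq_add_neg] at h2
  rw [← h2]
  refine wt_congr_weight p _ fun m _ => ?_
  -- The convention `0⁻¹ = 0` is used here: `m * m⁻¹ = 1 - 0 ^ m` for all `m`, and the weights `1 ^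
  -- m` and `0 ^ m` are the dilations by 1 and 0.
  rcases Nat.eq_zero_or_pos m with rfl | hm
  · simp
  · have : (m : ℂ) ≠ 0 := by exact_mod_cast hm.ne'
    rw [mul_inv_cancel₀ this]
    simp [hm.ne']

end Weights

/-- Fixed points of operators that strictly increase the order of agreement of the series with a
closed property. -/
theorem exists_fixedPoint_of {Λ W : Type*} [Zero W] (P : (List Λ → W) → Prop) (h0 : P fun _ => 0)
    (hlim : ∀ f, (∀ n : ℕ, ∃ g, P g ∧ ∀ l, l.length ≤ n → f l = g l) → P f)
    (Θ : (List Λ → W) → List Λ → W) (hP : ∀ f, P f → P (Θ f))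
    (hΘ : ∀ f g n, P f → P g → (∀ l, l.length < n → f l = g l) → ∀ l, l.length = n → Θ f l = Θ g l) :
    ∃ f, Θ f = f ∧ P f := by
  have hit : ∀ k, P (Θ^[k] fun _ => 0) := by
    intro k
    induction k with
    | zero => exact h0
    | succ k ih => rw [Function.iterate_succ_apply']; exact hP _ ih
  have key : ∀ n k j, n < k → n < j → ∀ l : List Λ, l.length = n →
      Θ^[k] (fun _ => 0) l = Θ^[j] (fun _ => 0) l := by
    intro n
    induction n using Nat.strong_induction_on with
    | h n ih =>
      intro k j hk hj l hl
      obtain ⟨k, rfl⟩ : ∃ i, k = i + 1 := ⟨k - 1, by omega⟩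
      obtain ⟨j, rfl⟩ : ∃ i, j = i + 1 := ⟨j - 1, by omega⟩
      rw [Function.iterate_succ_apply', Function.iterate_succ_apply']
      exact hΘ _ _ n (hit k) (hit j) (fun l' hl' => ih _ hl' k j (by omega) (by omega) l' rfl) l hl
  have hf : P fun l => Θ^[l.length + 1] (fun _ => 0) l :=
    hlim _ fun n => ⟨_, hit (n + 1), fun l hl => key l.length _ _ (by omega) (by omega) l rfl⟩
  refine ⟨_, funext fun l => ?_, hf⟩
  rw [Function.iterate_succ_apply']
  exact hΘ _ _ l.length hf (hit _) (fun l' hl' => key _ _ _ (by omega) hl' l' rfl) l rfl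

/-! ### Degrees of weighted and contracted series -/

section Graded

variable {m : ℕ} {A B : Type*} [AddCommGroup A] [Module ℂ A] [AddCommGroup B] [Module ℂ B]
  {𝒜 : ZMod m → Submodule ℂ A} {ℬ : ZMod m → Submodule ℂ B} {p : A →ₗ[ℂ] A}

theorem deg_dilate (hp : ∀ g, ∀ x ∈ 𝒜 g, p x ∈ 𝒜 g) (t : ℂ) : Deg 𝒜 𝒜 0 (lin (dilate p t)) :=
  Deg.lin fun g x hx => by
    rw [add_zero, dilate_apply]
    exact add_mem (hp _ _ hx) (Submodule.smul_mem _ _ (sub_mem hx (hp _ _ hx)))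

theorem Deg.wt (hp : ∀ g, ∀ x ∈ 𝒜 g, p x ∈ 𝒜 g) {d : ZMod m} {f : List A → B} (hf : ML f)
    (hd : Deg 𝒜 ℬ d f) (g : ℕ → ℂ) : Deg 𝒜 ℬ d (wt p g f) :=
  Deg.of_length fun n => by
    obtain ⟨c, hc⟩ := exists_wt_eq p g n
    exact ⟨_, sum_smul_induction (P := Deg 𝒜 ℬ d) Deg.zero (fun _ _ => Deg.add)
      (fun c _ h => h.smul c) _ c _ fun t => hd.comp (deg_dilate hp t), fun l hl => hc hf l hl⟩

theorem Good.wt [Fact (m = 0 ∨ m = 2)] (hp : ∀ g, ∀ x ∈ 𝒜 g, p x ∈ 𝒜 g) {k : ZMod m}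
    {f : List A → ℂ} (hf : Good 𝒜 k f) (g : ℕ → ℂ) : Good 𝒜 k (wt p g f) :=
  Good.of_length fun n => by
    obtain ⟨c, hc⟩ := exists_wt_eq p g n
    exact ⟨_, sum_smul_induction (P := Good 𝒜 k) Good.zero (fun _ _ => Good.add)
      (fun c _ h => h.smul c) _ c _ fun t => hf.comp (ML.lin _) (deg_dilate hp t),
      fun l hl => hc hf.ml l hl⟩

theorem koszul_neg_one [Fact (m = 0 ∨ m = 2)] (g : ZMod m) : koszul (-1) g = sgn g := by
  rw [koszul_comm, koszul_neg_right, koszul_comm, koszul_one_left]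

theorem Good.contr [Fact (m = 0 ∨ m = 2)] (h : DirectSum.IsInternal 𝒜)
    (hp : ∀ g, ∀ x ∈ 𝒜 g, p x ∈ 𝒜 g) {η : A →ₗ[ℂ] A} (hη : ∀ g, ∀ x ∈ 𝒜 (g + 1), η x ∈ 𝒜 g)
    {k : ZMod m} {f : List A → ℂ} (hf : Good 𝒜 k f) : Good 𝒜 (k - 1) (contr (parity h) p η f) := by
  rw [sub_eq_add_neg]
  refine Good.wt hp (hf.cod (fun a => ?_) (ML.lin η) (Deg.lin fun g x hx => ?_)) _
  · rw [parity_coe, koszul_neg_one]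
  · rw [neg_add_cancel_right]; exact hη g x hx

theorem Deg.contr (h : DirectSum.IsInternal 𝒜)
    (hp : ∀ g, ∀ x ∈ 𝒜 g, p x ∈ 𝒜 g) {η : A →ₗ[ℂ] A} (hη : ∀ g, ∀ x ∈ 𝒜 (g + 1), η x ∈ 𝒜 g)
    {d : ZMod m} {f : List A → B} (hf : ML f) (hd : Deg 𝒜 ℬ d f) :
    Deg 𝒜 ℬ (-1 + d) (contr (parity h) p η f) := by
  refine Deg.wt hp (hf.cod (ML.lin η)) (hd.cod (parity_mem h) (Deg.lin fun g x hx => ?_)) _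
  rw [neg_add_cancel_right]; exact hη g x hx

end Graded
end

noncomputable section

/-! ### Harmonic decomposition of the complex -/

section Homotopy

variable {m : ℕ} [hm : Fact (m = 0 ∨ m = 2)] {A W : Type*} [AddCommGroup A] [Module ℂ A]
  [AddCommGroup W] [Module ℂ W] {𝒜 : ZMod m → Submodule ℂ A}

theorem cod_eq_of_lowest {σ : A →ₗ[ℂ] A} {r : List A → A} {f : List A → W} (hf : ML f) {l : List A}
    (hl : l ≠ []) (h : ∀ b, b ≠ [] → b.length < l.length → r b = 0) : cod σ r f l = f [r l] := by
  obtain ⟨a, l, rfl⟩ := List.exists_cons_of_ne_nil hl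
  rw [cod_cons, dsum_eq_last, add_eq_left, cod_eq_dsum]
  · refine dsum_eq_zero fun u t e => dsum₁_eq_zero fun b v hb e' => ?_
    rw [h b hb (by simp [← e, ← e']; omega)]
    exact hf.zero (σ a :: u.map σ) v
  · intro x y e hy
    have := List.length_pos_iff.2 hy
    rw [h (a :: x) (by simp) (by simp [← e]; omega)]
    exact hf.zero [] y

/-- A special deformation retraction of a complex onto its cohomology. -/
structure AInf.Homotopy (X : AInf 𝒜) (η : A →ₗ[ℂ] A) : Prop where
  deg : ∀ g, ∀ x ∈ 𝒜 (g + 1), η x ∈ 𝒜 g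
  ηη : ∀ x, η (η x) = 0
  ηdη : ∀ x, η (X.r₁ (η x)) = η x
  dηd : ∀ x, X.r₁ (η (X.r₁ x)) = X.r₁ x

theorem AInf.r₁_mem (X : AInf 𝒜) {g : ZMod m} {x : A} (hx : x ∈ 𝒜 g) : X.r₁ x ∈ 𝒜 (g + 1) := by
  obtain ⟨a, ha, rfl⟩ := exists_letter hx
  have := X.deg [a]
  rw [tdeg_cons, tdeg_nil, ha] at this
  rw [X.r₁_apply]
  simpa using this

theorem AInf.r₁_r₁ (X : AInf 𝒜) (x : A) : X.r₁ (X.r₁ x) = 0 := by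
  have := X.rel [x]
  simp only [cod_cons, cod_nil, dsum_nil, add_zero] at this
  rw [X.r₁_apply, X.r₁_apply, this]

theorem AInf.σ_r₁ (X : AInf 𝒜) (x : A) : X.r₁ (X.σ x) = - X.σ (X.r₁ x) := by
  rw [X.r₁_apply, X.r₁_apply]
  exact X.map_σ [x]

theorem exists_retraction {V V' : Type*} [AddCommGroup V] [Module ℂ V] [AddCommGroup V'] [Module ℂ V']
    (φ : V →ₗ[ℂ] V') : ∃ ψ : V' →ₗ[ℂ] V, ∀ x, φ (ψ (φ x)) = φ x := by
  obtain ⟨s, hs⟩ := φ.rangeRestrict.exists_rightInverse_of_surjective φ.range_rangeRestrict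
  obtain ⟨q, hq⟩ := (LinearMap.range φ).subtype.exists_leftInverse_of_injective
    (Submodule.ker_subtype _)
  refine ⟨s ∘ₗ q, fun x => ?_⟩
  have h1 : q (φ x) = ⟨φ x, x, rfl⟩ := congrArg (fun ψ : _ →ₗ[ℂ] _ => ψ ⟨φ x, x, rfl⟩) hq
  have h2 := congrArg (fun ψ : _ →ₗ[ℂ] _ => ((ψ ⟨φ x, x, rfl⟩ : LinearMap.range φ) : V')) hs
  rw [LinearMap.comp_apply, h1]
  exact h2

/-- Over a field `r₁` has, degree by degree, a generalised inverse `κ` with `r₁ κ r₁ = r₁`. The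
remaining identities are enforced by the usual algebraic corrections. -/
theorem AInf.exists_homotopy (X : AInf 𝒜) : ∃ η, X.Homotopy η := by
  have hd : ∀ g, ∀ x ∈ 𝒜 g, X.r₁ x ∈ 𝒜 (g + 1) := fun g x hx => X.r₁_mem hx
  have h1 : ∀ g : ZMod m, ∃ k : 𝒜 g →ₗ[ℂ] A, (∀ y, k y ∈ 𝒜 (g - 1)) ∧
      ∀ x ∈ 𝒜 (g - 1), ∀ y : 𝒜 g, (y : A) = X.r₁ x → X.r₁ (k y) = y := by
    intro g
    let φ : 𝒜 (g - 1) →ₗ[ℂ] 𝒜 g := X.r₁.restrict fun x hx => by simpa using hd _ x hx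
    obtain ⟨ψ, hψ⟩ := exists_retraction φ
    refine ⟨(𝒜 (g - 1)).subtype ∘ₗ ψ, fun y => (ψ y).2, fun x hx y hy => ?_⟩
    obtain rfl : y = φ ⟨x, hx⟩ := Subtype.ext hy
    exact congrArg Subtype.val (hψ ⟨x, hx⟩)
  choose k hk hk' using h1
  obtain ⟨κ, hκ⟩ := exists_linearMap X.internal k
  have hκd : ∀ g, ∀ x ∈ 𝒜 (g + 1), κ x ∈ 𝒜 g := fun g x hx => by
    have := hk (g + 1) ⟨x, hx⟩
    rw [add_sub_cancel_right] at this
    rw [hκ (g + 1) ⟨x, hx⟩]; exact this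
  have hdκd : ∀ x, X.r₁ (κ (X.r₁ x)) = X.r₁ x := by
    have : X.r₁ ∘ₗ κ ∘ₗ X.r₁ = X.r₁ := linearMap_ext X.internal fun a => by
      have h2 := X.r₁_mem a.2.2
      have h3 := hk' (a.1 + 1 + 1) a.2 (by rw [add_sub_cancel_right]; exact a.2.2) ⟨_, h2⟩ rfl
      rw [← hκ] at h3
      exact h3
    exact fun x => congrArg (fun ψ : _ →ₗ[ℂ] _ => ψ x) this
  have hdd := X.r₁_r₁
  -- This gives `κ₀ r₁ κ₀ = κ₀` in addition.
  let κ₀ : A →ₗ[ℂ] A := κ ∘ₗ X.r₁ ∘ₗ κ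
  have e0 : ∀ x, κ₀ x = κ (X.r₁ (κ x)) := fun _ => rfl
  have a1 : ∀ x, κ₀ (X.r₁ (κ₀ x)) = κ₀ x := fun x => by simp only [e0, hdκd]
  have a2 : ∀ x, X.r₁ (κ₀ (X.r₁ x)) = X.r₁ x := fun x => by simp only [e0, hdκd]
  -- This gives `η η = 0`: by `κ₀ r₁ κ₀ = κ₀` the operator `1 - κ₀ r₁` annihilates the image of
  -- `κ₀`, up to the order of factors, and the terms cancel in pairs.
  let η : A →ₗ[ℂ] A := κ₀ - κ₀ ∘ₗ κ₀ ∘ₗ X.r₁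
  have e1 : ∀ x, η x = κ₀ x - κ₀ (κ₀ (X.r₁ x)) := fun _ => rfl
  refine ⟨η, fun g x hx => ?_, fun x => ?_, fun x => ?_, fun x => ?_⟩
  · have b : ∀ g, ∀ x ∈ 𝒜 (g + 1), κ₀ x ∈ 𝒜 g := fun g x hx => hκd _ _ (hd _ _ (hκd _ _ hx))
    rw [e1]
    exact sub_mem (b _ _ hx) (b _ _ (b _ _ (hd _ _ hx)))
  · simp only [e1, map_sub, a1, sub_self]
  · simp only [e1, map_sub, a1, hdd, map_zero, sub_zero]
  · simp only [e1, a2, hdd, map_zero, sub_zero]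

namespace AInf.Homotopy

variable {X : AInf 𝒜} {η : A →ₗ[ℂ] A}

/-- The projection to the harmonic elements. -/
def p (_ : X.Homotopy η) : A →ₗ[ℂ] A := LinearMap.id - X.r₁ ∘ₗ η - η ∘ₗ X.r₁

variable (H : X.Homotopy η)

theorem p_apply (x : A) : H.p x = x - X.r₁ (η x) - η (X.r₁ x) := rfl
theorem p_d (x : A) : H.p (X.r₁ x) = 0 := by simp [p_apply, X.r₁_r₁, H.dηd]
theorem d_p (x : A) : X.r₁ (H.p x) = 0 := by simp [p_apply, X.r₁_r₁, H.dηd]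
theorem p_η (x : A) : H.p (η x) = 0 := by simp [p_apply, H.ηη, H.ηdη]
theorem η_p (x : A) : η (H.p x) = 0 := by simp [p_apply, H.ηη, H.ηdη]
theorem p_p (x : A) : H.p (H.p x) = H.p x := by
  conv_lhs => rw [p_apply, H.d_p, H.η_p]
  simp

theorem p_mem (g : ZMod m) (x : A) (hx : x ∈ 𝒜 g) : H.p x ∈ 𝒜 g := by
  rw [p_apply]
  refine sub_mem (sub_mem hx ?_) (H.deg _ _ (X.r₁_mem hx))
  have h1 := X.r₁_mem (H.deg (g - 1) x (by simpa using hx))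
  simpa using h1

theorem η_σ (H : X.Homotopy η) (x : A) : η (X.σ x) = - X.σ (η x) := by
  have : η ∘ₗ X.σ = - (X.σ ∘ₗ η) := linearMap_ext X.internal fun a => by
    have h1 : η a.2 ∈ 𝒜 (a.1 - 1 + 1) := by simpa using H.deg _ _ a.2.2
    simp [parity_coe, parity_of_mem X.internal h1, sgn_sub]
  exact congrArg (fun ψ : _ →ₗ[ℂ] _ => ψ x) this

theorem p_σ (x : A) : X.σ (H.p x) = H.p (X.σ x) := by
  simp only [p_apply, map_sub, H.η_σ, X.σ_r₁, map_neg, neg_neg]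

/-- A series with linear part `r₁` whose other terms live on the image of `H.p` contracts to it. -/
theorem contraction {ρ : List A → A} (hρ : ML ρ) (hd : Deg 𝒜 𝒜 1 ρ)
    (h1 : ∀ l, H.p (ρ l) = ρ l) (h2 : ∀ l, ρ (l.map H.p) = ρ l) :
    Contraction X.σ H.p η fun l => lin X.r₁ l + ρ l where
  pp := H.p_p
  σp := H.p_σ
  ση := H.η_σ
  σσ := parity_parity X.internal
  ml := (ML.lin X.r₁).fun_add hρ
  map_σ b := by
    rw [hd.map_parity_odd X.internal X.internal sgn_one hρ, lin_map_σ X.σ_r₁, map_add, neg_add]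
  map_dilate t b hb := by
    have e1 : ρ (b.map (dilate H.p t)) = ρ b := by
      rw [← h2, List.map_map, ← h2 b]
      congr 1
      refine List.map_congr_left fun a _ => ?_
      simp [dilate_apply, H.p_p]
    have e2 : lin X.r₁ (b.map (dilate H.p t)) = dilate H.p t (lin X.r₁ b) := by
      match b with
      | [] => simp
      | [a] => simp [dilate_apply, H.p_d, H.d_p]
      | a :: a' :: b => simp
    rw [e1, e2, map_add, dilate_apply _ _ (ρ b), h1, sub_self, smul_zero, add_zero]
  htpy b hb := by
    rw [cod_op_add _ _ (ML.lin η), cod_lin_left _ _ _ hb, cod_lin_left _ _ _ hb, ← h1 b, H.η_p,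
      add_zero, cod_add, cod_lin_left _ _ _ hb]
    have e3 : cod X.σ (lin η) ρ b = 0 := by
      rw [cod_eq_dsum]
      refine dsum_eq_zero fun u t _ => dsum₁_eq_zero fun c v hc _ => ?_
      have e4 : H.p (lin η c) = 0 := by
        match c, hc with
        | [a], _ => exact H.p_η a
        | a :: a' :: b, _ => simp
      rw [← h2, List.map_append, List.map_cons, e4, hρ.zero]
    rw [e3, add_zero]
    match b with
    | [] => simp
    | [a] => simp [p_apply]; abel
    | a :: a' :: b => simp

end AInf.Homotopy

end Homotopy
end

noncomputable section

/-! ### Homotopy transfer as a fixed-point problem -/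

section Transfer

variable {m : ℕ} [hm : Fact (m = 0 ∨ m = 2)] {A W : Type*} [AddCommGroup A] [Module ℂ A]
  [AddCommGroup W] [Module ℂ W] {𝒜 : ZMod m → Submodule ℂ A}

namespace AInf.Homotopy

variable {X : AInf 𝒜} {η : A →ₗ[ℂ] A} (H : X.Homotopy η)

/-- The nonlinear part of the transfer isomorphism with source term `S`. -/
def φ (S : List A → A) : List A → A := fun l => H.p (contr X.σ H.p η S l) - η (S l)

/-- The nonlinear part of the transferred structure with source term `S`. -/
def ρ (S : List A → A) : List A → A := fun l => H.p (S (l.map H.p))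

/-- The source term that results from the source term `S`. -/
def source (S : List A → A) : List A → A := fun l =>
  comp (tail X.ser) (fun b => lin LinearMap.id b + H.φ S b) l - cod X.σ (H.ρ S) (H.φ S) l

/-- The source terms to consider. -/
structure IsSource (_ : X.Homotopy η) (S : List A → A) : Prop where
  ml : ML S
  deg : Deg 𝒜 𝒜 1 S
  low : ∀ l : List A, l.length < 2 → S l = 0

variable {S : List A → A}

theorem IsSource.φ_ml (hS : H.IsSource S) : ML (H.φ S) := (hS.ml.contr.map H.p).fun_sub (hS.ml.map η)

theorem IsSource.φ_deg (hS : H.IsSource S) : Deg 𝒜 𝒜 0 (H.φ S) := by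
  have h1 := Deg.contr X.internal H.p_mem H.deg hS.ml hS.deg
  rw [neg_add_cancel] at h1
  refine Deg.sub (fun l => H.p_mem _ _ (h1 l)) fun l => ?_
  rw [add_zero]
  exact H.deg _ _ (hS.deg l)

theorem IsSource.φ_low (hS : H.IsSource S) (l : List A) (hl : l.length < 2) : H.φ S l = 0 := by
  have h1 : contr X.σ H.p η S l = 0 := by
    rw [contr_congr_of_le (f' := fun _ => (0 : A)) fun w hw => hS.low w (hw.trans_lt hl),
      contr_eq_zero H.p_p H.p_η ML.zero_fun fun _ => rfl]
  rw [φ, h1, hS.low l hl, map_zero, map_zero, sub_zero]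

theorem IsSource.ρ_ml (hS : H.IsSource S) : ML (H.ρ S) := (hS.ml.comp_map H.p).map H.p

theorem IsSource.ρ_deg (hS : H.IsSource S) : Deg 𝒜 𝒜 1 (H.ρ S) := by
  have h1 : Deg 𝒜 𝒜 0 (lin H.p) := Deg.lin fun g x hx => by simpa using H.p_mem _ x hx
  intro l
  have h2 := hS.deg.comp h1 l
  rw [comp_lin_right hS.ml] at h2
  exact H.p_mem _ _ h2

theorem IsSource.ρ_low (hS : H.IsSource S) (l : List A) (hl : l.length < 2) : H.ρ S l = 0 := by
  rw [ρ, hS.low _ (by simpa using hl), map_zero]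

theorem IsSource.source (hS : H.IsSource S) : H.IsSource (H.source S) where
  ml := (X.ml.tail.comp ((ML.lin _).fun_add hS.φ_ml)).fun_sub (hS.φ_ml.cod hS.ρ_ml)
  deg := by
    have h1 : Deg 𝒜 𝒜 0 (lin (LinearMap.id : A →ₗ[ℂ] A)) := Deg.lin fun g x hx => by simpa using hx
    exact (X.deg.tail.comp (h1.add hS.φ_deg)).sub ((hS.φ_deg.cod (parity_mem X.internal) hS.ρ_deg).congr (add_zero 1))
  low l hl := by
    match l, hl with
    | [], _ => simp [Homotopy.source, tail]
    | [a], _ => simp [Homotopy.source, tail, comp_cons, cod_cons, hS.φ_low H [_]]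

/-- `tail X.ser` uses at least two blocks, so `φ` enters there on shorter words. In the other term
`ρ` starts in arity two and so does `φ`: a block of full length would leave `φ` with a single input,
where it vanishes. -/
theorem source_congr {S T : List A → A} (hS : H.IsSource S) (hT : H.IsSource T) {n : ℕ}
    (h : ∀ l : List A, l.length < n → S l = T l) (l : List A) (hl : l.length = n) :
    H.source S l = H.source T l := by
  have hφ : ∀ l : List A, l.length < n → H.φ S l = H.φ T l := fun l hl => by
    rw [φ, φ, h l hl, contr_congr_of_le fun w hw => h w (hw.trans_lt hl)]
  have e1 : comp (tail X.ser) (fun b => lin LinearMap.id b + H.φ S b) l =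
      comp (tail X.ser) (fun b => lin LinearMap.id b + H.φ T b) l :=
    comp_congr_right_of_tail (by simp [tail]) fun b _ hb => by rw [hφ b (hl ▸ hb)]
  rw [source, source, e1]
  congr 1
  rw [cod_eq_dsum, cod_eq_dsum]
  refine dsum_congr fun u t e => dsum₁_congr fun b v hb e' => ?_
  have hlen : u.length + (b.length + v.length) = n := by
    rw [← hl, ← e, ← e']; simp
  have hb1 := List.length_pos_iff.2 hb
  by_cases h1 : b.length < 2
  · rw [hS.ρ_low H b h1, hT.ρ_low H b h1, hS.φ_ml.zero, hT.φ_ml.zero]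
  by_cases h2 : b.length < n
  · have : H.ρ S b = H.ρ T b := by rw [ρ, ρ, h _ (by simpa using h2)]
    rw [this]
    exact hφ _ (by simp; omega)
  · have h3 : ∀ x : A, (u.map X.σ ++ x :: v).length < 2 := fun x => by simp; omega
    rw [hS.φ_low H _ (h3 _), hT.φ_low H _ (h3 _)]

theorem exists_source : ∃ S, H.source S = S ∧ H.IsSource S := by
  refine exists_fixedPoint_of H.IsSource ⟨ML.zero_fun, Deg.zero, fun _ _ => rfl⟩ (fun f hf => ?_) _
    (fun S hS => hS.source) fun S T n hS hT h l hl => H.source_congr hS hT h l hl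
  refine ⟨ML.of_length fun n => ?_, Deg.of_length fun n => ?_, fun l hl => ?_⟩
  · obtain ⟨g, hg, e⟩ := hf n; exact ⟨g, hg.ml, e⟩
  · obtain ⟨g, hg, e⟩ := hf n; exact ⟨g, hg.deg, e⟩
  · obtain ⟨g, hg, e⟩ := hf 2; rw [e l hl.le, hg.low l hl]

/-- The transferred structure with source term `S`. -/
def rt (S : List A → A) : List A → A := fun l => lin X.r₁ l + H.ρ S l

/-- The transfer isomorphism with source term `S`. -/
def Φ (S : List A → A) : List A → A := fun l => lin LinearMap.id l + H.φ S l

theorem r₁_lin (l : List A) : X.r₁ (lin X.r₁ l) = 0 := by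
  match l with
  | [] => simp
  | [a] => simp [X.r₁_r₁]
  | a :: a' :: b => simp

theorem IsSource.cod_d_ρ (hS : H.IsSource S) (l : List A) : cod X.σ (lin X.r₁) (H.ρ S) l = 0 := by
  rw [cod_eq_dsum]
  refine dsum_eq_zero fun u t _ => dsum₁_eq_zero fun c v hc _ => ?_
  have e4 : H.p (lin X.r₁ c) = 0 := by
    match c, hc with
    | [a], _ => exact H.p_d a
    | a :: a' :: b, _ => simp
  rw [ρ, List.map_append, List.map_cons, e4, hS.ml.zero, map_zero]

theorem cod_d_d {f : List A → W} (hf : ML f) (l : List A) :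
    cod X.σ (lin X.r₁) (cod X.σ (lin X.r₁) f) l = 0 :=
  cod_cod_self (fun b => lin_map_σ X.σ_r₁ b) hf fun b hb _ => by
    rw [cod_lin_left _ _ _ hb, r₁_lin]

theorem IsSource.rt_ml (hS : H.IsSource S) : ML (H.rt S) := (ML.lin _).fun_add hS.ρ_ml
theorem IsSource.rt_deg (hS : H.IsSource S) : Deg 𝒜 𝒜 1 (H.rt S) :=
  Deg.add (Deg.lin fun _ _ hx => X.r₁_mem hx) hS.ρ_deg
theorem IsSource.Φ_ml (hS : H.IsSource S) : ML (H.Φ S) := (ML.lin _).fun_add hS.φ_ml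
theorem IsSource.Φ_deg (hS : H.IsSource S) : Deg 𝒜 𝒜 0 (H.Φ S) :=
  Deg.add (Deg.lin fun g x hx => by simpa using hx) hS.φ_deg
theorem IsSource.Φ_singleton (hS : H.IsSource S) (a : A) : H.Φ S [a] = a := by
  simp [Φ, hS.φ_low H [a]]
theorem IsSource.Φ_nil (hS : H.IsSource S) : H.Φ S [] = 0 := by simp [Φ, hS.φ_low H []]

theorem IsSource.rt_rt (hS : H.IsSource S) {l : List A} (hl : l ≠ []) :
    cod X.σ (H.rt S) (H.rt S) l = cod X.σ (H.ρ S) (H.ρ S) l := by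
  have h1 : cod X.σ (H.rt S) (H.rt S) l =
      cod X.σ (H.rt S) (lin X.r₁) l + cod X.σ (H.rt S) (H.ρ S) l := cod_add _ _ _ _ _
  have h2 : cod X.σ (H.rt S) (H.ρ S) l =
      cod X.σ (lin X.r₁) (H.ρ S) l + cod X.σ (H.ρ S) (H.ρ S) l := cod_op_add _ _ hS.ρ_ml _
  rw [h1, h2, cod_lin_left _ _ _ hl, hS.cod_d_ρ, rt, map_add, r₁_lin, ρ, H.d_p]
  simp

/-- For a fixed point, `S` collects all nonlinear terms of the morphism equation for `Φ = id + φ`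
and the structure `r₁ + ρ`, apart from `ρ` itself. The remaining equation is linear in `φ`: its
differential has to equal `ρ - S`. The choices `φ = p (contr S) - η S` and `ρ = p S p` are made to
solve it. -/
theorem IsSource.defect (hS : H.IsSource S) (hfix : H.source S = S) {l : List A} (hl : l ≠ []) :
    comp X.ser (H.Φ S) l - cod X.σ (H.rt S) (H.Φ S) l =
      X.r₁ (H.φ S l) - cod X.σ (lin X.r₁) (H.φ S) l + S l - H.ρ S l := by
  have h1 : S l = comp (tail X.ser) (H.Φ S) l - cod X.σ (H.ρ S) (H.φ S) l := by
    conv_lhs => rw [← hfix]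
    rfl
  have h2 : cod X.σ (H.rt S) (H.Φ S) l =
      cod X.σ (lin X.r₁) (H.Φ S) l + cod X.σ (H.ρ S) (H.Φ S) l := cod_op_add _ _ hS.Φ_ml _
  have h3 : ∀ r : List A → A, cod X.σ r (H.Φ S) l = r l + cod X.σ r (H.φ S) l := fun r => by
    rw [show cod X.σ r (H.Φ S) l = _ from cod_add _ _ _ _ _, cod_lin_left _ _ _ hl]; rfl
  have h4 : X.r₁ (lin LinearMap.id l) = lin X.r₁ l := by
    match l with
    | [] => simp
    | [a] => simp
    | a :: a' :: b => simp
  rw [comp_eq_add_tail X.ml _ hl, h2, h3, h3, h1, ← X.r₁_apply, Φ, map_add, h4]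
  abel

/-- The defect `E` of the morphism equation and the square `V` of the new structure are treated
together. A Bianchi identity expresses `V` by the differential of `E`; together with
`IsSource.defect` it computes `D S`, which is what the contraction identity needs to show `E = 0`.
Then `V = 0` follows. -/
theorem IsSource.transfer_step (hS : H.IsSource S) (hfix : H.source S = S) {n : ℕ} (hn : n ≠ 0)
    (ih : ∀ l : List A, l.length < n → comp X.ser (H.Φ S) l = cod X.σ (H.rt S) (H.Φ S) l ∧
      cod X.σ (H.rt S) (H.rt S) l = 0) (l : List A) (hl : l.length = n) :
    comp X.ser (H.Φ S) l = cod X.σ (H.rt S) (H.Φ S) l ∧ cod X.σ (H.rt S) (H.rt S) l = 0 := by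
  let D := fun (f : List A → A) => cod X.σ (lin X.r₁) f
  let E : List A → A := fun l => comp X.ser (H.Φ S) l - cod X.σ (H.rt S) (H.Φ S) l
  let V : List A → A := cod X.σ (H.rt S) (H.rt S)
  have ne : ∀ l : List A, l.length = n → l ≠ [] := fun l hl h => hn (by rw [← hl, h]; rfl)
  have hE : ML E := (X.ml.comp hS.Φ_ml).fun_sub (hS.Φ_ml.cod hS.rt_ml)
  have hV : ML V := hS.rt_ml.cod hS.rt_ml
  have hE0 : ∀ l : List A, l.length < n → E l = 0 := fun l hl => sub_eq_zero.2 (ih l hl).1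
  -- Bianchi identity: apply the new coderivation to the morphism equation. Lower defects vanish, so
  -- on words of length `n` only the linear part `r₁` acts on `E`.
  have key1 : ∀ l : List A, l.length = n → X.r₁ (E l) + D E l = - V l := by
    intro l hl
    have a1 : cod X.σ (H.rt S) (comp X.ser (H.Φ S)) l = - X.r₁ (E l) := by
      rw [cod_comp_eq_of_length_le X.ml
        (hS.Φ_deg.map_parity_zero X.internal X.internal hS.Φ_ml)
        (fun b _ hb => (ih b hb).1.symm) (ne l hl) hl.le, funext X.rel, comp_zero, zero_add,
        ← X.r₁_apply, ← X.r₁_apply, map_sub, neg_sub]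
    have a2 : cod X.σ (H.rt S) (cod X.σ (H.rt S) (H.Φ S)) l = V l := by
      have b1 := _root_.cod_cod (τ := LinearMap.id) (parity_parity X.internal)
        (hS.rt_deg.map_parity_odd X.internal X.internal sgn_one hS.rt_ml)
        (hS.rt_deg.map_parity_odd X.internal X.internal sgn_one hS.rt_ml) hS.Φ_ml l
      rw [cod_eq_of_lowest hS.Φ_ml (ne l hl) (fun b _ hb => by
        rw [(ih b (hl ▸ hb)).2, add_zero]), hS.Φ_singleton, ← two_smul ℂ, ← two_smul ℂ] at b1
      exact smul_right_injective _ (two_ne_zero (α := ℂ)) b1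
    have a3 : cod X.σ (H.rt S) E l = - X.r₁ (E l) - V l := by
      rw [show cod X.σ (H.rt S) E l = _ from cod_sub _ _ _ _ _, a1, a2]
    have a4 : cod X.σ (H.rt S) E l = D E l := by
      rw [show cod X.σ (H.rt S) E l = _ from cod_op_add _ _ hE _, add_eq_left, cod_eq_dsum]
      refine dsum_eq_zero fun u t e => dsum₁_eq_zero fun b v hb e' => ?_
      by_cases h1 : b.length < 2
      · rw [hS.ρ_low H b h1, hE.zero]
      · refine hE0 _ ?_
        rw [← hl, ← e, ← e']; simp; omega
    rw [← a4, a3]; abel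
  have hdef : ∀ l : List A, l.length = n →
      E l = X.r₁ (H.φ S l) - D (H.φ S) l + S l - H.ρ S l := fun l hl => hS.defect H hfix (ne l hl)
  let E' : List A → A := fun l => X.r₁ (H.φ S l) - D (H.φ S) l + S l - H.ρ S l
  have hE' : ML E' := (((hS.φ_ml.map X.r₁).fun_sub (hS.φ_ml.cod (ML.lin _))).fun_add hS.ml).fun_sub hS.ρ_ml
  -- Insert the formula for `E` in the Bianchi identity; the `φ`-terms cancel because `r₁` and `D`
  -- square to 0 and commute.
  have key2 : ∀ l : List A, l.length = n → D S l = - V l + - X.r₁ (S l) := by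
    intro l hl
    have a1 : D E l = X.r₁ (D (H.φ S) l) + D S l := by
      rw [show D E l = D E' l from cod_congr_of_length _ hE hE' fun w hw => hdef w (hw.trans hl)]
      simp only [D, E', cod_sub, cod_add, hS.cod_d_ρ, cod_d_d hS.φ_ml, sub_zero, map_cod]
    have a2 := key1 l hl
    rw [a1, hdef l hl] at a2
    simp only [map_sub, map_add, X.r₁_r₁, ρ, H.d_p] at a2
    rw [← a2]; abel
  have hC : Contraction X.σ H.p η (lin X.r₁) := by
    have := H.contraction (ρ := fun _ => 0) ML.zero_fun Deg.zero (fun _ => map_zero _) fun _ => rfl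
    simpa using this
  have hρp : ∀ l, H.ρ S (l.map H.p) = H.ρ S l := fun l => by
    rw [ρ, ρ, List.map_map]
    congr 2
    exact List.map_congr_left fun a _ => H.p_p a
  have hρρ : ∀ l, cod X.σ (H.ρ S) (H.ρ S) l = V l := fun l => by
    rcases eq_or_ne l [] with rfl | hl
    · simp [V]
    · exact (hS.rt_rt H hl).symm
  have hVp : ∀ l, V (l.map H.p) = V l := fun l => by
    rw [← hρρ, ← hρρ, ← comp_lin_right (hS.ρ_ml.cod hS.ρ_ml), ← cod_comp_of_eq hS.ρ_ml (σ := X.σ)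
      (r := H.ρ S) (fun b => ?_) fun b hb => ?_]
    · exact cod_congr fun w _ _ => by rw [comp_lin_right hS.ρ_ml, hρp]
    · match b with
      | [] => simp
      | [a] => simp [H.p_σ]
      | a :: a' :: b => simp
    · rw [cod_lin_left _ _ _ hb, comp_lin_right hS.ρ_ml, hρp, ρ, H.p_p]
  have hpV : ∀ l, H.p (V l) = V l := fun l => by
    rw [← hρρ, map_cod]
    simp only [ρ, H.p_p]
    rfl
  -- `V` depends only on harmonic inputs and `p r₁ = 0`, so `p (contr (D S)) = 0` by `key2`. The
  -- contraction identity then evaluates `D φ`, and what remains is `S - r₁ η S - η r₁ S - p S`,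
  -- which is 0 by the definition of `p`.
  have hE1 : ∀ l : List A, l.length = n → E l = 0 := by
    intro l hl
    have a1 : D (H.φ S) l = H.p (D (contr X.σ H.p η S) l) - η (D S l) := by
      rw [map_cod, map_cod]
      exact cod_sub _ _ _ _ _
    have a2 : H.p (contr X.σ H.p η (D S) l) = 0 := by
      rw [contr_congr (hS.ml.cod (ML.lin _)) (hV.fun_neg.fun_add (hS.ml.map X.r₁).fun_neg)
        fun w hw => key2 w (hw.trans hl), contr_add, contr_eq_zero H.p_p H.p_η hV.fun_neg
        (fun l => by rw [hVp]), zero_add, contr_map]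
      simp only [map_neg, H.p_d, neg_zero]
      exact contr_eq_zero H.p_p H.p_η ML.zero_fun (fun _ => rfl) _
    have a3 := congrArg H.p (hC.contr_cod hS.ml l)
    rw [map_add, a2, zero_add, map_sub] at a3
    rw [hdef l hl, a1, a3, key2 l hl, φ, map_sub, H.d_p, ρ, map_add, map_neg, map_neg, ← hpV, H.η_p,
      H.p_apply (S l)]
    abel
  refine ⟨sub_eq_zero.1 (hE1 l hl), ?_⟩
  have := key1 l hl
  rw [hE1 l hl, map_zero, zero_add, show D E l = D (fun _ => 0) l from
    cod_congr_of_length _ hE ML.zero_fun fun w hw => hE1 w (hw.trans hl)] at this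
  simpa [D] using this

end AInf.Homotopy
end Transfer
end

noncomputable section

/-! ### Minimal models on cohomology -/

section Hub

variable {m : ℕ} {A C : Type*} [AddCommGroup A] [Module ℂ A]
  [AddCommGroup C] [Module ℂ C] {𝒜 : ZMod m → Submodule ℂ A} {𝒞 : ZMod m → Submodule ℂ C}

theorem isInternal_of_retract (h : DirectSum.IsInternal 𝒜) (ι : C →ₗ[ℂ] A) (π : A →ₗ[ℂ] C)
    (hπι : ∀ x, π (ι x) = x) (hι : ∀ g, ∀ x ∈ 𝒞 g, ι x ∈ 𝒜 g) (hπ : ∀ g, ∀ x ∈ 𝒜 g, π x ∈ 𝒞 g) :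
    DirectSum.IsInternal 𝒞 := by
  refine (DirectSum.isInternal_submodule_iff_iSupIndep_and_iSup_eq_top _).2 ⟨fun g => ?_, ?_⟩
  · rw [Submodule.disjoint_def]
    intro x hx hx'
    have h1 := Submodule.mem_map_of_mem (f := ι) hx'
    simp only [Submodule.map_iSup] at h1
    have h2 : ι x ∈ ⨆ j, ⨆ (_ : j ≠ g), 𝒜 j :=
      (iSup₂_mono fun j _ => Submodule.map_le_iff_le_comap.2 fun y hy => hι j y hy) h1
    have h3 := Submodule.disjoint_def.1 (h.submodule_iSupIndep g) _ (hι g x hx) h2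
    rw [← hπι x, h3, map_zero]
  · rw [eq_top_iff]
    intro x _
    have h1 : ι x ∈ ⨆ g, 𝒜 g := by rw [h.submodule_iSup_eq_top]; trivial
    have h2 := Submodule.mem_map_of_mem (f := π) h1
    rw [Submodule.map_iSup, hπι] at h2
    exact (iSup_mono fun j => Submodule.map_le_iff_le_comap.2 fun y hy => hπ j y hy) h2

variable [hm : Fact (m = 0 ∨ m = 2)] {X : AInf 𝒜} {η : A →ₗ[ℂ] A}

namespace AInf.Homotopy

/-- Strong induction on word length with `transfer_step`. The model stays on `A`, as `r₁` plus
operations on harmonic elements, so that its comparison with `X` is an isomorphism and its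
comparison with cohomology is strict. -/
theorem exists_transfer (H : X.Homotopy η) : ∃ (Z : AInf 𝒜) (ρ : List A → A) (F : AInfHom Z X),
    ML ρ ∧ Deg 𝒜 𝒜 1 ρ ∧ (∀ l : List A, l.length < 2 → ρ l = 0) ∧ (∀ l, H.p (ρ l) = ρ l) ∧
      (∀ l, ρ (l.map H.p) = ρ l) ∧ (∀ l, Z.ser l = lin X.r₁ l + ρ l) ∧ F.F₁ = LinearMap.id := by
  obtain ⟨S, hfix, hS⟩ := H.exists_source
  have key : ∀ n, ∀ l : List A, l.length = n → comp X.ser (H.Φ S) l = cod X.σ (H.rt S) (H.Φ S) l ∧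
      cod X.σ (H.rt S) (H.rt S) l = 0 := by
    intro n
    induction n using Nat.strong_induction_on with
    | h n ih =>
      rcases eq_or_ne n 0 with rfl | hn
      · intro l hl
        obtain rfl := List.length_eq_zero_iff.1 hl
        simp
      · exact hS.transfer_step H hfix hn fun l hl => ih _ hl l rfl
  let Z : AInf 𝒜 := AInf.ofSer X.internal hS.rt_ml (by simp [rt, hS.ρ_low H []]) hS.rt_deg
    fun l => (key _ l rfl).2
  have hZ : Z.ser = H.rt S := AInf.ser_ofSer _ _ _ _ _
  let F : AInfHom Z X := AInfHom.ofSer hS.Φ_ml (hS.Φ_nil H) hS.Φ_deg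
    fun l _ => by rw [hZ]; exact (key _ l rfl).1.symm
  have hF : F.ser = H.Φ S := AInfHom.ser_ofSer _ _ _ _
  refine ⟨Z, H.ρ S, F, hS.ρ_ml, hS.ρ_deg, hS.ρ_low H, fun l => H.p_p _, fun l => ?_,
    fun l => by rw [hZ]; rfl, LinearMap.ext fun a => ?_⟩
  · rw [ρ, ρ, List.map_map]
    congr 2
    exact List.map_congr_left fun a _ => H.p_p a
  · rw [F.F₁_apply, hF, hS.Φ_singleton]; rfl

/-- The inclusion of cohomology as the harmonic elements. -/
def incl (H : X.Homotopy η) : X.Coh →ₗ[ℂ] A :=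
  Submodule.liftQ _ (H.p ∘ₗ (LinearMap.ker X.r₁).subtype) fun x hx => by
    obtain ⟨y, hy⟩ := hx
    change H.p (x : A) = 0
    rw [show (x : A) = X.r₁ y from hy.symm, H.p_d]

/-- The projection to cohomology along the harmonic decomposition. -/
def retr (H : X.Homotopy η) : A →ₗ[ℂ] X.Coh :=
  Submodule.mkQ _ ∘ₗ H.p.codRestrict (LinearMap.ker X.r₁) fun x => H.d_p x

variable (H : X.Homotopy η)

theorem incl_cls (x : A) (hx : X.r₁ x = 0) : H.incl (X.cls x hx) = H.p x := rfl

theorem retr_apply (x : A) : H.retr x = X.cls (H.p x) (H.d_p x) := rfl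

theorem exists_cls (c : X.Coh) : ∃ (x : A) (hx : X.r₁ x = 0), X.cls x hx = c := by
  obtain ⟨x, rfl⟩ := Submodule.Quotient.mk_surjective _ c
  exact ⟨x, x.2, rfl⟩

theorem cls_eq_iff {x y : A} (hx : X.r₁ x = 0) (hy : X.r₁ y = 0) :
    X.cls x hx = X.cls y hy ↔ ∃ z, X.r₁ z = x - y := by
  rw [AInf.cls, AInf.cls, Submodule.Quotient.eq]
  rfl

theorem incl_retr (x : A) : H.incl (H.retr x) = H.p x := by
  rw [retr_apply, incl_cls, H.p_p]

theorem retr_incl (c : X.Coh) : H.retr (H.incl c) = c := by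
  obtain ⟨x, hx, rfl⟩ := exists_cls c
  rw [incl_cls, retr_apply, cls_eq_iff]
  refine ⟨- η x, ?_⟩
  rw [H.p_p, p_apply, hx]; simp

theorem incl_mem (g : ZMod m) (c : X.Coh) (hc : c ∈ X.cohGrading g) : H.incl c ∈ 𝒜 g := by
  obtain ⟨x, hx, rfl⟩ := hc
  exact H.p_mem _ _ hx

theorem retr_mem (g : ZMod m) (x : A) (hx : x ∈ 𝒜 g) : H.retr x ∈ X.cohGrading g :=
  ⟨⟨H.p x, H.d_p x⟩, H.p_mem _ _ hx, rfl⟩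

theorem cohGrading_internal (H : X.Homotopy η) : DirectSum.IsInternal X.cohGrading :=
  isInternal_of_retract X.internal H.incl H.retr H.retr_incl H.incl_mem H.retr_mem

theorem d_incl (c : X.Coh) : X.r₁ (H.incl c) = 0 := by
  obtain ⟨x, hx, rfl⟩ := exists_cls c
  rw [incl_cls, H.d_p]

theorem retr_d (x : A) : H.retr (X.r₁ x) = 0 := by
  rw [← H.retr_incl (H.retr (X.r₁ x)), H.incl_retr, H.p_d, map_zero]

end AInf.Homotopy

/-- Every `A_∞`-algebra has a minimal model on its cohomology, and the inclusion of the model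
is invertible up to homotopy as far as closed `2`-forms are concerned. -/
theorem AInf.exists_minimalModel (X : AInf 𝒜) : ∃ (Y : AInf X.cohGrading) (F : AInfHom Y X)
    (G : AInfHom X Y), Y.Minimal ∧ F.IsQuasiIso ∧ comp G.ser F.ser = lin LinearMap.id ∧
      ∀ (k : ZMod m) (w : List A → ℂ), Good 𝒜 k w → (∀ l, cod X.σ X.ser w l = 0) →
        ∃ u, Good 𝒜 (k - 1) u ∧
          ∀ l, comp (comp w F.ser) G.ser l = w l + cod X.σ X.ser u l := by
  obtain ⟨η, H⟩ := X.exists_homotopy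
  obtain ⟨Z, ρ, Φ, hρ, hρd, hlow, hpρ, hρp, hZ, hΦ⟩ := H.exists_transfer
  have hc := H.cohGrading_internal
  have hdρ : ∀ l, X.r₁ (ρ l) = 0 := fun l => by rw [← hpρ, H.d_p]
  have hιd : Deg X.cohGrading 𝒜 0 (lin H.incl) :=
    Deg.lin fun g x hx => by simpa using H.incl_mem _ x hx
  have hιpr : ∀ l : List A, (l.map H.retr).map H.incl = l.map H.p := fun l => by
    rw [List.map_map]; exact List.map_congr_left fun a _ => H.incl_retr a
  let r₀ : List X.Coh → X.Coh := fun l => H.retr (ρ (l.map H.incl))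
  have hr₀ : ML r₀ := (hρ.comp_map _).map _
  have hιr₀ : ∀ l : List X.Coh, H.incl (r₀ l) = ρ (l.map H.incl) := fun l => by
    rw [H.incl_retr, hpρ]
  have hZι : ∀ l : List X.Coh, Z.ser (l.map H.incl) = ρ (l.map H.incl) := fun l => by
    rw [hZ, add_eq_right]
    match l with
    | [] => simp
    | [a] => simp [H.d_incl]
    | a :: a' :: b => simp
  have hσι : ∀ b : List X.Coh, lin H.incl (b.map (parity hc)) = Z.σ (lin H.incl b) :=
    hιd.map_parity_zero hc Z.internal (ML.lin _)
  -- As `r₁ ρ = 0` and `r₁ r₁ = 0`, the relation for `Z` reduces to the vanishing of its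
  -- coderivation on `ρ`; this restricts to the harmonic elements.
  have hrel : ∀ l, cod (parity hc) r₀ r₀ l = 0 := fun l => by
    have h1 : ∀ l, cod Z.σ Z.ser ρ l = 0 := fun l => by
      rcases eq_or_ne l [] with rfl | hl
      · simp
      have h2 := Z.rel l
      rw [show cod Z.σ Z.ser Z.ser l = cod Z.σ Z.ser (fun l => lin X.r₁ l + ρ l) l from
        cod_congr fun w _ _ => hZ w, cod_add, cod_lin_left _ _ _ hl, hZ, map_add,
        AInf.Homotopy.r₁_lin, hdρ, add_zero, zero_add] at h2
      exact h2
    have h2 : ∀ l, cod (parity hc) r₀ (comp ρ (lin H.incl)) l = comp (cod Z.σ Z.ser ρ) (lin H.incl) l :=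
      cod_comp_of_eq hρ hσι fun b hb => by
        rw [cod_lin_left _ _ _ hb, comp_lin_right Z.ml, hιr₀, hZι]
    rw [funext h1, show comp ρ (lin H.incl) = _ from funext (comp_lin_right hρ _)] at h2
    rw [show cod (parity hc) r₀ r₀ l = _ from (map_cod H.retr _ _ _ _).symm, h2, comp_zero, map_zero]
  have hr₀d : Deg X.cohGrading X.cohGrading 1 r₀ := fun l => by
    have h1 := hρd.comp hιd l
    rw [comp_lin_right hρ] at h1
    exact H.retr_mem _ _ h1
  let Y : AInf X.cohGrading := AInf.ofSer hc hr₀ (by simp [r₀, hlow]) hr₀d hrel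
  have hY : Y.ser = r₀ := AInf.ser_ofSer _ _ _ _ _
  let I : AInfHom Y Z := AInfHom.strict H.incl H.incl_mem fun l _ => by rw [hY, hιr₀, hZι]
  let P : AInfHom Z Y := AInfHom.strict H.retr H.retr_mem fun l _ => by
    have h1 : H.retr (lin X.r₁ l) = 0 := by
      match l with
      | [] => simp
      | [a] => simp [H.retr_d]
      | a :: a' :: b => simp
    rw [hY, hZ, map_add, h1, zero_add]
    simp only [r₀, hιpr, hρp]
  have hI : I.ser = lin H.incl := AInfHom.ser_strict _ _ _
  have hP : P.ser = lin H.retr := AInfHom.ser_strict _ _ _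
  obtain ⟨Ψ, -, hΦΨ, hΨΦ⟩ := Φ.exists_symm (by
    rw [AInfHom.IsIso, hΦ]; exact Function.bijective_id)
  refine ⟨Y, I.trans Φ, Ψ.trans P, LinearMap.ext fun c => ?_, ?_, ?_, fun k w hw hcl => ?_⟩
  · rw [Y.r₁_apply, hY]
    simp [r₀, hlow]
  · have h1 : ∀ c, (I.trans Φ).F₁ c = H.incl c := fun c => by
      rw [AInfHom.trans_F₁, hΦ, I.F₁_apply, hI]; rfl
    constructor
    · rintro c - ⟨y, hy⟩
      refine ⟨0, ?_⟩
      rw [h1] at hy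
      rw [map_zero, ← H.retr_incl c, ← hy, H.retr_d]
    · intro y hy
      refine ⟨H.retr y, ?_, η y, ?_⟩
      · rw [Y.r₁_apply, hY]; simp [r₀, hlow]
      · rw [h1, H.incl_retr, H.p_apply, hy]; simp
  · rw [AInfHom.ser_trans, AInfHom.ser_trans]
    funext l
    rw [comp_assoc P.ml, ← funext (comp_assoc Ψ.ml _ _), hΨΦ, hP, hI]
    have h1 : comp (lin LinearMap.id) (lin H.incl) = lin H.incl := funext fun l => by
      rw [comp_lin_right (ML.lin _)]
      match l with
      | [] => simp
      | [a] => simp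
      | a :: a' :: b => simp
    rw [h1, comp_lin_right (ML.lin _)]
    match l with
    | [] => simp
    | [a] => simp [H.retr_incl]
    | a :: a' :: b => simp
  · let w' := comp w Φ.ser
    have hw' : Good 𝒜 k w' := hw.comp Φ.ml Φ.deg
    have hcl' : ∀ l, cod Z.σ Z.ser w' l = 0 := fun l => by
      rw [Φ.cod_comp hw.ml, funext hcl, comp_zero]
    have hC := H.contraction hρ hρd hpρ hρp
    rw [← funext hZ] at hC
    let u' := contr X.σ H.p η w'
    have hu' : Good 𝒜 (k - 1) u' := hw'.contr X.internal H.p_mem H.deg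
    -- Closedness of `w'` removes the first term of the contraction identity, so `w'` differs from
    -- its harmonic restriction by a coboundary.
    have e1 : ∀ l, cod Z.σ Z.ser u' l = w' l - w' (l.map H.p) := fun l => by
      have h1 := hC.contr_cod hw'.ml l
      rw [show cod X.σ Z.ser w' = _ from funext hcl', contr_eq_zero H.p_p H.p_η ML.zero_fun fun _ => rfl,
        zero_add] at h1
      exact h1
    -- The primitive is carried back from `Z` to `X` by the inverse `Ψ` of the transfer isomorphism.
    refine ⟨fun l => - comp u' Ψ.ser l, (hu'.comp Ψ.ml Ψ.deg).neg, fun l => ?_⟩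
    have e2 : ∀ l, comp w' Ψ.ser l = w l := fun l => by
      rw [comp_assoc hw.ml, hΦΨ, comp_lin_id hw.ml]
    rw [cod_neg, Ψ.cod_comp hu'.ml, funext e1, comp_sub, e2, Ψ.comp_trans P (hw.ml.comp (I.trans Φ).ml),
      hP]
    rw [neg_sub, add_sub_cancel]
    congr 1
    funext l
    rw [comp_lin_right (hw.ml.comp (I.trans Φ).ml), I.comp_trans Φ hw.ml, hI, comp_lin_right hw'.ml, hιpr]

end Hub
end

noncomputable section

/-! ### Inverting a non-degenerate pairing on series -/

section Solve

variable {m : ℕ} {A W : Type*} [AddCommGroup A] [Module ℂ A] [AddCommGroup W] [Module ℂ W]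
  {𝒜 : ZMod m → Submodule ℂ A}

theorem extend_congr (h : DirectSum.IsInternal 𝒜) {f f' : List (Letter 𝒜) → W} {l : List A}
    (e : ∀ w, w.length = l.length → f w = f' w) : extend h f l = extend h f' l := by
  classical
  induction l generalizing f f' with
  | nil => exact e [] rfl
  | cons a l ih =>
    rw [extend, extend]
    refine Finset.sum_congr rfl fun g _ => ih fun w hw => e _ (by simp [hw])

/-- The bilinear form `β` has tilde degree `k` in the coordinates. -/
def DegB (𝒜 : ZMod m → Submodule ℂ A) (k : ZMod m) (β : A →ₗ[ℂ] A →ₗ[ℂ] ℂ) : Prop :=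
  ∀ a b : Letter 𝒜, β a.2 b.2 ≠ 0 → a.1 + b.1 = -k

/-- Degree by degree: a homogeneous component of `y` pairs only with the complementary degree, and
there its pairings agree with those of `y`. -/
theorem NonDeg.eq_zero (h : DirectSum.IsInternal 𝒜) {k : ZMod m} {β : A →ₗ[ℂ] A →ₗ[ℂ] ℂ}
    (hβ : NonDeg 𝒜 k β) (hd : DegB 𝒜 k β) {y : A} (hy : ∀ x, β y x = 0) : y = 0 := by
  have h1 : ∀ g : ZMod m, proj h g y = 0 := by
    intro g
    have hmem : proj h g y ∈ 𝒜 (g - 1 + 1) := by rw [sub_add_cancel]; exact proj_mem h g y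
    have h2 := (hβ (g - 1) (-k - (g - 1)) (by abel)).1
    have h3 := @h2 ⟨proj h g y, hmem⟩ 0 (LinearMap.ext fun x => ?_)
    · exact congrArg Subtype.val h3
    · change β (proj h g y) x = β ((0 : 𝒜 (g - 1 + 1)) : A) x
      rw [ZeroMemClass.coe_zero, map_zero, LinearMap.zero_apply]
      have h4 : β.flip x ∘ₗ proj h g = β.flip x := linearMap_ext h fun a => by
        simp only [LinearMap.comp_apply, LinearMap.flip_apply]
        by_cases hg : a.1 + 1 = g
        · rw [proj_of_mem h (by rw [← hg]; exact a.2.2)]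
        · rw [proj_of_ne h hg a.2.2, map_zero, LinearMap.zero_apply]
          by_contra hne
          have := hd a ⟨_, x⟩ (Ne.symm hne)
          simp only at this
          refine hg ?_
          rw [← eq_sub_iff_add_eq] at this
          rw [this]; ring
      have := congrArg (fun φ : A →ₗ[ℂ] ℂ => φ y) h4
      simp only [LinearMap.comp_apply, LinearMap.flip_apply] at this
      rw [this, hy]
  have h2 : decomp h y = 0 := by
    have key : ∀ g, (DirectSum.component ℂ (ZMod m) (fun g => 𝒜 g) g (decomp h y) : A) = proj h g y := by
      intro g
      have : (𝒜 g).subtype ∘ₗ DirectSum.component ℂ (ZMod m) (fun g => 𝒜 g) g ∘ₗ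
          (decomp h).toLinearMap = proj h g := linearMap_ext h fun a => by
        simp only [LinearMap.comp_apply, LinearEquiv.coe_coe, decomp_coe, Submodule.subtype_apply]
        by_cases hg : a.1 + 1 = g
        · subst hg
          rw [DirectSum.component.lof_self, proj_of_mem h a.2.2]
        · rw [DirectSum.component.of, dif_neg hg, proj_of_ne h hg a.2.2]; rfl
      exact congrArg (fun φ : A →ₗ[ℂ] _ => φ y) this
    refine DirectSum.ext_component ℂ fun g => Subtype.ext ?_
    rw [key, h1, map_zero]; rfl
  simpa using h2

/-- The series whose values `y` at words `l` solve `β y x = T (l x)`. -/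
def solve (β : A →ₗ[ℂ] A →ₗ[ℂ] ℂ) (T : List A → ℂ) (l : List A) : A :=
  Classical.epsilon fun y => ∀ x, β y x = T (l ++ [x])

/-- Choosing the value pointwise by `epsilon` makes this locality immediate, as the recursions
require. Multilinearity and homogeneity are recovered afterwards from uniqueness, in `solve_eq`. -/
theorem solve_congr (β : A →ₗ[ℂ] A →ₗ[ℂ] ℂ) {T T' : List A → ℂ} {l : List A}
    (h : ∀ w, w.length = l.length + 1 → T w = T' w) : solve β T l = solve β T' l := by
  have : ∀ x, T (l ++ [x]) = T' (l ++ [x]) := fun x => h _ (by simp)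
  simp only [solve, this]

theorem exists_solve (h : DirectSum.IsInternal 𝒜) {k e : ZMod m} {β : A →ₗ[ℂ] A →ₗ[ℂ] ℂ}
    (hβ : NonDeg 𝒜 k β) (hd : DegB 𝒜 k β) {T : List A → ℂ} (hT : ML T) (hTd : DegF 𝒜 (k + e) T) :
    ∃ G : List A → A, ML G ∧ Deg 𝒜 𝒜 e G ∧ ∀ l x, β (G l) x = T (l ++ [x]) := by
  have h1 : ∀ l : List (Letter 𝒜), ∃ y : A, y ∈ 𝒜 (tdeg l + e + 1) ∧
      ∀ x, β y x = T (coeW l ++ [x]) := by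
    intro l
    let φ := hT.slot (coeW l) []
    obtain ⟨y, hy⟩ := (hβ (tdeg l + e) (-k - (tdeg l + e)) (by abel)).2
      (φ ∘ₗ (𝒜 _).subtype)
    refine ⟨y, y.2, fun x => ?_⟩
    have h2 : β (y : A) = φ := linearMap_ext h fun a => by
      by_cases ha : a.1 = -k - (tdeg l + e)
      · obtain ⟨a, x⟩ := a
        simp only at ha
        subst ha
        exact congrArg (fun ψ : _ →ₗ[ℂ] ℂ => ψ x) hy
      · have e1 : β (y : A) a.2 = 0 := by
          by_contra hne
          refine ha ?_
          rw [← hd ⟨_, y⟩ a hne]; simp only; abel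
        have e2 : φ a.2 = 0 := by
          by_contra hne
          have := hTd (l ++ [a]) (by simpa [φ, ML.slot_apply] using hne)
          rw [tdeg_append, tdeg_singleton] at this
          refine ha ?_
          have h3 : a.1 = -(k + e) - tdeg l := by rw [← this]; abel
          rw [h3]; abel
        rw [e1, e2]
    rw [h2]; rfl
  choose G hG hG' using h1
  have hlin : SlotLinear (LetterRel 𝒜) G := by
    intro c x y z hR u v
    refine sub_eq_zero.1 (hβ.eq_zero h hd fun t => ?_)
    have h2 := hT.letterRel c x y z hR
    rw [map_sub, map_add, map_smul, LinearMap.sub_apply, LinearMap.add_apply, LinearMap.smul_apply,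
      hG', hG', hG', sub_eq_zero]
    obtain ⟨g, a, b, rfl, rfl, rfl⟩ := hR
    simpa using hT.smul_add (coeW u) (coeW v ++ [t]) c (a : A) b
  refine ⟨extend h G, ML.extend h hlin, fun l => ?_, fun l x => ?_⟩
  · rw [extend_coeW h hlin]; exact hG l
  · refine ML.ext h ((ML.extend h hlin).map (β.flip x)) (?_ : ML fun l => T (l ++ [x])) (fun l => ?_) l
    · exact SlotLinear.append_right hT [x]
    · rw [extend_coeW h hlin]; exact hG' l x

theorem solve_eq (h : DirectSum.IsInternal 𝒜) {k e : ZMod m} {β : A →ₗ[ℂ] A →ₗ[ℂ] ℂ}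
    (hβ : NonDeg 𝒜 k β) (hd : DegB 𝒜 k β) {T : List A → ℂ} (hT : ML T) (hTd : DegF 𝒜 (k + e) T) :
    ML (solve β T) ∧ Deg 𝒜 𝒜 e (solve β T) ∧ ∀ l x, β (solve β T l) x = T (l ++ [x]) := by
  obtain ⟨G, h1, h2, h3⟩ := exists_solve h hβ hd hT hTd
  have h4 : ∀ l x, β (solve β T l) x = T (l ++ [x]) := fun l => by
    have : ∃ y, ∀ x, β y x = T (l ++ [x]) := ⟨G l, h3 l⟩
    exact Classical.epsilon_spec this
  have h5 : solve β T = G := funext fun l => sub_eq_zero.1 (hβ.eq_zero h hd fun x => by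
    rw [map_sub, LinearMap.sub_apply, h4, h3, sub_self])
  rw [h5]
  exact ⟨h1, h2, h3⟩

variable [hm : Fact (m = 0 ∨ m = 2)]

/-- A primitive of a cyclically trivial series with respect to the rotation of words. -/
def prim (h : DirectSum.IsInternal 𝒜) (y : List A → ℂ) : List A → ℂ :=
  extend h fun l => - rotW koszulL (rotPrimitive koszulL fun l => y (coeW l)) l

theorem rotW_iterate_congr {Λ : Type*} {κ : Λ → Λ → ℂ} {f g : List Λ → ℂ} {n : ℕ}
    (h : ∀ w, w.length = n → f w = g w) (i : ℕ) :
    ∀ w, w.length = n → (rotW κ)^[i] f w = (rotW κ)^[i] g w := by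
  induction i with
  | zero => exact h
  | succ i ih =>
    intro w hw
    rw [Function.iterate_succ_apply', Function.iterate_succ_apply']
    exact rotW_congr fun w' hw' => ih w' (hw'.trans hw)

theorem prim_congr (h : DirectSum.IsInternal 𝒜) {y y' : List A → ℂ} {l : List A}
    (e : ∀ w, w.length = l.length → y w = y' w) : prim h y l = prim h y' l := by
  refine extend_congr h fun w hw => ?_
  congr 1
  refine rotW_congr fun w' hw' => ?_
  rw [rotPrimitive, rotPrimitive]
  congr 1
  refine Finset.sum_congr rfl fun i _ => ?_
  rw [rotW_iterate_congr (fun w'' hw'' => e _ (by simpa using hw'')) i w' (hw'.trans hw)]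

theorem rotW_iterate_tdeg {f : List (Letter 𝒜) → ℂ} {k : ZMod m} (hf : ∀ l, f l ≠ 0 → tdeg l = -k) (i : ℕ)
    (l : List (Letter 𝒜)) (hl : tdeg l ≠ -k) : (rotW koszulL)^[i] f l = 0 := by
  induction i generalizing l with
  | zero => by_contra h'; exact hl (hf l h')
  | succ i ih =>
    rw [Function.iterate_succ_apply']
    rcases List.eq_nil_or_concat l with rfl | ⟨u, x, rfl⟩
    · exact ih [] hl
    · rw [List.concat_eq_append] at hl ⊢
      rw [rotW_concat, ih _ (by simpa [add_comm] using hl), mul_zero]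

/-- With `y = S - rot S`, the series `prim` is the summand `-rot S`. It is to be the half of `y` in
which a vector field hits the first argument of the quadratic form; `S` will be the other half. -/
theorem Good.prim_spec (h : DirectSum.IsInternal 𝒜) {k : ZMod m} {y : List A → ℂ} (hy : Good 𝒜 k y) :
    ML (prim h y) ∧ DegF 𝒜 k (prim h y) ∧ ∃ S : List (Letter 𝒜) → ℂ,
      (∀ l, prim h y (coeW l) = - rotW koszulL S l) ∧ ∀ l, S l - rotW koszulL S l = y (coeW l) := by
  let S : List (Letter 𝒜) → ℂ := rotPrimitive koszulL fun l => y (coeW l)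
  have hR : ∀ (c : ℂ) (x y z : Letter 𝒜), LetterRel 𝒜 c x y z → ∀ t : Letter 𝒜,
      (koszulL x t = koszulL z t ∧ koszulL y t = koszulL z t) ∧
      (koszulL t x = koszulL t z ∧ koszulL t y = koszulL t z) := by
    intro c x y z h t
    simp [koszulL, h.degs.1, h.degs.2]
  have hlin : SlotLinear (LetterRel 𝒜) fun l => - rotW koszulL S l := by
    have h1 : SlotLinear (LetterRel 𝒜) (rotW koszulL S) :=
      (hy.ml.letterRel.rotPrimitive (fun c x y z h t => (hR c x y z h t).1)
        fun c x y z h t => (hR c x y z h t).2).rotW (fun c x y z h t => (hR c x y z h t).1)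
        fun c x y z h t => (hR c x y z h t).2
    intro c x y z hr u v
    simp only [h1 c x y z hr u v, smul_eq_mul]
    ring
  have e : ∀ l, prim h y (coeW l) = - rotW koszulL S l := fun l => extend_coeW h hlin l
  refine ⟨ML.extend h hlin, fun l hl => ?_, S, e, fun l => rotPrimitive_sub koszulL_mul hy.nil hy.cyc l⟩
  by_contra hne
  refine hl ?_
  have hS : ∀ l, S l ≠ 0 → tdeg l = -k := fun l hl => by
    by_contra hne
    refine hl ?_
    simp only [S, rotPrimitive, rotW_iterate_tdeg hy.deg _ l hne]
    simp
  rw [e, show rotW koszulL S l = 0 from rotW_iterate_tdeg hS 1 l hne, neg_zero]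

theorem quad_cons (β : A →ₗ[ℂ] A →ₗ[ℂ] ℂ) (x : A) : (fun w => quad β (x :: w)) = lin (β x) := by
  funext w
  match w with
  | [] => rfl
  | [a] => rfl
  | a :: b :: w => rfl

theorem cod_quad (τ : A →ₗ[ℂ] A) (g : List A → A) (β : A →ₗ[ℂ] A →ₗ[ℂ] ℂ) (a : A) (l : List A) :
    cod τ g (quad β) (a :: l) =
      dsum (fun x y => lin (β (g (a :: x))) y) l + if l = [] then 0 else β (τ a) (g l) := by
  rw [cod_cons, quad_cons]
  congr 1
  · exact dsum_congr fun x y _ => congrFun (quad_cons β _) y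
  · split_ifs with hl
    · rw [hl, cod_nil]
    · rw [cod_lin_left _ _ _ hl]

theorem comp_quad {B : Type*} [AddCommGroup B] [Module ℂ B] (β : A →ₗ[ℂ] A →ₗ[ℂ] ℂ) {F : List B → A}
    (h0 : F [] = 0) (a : B) (l : List B) :
    comp (quad β) F (a :: l) = dsum (fun x y => β (F (a :: x)) (F y)) l := by
  rw [comp_cons]
  refine dsum_congr fun x y _ => ?_
  rw [quad_cons]
  rcases eq_or_ne y [] with rfl | hy
  · simp [h0]
  · rw [comp_lin_left _ _ hy]

/-- The solution `g` of `cod τ g (quad β) = y`. -/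
def sol (h : DirectSum.IsInternal 𝒜) (β : A →ₗ[ℂ] A →ₗ[ℂ] ℂ) (y : List A → ℂ) : List A → A :=
  solve β (prim h y)

theorem sol_congr (h : DirectSum.IsInternal 𝒜) (β : A →ₗ[ℂ] A →ₗ[ℂ] ℂ) {y y' : List A → ℂ} {l : List A}
    (e : ∀ w, w.length = l.length + 1 → y w = y' w) : sol h β y l = sol h β y' l :=
  solve_congr β fun _ hw => prim_congr h fun w' hw' => e w' (hw'.trans hw)

/-- The derivative of `quad β` along `g` has two terms, with `g` in the first or in the second
argument of `β`. The first is `-rot S` by construction of `g`, the second is `S` because the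
symmetry of `β` turns it into a rotation of the first; their sum is `y`. Non-degeneracy is what
allows solving for `g`. -/
theorem cod_sol (h : DirectSum.IsInternal 𝒜) {k e : ZMod m} {β : A →ₗ[ℂ] A →ₗ[ℂ] ℂ}
    (hβ : NonDeg 𝒜 k β) (hd : DegB 𝒜 k β) (hb : Good 𝒜 k (quad β)) {τ : A →ₗ[ℂ] A}
    (hτ : ∀ a : Letter 𝒜, τ a.2 = koszul e a.1 • (a.2 : A)) {y : List A → ℂ} (hy : Good 𝒜 (k + e) y) :
    ML (sol h β y) ∧ Deg 𝒜 𝒜 e (sol h β y) ∧ ∀ l, cod τ (sol h β y) (quad β) l = y l := by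
  obtain ⟨h1, h2, S, h3, h4⟩ := hy.prim_spec h
  obtain ⟨k1, k2, k3⟩ := solve_eq h hβ hd h1 h2
  refine ⟨k1, k2, ML.ext h (hb.ml.cod k1) hy.ml fun l => ?_⟩
  match l with
  | [] => simp [hy.nil]
  | [a] =>
    rw [coeW_cons, coeW_nil, cod_quad, hy.singleton h]
    simp
  | a :: c :: l =>
    obtain ⟨f, z, hfz⟩ : ∃ f z, c :: l = f ++ [z] := by
      rcases List.eq_nil_or_concat (c :: l) with h | ⟨f, z, h⟩
      · simp at h
      · exact ⟨f, z, by rw [h, List.concat_eq_append]⟩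
    have hsymm : ∀ a c : Letter 𝒜, β a.2 c.2 = - koszul a.1 c.1 * β c.2 a.2 := fun a c => by
      have := hb.cyc [a, c]
      simp [_root_.cyc, dsum_cons, kw_singleton, koszulL, quad, koszul_comm c.1] at this
      linear_combination this
    rw [← h4, coeW_cons, cod_quad, if_neg (by simp)]
    have e1 : dsum (fun x t => lin (β (sol h β y ((a.2 : A) :: x))) t) (coeW (c :: l)) =
        - rotW koszulL S (a :: c :: l) := by
      rw [hfz, coeW_append, coeW_cons, coeW_nil, dsum_concat, lin_nil, add_zero, dsum_eq_last]
      · have := k3 ((a.2 : A) :: coeW f) z.2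
        have e2 := h3 (a :: (f ++ [z]))
        simp only [coeW_cons, coeW_append, coeW_nil] at e2
        rw [← e2]
        exact this
      · intro x t _ ht
        exact lin_of_length_ne (by simpa using ht)
    -- Exchange the arguments of `β`: this is the first term on the rotated word, and `rot` brings
    -- the word back to its original order.
    have e2 : β (τ a.2) (sol h β y (coeW (c :: l))) = S (a :: c :: l) := by
      let g' : Letter 𝒜 := k2.op (c :: l)
      have e3 := hsymm a g'
      have e4 : β (g'.2 : A) a.2 = - rotW koszulL S (c :: l ++ [a]) := by
        rw [← h3, coeW_append]
        exact k3 _ _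
      rw [rotW_concat, kw_koszulL, tdeg_singleton] at e4
      rw [hτ, map_smul, LinearMap.smul_apply, show sol h β y (coeW (c :: l)) = (g'.2 : A) from rfl, e3, e4,
        show g'.1 = tdeg (c :: l) + e from rfl, koszul_add_right, smul_eq_mul, koszul_comm e]
      linear_combination S (a :: c :: l) * (koszul a.1 e * koszul a.1 e) * koszul_mul_self a.1 (tdeg (c :: l)) + S (a :: c :: l) * koszul_mul_self a.1 e
    rw [e1, e2]
    ring

theorem sol_of_low (h : DirectSum.IsInternal 𝒜) {k : ZMod m} {β : A →ₗ[ℂ] A →ₗ[ℂ] ℂ}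
    (hβ : NonDeg 𝒜 k β) (hd : DegB 𝒜 k β) {y : List A → ℂ} {n : ℕ}
    (hn : ∀ l : List A, l.length = n + 1 → y l = 0) (l : List A) (hl : l.length = n) : sol h β y l = 0 := by
  have h1 : sol h β y l = sol h β (fun _ => 0) l := sol_congr h β fun w hw => hn w (by rw [hw, hl])
  obtain ⟨k1, k2, -, k4, k5⟩ := (Good.zero (𝒜 := 𝒜) (k := k)).prim_spec h
  have h2 : prim h (fun _ => (0 : ℂ)) = fun _ => 0 := funext (ML.ext h k1 ML.zero_fun fun l => by
    refine (extend_congr h (f' := fun _ => (0 : ℂ)) fun w _ => ?_).trans (extend_zero h _)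
    have : ∀ i (w : List (Letter 𝒜)), (rotW koszulL)^[i] (fun _ => (0 : ℂ)) w = 0 := by
      intro i
      induction i with
      | zero => intro w; rfl
      | succ i ih =>
        intro w
        rw [Function.iterate_succ_apply', funext ih, rotW]
        simp
    simp [rotPrimitive, rotW, this])
  rw [h1]
  refine hβ.eq_zero h hd fun x => ?_
  rw [sol, h2]
  exact (solve_eq (e := 0) h hβ hd ML.zero_fun (fun _ h => (h rfl).elim)).2.2 l x

end Solve
end

noncomputable section

/-! ### Formal Darboux theorem -/

section Darboux

variable {m : ℕ} [hm : Fact (m = 0 ∨ m = 2)] {A W : Type*} [AddCommGroup A] [Module ℂ A]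
  [AddCommGroup W] [Module ℂ W] {𝒜 : ZMod m → Submodule ℂ A}

theorem Good.quad {k : ZMod m} {w : List A → ℂ} (hw : Good 𝒜 k w) {β : A →ₗ[ℂ] A →ₗ[ℂ] ℂ}
    (hβ : ∀ x y, w [x, y] = β x y) : Good 𝒜 k (quad β) := by
  have : _root_.quad β = fun l => if l.length = 2 then w l else 0 := by
    funext l
    match l with
    | [] => rfl
    | [a] => rfl
    | [a, b] => simp [_root_.quad, hβ]
    | a :: b :: c :: l => simp [_root_.quad]
  rw [this]
  exact hw.truncate (· = 2)

theorem Good.degB {k : ZMod m} {w : List A → ℂ} (hw : Good 𝒜 k w) {β : A →ₗ[ℂ] A →ₗ[ℂ] ℂ}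
    (hβ : ∀ x y, w [x, y] = β x y) : DegB 𝒜 k β := fun a b h => by
  have := hw.deg [a, b] (by simpa [hβ] using h)
  simpa using this

theorem quad_eq_of_length_le (h : DirectSum.IsInternal 𝒜) {k : ZMod m} {w : List A → ℂ} (hw : Good 𝒜 k w)
    {β : A →ₗ[ℂ] A →ₗ[ℂ] ℂ} (hβ : ∀ x y, w [x, y] = β x y) (l : List A) (hl : l.length ≤ 2) :
    w l = quad β l := by
  match l, hl with
  | [], _ => rw [hw.nil]; rfl
  | [a], _ => rw [hw.singleton h]; rfl
  | [a, b], _ => rw [hβ]; rfl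

/-- Formal Darboux theorem. -/
theorem exists_darboux (h : DirectSum.IsInternal 𝒜) {k : ZMod m} {w : List A → ℂ} (hw : Good 𝒜 k w)
    {β : A →ₗ[ℂ] A →ₗ[ℂ] ℂ} (hβ : ∀ x y, w [x, y] = β x y) (hnd : NonDeg 𝒜 k β) :
    ∃ ψ : List A → A, ML ψ ∧ ψ [] = 0 ∧ Deg 𝒜 𝒜 0 ψ ∧ (∀ a, ψ [a] = a) ∧ ∀ l, comp (quad β) ψ l = w l := by
  have hb := hw.quad hβ
  have hd := hw.degB hβ
  -- For `ψ = id + g` the pull-back of `quad β` is `quad β`, plus its derivative along `g`, plus the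
  -- part quadratic in `g`. The derivative along `g` has to equal the rest, `y g`.
  let y : (List A → A) → List A → ℂ := fun g l => w l - quad β l - comp (quad β) g l
  let P : (List A → A) → Prop := fun g => ML g ∧ Deg 𝒜 𝒜 0 g ∧ ∀ l : List A, l.length < 2 → g l = 0
  have hy : ∀ g, P g → Good 𝒜 (k + 0) (y g) := fun g hg => by
    rw [add_zero]
    exact (hw.sub hb).sub (hb.comp hg.1 hg.2.1)
  have hτ : ∀ a : Letter 𝒜, (LinearMap.id : A →ₗ[ℂ] A) a.2 = koszul 0 a.1 • (a.2 : A) := by simp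
  have hylow : ∀ g, P g → ∀ l : List A, l.length ≤ 2 → y g l = 0 := fun g hg l hl => by
    have h1 : comp (quad β) g l = 0 := by
      match l, hl with
      | [], _ => rfl
      | a :: l, hl =>
        rw [comp_quad _ (hg.2.2 [] (by simp))]
        refine dsum_eq_zero fun x t e => ?_
        rw [hg.2.2 t (by
          have : x.length + t.length = l.length := by rw [← List.length_append, e]
          simp at hl; omega), map_zero]
    simp only [y, h1, quad_eq_of_length_le h hw hβ l hl, sub_self]
  obtain ⟨g, hfix, hg⟩ := exists_fixedPoint_of P ⟨ML.zero_fun, Deg.zero, fun _ _ => rfl⟩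
    (fun f hf => ⟨ML.of_length fun n => (hf n).imp fun g hg => ⟨hg.1.1, hg.2⟩,
      Deg.of_length fun n => (hf n).imp fun g hg => ⟨hg.1.2.1, hg.2⟩, fun l hl => by
        obtain ⟨g, hg, e⟩ := hf 2
        rw [e l hl.le, hg.2.2 l hl]⟩)
    (fun g => sol h β (y g)) (fun g hg => by
      obtain ⟨k1, k2, -⟩ := cod_sol h hnd hd hb hτ (hy g hg)
      exact ⟨k1, k2, fun l hl => sol_of_low h hnd hd (fun l' hl' => hylow g hg l' (by omega)) l rfl⟩)
    -- `sol` at length `n` uses `y` at length `n + 1`. There the two arguments of `β` share `n + 1`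
    -- letters and each needs at least two, so each has fewer than `n`.
    (fun f g n hf hg e l hl => by
      refine sol_congr h β fun w' hw' => ?_
      simp only [y]
      congr 1
      match w', hw' with
      | a :: w', hw' =>
        rw [comp_quad _ (hf.2.2 [] (by simp)), comp_quad _ (hg.2.2 [] (by simp))]
        refine dsum_congr fun x t e' => ?_
        have h1 : x.length + t.length = n := by
          rw [← List.length_append, e']; simpa [hl] using hw'
        by_cases hx : x.length < 1
        · rw [hf.2.2 (a :: x) (by rw [List.length_cons]; omega),
            hg.2.2 (a :: x) (by rw [List.length_cons]; omega), map_zero]; rfl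
        by_cases ht : t.length < 2
        · rw [hf.2.2 t ht, hg.2.2 t ht, map_zero, map_zero]
        · rw [e (a :: x) (by simp; omega), e t (by omega)])
  have hc := (cod_sol h hnd hd hb hτ (hy g hg)).2.2
  rw [hfix] at hc
  have h0 : lin LinearMap.id ([] : List A) + g [] = 0 := by simp [hg.2.2 []]
  refine ⟨fun l => lin LinearMap.id l + g l, (ML.lin _).fun_add hg.1, h0, Deg.add
    (Deg.lin fun g x hx => by simpa using hx) hg.2.1, fun a => by simp [hg.2.2 [a]], fun l => ?_⟩
  match l with
  | [] => exact hw.nil.symm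
  | a :: l =>
    have e1 := hc (a :: l)
    rw [cod_quad] at e1
    have e2 : quad β (a :: l) = dsum (fun x t => β (lin LinearMap.id (a :: x)) (lin LinearMap.id t)) l := by
      rw [← comp_quad _ rfl, comp_lin_id hb.ml]
    have e3 : dsum (fun x t => β (lin LinearMap.id (a :: x)) (g t)) l =
        if l = [] then 0 else β ((LinearMap.id : A →ₗ[ℂ] A) a) (g l) := by
      rw [dsum_eq_first]
      · split_ifs with hl
        · rw [hl, hg.2.2 [] (by simp), map_zero]
        · rfl
      · intro x t _ hx
        rw [lin_of_length_ne (by simpa using hx)]; simp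
    have e4 : ∀ x t, β (g (a :: x)) (lin LinearMap.id t) = lin (β (g (a :: x))) t := by
      intro x t
      match t with
      | [] => simp
      | [c] => simp
      | c :: d :: t => simp
    rw [comp_quad _ h0]
    simp only [map_add, LinearMap.add_apply, dsum_add, ← e2, e3, e4]
    rw [← comp_quad _ (hg.2.2 [] (by simp))]
    simp only [y] at e1
    linear_combination e1

end Darboux

/-! ### Exponentials of even coderivations -/

section Exponential

variable {m : ℕ} [hm : Fact (m = 0 ∨ m = 2)] {A W W' : Type*} [AddCommGroup A] [Module ℂ A]
  [AddCommGroup W] [Module ℂ W] [AddCommGroup W'] [Module ℂ W'] {𝒜 : ZMod m → Submodule ℂ A}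

/-- The iterates of the even coderivation with components `q`. -/
def iter (q : List A → A) (k : ℕ) (f : List A → W) : List A → W := (cod LinearMap.id q)^[k] f

/-- Power series in the even coderivation with components `q`. -/
def pser (q : List A → A) (c : ℕ → ℂ) (f : List A → W) (l : List A) : W :=
  ∑ k ∈ Finset.range (l.length + 1), c k • iter q k f l

variable {q : List A → A}

theorem iter_succ (k : ℕ) (f : List A → W) :
    iter q (k + 1) f = cod LinearMap.id q (iter q k f) := Function.iterate_succ_apply' _ _ _

theorem iter_succ' (k : ℕ) (f : List A → W) :
    iter q (k + 1) f = iter q k (cod LinearMap.id q f) := Function.iterate_succ_apply _ _ _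

theorem ML.iter (hq : ML q) {f : List A → W} (hf : ML f) (k : ℕ) : ML (iter q k f) := by
  induction k with
  | zero => exact hf
  | succ k ih => rw [iter_succ]; exact ih.cod hq

theorem iter_map (φ : W →ₗ[ℂ] W') (k : ℕ) (f : List A → W) (l : List A) :
    φ (iter q k f l) = iter q k (fun w => φ (f w)) l := by
  induction k generalizing l with
  | zero => rfl
  | succ k ih => rw [iter_succ, iter_succ, map_cod, funext ih]

/-- A coderivation without linear part shortens words, so each application raises the order of
vanishing. This makes power series in it locally finite. -/
theorem cod_low (hq1 : ∀ a, q [a] = 0) {f : List A → W} (hf : ML f) {n : ℕ}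
    (h : ∀ l : List A, l.length ≤ n → f l = 0) (l : List A) (hl : l.length ≤ n + 1) :
    cod LinearMap.id q f l = 0 := by
  rw [cod_eq_dsum]
  refine dsum_eq_zero fun u t e => dsum₁_eq_zero fun b v hb e' => ?_
  match b, hb with
  | [a], _ => rw [hq1, hf.zero]
  | a :: c :: b, _ =>
    refine h _ ?_
    rw [← e, ← e'] at hl
    simp at hl ⊢; omega

theorem iter_low (hq : ML q) (hq1 : ∀ a, q [a] = 0) {f : List A → W} (hf : ML f) {n : ℕ}
    (h : ∀ l : List A, l.length ≤ n → f l = 0) (k : ℕ) (l : List A) (hl : l.length ≤ n + k) :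
    iter q k f l = 0 := by
  induction k generalizing l with
  | zero => exact h l hl
  | succ k ih => rw [iter_succ]; exact cod_low hq1 (ML.iter hq hf k) ih l hl

theorem iter_eq_zero (hq : ML q) (hq1 : ∀ a, q [a] = 0) {f : List A → W} (hf : ML f) {k : ℕ} (hk : k ≠ 0)
    {l : List A} (hl : l.length ≤ k) : iter q k f l = 0 := by
  obtain ⟨k, rfl⟩ := Nat.exists_eq_succ_of_ne_zero hk
  rw [Nat.succ_eq_add_one, iter_succ']
  refine iter_low hq hq1 (hf.cod hq) (n := 1) (fun l hl => ?_) k l (by omega)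
  match l, hl with
  | [], _ => rfl
  | [a], _ =>
    rw [cod_cons, dsum_nil, hq1, cod_nil, add_zero]
    exact hf.zero [] []

theorem pser_eq (hq : ML q) (hq1 : ∀ a, q [a] = 0) {f : List A → W} (hf : ML f) (c : ℕ → ℂ) {l : List A}
    {N : ℕ} (hN : l.length < N) : pser q c f l = ∑ k ∈ Finset.range N, c k • iter q k f l := by
  refine Finset.sum_subset (fun k hk => by simp at hk ⊢; omega) fun k _ hk => ?_
  simp at hk
  rw [iter_eq_zero hq hq1 hf (by omega) (by omega), smul_zero]

theorem pser_of_length (hq : ML q) (hq1 : ∀ a, q [a] = 0) {f : List A → W} (hf : ML f) (c : ℕ → ℂ)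
    (P : (List A → W) → Prop) (h0 : P fun _ => 0)
    (ha : ∀ f g, P f → P g → P fun l => f l + g l) (hc : ∀ (c : ℂ) f, P f → P fun l => c • f l)
    (hi : ∀ k, P (iter q k f)) (n : ℕ) : ∃ g, P g ∧ ∀ l : List A, l.length ≤ n → pser q c f l = g l :=
  ⟨_, sum_smul_induction h0 ha hc (Finset.range (n + 1)) c _ hi, fun l hl =>
    pser_eq hq hq1 hf c (by omega)⟩

theorem ML.pser (hq : ML q) (hq1 : ∀ a, q [a] = 0) {f : List A → W} (hf : ML f) (c : ℕ → ℂ) :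
    ML (pser q c f) :=
  ML.of_length (pser_of_length hq hq1 hf c ML ML.zero_fun (fun _ _ => ML.fun_add)
    (fun c _ h => h.fun_smul c) (ML.iter hq hf))

theorem Deg.pser (hq : ML q) (hq1 : ∀ a, q [a] = 0) (hqd : Deg 𝒜 𝒜 0 q) {f : List A → A} (hf : ML f)
    (hd : Deg 𝒜 𝒜 0 f) (c : ℕ → ℂ) : Deg 𝒜 𝒜 0 (pser q c f) :=
  Deg.of_length (pser_of_length hq hq1 hf c (Deg 𝒜 𝒜 0) Deg.zero (fun _ _ => Deg.add)
    (fun c _ h => h.smul c) fun k => by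
      induction k with
      | zero => exact hd
      | succ k ih =>
        rw [iter_succ]
        exact (ih.cod (fun _ _ h => h) hqd).congr (add_zero 0))

theorem Good.pser (hq : ML q) (hq1 : ∀ a, q [a] = 0) (hqd : Deg 𝒜 𝒜 0 q) {k : ZMod m} {f : List A → ℂ}
    (hf : Good 𝒜 k f) (c : ℕ → ℂ) : Good 𝒜 k (pser q c f) :=
  Good.of_length (pser_of_length hq hq1 hf.ml c (Good 𝒜 k) Good.zero (fun _ _ => Good.add)
    (fun c _ h => h.smul c) fun j => by
      induction j with
      | zero => exact hf
      | succ j ih =>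
        rw [iter_succ]
        exact (ih.cod (fun a => by simp) hq hqd).congr_deg (add_zero k))

/-- Leibniz rule for the iterates of a derivation. -/
theorem iterate_leibniz {V : Type*} [AddCommGroup V] (D : V →+ V) (T : ℕ → ℕ → V)
    (h : ∀ i j, D (T i j) = T (i + 1) j + T i (j + 1)) (n : ℕ) :
    D^[n] (T 0 0) = ∑ ij ∈ Finset.HasAntidiagonal.antidiagonal n, n.choose ij.1 • T ij.1 ij.2 := by
  induction n with
  | zero => simp
  | succ n ih =>
    rw [Function.iterate_succ_apply', ih, map_sum, Finset.sum_antidiagonal_choose_succ_nsmul,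
      ← Finset.sum_add_distrib]
    refine Finset.sum_congr rfl fun ij hij => ?_
    rw [Finset.HasAntidiagonal.mem_antidiagonal] at hij
    rw [map_nsmul, h, smul_add, add_comm, ← hij, Nat.choose_symm_add]

theorem iter_congr {f f' : List A → W} (h : ∀ l, l ≠ [] → f l = f' l) (k : ℕ) (l : List A)
    (hl : l ≠ []) : iter q k f l = iter q k f' l := by
  induction k generalizing l with
  | zero => exact h l hl
  | succ k ih => rw [iter_succ, iter_succ]; exact cod_congr fun w hw _ => ih w hw

/-- `iter q j (f (x :: ·)) y` is linear in `x`. -/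
def ML.headIter (_hq : ML q) {f : List A → W} (hf : ML f) (j : ℕ) (y : List A) : A →ₗ[ℂ] W where
  toFun x := _root_.iter q j (fun w => f (x :: w)) y
  map_add' x x' := by
    induction j generalizing y with
    | zero => exact hf.add [] y x x'
    | succ j ih => simp only [iter_succ, ← cod_add, funext ih]
  map_smul' c x := by
    induction j generalizing y with
    | zero => exact hf.smul [] y c x
    | succ j ih =>
      simp only [iter_succ, RingHom.id_apply, ← cod_smul]
      exact cod_congr fun w _ _ => ih w

theorem dsum₁_sum {Λ : Type*} (s : Finset ℕ) (g : ℕ → List Λ → List Λ → W) (l : List Λ) :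
    dsum₁ (fun x y => ∑ i ∈ s, g i x y) l = ∑ i ∈ s, dsum₁ (g i) l := by
  classical
  induction s using Finset.induction_on with
  | empty => simpa using dsum₁_eq_zero (fun _ _ _ _ => rfl)
  | insert i s hi ih => simp only [Finset.sum_insert hi, dsum₁_add, ih]

/-- The exponential of a derivation is multiplicative. -/
theorem comp_exp (hq : ML q) (hq1 : ∀ a, q [a] = 0) {f : List A → W} (hf : ML f) (l : List A) :
    comp f (pser q (fun k => ((k.factorial : ℂ))⁻¹) (lin LinearMap.id)) l =
      pser q (fun k => ((k.factorial : ℂ))⁻¹) f l := by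
  let c : ℕ → ℂ := fun k => ((k.factorial : ℂ))⁻¹
  change comp f (pser q c (lin LinearMap.id)) l = pser q c f l
  have hid : ML (lin (LinearMap.id : A →ₗ[ℂ] A)) := ML.lin _
  induction l using length_induction generalizing f with
  | h l ih =>
    rcases eq_or_ne l [] with rfl | hl
    · simp [pser, c]; rfl
    -- `T i j` applies the derivation `i` times to the first block and `j` times to the remaining
    -- arguments of `f`; the derivation then acts on `T` by the Leibniz rule.
    let T : ℕ → ℕ → List A → W := fun i j l =>
      dsum (fun x y => ML.headIter hq hf j y (iter q i (lin LinearMap.id) x)) l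
    let D : (List A → W) →+ (List A → W) := AddMonoidHom.mk' (cod LinearMap.id q)
      fun f g => funext fun l => cod_add _ _ f g l
    have hT : ∀ i j, D (T i j) = T (i + 1) j + T i (j + 1) := fun i j => funext fun l => by
      change cod LinearMap.id q (fun l => dsum (fun x y => ML.headIter hq hf j y
        (iter q i (lin LinearMap.id) x)) l) l = _
      rw [cod_dsum]
      refine congrArg₂ (· + ·) (dsum_congr fun x y _ => ?_) (dsum_congr fun x y _ => ?_)
      · rw [← map_cod, iter_succ]
      · simp only [LinearMap.id_coe, List.map_id_fun, id_eq]
        change _ = iter q (j + 1) _ y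
        rw [iter_succ]
        rfl
    have hnil : ∀ i, iter q i (lin (LinearMap.id : A →ₗ[ℂ] A)) [] = 0 := fun i => by
      cases i with
      | zero => rfl
      | succ i => rw [iter_succ]; rfl
    have hT0 : ∀ l, l ≠ [] → f l = T 0 0 l := fun l hl => by
      obtain ⟨a, l, rfl⟩ := List.exists_cons_of_ne_nil hl
      simp only [T]
      rw [dsum_cons, hnil, map_zero, zero_add, dsum_eq_first]
      · rfl
      · intro x y _ hx
        change ML.headIter hq hf 0 y (lin LinearMap.id (a :: x)) = 0
        rw [lin_of_length_ne (by simpa using hx), map_zero]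
    have hD : ∀ k (f : List A → W), D^[k] f = iter q k f := fun k f => rfl
    -- The order estimate applied to both factors; it cuts the square of pairs `(i, j)` down to the
    -- triangle on which the binomial expansion is summed.
    have hTz : ∀ i j, l.length ≤ i + j → T i j l = 0 := fun i j hij => by
      refine dsum_eq_zero fun x y e => ?_
      have hlen : x.length + y.length = l.length := by rw [← List.length_append, e]
      rcases eq_or_ne x [] with rfl | hx
      · rw [hnil, map_zero]
      have hx' := List.length_pos_iff.2 hx
      by_cases h1 : i ≠ 0 ∧ x.length ≤ i
      · rw [iter_eq_zero hq hq1 hid h1.1 h1.2, map_zero]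
      · exact iter_eq_zero hq hq1 (hf.cons _) (by omega) (by omega)
    let N := l.length + 1
    have e1 : pser q c f l = ∑ k ∈ Finset.range N, ∑ i ∈ Finset.range (k + 1),
        (c i * c (k - i)) • T i (k - i) l := by
      refine Finset.sum_congr rfl fun k _ => ?_
      rw [iter_congr hT0 k l hl, ← hD, iterate_leibniz D T hT, Finset.sum_apply, Finset.smul_sum,
        ← Finset.Nat.sum_antidiagonal_eq_sum_range_succ (fun i j => (c i * c j) • T i j l)]
      refine Finset.sum_congr rfl fun ij hij => ?_
      rw [Finset.HasAntidiagonal.mem_antidiagonal] at hij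
      have h1 : (k.choose ij.1 : ℂ) * c k = c ij.1 * c ij.2 := by
        rw [← hij, Nat.choose_symm_add, Nat.add_choose]
        simp only [c]
        rw [Nat.cast_div (Nat.factorial_mul_factorial_dvd_factorial_add _ _) (by
          simp [Nat.factorial_ne_zero])]
        have h2 : ((ij.1 + ij.2).factorial : ℂ) ≠ 0 := by exact_mod_cast Nat.factorial_ne_zero _
        push_cast
        field_simp
      rw [← h1, Pi.smul_apply, ← Nat.cast_smul_eq_nsmul ℂ, smul_smul, mul_comm]
    have e2 : ∀ b v, b ++ v = l → b ≠ [] → comp (fun w => f (pser q c (lin LinearMap.id) b :: w))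
        (pser q c (lin LinearMap.id)) v = ∑ i ∈ Finset.range N, ∑ j ∈ Finset.range N,
          (c i * c j) • ML.headIter hq hf j v (iter q i (lin LinearMap.id) b) := by
      intro b v e hb
      have hlen : b.length + v.length = l.length := by rw [← List.length_append, e]
      have hb' := List.length_pos_iff.2 hb
      rw [ih v (by omega) (hf.cons _), pser_eq hq hq1 (hf.cons _) c (N := N) (by omega),
        Finset.sum_comm]
      refine Finset.sum_congr rfl fun j _ => ?_
      change c j • ML.headIter hq hf j v (pser q c (lin LinearMap.id) b) = _
      rw [pser_eq hq hq1 hid c (N := N) (by omega), map_sum, Finset.smul_sum]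
      refine Finset.sum_congr rfl fun i _ => ?_
      rw [map_smul, smul_smul, mul_comm]
    have e3 : comp f (pser q c (lin LinearMap.id)) l =
        ∑ i ∈ Finset.range N, ∑ j ∈ Finset.range N, (c i * c j) • T i j l := by
      rw [comp_eq_dsum₁ _ _ hl, dsum₁_congr fun b v hb e => e2 b v e hb]
      have e4 : ∀ i j, (c i * c j) • T i j l = dsum₁ (fun b v =>
          (c i * c j) • ML.headIter hq hf j v (iter q i (lin LinearMap.id) b)) l := fun i j => by
        rw [dsum₁_smul]
        congr 1
        simp only [T]
        rw [dsum_eq_add_dsum₁, hnil, map_zero, zero_add]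
      simp only [e4, ← dsum₁_sum]
    rw [e1, e3, Finset.sum_range_diag_flip N fun i j => (c i * c j) • T i j l]
    refine Finset.sum_congr rfl fun i _ => ?_
    refine (Finset.sum_subset (fun j hj => by simp at hj ⊢; omega) fun j _ hj => ?_).symm
    rw [hTz i j (by simp at hj; omega), smul_zero]

end Exponential
end

noncomputable section

/-! ### Formal Moser theorem -/

section Moser

variable {m : ℕ} [hm : Fact (m = 0 ∨ m = 2)] {A W : Type*} [AddCommGroup A] [Module ℂ A]
  [AddCommGroup W] [Module ℂ W] {𝒜 : ZMod m → Submodule ℂ A}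

namespace AInf

variable (Y : AInf 𝒜)

/-- The components of the commutator of the coderivation of `Y` with that with components `v`. -/
def bracket (v : List A → A) : List A → A := fun b => cod Y.σ Y.ser v b + cod Y.σ v Y.ser b

variable {Y} {v : List A → A}

theorem bracket_ml (hv : ML v) : ML (Y.bracket v) := (hv.cod Y.ml).fun_add (Y.ml.cod hv)

theorem bracket_deg (hd : Deg 𝒜 𝒜 (-1) v) : Deg 𝒜 𝒜 0 (Y.bracket v) :=
  ((hd.cod (parity_mem Y.internal) Y.deg).congr (by ring)).add
    ((Y.deg.cod (parity_mem Y.internal) hd).congr (by ring))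

theorem Minimal.ser_singleton (hY : Y.Minimal) (a : A) : Y.ser [a] = 0 := by
  rw [← Y.r₁_apply, hY]; rfl

theorem Minimal.bracket_singleton (hY : Y.Minimal) (hv : ML v) (a : A) : Y.bracket v [a] = 0 := by
  simp only [bracket, cod_cons, cod_nil, dsum_nil, hY.ser_singleton, add_zero]
  exact hv.zero [] []

theorem cod_bracket (hv : ML v) (hd : Deg 𝒜 𝒜 (-1) v) {f : List A → W} (hf : ML f) (l : List A) :
    cod LinearMap.id (Y.bracket v) f l =
      cod Y.σ Y.ser (cod Y.σ v f) l + cod Y.σ v (cod Y.σ Y.ser f) l :=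
  (_root_.cod_cod (parity_parity Y.internal)
    (hd.map_parity_odd Y.internal Y.internal (by rw [sgn_neg, sgn_one]) hv) Y.map_σ hf l).symm

/-- The structure coderivation squares to 0, so it commutes with its bracket with any `v`. -/
theorem cod_iter_bracket (hv : ML v) (hd : Deg 𝒜 𝒜 (-1) v) {f : List A → W} (hf : ML f) (k : ℕ) :
    cod Y.σ Y.ser (iter (Y.bracket v) k f) = iter (Y.bracket v) k (cod Y.σ Y.ser f) := by
  induction k generalizing f with
  | zero => rfl
  | succ k ih =>
    rw [iter_succ', iter_succ', ih (hf.cod (bracket_ml hv))]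
    congr 1
    funext l
    rw [cod_bracket hv hd (hf.cod Y.ml), funext (cod_bracket hv hd hf), cod_add,
      Y.cod_cod (hf.cod hv), funext (Y.cod_cod hf), cod_zero, zero_add, add_zero]

theorem Minimal.cod_pser (hY : Y.Minimal) (hv : ML v) (σ : A →ₗ[ℂ] A) (r : List A → A)
    (c : ℕ → ℂ) {f : List A → W} (hf : ML f) {l : List A} {N : ℕ} (hN : l.length < N) :
    cod σ r (pser (Y.bracket v) c f) l =
      ∑ k ∈ Finset.range N, c k • cod σ r (iter (Y.bracket v) k f) l := by
  rw [← cod_sum_smul]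
  exact cod_congr fun w _ hw => pser_eq (bracket_ml hv) (hY.bracket_singleton hv) hf c (by omega)

/-- By minimality `Y.ser` starts in arity two, so in the bracket it leaves to `v` fewer letters than
the word has. -/
theorem Minimal.bracket_congr (hY : Y.Minimal) {v v' : List A → A} (hv : ML v) (hv' : ML v') {n : ℕ}
    (h : ∀ l : List A, l.length < n → v l = v' l) (b : List A) (hb : b.length ≤ n) :
    Y.bracket v b = Y.bracket v' b := by
  rw [bracket, bracket, cod_eq_dsum, cod_eq_dsum, cod_eq_dsum, cod_eq_dsum]
  refine congrArg₂ (· + ·) (dsum_congr fun u t e => dsum₁_congr fun c s hc e' => ?_)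
    (dsum_congr fun u t e => dsum₁_congr fun c s hc e' => ?_)
  · match c, hc with
    | [a], _ => rw [hY.ser_singleton, hv.zero, hv'.zero]
    | a :: a' :: c, _ =>
      refine h _ ?_
      rw [← e, ← e'] at hb
      simp at hb ⊢; omega
  · have hlen : u.length + (c.length + s.length) ≤ n := by
      rw [← e, ← e'] at hb; simpa using hb
    by_cases h1 : c.length < n
    · rw [h c h1]
    · have := List.length_pos_iff.2 hc
      obtain rfl : u = [] := List.length_eq_zero_iff.1 (by omega)
      obtain rfl : s = [] := List.length_eq_zero_iff.1 (by omega)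
      simp [hY.ser_singleton]

/-- A block longer than `n` leaves a word of length at most `k + 1`, on which the `k`-th iterate
already vanishes, since `f` has no terms of order at most one. -/
theorem Minimal.iter_congr (hY : Y.Minimal) {v v' : List A → A} (hv : ML v) (hv' : ML v') {n : ℕ}
    (h : ∀ l : List A, l.length < n → v l = v' l) {f : List A → W} (hf : ML f)
    (h1 : ∀ l : List A, l.length ≤ 1 → f l = 0) (k : ℕ) (l : List A) (hl : l.length ≤ n + 1) :
    iter (Y.bracket v) k f l = iter (Y.bracket v') k f l := by
  induction k generalizing l with
  | zero => rfl
  | succ k ih =>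
    rw [iter_succ, iter_succ, cod_eq_dsum, cod_eq_dsum]
    refine dsum_congr fun u t e => dsum₁_congr fun c s hc e' => ?_
    have hc' := List.length_pos_iff.2 hc
    have hlen : u.length + (c.length + s.length) ≤ n + 1 := by
      rw [← e, ← e'] at hl; simpa using hl
    by_cases h2 : c.length ≤ n
    · rw [hY.bracket_congr hv hv' h c h2]
      exact ih _ (by simp; omega)
    · have h3 : ∀ x : A, (u.map (LinearMap.id : A →ₗ[ℂ] A) ++ x :: s).length ≤ 1 + k := fun x => by
        simp; omega
      rw [iter_low (bracket_ml hv) (hY.bracket_singleton hv) hf h1 k _ (h3 _),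
        iter_low (bracket_ml hv') (hY.bracket_singleton hv') hf h1 k _ (h3 _)]

/-- The formal exponential of an even coderivation that is an infinitesimal homotopy. -/
theorem Minimal.exists_exp (hY : Y.Minimal) (hv : ML v) (hd : Deg 𝒜 𝒜 (-1) v) :
    ∃ F : AInfHom Y Y, F.F₁ = LinearMap.id ∧
      F.ser = pser (Y.bracket v) (fun k => ((k.factorial : ℂ))⁻¹) (lin LinearMap.id) := by
  let c : ℕ → ℂ := fun k => ((k.factorial : ℂ))⁻¹
  have hq := bracket_ml (Y := Y) hv
  have hq1 := hY.bracket_singleton hv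
  have hid : ML (lin (LinearMap.id : A →ₗ[ℂ] A)) := ML.lin _
  -- `comp_exp` turns the right side into the exponential applied to `Y.ser`, and the structure
  -- coderivation commutes with the bracket; the terms agree one by one.
  have hrel : ∀ l, l ≠ [] → cod Y.σ Y.ser (pser (Y.bracket v) c (lin LinearMap.id)) l =
      comp Y.ser (pser (Y.bracket v) c (lin LinearMap.id)) l := fun l hl => by
    rw [comp_exp hq hq1 Y.ml, hY.cod_pser hv _ _ c hid (Nat.lt_succ_self _)]
    refine Finset.sum_congr rfl fun k _ => ?_
    rw [cod_iter_bracket hv hd hid, _root_.iter_congr (fun l hl => cod_lin_left _ _ _ hl) k l hl]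
    rfl
  refine ⟨AInfHom.ofSer (ML.pser hq hq1 hid c) (by simp [pser, iter]) (Deg.pser hq hq1 (bracket_deg hd) hid
    (Deg.lin fun g x hx => by simpa using hx) c) hrel, LinearMap.ext fun a => ?_, AInfHom.ser_ofSer _ _ _ _⟩
  rw [AInfHom.F₁_apply, AInfHom.ser_ofSer, pser]
  simp only [List.length_singleton, Finset.sum_range_succ, Finset.sum_range_zero, zero_add]
  rw [iter_eq_zero hq hq1 hid one_ne_zero (by simp)]
  simp [c, iter]

/-- For closed `w` and `D = [Q, v]` one has `D^{k+1} w = Q v D^k w`, because `Q D^k w = D^k Q w =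
0`. Summing `D^{k+1} w / (k+1)!` exhibits `exp(D) w - w` as exact, with an explicit primitive. -/
theorem Minimal.comp_exp (hY : Y.Minimal) (hv : ML v) (hd : Deg 𝒜 𝒜 (-1) v) {w : List A → ℂ} (hw : ML w)
    (hcl : ∀ l, cod Y.σ Y.ser w l = 0) (l : List A) :
    comp w (pser (Y.bracket v) (fun k => ((k.factorial : ℂ))⁻¹) (lin LinearMap.id)) l =
      w l + cod Y.σ Y.ser (cod Y.σ v (pser (Y.bracket v) (fun k => (((k + 1).factorial : ℂ))⁻¹) w)) l := by
  have hq := bracket_ml (Y := Y) hv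
  have hq1 := hY.bracket_singleton hv
  have e1 : cod Y.σ Y.ser (cod Y.σ v (pser (Y.bracket v) (fun k => (((k + 1).factorial : ℂ))⁻¹) w)) l =
      ∑ k ∈ Finset.range (l.length + 1), (((k + 1).factorial : ℂ))⁻¹ •
        cod Y.σ Y.ser (cod Y.σ v (iter (Y.bracket v) k w)) l := by
    rw [← cod_sum_smul]
    exact cod_congr fun w' _ hw' => hY.cod_pser hv _ _ _ hw (by omega)
  rw [_root_.comp_exp hq hq1 hw, pser_eq hq hq1 hw _ (show l.length < l.length + 1 + 1 by omega),
    Finset.sum_range_succ', e1, add_comm]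
  congr 1
  · simp [iter]
  · refine Finset.sum_congr rfl fun k _ => ?_
    rw [iter_succ, cod_bracket hv hd (ML.iter hq hw k), cod_iter_bracket hv hd hw, funext hcl]
    have : iter (Y.bracket v) k (fun _ : List A => (0 : ℂ)) = fun _ => 0 := funext fun l => by
      have := iter_map (q := Y.bracket v) (0 : ℂ →ₗ[ℂ] ℂ) k w l
      simpa using this.symm
    rw [this, cod_zero, add_zero]

/-- Formal Moser theorem. -/
theorem Minimal.exists_moser (hY : Y.Minimal) {k : ZMod m} {w u : List A → ℂ} (hw : Good 𝒜 k w)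
    (hcl : ∀ l, cod Y.σ Y.ser w l = 0) (hu : Good 𝒜 (k - 1) u) {β : A →ₗ[ℂ] A →ₗ[ℂ] ℂ}
    (hβ : ∀ x y, w [x, y] = β x y) (hnd : NonDeg 𝒜 k β) :
    ∃ F : AInfHom Y Y, F.F₁ = LinearMap.id ∧ ∀ l, comp w F.ser l = w l + cod Y.σ Y.ser u l := by
  have h := Y.internal
  have hb := hw.quad hβ
  have hd := hw.degB hβ
  have hτ : ∀ a : Letter 𝒜, Y.σ a.2 = koszul (-1) a.1 • (a.2 : A) := fun a => by
    rw [parity_coe, koszul_neg_one]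
  have hw1 : ∀ l : List A, l.length ≤ 1 → w l = 0 := fun l hl => by
    rw [quad_eq_of_length_le h hw hβ l (by omega), quad_of_length_ne β (by omega)]
  let c : ℕ → ℂ := fun k => (((k + 1).factorial : ℂ))⁻¹
  let P : (List A → A) → Prop := fun v => ML v ∧ Deg 𝒜 𝒜 (-1) v
  let g : (List A → A) → List A → ℂ := fun v => pser (Y.bracket v) c w
  -- The primitive given by `comp_exp` has to be `u`, an equation for `v`. Its leading part is the
  -- derivative of `quad β` along `v`, solved by `sol`; the rest of `g v` goes to the right side.
  let y : (List A → A) → List A → ℂ := fun v l => u l - cod Y.σ v (fun l => g v l - quad β l) l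
  have hg : ∀ v, P v → Good 𝒜 k (g v) := fun v hv =>
    Good.pser (bracket_ml hv.1) (hY.bracket_singleton hv.1) (bracket_deg hv.2) hw c
  have hy : ∀ v, P v → Good 𝒜 (k + -1) (y v) := fun v hv =>
    (hu.congr_deg (sub_eq_add_neg k 1)).sub (((hg v hv).sub hb).cod hτ hv.1 hv.2)
  have hglow : ∀ v, P v → ∀ l : List A, l.length ≤ 2 → g v l - quad β l = 0 := fun v hv l hl => by
    rw [sub_eq_zero, ← quad_eq_of_length_le h hw hβ l hl]
    simp only [g, pser]
    rw [Finset.sum_range_succ', Finset.sum_eq_zero]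
    · simp [c, iter]
    · intro k _
      rw [iter_low (bracket_ml hv.1) (hY.bracket_singleton hv.1) hw.ml hw1 (k + 1) l (by omega), smul_zero]
  obtain ⟨v, hfix, hv⟩ := exists_fixedPoint_of P ⟨ML.zero_fun, Deg.zero⟩
    (fun f hf => ⟨ML.of_length fun n => (hf n).imp fun g hg => ⟨hg.1.1, hg.2⟩,
      Deg.of_length fun n => (hf n).imp fun g hg => ⟨hg.1.2, hg.2⟩⟩)
    (fun v => sol h β (y v)) (fun v hv => by
      obtain ⟨k1, k2, -⟩ := cod_sol h hnd hd hb hτ (hy v hv)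
      exact ⟨k1, k2⟩)
    -- On words of length `n + 1`, a block shorter than `n` sees `v` where it is known. A longer
    -- block leaves at most two letters, where `g v - quad β` vanishes; on the other words `g v`
    -- itself depends only on known values of `v`.
    (fun v v' n hv hv' e l hl => by
      refine sol_congr h β fun w' hw' => ?_
      simp only [y]
      congr 1
      rw [cod_eq_dsum, cod_eq_dsum]
      refine dsum_congr fun s t e1 => dsum₁_congr fun b s' hb' e2 => ?_
      have hb1 := List.length_pos_iff.2 hb'
      have hlen : s.length + (b.length + s'.length) = n + 1 := by
        rw [← hl, ← hw', ← e1, ← e2]; simp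
      by_cases h1 : b.length < n
      · rw [e b h1]
        congr 1
        refine Finset.sum_congr rfl fun k _ => ?_
        rw [hY.iter_congr hv.1 hv'.1 e hw.ml hw1 k _ (by simp; omega)]
      · rw [hglow v hv _ (by simp; omega), hglow v' hv' _ (by simp; omega)])
  have hc := (cod_sol h hnd hd hb hτ (hy v hv)).2.2
  rw [hfix] at hc
  have hV : ∀ l, cod Y.σ v (g v) l = u l := fun l => by
    have := hc l
    simp only [y, cod_sub] at this
    linear_combination this
  obtain ⟨F, hF1, hF⟩ := hY.exists_exp hv.1 hv.2
  refine ⟨F, hF1, fun l => ?_⟩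
  rw [hF, hY.comp_exp hv.1 hv.2 hw.ml hcl, ← funext hV]

end AInf
end Moser
end

noncomputable section

/-! ### Pairings, flat forms and cyclicity -/

section Pairing

variable {m : ℕ} [hm : Fact (m = 0 ∨ m = 2)] {A : Type*} [AddCommGroup A] [Module ℂ A]
  {𝒜 : ZMod m → Submodule ℂ A} (h : DirectSum.IsInternal 𝒜) {k : ZMod m}

/-- The quadratic coefficients of the scalar series of the flat form of the pairing `β`. -/
def flatCoeff (β : A →ₗ[ℂ] A →ₗ[ℂ] ℂ) : A →ₗ[ℂ] A →ₗ[ℂ] ℂ := (-2 : ℂ) • β ∘ₗ parity h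

omit hm in
theorem flatCoeff_apply (β : A →ₗ[ℂ] A →ₗ[ℂ] ℂ) (x y : A) :
    flatCoeff h β x y = -2 * β (parity h x) y := rfl

omit hm in
theorem flatCoeff_coe (β : A →ₗ[ℂ] A →ₗ[ℂ] ℂ) (a : Letter 𝒜) (y : A) :
    flatCoeff h β a.2 y = -2 * sgn a.1 * β a.2 y := by
  rw [flatCoeff_apply, parity_coe, map_smul, LinearMap.smul_apply, smul_eq_mul, mul_assoc]

omit hm in
theorem ML.exists_bilinear {w : List A → ℂ} (hw : ML w) :
    ∃ b : A →ₗ[ℂ] A →ₗ[ℂ] ℂ, ∀ x y, w [x, y] = b x y :=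
  ⟨LinearMap.mk₂ ℂ (fun x y => w [x, y]) (fun x x' y => (hw.slot [] [y]).map_add x x')
    (fun c x y => (hw.slot [] [y]).map_smul c x) (fun x y y' => (hw.slot [x] []).map_add y y')
    fun c x y => (hw.slot [x] []).map_smul c y, fun _ _ => rfl⟩

theorem ML.exists_pairing {w : List A → ℂ} (hw : ML w) :
    ∃ β : A →ₗ[ℂ] A →ₗ[ℂ] ℂ, ∀ x y, w [x, y] = flatCoeff h β x y := by
  obtain ⟨b, hb⟩ := hw.exists_bilinear
  refine ⟨(-1 / 2 : ℂ) • b ∘ₗ parity h, fun x y => ?_⟩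
  rw [hb, flatCoeff_apply, LinearMap.smul_apply, LinearMap.smul_apply, LinearMap.comp_apply,
    parity_parity, smul_eq_mul]
  ring

theorem isFlatPairing_iff {f : List (DLetter 𝒜) → ℂ} (hf : f ∈ closedForms 𝒜 k)
    {β : A →ₗ[ℂ] A →ₗ[ℂ] ℂ} :
    IsFlatPairing f β ↔ ∀ x y, pot h f [x, y] = flatCoeff h β x y := by
  obtain ⟨b, hb⟩ := (Good.pot h hf).ml.exists_bilinear
  have key : ∀ a b : Letter 𝒜, β a.2 b.2 = -sgn a.1 * flatPart f a b ↔
      pot h f [(a.2 : A), (b.2 : A)] = flatCoeff h β a.2 b.2 := fun a b => by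
    rw [flatPart_eq h hf.1.1, flatCoeff_coe]
    have := sgn_mul_self a.1
    constructor
    · intro e
      rw [e]
      linear_combination - pot h f [(a.2 : A), (b.2 : A)] * this
    · intro e
      rw [e]
      linear_combination - β a.2 b.2 * this
  refine ⟨fun e => ?_, fun e a b => (key a b).2 (e _ _)⟩
  have : b = flatCoeff h β := linearMap_ext h fun x => linearMap_ext h fun y => by
    rw [← hb]; exact (key x y).1 (e x y)
  intro x y
  rw [hb, this]

omit hm in
theorem nonDeg_flatCoeff [Fact (m = 0 ∨ m = 2)] {β : A →ₗ[ℂ] A →ₗ[ℂ] ℂ} :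
    NonDeg 𝒜 k (flatCoeff h β) ↔ NonDeg 𝒜 k β := by
  refine forall_congr' fun g => forall_congr' fun g' => imp_congr_right fun _ => ?_
  have hne : (-2 * sgn g : ℂ) ≠ 0 := mul_ne_zero (by norm_num) (sgn_ne_zero g)
  have : (fun a : 𝒜 (g + 1) =>
      ((flatCoeff h β (a : A)).comp (𝒜 (g' + 1)).subtype : Module.Dual ℂ (𝒜 (g' + 1)))) =
      (fun φ : Module.Dual ℂ (𝒜 (g' + 1)) => (-2 * sgn g : ℂ) • φ) ∘
        fun a : 𝒜 (g + 1) => (β (a : A)).comp (𝒜 (g' + 1)).subtype := by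
    funext a
    exact LinearMap.ext fun y => flatCoeff_coe h β ⟨g, a⟩ y
  rw [this]
  exact (LinearEquiv.smulOfNeZero ℂ (Module.Dual ℂ (𝒜 (g' + 1))) _ hne).bijective.of_comp_iff' _

theorem Good.pairing_degree {w : List A → ℂ} (hw : Good 𝒜 k w) {β : A →ₗ[ℂ] A →ₗ[ℂ] ℂ}
    (hβ : ∀ x y, w [x, y] = flatCoeff h β x y) (a b : Letter 𝒜) (hab : β a.2 b.2 ≠ 0) :
    a.1 + b.1 = -k :=
  hw.degB hβ a b (by
    rw [flatCoeff_coe]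
    exact mul_ne_zero (mul_ne_zero (by norm_num) (sgn_ne_zero _)) hab)

theorem Good.pairing_symm {w : List A → ℂ} (hw : Good 𝒜 k w) {β : A →ₗ[ℂ] A →ₗ[ℂ] ℂ}
    (hβ : ∀ x y, w [x, y] = flatCoeff h β x y) (a b : Letter 𝒜) :
    β a.2 b.2 = koszul (a.1 + 1) (b.1 + 1) * β b.2 a.2 := by
  have h1 := hw.cyc [a, b]
  simp only [_root_.cyc, dsum_cons, dsum_nil, coeW_cons, coeW_nil, List.nil_append,
    List.cons_append, reduceCtorEq, if_false, if_true, hβ, flatCoeff_coe, kw_koszulL, tdeg_cons,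
    tdeg_nil, add_zero, koszul_zero_right] at h1
  rw [koszul_add_left, koszul_add_right, koszul_add_right, koszul_one_left, koszul_one_left,
    koszul_one_right, sgn_one, koszul_comm]
  have h2 := sgn_mul_self a.1
  linear_combination (-1 / 2 * sgn a.1) * h1 - β a.2 b.2 * h2

theorem cod_flatCoeff_coeW (X : AInf 𝒜) {β : A →ₗ[ℂ] A →ₗ[ℂ] ℂ}
    (hs : ∀ a b : Letter 𝒜, β a.2 b.2 = koszul (a.1 + 1) (b.1 + 1) * β b.2 a.2)
    (a c : Letter 𝒜) (l : List (Letter 𝒜)) :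
    cod X.σ X.ser (quad (flatCoeff X.internal β)) (coeW (a :: (l ++ [c]))) =
      2 * (koszul c.1 (tdeg (a :: l)) * β c.2 (X.ser (coeW (a :: l))) -
        β a.2 (X.ser (coeW (l ++ [c])))) := by
  rw [coeW_cons, cod_quad, if_neg (by simp), coeW_append, coeW_cons, coeW_nil, dsum_concat,
    lin_nil, add_zero, dsum_eq_last]
  · have h1 := hs (X.op (a :: l)) c
    rw [X.coe_op, show (X.op (a :: l)).1 = tdeg (a :: l) + 1 from rfl, koszul_add_left,
      koszul_add_left, koszul_add_right, koszul_one_left, koszul_one_right, koszul_comm] at h1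
    have h2 := flatCoeff_coe X.internal β (X.op (a :: l)) c.2
    rw [X.coe_op, show (X.op (a :: l)).1 = tdeg (a :: l) + 1 from rfl, sgn_add, sgn_one] at h2
    rw [coeW_cons] at h1 h2
    rw [List.nil_append, lin_singleton, h2, h1, flatCoeff_apply, parity_parity, coeW_cons]
    have h3 := sgn_mul_self (tdeg (a :: l))
    have h4 := sgn_mul_self (c.1 + 1)
    linear_combination 2 * koszul c.1 (tdeg (a :: l)) * β c.2 (X.ser (a.2 :: coeW l)) * (h3 * (sgn (c.1 + 1) * sgn (c.1 + 1)) + h4)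
  · intro x y _ hy
    exact lin_of_length_ne fun hl => hy (by simpa using hl)

/-- The coefficient of the Lie derivative of the flat form at `a ⋯ c` is, up to the factor 2 and a
sign, the difference of the two sides of the cyclicity equation. So cyclicity is closedness of the
flat form, a condition that can be transported by coordinate changes. -/
theorem isCyclic_iff (X : AInf 𝒜) {β : A →ₗ[ℂ] A →ₗ[ℂ] ℂ}
    (hs : ∀ a b : Letter 𝒜, β a.2 b.2 = koszul (a.1 + 1) (b.1 + 1) * β b.2 a.2) :
    X.IsCyclic β ↔ ∀ l, cod X.σ X.ser (quad (flatCoeff X.internal β)) l = 0 := by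
  have key : ∀ (c a : Letter 𝒜) (l : List (Letter 𝒜)),
      cod X.σ X.ser (quad (flatCoeff X.internal β)) (coeW (a :: (l ++ [c]))) = 0 ↔
      β c.2 (evalWord X.r (a :: l)) =
        koszul c.1 (tdeg (a :: l)) * β a.2 (evalWord X.r (l ++ [c])) := fun c a l => by
    rw [cod_flatCoeff_coeW X hs, evalWord_eq, evalWord_eq]
    change _ ↔ β c.2 (X.ser _) = _ * β a.2 (X.ser _)
    have h1 := koszul_mul_self c.1 (tdeg (a :: l))
    constructor
    · intro e
      linear_combination koszul c.1 (tdeg (a :: l)) / 2 * e - β c.2 (X.ser (coeW (a :: l))) * h1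
    · intro e
      linear_combination 2 * koszul c.1 (tdeg (a :: l)) * e + 2 * β a.2 (X.ser (coeW (l ++ [c]))) * h1
  refine ⟨fun e => ML.ext X.internal ((ML.quad _).cod X.ml) ML.zero_fun fun l => ?_,
    fun e c a l => (key c a l).1 (e _)⟩
  match l with
  | [] => rfl
  | a :: l =>
    rcases List.eq_nil_or_concat l with rfl | ⟨l, c, rfl⟩
    · simp [cod_quad]
    · rw [List.concat_eq_append]
      exact (key c a l).2 (e c a l)

theorem NonDeg.compl₁₂ {β : A →ₗ[ℂ] A →ₗ[ℂ] ℂ} (hβ : NonDeg 𝒜 k β) (e : A ≃ₗ[ℂ] A)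
    (he : ∀ g, ∀ x ∈ 𝒜 g, e x ∈ 𝒜 g) (he' : ∀ g, ∀ x ∈ 𝒜 g, e.symm x ∈ 𝒜 g) :
    NonDeg 𝒜 k (β.compl₁₂ (e : A →ₗ[ℂ] A) (e : A →ₗ[ℂ] A)) := by
  intro g g' hg
  constructor
  · intro a a' haa
    have h1 : (⟨e a, he _ _ a.2⟩ : 𝒜 (g + 1)) = ⟨e a', he _ _ a'.2⟩ :=
      (hβ g g' hg).1 (LinearMap.ext fun y => by
        have h2 := congrArg (fun φ : Module.Dual ℂ (𝒜 (g' + 1)) => φ ⟨e.symm y, he' _ _ y.2⟩) haa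
        simpa using h2)
    exact Subtype.ext (e.injective (congrArg Subtype.val h1))
  · intro φ
    obtain ⟨a, ha⟩ := (hβ g g' hg).2 (φ ∘ₗ
      ((e.symm : A →ₗ[ℂ] A).restrict fun x hx => he' _ x hx : 𝒜 (g' + 1) →ₗ[ℂ] 𝒜 (g' + 1)))
    refine ⟨⟨e.symm a, he' _ _ a.2⟩, LinearMap.ext fun y => ?_⟩
    have h2 := congrArg (fun φ : Module.Dual ℂ (𝒜 (g' + 1)) => φ ⟨e y, he _ _ y.2⟩) ha
    simp only [LinearMap.comp_apply, Submodule.subtype_apply] at h2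
    have h3 : (((e.symm : A →ₗ[ℂ] A).restrict fun x hx => he' _ x hx :
      𝒜 (g' + 1) →ₗ[ℂ] 𝒜 (g' + 1)) ⟨e y, he _ _ y.2⟩) = y := Subtype.ext (e.symm_apply_apply _)
    rw [h3] at h2
    simpa using h2

end Pairing

/-! ### Classes of closed series and quasi-isomorphisms -/

section Cohomologous

variable {m : ℕ} [hm : Fact (m = 0 ∨ m = 2)] {A B : Type*} [AddCommGroup A] [Module ℂ A]
  [AddCommGroup B] [Module ℂ B] {𝒜 : ZMod m → Submodule ℂ A} {ℬ : ZMod m → Submodule ℂ B}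

namespace AInf

/-- The scalar series of an `L_Q`-closed and `d`-closed `2`-form. -/
def Cocycle (X : AInf 𝒜) (k : ZMod m) (w : List A → ℂ) : Prop :=
  Good 𝒜 k w ∧ ∀ l, cod X.σ X.ser w l = 0

/-- Equality of classes in the `L_Q`-cohomology of closed `2`-forms, for their scalar series. -/
def Cohomologous (X : AInf 𝒜) (k : ZMod m) (w w' : List A → ℂ) : Prop :=
  ∃ u, Good 𝒜 (k - 1) u ∧ ∀ l, w l = w' l + cod X.σ X.ser u l

variable {X : AInf 𝒜} {Y : AInf ℬ} {k : ZMod m} {w w' w'' : List A → ℂ}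

theorem Cohomologous.refl (X : AInf 𝒜) (k : ZMod m) (w : List A → ℂ) : X.Cohomologous k w w :=
  ⟨fun _ => 0, Good.zero, fun l => by rw [cod_zero, add_zero]⟩

theorem Cohomologous.symm (h : X.Cohomologous k w w') : X.Cohomologous k w' w := by
  obtain ⟨u, hu, e⟩ := h
  exact ⟨fun l => - u l, hu.neg, fun l => by rw [e, cod_neg]; ring⟩

theorem Cohomologous.trans (h : X.Cohomologous k w w') (h' : X.Cohomologous k w' w'') :
    X.Cohomologous k w w'' := by
  obtain ⟨u, hu, e⟩ := h
  obtain ⟨u', hu', e'⟩ := h'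
  exact ⟨fun l => u l + u' l, hu.add hu', fun l => by rw [e, e', cod_add]; ring⟩

theorem Cohomologous.comp (h : X.Cohomologous k w w') (F : AInfHom Y X) :
    Y.Cohomologous k (comp w F.ser) (comp w' F.ser) := by
  obtain ⟨u, hu, e⟩ := h
  refine ⟨_root_.comp u F.ser, hu.comp F.ml F.deg, fun l => ?_⟩
  rw [F.cod_comp hu.ml, ← comp_add, funext e]

theorem Cocycle.comp (h : X.Cocycle k w) (F : AInfHom Y X) : Y.Cocycle k (comp w F.ser) :=
  ⟨h.1.comp F.ml F.deg, fun l => by rw [F.cod_comp h.1.ml, funext h.2, comp_zero]⟩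

/-- A bilinear coefficient can only arise from the linear coefficient of `u`, which is 0 by cyclic
triviality, or from `r₁ = 0`: an exact form on a minimal algebra has no flat part. -/
theorem Minimal.cod_pair (hX : X.Minimal) {u : List A → ℂ} (hu : Good 𝒜 k u) (x y : A) :
    cod X.σ X.ser u [x, y] = 0 := by
  simp only [cod_cons, cod_nil, dsum_cons, dsum_nil, hX.ser_singleton, add_zero,
    hu.singleton X.internal]
  rw [show u [0, y] = 0 from (hu.ml.slot [] [y]).map_zero,
    show u [X.σ x, 0] = 0 from (hu.ml.slot [X.σ x] []).map_zero, add_zero]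

theorem Cohomologous.pair (h : X.Cohomologous k w w') (hX : X.Minimal) (x y : A) :
    w [x, y] = w' [x, y] := by
  obtain ⟨u, hu, e⟩ := h
  rw [e, hX.cod_pair hu, add_zero]

/-- The quadratic part of the closedness equation says that the pairing is compatible with `r₁`;
hence it does not change when cocycles are replaced by cohomologous ones. -/
theorem Cocycle.pair_eq (hw : X.Cocycle k w) {x x' y y' z t : A} (hx : X.r₁ x = 0) (hy : X.r₁ y = 0)
    (hz : X.r₁ z = x' - x) (ht : X.r₁ t = y' - y) : w [x', y'] = w [x, y] := by
  have key : ∀ a b, w [X.r₁ a, b] = - w [X.σ a, X.r₁ b] := fun a b => by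
    have := hw.2 [a, b]
    simp only [cod_cons, cod_nil, dsum_cons, dsum_nil, add_zero, hw.1.singleton X.internal,
      ← X.r₁_apply] at this
    linear_combination this
  have h0 : ∀ a, w [a, 0] = 0 := fun a => (hw.1.ml.slot [a] []).map_zero
  have h0' : ∀ a, w [0, a] = 0 := fun a => (hw.1.ml.slot [] [a]).map_zero
  have h1 : w [x' - x, y] = 0 := by rw [← hz, key, hy, h0, neg_zero]
  have hx' : X.r₁ x' = 0 := by
    have := X.r₁_r₁ z
    rwa [hz, map_sub, hx, sub_zero] at this
  have h2 : w [x', y' - y] = 0 := by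
    have h3 := key (X.σ x') t
    rw [parity_parity, ht] at h3
    have h4 := X.σ_r₁ x'
    rw [hx', map_zero] at h4
    have h5 : X.r₁ (X.σ x') = 0 := by simpa using h4
    rw [h5, h0'] at h3
    linear_combination h3
  have e1 : w [x' - x, y] = w [x', y] - w [x, y] := (hw.1.ml.slot [] [y]).map_sub x' x
  have e2 : w [x', y' - y] = w [x', y'] - w [x', y] := (hw.1.ml.slot [x'] []).map_sub y' y
  linear_combination h1 + h2 - e1 - e2

end AInf

namespace AInfHom

variable {C : Type*} [AddCommGroup C] [Module ℂ C] {𝒞 : ZMod m → Submodule ℂ C}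
variable {X : AInf 𝒜} {Y : AInf ℬ} {Z : AInf 𝒞}

theorem F₁_r₁ (F : AInfHom X Y) (x : A) : F.F₁ (X.r₁ x) = Y.r₁ (F.F₁ x) := by
  have := F.rel [x]
  simpa only [cod_cons, cod_nil, comp_cons, comp_nil, dsum_nil, add_zero, ← F₁_apply,
    ← AInf.r₁_apply] using this

omit hm in
theorem F₁_mem (F : AInfHom X Y) {g : ZMod m} {x : A} (hx : x ∈ 𝒜 g) : F.F₁ x ∈ ℬ g := by
  obtain ⟨a, ha, rfl⟩ := exists_letter hx
  have := F.deg [a]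
  rw [F₁_apply]
  rwa [tdeg_cons, tdeg_nil, add_zero, add_zero, ha, sub_add_cancel] at this

theorem IsQuasiIso.trans {F : AInfHom X Y} {G : AInfHom Y Z} (hF : F.IsQuasiIso)
    (hG : G.IsQuasiIso) : (F.trans G).IsQuasiIso := by
  refine ⟨fun x hx ⟨y, hy⟩ => ?_, fun z hz => ?_⟩
  · rw [trans_F₁] at hy
    exact hF.1 x hx (hG.1 _ (by rw [← F₁_r₁, hx, map_zero]) ⟨y, hy⟩)
  · obtain ⟨y, hy, t, ht⟩ := hG.2 z hz
    obtain ⟨x, hx, s, hs⟩ := hF.2 y hy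
    refine ⟨x, hx, t + G.F₁ s, ?_⟩
    rw [trans_F₁, map_add, ht, ← F₁_r₁, hs, map_sub]
    abel

theorem IsIso.isQuasiIso {F : AInfHom X Y} (hF : F.IsIso) : F.IsQuasiIso := by
  refine ⟨fun x hx ⟨y, hy⟩ => ?_, fun y hy => ?_⟩
  · obtain ⟨z, rfl⟩ := hF.2 y
    exact ⟨z, hF.1 (by rw [F₁_r₁, hy])⟩
  · obtain ⟨x, rfl⟩ := hF.2 y
    exact ⟨x, hF.1 (by rw [F₁_r₁, hy, map_zero]), 0, by rw [map_zero, sub_self]⟩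

omit hm in
theorem IsQuasiIso.isIso {F : AInfHom X Y} (hF : F.IsQuasiIso) (hX : X.Minimal) (hY : Y.Minimal) :
    F.IsIso := by
  rw [AInf.Minimal] at hX hY
  refine ⟨(injective_iff_map_eq_zero _).2 fun x hx => ?_, fun y => ?_⟩
  · obtain ⟨z, hz⟩ := hF.1 x (by rw [hX]; rfl) ⟨0, by rw [hx, map_zero]⟩
    rw [← hz, hX]; rfl
  · obtain ⟨x, _, z, hz⟩ := hF.2 y (by rw [hY]; rfl)
    rw [hY] at hz
    exact ⟨x, (sub_eq_zero.1 hz.symm).symm⟩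

theorem IsQuasiIso.of_comp_eq {F : AInfHom X Y} {G : AInfHom Y X} (hF : F.IsQuasiIso)
    (h : comp G.ser F.ser = lin LinearMap.id) : G.IsQuasiIso := by
  have h1 : ∀ x, G.F₁ (F.F₁ x) = x := fun x => by
    rw [← trans_F₁, F₁_apply, ser_trans, h]; rfl
  refine ⟨fun y hy ⟨x, hx⟩ => ?_, fun x hx => ⟨F.F₁ x, by rw [← F₁_r₁, hx, map_zero], 0, by
    rw [h1, map_zero, sub_self]⟩⟩
  obtain ⟨x', _, z, hz⟩ := hF.2 y hy
  refine ⟨F.F₁ (x - G.F₁ z) + z, ?_⟩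
  rw [map_add, ← F₁_r₁, hz, map_sub, ← G.F₁_r₁, hz, hx]
  simp only [map_sub, h1]
  abel

theorem isIso_refl (X : AInf 𝒜) : (AInfHom.refl X).IsIso := by
  have : ⇑(AInfHom.refl X).F₁ = id := funext fun x => by rw [F₁_apply, ser_refl]; rfl
  rw [IsIso, this]
  exact Function.bijective_id

theorem IsIso.trans {F : AInfHom X Y} {G : AInfHom Y Z} (hF : F.IsIso) (hG : G.IsIso) :
    (F.trans G).IsIso := by
  have : ⇑(F.trans G).F₁ = G.F₁ ∘ F.F₁ := funext fun x => F.trans_F₁ G x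
  rw [IsIso, this]
  exact Function.Bijective.comp hG hF

/-- A quasi-isomorphism acts bijectively on the cohomology of closed `2`-forms, with an inverse
induced by a quasi-isomorphism. -/
theorem IsQuasiIso.exists_inverse {F : AInfHom X Y} (hF : F.IsQuasiIso) :
    ∃ G : AInfHom Y X, G.IsQuasiIso ∧ ∀ k w, Y.Cocycle k w →
      Y.Cohomologous k (comp (comp w F.ser) G.ser) w := by
  obtain ⟨M, I, P, hM, hI, hPI, -⟩ := X.exists_minimalModel
  obtain ⟨N, J, Q, hN, hJ, hQJ, hQ⟩ := Y.exists_minimalModel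
  have hQq := hJ.of_comp_eq hQJ
  -- Between minimal models the induced map is a quasi-isomorphism with vanishing differentials,
  -- hence invertible; its inverse, conjugated back, is the required morphism.
  obtain ⟨K, hK, hLK, -⟩ :=
    (I.trans (F.trans Q)).exists_symm (((hI.trans (hF.trans hQq)).isIso hM hN))
  refine ⟨Q.trans (K.trans I), hQq.trans (hK.isQuasiIso.trans hI), fun k w hw => ?_⟩
  have hw' : Y.Cohomologous k (comp (comp w J.ser) Q.ser) w := by
    obtain ⟨u, hu, e⟩ := hQ k w hw.1 hw.2
    exact ⟨u, hu, e⟩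
  have e1 : comp (comp w F.ser) (Q.trans (K.trans I)).ser =
      comp (comp (comp (comp w F.ser) I.ser) K.ser) Q.ser := funext fun l => by
    rw [comp_trans _ _ (hw.1.ml.comp F.ml),
      funext (K.comp_trans I (hw.1.ml.comp F.ml))]
  have e2 : comp (comp (comp (comp (comp w J.ser) Q.ser) F.ser) I.ser) K.ser = comp w J.ser := by
    have hJm := hw.1.ml.comp J.ml
    have : comp (comp (comp (comp w J.ser) Q.ser) F.ser) I.ser =
        comp (comp w J.ser) (I.trans (F.trans Q)).ser := funext fun l => by
      rw [comp_trans _ _ hJm, funext (F.comp_trans Q hJm)]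
    rw [this]
    funext l
    rw [comp_assoc hJm, hLK, comp_lin_id hJm]
  rw [e1]
  -- Replace `w` by its pull-back from the minimal model of `Y`; then the invertible map and its
  -- inverse meet and cancel.
  refine (((((hw'.symm.comp F).comp I).comp K).comp Q).trans ?_)
  rw [e2]
  exact hw'

end AInfHom

end Cohomologous

end

noncomputable section

/-! ### Classes of forms and cyclic minimal models -/

section CyclicModels

variable {m : ℕ} [hm : Fact (m = 0 ∨ m = 2)] {A : Type*} [AddCommGroup A] [Module ℂ A]
  {𝒜 : ZMod m → Submodule ℂ A} {X : AInf 𝒜} {k : ZMod m}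

theorem cocycle_pot (ω : cocycles X k) : X.Cocycle k (pot X.internal ω) :=
  have h := (mem_cocycles_iff X).1 ω.2
  ⟨Good.pot _ h.1, h.2⟩

theorem AInf.Cocycle.exists_form {w : List A → ℂ} (hw : X.Cocycle k w) :
    ∃ ω : cocycles X k, pot X.internal (ω : List (DLetter 𝒜) → ℂ) = w := by
  obtain ⟨f, hf, rfl⟩ := exists_closedForm X.internal hw.1
  exact ⟨⟨f, (mem_cocycles_iff X).2 ⟨hf, hw.2⟩⟩, rfl⟩

theorem mk_eq_mk_iff (ω ω' : cocycles X k) :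
    (Submodule.Quotient.mk ω : H2 X k) = Submodule.Quotient.mk ω' ↔
      X.Cohomologous k (pot X.internal ω) (pot X.internal ω') := by
  rw [Submodule.Quotient.eq]
  exact sub_mem_coboundaries_iff X ω.2.1 ω'.2.1

theorem comp_pair {B : Type*} [AddCommGroup B] [Module ℂ B] {ℬ : ZMod m → Submodule ℂ B} {Y : AInf ℬ}
    (F : AInfHom Y X) {w : List A → ℂ} (hw : Good 𝒜 k w) (x y : B) :
    comp w F.ser [x, y] = w [F.F₁ x, F.F₁ y] := by
  simp only [comp_cons, comp_nil, dsum_cons, dsum_nil, hw.singleton X.internal, add_zero,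
    F.F₁_apply]

/-- `F₁` induces a graded automorphism of the cohomology, and by `Cocycle.pair_eq` the pairing of
representatives depends only on classes. So the two pairings differ by a graded change of basis. -/
theorem homNonDeg_iff {f : List (DLetter 𝒜) → ℂ} (hf : f ∈ cocycles X k) {Y : AInf X.cohGrading}
    (hY : Y.Minimal) {F : AInfHom Y X} (hF : F.IsQuasiIso) {β : X.Coh →ₗ[ℂ] X.Coh →ₗ[ℂ] ℂ}
    (hβ : ∀ x y, comp (pot X.internal f) F.ser [x, y] = flatCoeff Y.internal β x y) :
    HomNonDeg X k f ↔ NonDeg X.cohGrading k β := by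
  have hw : X.Cocycle k (pot X.internal f) := cocycle_pot ⟨f, hf⟩
  have hr : ∀ c, X.r₁ (F.F₁ c) = 0 := fun c => by
    rw [← F.F₁_r₁, hY, LinearMap.zero_apply, map_zero]
  let κ : X.Coh →ₗ[ℂ] X.Coh :=
    Submodule.mkQ _ ∘ₗ F.F₁.codRestrict (LinearMap.ker X.r₁) hr
  have hκ : ∀ c, κ c = X.cls (F.F₁ c) (hr c) := fun _ => rfl
  have hi : Function.Injective κ := (injective_iff_map_eq_zero κ).2 fun c hc => by
    have h0 : κ c = X.cls 0 (map_zero _) := hc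
    obtain ⟨z, hz⟩ := (AInf.Homotopy.cls_eq_iff _ _).1 h0
    obtain ⟨t, ht⟩ := hF.1 c (by rw [hY]; rfl) ⟨z, by rw [hz, sub_zero]⟩
    rw [← ht, hY]; rfl
  have hs : Function.Surjective κ := fun c => by
    obtain ⟨y, hy, rfl⟩ := AInf.Homotopy.exists_cls c
    obtain ⟨x, _, z, hz⟩ := hF.2 y hy
    exact ⟨x, ((AInf.Homotopy.cls_eq_iff _ _).2 ⟨z, hz⟩).symm⟩
  let e : X.Coh ≃ₗ[ℂ] X.Coh := LinearEquiv.ofBijective κ ⟨hi, hs⟩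
  have he : ∀ g, ∀ c ∈ X.cohGrading g, e c ∈ X.cohGrading g := fun g c hc =>
    ⟨⟨F.F₁ c, hr c⟩, F.F₁_mem hc, rfl⟩
  have he' : ∀ g, ∀ c ∈ X.cohGrading g, e.symm c ∈ X.cohGrading g := fun g c hc =>
    mem_of_map_mem Y.internal Y.internal (φ := (e : X.Coh →ₗ[ℂ] X.Coh)) he e.injective (by simpa using hc)
  have hval : ∀ c d : Letter X.cohGrading,
      β c.2 d.2 = -sgn c.1 * (1 / 2 * pot X.internal f [F.F₁ c.2, F.F₁ d.2]) := fun c d => by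
    rw [← comp_pair F hw.1, hβ, flatCoeff_coe]
    linear_combination - β c.2 d.2 * sgn_mul_self c.1
  constructor
  · rintro ⟨β', h1, h2⟩
    have : β = β'.compl₁₂ (e : X.Coh →ₗ[ℂ] X.Coh) (e : X.Coh →ₗ[ℂ] X.Coh) :=
      linearMap_ext Y.internal fun c => linearMap_ext Y.internal fun d => by
        have h3 := h1 ⟨c.1, F.F₁ c.2, F.F₁_mem c.2.2⟩ ⟨d.1, F.F₁ d.2, F.F₁_mem d.2.2⟩ (hr _) (hr _)
        rw [flatPart_eq X.internal hf.1.1.1] at h3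
        rw [hval, ← h3]; rfl
    rw [this]
    exact h2.compl₁₂ e he he'
  · intro h
    refine ⟨_, fun a b ha hb => ?_, h.compl₁₂ e.symm he' he⟩
    have hca : X.cls a.2 ha ∈ X.cohGrading (a.1 + 1) := ⟨⟨a.2, ha⟩, a.2.2, rfl⟩
    have hcb : X.cls b.2 hb ∈ X.cohGrading (b.1 + 1) := ⟨⟨b.2, hb⟩, b.2.2, rfl⟩
    have h1 := hval ⟨a.1, _, he' _ _ hca⟩ ⟨b.1, _, he' _ _ hcb⟩
    obtain ⟨z, hz⟩ := (AInf.Homotopy.cls_eq_iff (hr _) ha).1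
      ((hκ (e.symm (X.cls a.2 ha))).symm.trans (e.apply_symm_apply _))
    obtain ⟨t, ht⟩ := (AInf.Homotopy.cls_eq_iff (hr _) hb).1
      ((hκ (e.symm (X.cls b.2 hb))).symm.trans (e.apply_symm_apply _))
    rw [hw.pair_eq ha hb hz ht] at h1
    rw [flatPart_eq X.internal hf.1.1.1]
    exact h1

namespace CyclicMinimalModel

/-- The scalar series of the flat form of the pairing. -/
def series (M : CyclicMinimalModel X k) : List X.Coh → ℂ :=
  quad (flatCoeff M.alg.internal M.pairing)

variable (M N : CyclicMinimalModel X k)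

theorem flatForm_mem : flatForm X.cohGrading M.pairing ∈ closedForms X.cohGrading k :=
  flatForm_mem_closedForms M.pairing_degree

theorem pot_flatForm : pot M.alg.internal (flatForm X.cohGrading M.pairing) = M.series :=
  _root_.pot_flatForm _ M.pairing_degree M.pairing_symm

theorem cocycle_series : M.alg.Cocycle k M.series :=
  ⟨M.pot_flatForm ▸ Good.pot _ M.flatForm_mem, (isCyclic_iff _ M.pairing_symm).1 M.cyclic⟩

/-- The cohomology class of the form `f` corresponds to the cyclic minimal model `M`. -/
def Represents (f : List (DLetter 𝒜) → ℂ) : Prop :=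
  ∃ F : AInfHom M.alg X, F.IsQuasiIso ∧
    push F f - flatForm X.cohGrading M.pairing ∈ coboundaries M.alg k

variable {M N}

theorem represents_iff (ω : cocycles X k) : M.Represents ω ↔ ∃ F : AInfHom M.alg X,
    F.IsQuasiIso ∧ M.alg.Cohomologous k (comp (pot X.internal ω) F.ser) M.series := by
  refine exists_congr fun F => and_congr_right fun _ => ?_
  rw [← pot_push F ω.2.1, ← M.pot_flatForm]
  exact sub_mem_coboundaries_iff M.alg (push_mem_closedForms F ω.2.1) M.flatForm_mem

theorem isomorphic_iff : M.Isomorphic N ↔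
    ∃ φ : AInfHom M.alg N.alg, φ.IsIso ∧ comp N.series φ.ser = M.series := by
  refine exists_congr fun φ => and_congr_right fun _ => ?_
  rw [sub_mem_commutators_iff M.alg.internal (push_mem_closedForms φ N.flatForm_mem) M.flatForm_mem,
    pot_push φ N.flatForm_mem, M.pot_flatForm, N.pot_flatForm]

theorem isomorphic_equivalence : Equivalence (Isomorphic (X := X) (k := k)) where
  refl M := isomorphic_iff.2 ⟨AInfHom.refl _, AInfHom.isIso_refl _, funext fun l => by
    rw [AInfHom.ser_refl, comp_lin_id M.cocycle_series.1.ml]⟩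
  symm {M N} h := by
    obtain ⟨φ, hφ, e⟩ := isomorphic_iff.1 h
    obtain ⟨ψ, hψ, h1, -⟩ := φ.exists_symm hφ
    refine isomorphic_iff.2 ⟨ψ, hψ, funext fun l => ?_⟩
    rw [← e, comp_assoc N.cocycle_series.1.ml, h1, comp_lin_id N.cocycle_series.1.ml]
  trans {M N L} h h' := by
    obtain ⟨φ, hφ, e⟩ := isomorphic_iff.1 h
    obtain ⟨ψ, hψ, e'⟩ := isomorphic_iff.1 h'
    refine isomorphic_iff.2 ⟨φ.trans ψ, hφ.trans hψ, funext fun l => ?_⟩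
    rw [AInfHom.comp_trans _ _ L.cocycle_series.1.ml, e', e]

/-- Darboux coordinates make the form flat; in these coordinates the structure of `Y` becomes a new
one `Z`, and closedness of the form, now flat, is cyclicity of `Z`. -/
theorem exists_of_cocycle {Y : AInf X.cohGrading} (hY : Y.Minimal) {F : AInfHom Y X}
    (hF : F.IsQuasiIso) {w : List X.Coh → ℂ} (hw : Y.Cocycle k w)
    {β : X.Coh →ₗ[ℂ] X.Coh →ₗ[ℂ] ℂ} (hβ : ∀ x y, w [x, y] = flatCoeff Y.internal β x y)
    (hn : NonDeg X.cohGrading k β) :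
    ∃ (M : CyclicMinimalModel X k) (φ : AInfHom M.alg Y), φ.F₁ = LinearMap.id ∧ M.pairing = β ∧
      comp w φ.ser = M.series := by
  obtain ⟨ψ, h1, h2, h3, h4, h5⟩ := exists_darboux Y.internal hw.1 hβ
    ((nonDeg_flatCoeff Y.internal).2 hn)
  obtain ⟨Z, φ', φ, h6, h7, -, h8, h9⟩ := Y.exists_transport h1 h2 h3 h4
  have hser : comp w φ.ser = quad (flatCoeff Y.internal β) := funext fun l => by
    rw [← funext h5, comp_assoc (ML.quad _), ← h6, h7, comp_lin_id (ML.quad _)]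
  have hiso : φ.IsIso := by rw [AInfHom.IsIso, h9]; exact Function.bijective_id
  have hs := hw.1.pairing_symm Y.internal hβ
  refine ⟨⟨Z, LinearMap.ext fun c => ?_, ⟨φ.trans F, hiso.isQuasiIso.trans hF⟩, β,
    hw.1.pairing_degree Y.internal hβ, hs, hn, (isCyclic_iff Z hs).2 fun l => ?_⟩, φ, h9, rfl, hser⟩
  · rw [Z.r₁_apply, h8, hY.ser_singleton]; rfl
  · rw [← hser]
    exact (hw.comp φ).2 l

/-- Every cyclic minimal model comes from a closed form on `X`, along any quasi-isomorphism. -/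
theorem exists_form (M : CyclicMinimalModel X k) {F : AInfHom M.alg X} (hF : F.IsQuasiIso) :
    ∃ ω : cocycles X k, HomNonDeg X k ω ∧ comp (pot X.internal ω) F.ser = M.series := by
  obtain ⟨G, hG, -⟩ := hF.exists_inverse
  -- The composite of `F` with its inverse up to homotopy is an automorphism of the minimal algebra.
  -- Correcting by its inverse `S` makes the pull-back along `F` equal to the given series, not just
  -- cohomologous to it.
  obtain ⟨S, _, -, hS⟩ := (F.trans G).exists_symm ((hF.trans hG).isIso M.minimal M.minimal)
  have hc := M.cocycle_series
  obtain ⟨ω, hω⟩ := ((hc.comp S).comp G).exists_form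
  have e : comp (pot X.internal ω) F.ser = M.series := funext fun l => by
    have h1 := hc.1.ml.comp S.ml
    rw [hω, comp_assoc h1, ← F.ser_trans G, comp_assoc hc.1.ml, hS, comp_lin_id hc.1.ml]
  exact ⟨ω, (homNonDeg_iff ω.2 M.minimal hF fun x y => by rw [e]; rfl).2 M.nonDeg, e⟩

theorem exists_represents {ω : cocycles X k} (h : HomNonDeg X k ω) :
    ∃ M : CyclicMinimalModel X k, M.Represents ω := by
  obtain ⟨Y, F, -, hY, hF, -⟩ := X.exists_minimalModel
  have hw := (cocycle_pot ω).comp F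
  obtain ⟨β, hβ⟩ := hw.1.ml.exists_pairing Y.internal
  obtain ⟨M, φ, h1, -, h3⟩ := exists_of_cocycle hY hF hw hβ ((homNonDeg_iff ω.2 hY hF hβ).1 h)
  have hφ : φ.IsIso := by rw [AInfHom.IsIso, h1]; exact Function.bijective_id
  refine ⟨M, (represents_iff ω).2 ⟨φ.trans F, hφ.isQuasiIso.trans hF, ?_⟩⟩
  rw [funext (φ.comp_trans F (cocycle_pot ω).1.ml), h3]
  exact .refl _ _ _

theorem Represents.of_isomorphic {ω : cocycles X k} (h : M.Represents ω) (hMN : M.Isomorphic N) :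
    N.Represents ω := by
  obtain ⟨ψ, hψ, e⟩ := isomorphic_iff.1 (isomorphic_equivalence.symm hMN)
  obtain ⟨F, hF, hw⟩ := (represents_iff ω).1 h
  refine (represents_iff ω).2 ⟨ψ.trans F, hψ.isQuasiIso.trans hF, ?_⟩
  rw [funext (ψ.comp_trans F (cocycle_pot ω).1.ml), ← e]
  exact hw.comp ψ

/-- Going to `X` by `F` and back by the inverse of `F'` gives an isomorphism between the two minimal
algebras that matches the flat forms up to a coboundary. The Moser theorem removes the coboundary by
an automorphism. -/
theorem Represents.isomorphic {ω : cocycles X k} (h : M.Represents ω) (h' : N.Represents ω) :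
    M.Isomorphic N := by
  obtain ⟨F, hF, hw⟩ := (represents_iff ω).1 h
  obtain ⟨F', hF', hw'⟩ := (represents_iff ω).1 h'
  obtain ⟨G, hG, hFG⟩ := hF'.exists_inverse
  have hS := (hF.trans hG).isIso M.minimal N.minimal
  have hc : M.alg.Cohomologous k M.series (comp N.series (F.trans G).ser) := by
    rw [funext (F.comp_trans G N.cocycle_series.1.ml)]
    exact hw.symm.trans (((hFG k _ (cocycle_pot ω)).symm.trans (hw'.comp G)).comp F)
  have hpair := hc.pair M.minimal
  have hN := N.cocycle_series.comp (F.trans G)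
  obtain ⟨u, hu, e⟩ := hc
  obtain ⟨φ, h1, h2⟩ := M.minimal.exists_moser hN.1 hN.2 hu (fun x y => (hpair x y).symm)
    ((nonDeg_flatCoeff M.alg.internal).2 M.nonDeg)
  have hφ : φ.IsIso := by rw [AInfHom.IsIso, h1]; exact Function.bijective_id
  refine isomorphic_iff.2 ⟨φ.trans (F.trans G), hφ.trans hS, funext fun l => ?_⟩
  rw [φ.comp_trans _ N.cocycle_series.1.ml, h2, e]

end CyclicMinimalModel

/-- On a minimal model cohomologous forms have equal flat parts, and non-degeneracy can be tested
there. -/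
theorem HomNonDeg.of_mk_eq {ω ω' : cocycles X k}
    (e : (Submodule.Quotient.mk ω : H2 X k) = Submodule.Quotient.mk ω') (h : HomNonDeg X k ω) :
    HomNonDeg X k ω' := by
  obtain ⟨Y, F, -, hY, hF, -⟩ := X.exists_minimalModel
  obtain ⟨β, hβ⟩ := ((cocycle_pot ω).comp F).1.ml.exists_pairing Y.internal
  have hc := ((mk_eq_mk_iff ω ω').1 e).comp F
  exact (homNonDeg_iff ω'.2 hY hF fun x y => by rw [← hc.pair hY, hβ]).2
    ((homNonDeg_iff ω.2 hY hF hβ).1 h)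

namespace ScrH

theorem quasiIsomorphic_iff {ω ω' : cocycles X k} (h : HomNonDeg X k ω) (h' : HomNonDeg X k ω') :
    QuasiIsomorphic (mk ω h) (mk ω' h') ↔ ∃ F : AInfHom X X, F.IsQuasiIso ∧
      X.Cohomologous k (comp (pot X.internal ω') F.ser) (pot X.internal ω) := by
  refine exists_congr fun F => and_congr_right fun _ => ?_
  have key : ∀ η η' : cocycles X k,
      push F (η' : List (DLetter 𝒜) → ℂ) - (η : List (DLetter 𝒜) → ℂ) ∈ coboundaries X k ↔
      X.Cohomologous k (comp (pot X.internal η') F.ser) (pot X.internal η) := fun η η' => by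
    rw [← pot_push F η'.2.1]
    exact sub_mem_coboundaries_iff X (push_mem_closedForms F η'.2.1) η.2.1
  constructor
  · rintro ⟨η, η', e, e', hη⟩
    exact (((mk_eq_mk_iff _ _).1 e'.symm).comp F).trans
      (((key η η').1 hη).trans ((mk_eq_mk_iff _ _).1 e))
  · exact fun hω => ⟨ω, ω', rfl, rfl, (key ω ω').2 hω⟩

theorem exists_mk (c : ScrH X k) : ∃ (ω : cocycles X k) (h : HomNonDeg X k ω), mk ω h = c := by
  obtain ⟨_, ω, rfl, h⟩ := c
  exact ⟨ω, h, rfl⟩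

theorem quasiIsomorphic_equivalence : Equivalence (QuasiIsomorphic (X := X) (k := k)) where
  refl c := by
    obtain ⟨ω, h, rfl⟩ := exists_mk c
    refine (quasiIsomorphic_iff h h).2 ⟨AInfHom.refl X, (AInfHom.isIso_refl X).isQuasiIso, ?_⟩
    rw [AInfHom.ser_refl, funext (comp_lin_id (cocycle_pot ω).1.ml)]
    exact .refl _ _ _
  symm {c c'} hc := by
    obtain ⟨ω, h, rfl⟩ := exists_mk c
    obtain ⟨ω', h', rfl⟩ := exists_mk c'
    obtain ⟨F, hF, hw⟩ := (quasiIsomorphic_iff h h').1 hc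
    obtain ⟨G, hG, hFG⟩ := hF.exists_inverse
    exact (quasiIsomorphic_iff h' h).2
      ⟨G, hG, (hw.symm.comp G).trans (hFG k _ (cocycle_pot ω'))⟩
  trans {c c' c''} hc hc' := by
    obtain ⟨ω, h, rfl⟩ := exists_mk c
    obtain ⟨ω', h', rfl⟩ := exists_mk c'
    obtain ⟨ω'', h'', rfl⟩ := exists_mk c''
    obtain ⟨F, hF, hw⟩ := (quasiIsomorphic_iff h h').1 hc
    obtain ⟨G, hG, hw'⟩ := (quasiIsomorphic_iff h' h'').1 hc'
    refine (quasiIsomorphic_iff h h'').2 ⟨F.trans G, hF.trans hG, ?_⟩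
    rw [funext (F.comp_trans G (cocycle_pot ω'').1.ml)]
    exact (hw'.comp F).trans hw

/-- Compose the morphism that represents `ω` with the one relating `ω` to `ω'`; conversely go from
`X` to `M` by an inverse up to homotopy and back by the morphism that represents `ω'`. -/
theorem quasiIsomorphic_iff_represents {ω ω' : cocycles X k} (h : HomNonDeg X k ω)
    (h' : HomNonDeg X k ω') {M : CyclicMinimalModel X k} (hM : M.Represents ω) :
    QuasiIsomorphic (mk ω h) (mk ω' h') ↔ M.Represents ω' := by
  obtain ⟨F, hF, hw⟩ := (CyclicMinimalModel.represents_iff ω).1 hM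
  constructor
  · intro hq
    obtain ⟨G, hG, hw'⟩ := (quasiIsomorphic_iff h h').1 hq
    refine (CyclicMinimalModel.represents_iff ω').2 ⟨F.trans G, hF.trans hG, ?_⟩
    rw [funext (F.comp_trans G (cocycle_pot ω').1.ml)]
    exact (hw'.comp F).trans hw
  · intro hM'
    obtain ⟨F', hF', hw'⟩ := (CyclicMinimalModel.represents_iff ω').1 hM'
    obtain ⟨G, hG, hFG⟩ := hF.exists_inverse
    refine (quasiIsomorphic_iff h h').2 ⟨G.trans F', hG.trans hF', ?_⟩
    rw [funext (G.comp_trans F' (cocycle_pot ω').1.ml)]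
    exact ((hw'.trans hw.symm).comp G).trans (hFG k _ (cocycle_pot ω))

end ScrH

/-- A relation between two types that determines either side up to an equivalence relation is a
bijection of the quotients. -/
theorem exists_quot_equiv {α β : Type*} {r : α → α → Prop} {s : β → β → Prop}
    (hs : Equivalence s) (R : α → β → Prop) (hl : ∀ a, ∃ b, R a b) (hR : ∀ b, ∃ a, R a b)
    (h : ∀ a a' b, R a b → (r a a' ↔ R a' b)) (h' : ∀ a b b', R a b → (s b b' ↔ R a b')) :
    ∃ Φ : Quot r ≃ Quot s, ∀ a b, Φ (Quot.mk _ a) = Quot.mk _ b ↔ R a b := by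
  choose f hf using hl
  let φ : Quot r → Quot s := Quot.lift (fun a => Quot.mk s (f a)) fun a a' ha =>
    Quot.sound ((h' a' _ _ ((h a a' _ (hf a)).1 ha)).2 (hf a'))
  have hφ : ∀ a b, φ (Quot.mk _ a) = Quot.mk _ b ↔ R a b := fun a b =>
    
    ⟨fun e => (h' a _ _ (hf a)).1 (hs.eqvGen_iff.1 (Quot.eqvGen_exact e)),
      fun e => Quot.sound ((h' a _ _ (hf a)).2 e)⟩
  have hb : Function.Bijective φ := by
    constructor
    · rintro ⟨a⟩ ⟨a'⟩ e
      exact Quot.sound ((h a a' (f a') ((hφ a _).1 e)).2 (hf a'))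
    · rintro ⟨b⟩
      obtain ⟨a, ha⟩ := hR b
      exact ⟨Quot.mk _ a, (hφ a b).2 ha⟩
  exact ⟨Equiv.ofBijective φ hb, hφ⟩

end CyclicModels

end

/-! ### The theorem -/

theorem mainTheorem1 {m : ℕ} (hm : m = 0 ∨ m = 2) {A : Type*} [AddCommGroup A] [Module ℂ A]
    (𝒜 : ZMod m → Submodule ℂ A) (X : AInf 𝒜) (k : ZMod m) :
    -- homological non-degeneracy only depends on the cohomology class
    (∀ ω ω' : cocycles X k,
      (Submodule.Quotient.mk ω : H2 X k) = Submodule.Quotient.mk ω' →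
        HomNonDeg X k ω → HomNonDeg X k ω') ∧
    -- every representative and every minimal model give a cyclic minimal model on cohomology, whose
    -- pairing is the flat part of the transported form
    (∀ ω : cocycles X k, HomNonDeg X k ω →
      ∀ Y : AInf X.cohGrading, Y.Minimal → ∀ F : AInfHom Y X, F.IsQuasiIso →
        ∃ (M : CyclicMinimalModel X k) (φ : AInfHom M.alg Y), φ.F₁ = LinearMap.id ∧
          IsFlatPairing (push F ω) M.pairing ∧
          push φ (push F ω) - flatForm X.cohGrading M.pairing ∈ commutators X.cohGrading) ∧
    -- the pairings for which a cyclic minimal model exists are exactly those obtained in this way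
    (∀ β : X.Coh →ₗ[ℂ] X.Coh →ₗ[ℂ] ℂ,
      (∃ M : CyclicMinimalModel X k, M.pairing = β) ↔
        ∃ ω : cocycles X k, HomNonDeg X k ω ∧
          ∃ (Y : AInf X.cohGrading) (F : AInfHom Y X),
            Y.Minimal ∧ F.IsQuasiIso ∧ IsFlatPairing (push F ω) β) ∧
    -- classes up to quasi-isomorphism correspond bijectively to cyclic minimal models up to
    -- change of basis
    Equivalence (ScrH.QuasiIsomorphic (X := X) (k := k)) ∧
    Equivalence (CyclicMinimalModel.Isomorphic (X := X) (k := k)) ∧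
    ∃ Φ : Quot (ScrH.QuasiIsomorphic (X := X) (k := k)) ≃
        Quot (CyclicMinimalModel.Isomorphic (X := X) (k := k)),
      ∀ (ω : cocycles X k) (h : HomNonDeg X k ω) (M : CyclicMinimalModel X k),
        Φ (Quot.mk _ (ScrH.mk ω h)) = Quot.mk _ M ↔
          ∃ F : AInfHom M.alg X, F.IsQuasiIso ∧
            push F ω - flatForm X.cohGrading M.pairing ∈ coboundaries M.alg k := by
  have : Fact (m = 0 ∨ m = 2) := ⟨hm⟩
  refine ⟨fun ω ω' e h => h.of_mk_eq e, fun ω h Y hY F hF => ?_, fun β => ⟨?_, ?_⟩,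
    ScrH.quasiIsomorphic_equivalence, CyclicMinimalModel.isomorphic_equivalence, ?_⟩
  · have hw := (cocycle_pot ω).comp F
    have hc := push_mem_closedForms F ω.2.1
    obtain ⟨β, hβ⟩ := hw.1.ml.exists_pairing Y.internal
    obtain ⟨M, φ, h1, rfl, h3⟩ := CyclicMinimalModel.exists_of_cocycle hY hF hw hβ
      ((homNonDeg_iff ω.2 hY hF hβ).1 h)
    refine ⟨M, φ, h1, (isFlatPairing_iff Y.internal hc).2 ?_, ?_⟩
    · rwa [pot_push F ω.2.1]
    · rw [sub_mem_commutators_iff M.alg.internal (push_mem_closedForms φ hc) M.flatForm_mem,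
        pot_push φ hc, pot_push F ω.2.1, M.pot_flatForm, h3]
  · rintro ⟨M, rfl⟩
    obtain ⟨F, hF⟩ := M.isModel
    obtain ⟨ω, hω, e⟩ := M.exists_form hF
    refine ⟨ω, hω, M.alg, F, M.minimal, hF,
      (isFlatPairing_iff M.alg.internal (push_mem_closedForms F ω.2.1)).2 fun x y => ?_⟩
    rw [pot_push F ω.2.1, e]
    rfl
  · rintro ⟨ω, hω, Y, F, hY, hF, hβ⟩
    rw [isFlatPairing_iff Y.internal (push_mem_closedForms F ω.2.1), pot_push F ω.2.1] at hβ
    obtain ⟨M, -, -, h, -⟩ := CyclicMinimalModel.exists_of_cocycle hY hF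
      ((cocycle_pot ω).comp F) hβ ((homNonDeg_iff ω.2 hY hF hβ).1 hω)
    exact ⟨M, h⟩
  -- The relation is put on classes by asking for some representative; that every representative
  -- then works is settled at the end by reflexivity of quasi-isomorphism.
  · obtain ⟨Φ, hΦ⟩ := exists_quot_equiv
      CyclicMinimalModel.isomorphic_equivalence
      (fun (c : ScrH X k) (M : CyclicMinimalModel X k) =>
        ∃ (ω : cocycles X k) (h : HomNonDeg X k ω), ScrH.mk ω h = c ∧ M.Represents ω)
      (fun c => by
        obtain ⟨ω, h, rfl⟩ := ScrH.exists_mk c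
        obtain ⟨M, hM⟩ := CyclicMinimalModel.exists_represents h
        exact ⟨M, ω, h, rfl, hM⟩)
      (fun M => by
        obtain ⟨F, hF⟩ := M.isModel
        obtain ⟨ω, h, e⟩ := M.exists_form hF
        refine ⟨_, ω, h, rfl, (CyclicMinimalModel.represents_iff ω).2 ⟨F, hF, ?_⟩⟩
        rw [e]
        exact .refl _ _ _)
      (by
        rintro _ c' M ⟨ω, h, rfl, hM⟩
        constructor
        · intro hq
          obtain ⟨ω', h', rfl⟩ := ScrH.exists_mk c'
          exact ⟨ω', h', rfl, (ScrH.quasiIsomorphic_iff_represents h h' hM).1 hq⟩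
        · rintro ⟨ω', h', rfl, hM'⟩
          exact (ScrH.quasiIsomorphic_iff_represents h h' hM).2 hM')
      (by
        rintro _ M N ⟨ω, h, rfl, hM⟩
        constructor
        · exact fun hMN => ⟨ω, h, rfl, hM.of_isomorphic hMN⟩
        · rintro ⟨ω', h', e, hN⟩
          exact hM.isomorphic ((ScrH.quasiIsomorphic_iff_represents h' h hN).1
            (e ▸ ScrH.quasiIsomorphic_equivalence.refl _)))
    refine ⟨Φ, fun ω h M => (hΦ _ _).trans ⟨?_, fun hM => ⟨ω, h, rfl, hM⟩⟩⟩
    rintro ⟨ω', h', e, hM⟩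
    exact (ScrH.quasiIsomorphic_iff_represents h' h hM).1
      (e ▸ ScrH.quasiIsomorphic_equivalence.refl _)
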